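/- Let $k$ be a commutative ring, $\mathcal U$ a small category and $\mathcal A$ a $k$-quiver on $\mathcal U$: for each object $U$ a set of objects $\mathrm{Ob}\,\mathcal A(U)$ and $k$-modules $\mathcal A(U)(A,A')$, and for each $u:V\to U$ a function $u^*:\mathrm{Ob}\,\mathcal A(U)\to \mathrm{Ob}\,\mathcal A(V)$ (no functoriality required). For a simplex $\sigma=(U_0\xrightarrow{u_1}\cdots\xrightarrow{u_p}U_p)$ of the nerve put $\sigma^*=u_1^*\circ\cdots\circ u_p^*$, and for a strictly increasing map $f:[r]\to[p]$ preserving end points let $f(\sigma)$ be the induced $r$-simplex. Put $$\mathbf C_\square^{p,q,r}(\mathcal A)=\prod_{\sigma:V\to U,\ f}\ \prod_{A_0,\dots,A_q\in\mathcal A(U)}\mathrm{Hom}_k\Big(\bigotimes_{i=1}^q\mathcal A(U)(A_{i-1},A_i),\ \mathcal A(V)(\sigma^*A_0,f(\sigma)^*A_q)\Big),$$ where $\sigma$ runs over the $p$-simplices and $f$ over the maps $[r]\to[p]$ as above (so this is $0$ for $p<r$). **Composition.** For $\theta\in\mathbf C_\square^{p,n,r}$ and $\theta_j\in\mathbf C_\square^{p_{j-1},q_j,p_j}$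 $(1\le j\le n)$, the composite $\theta\circ(\theta_1,\dots,\theta_n)\in\mathbf C_\square^{p+p_0,\sum q_j,r+p_n}$ has as component at $(\sigma,f)$ the sum, over all $f_0:[r]\to[p]$ and $f_j:[p_j]\to[p_{j-1}]$ such that $f$ is the concatenation of $f_0$ and $f_1\circ\cdots\circ f_n$, of $\theta^{\sigma_{\le p},f_0}\circ\big(\theta_1^{\tau_0,f_1}\otimes\cdots\otimes\theta_n^{\tau_{n-1},f_n}\big)$; here $\sigma_{\le p}$ consists of the first $p$ arrows of $\sigma$, $\tau_0$ of the last $p_0$ arrows, and $\tau_j=f_j(\tau_{j-1})$. For $n=0$ the number $p_0\ge0$ is arbitrary. The unit is $\eta=\mathrm{Id}\in\mathbf C_\square^{0,1,0}$. **Stackings.** A stacking in standard order is a planar tree built from boxes: it is either the unit $\eta$ of size $(0,1,0)$, or a bottom box of size $(p,n,r)$ together with stackings $S_1,\dots,S_n$ of sizes $(p_{j-1},q_j,p_j)$ on top of it (for $n=0$, together with a start value $p_0\geq 0$); it then has size $(p+p_0,\sum_jq_j,r+p_n)$. Its boxes are numbered with the bottom box first, followed by those of $S_1,\dots,S_n$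 in this order. Filling the boxes and composing, a stacking of $n$ boxes acts on $n$ elements of $\mathbf C_\square(\mathcal A)$. Its horizontal composite graph is the planar graph obtained by connecting, for each box, the $p_j$ outputs of $S_j$ with the $p_j$ inputs of $S_{j+1}$; the inputs and outputs of a box of size $(p,q,r)$ are its $p$ left and $r$ right unit segments, and a start value $p_0$ contributes $p_0$ parallel wires. Every wire belongs to a connected component, also if it meets no box. A box of size $(p,q,r)$ is thin if $p=r=0$, semi-thin if exactly one of $p,r$ is $0$. Put $\mathsf{td}(p,q,r)=q-1$ if $p=r=0$ and $\mathsf{td}(p,q,r)=p-r+q$ otherwise. A stacking $S$ of boxes of sizes $c_1,\dots,c_n$ and resulting size $c$ has degree $|S|=\mathsf{td}(c)-\sum_i\mathsf{td}(c_i)$. It is *thin-quadratic* if $|S|=2-n$, its horizontal composite graph has exactly two connected components and no $c_i$ is semi-thin. **Signs.** Put $S^{\mathsf d}=0$ for $S=\eta$ and, for $S$ built from a bottom box of size $(p,n,r)$ and $S_1,\dots,S_n$ as above, $$S^{\mathsf d}=(p_0+p_n)r+\sum_{i=1}^n(q_i-1)(n-i)+\sum_{i=1}^n(q_i-1)(p-r+p_0-p_{i-1})+\sum_{i=1}^nS_i^{\mathsf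 d}.$$ For a stacking $S$ of $n$ boxes put $S^{\mathsf{td}}=S^{\mathsf d}+n+\sum_{t}\mathsf{td}(c_t)\cdot\#\{t'>t: c_{t'}\text{ not thin}\}$. **Operations.** Let $\mathrm{Tot}=\mathrm{Tot}(s_{\mathsf{td}}^{-1}\mathbf C_\square(\mathcal A))$ be the graded $k$-module with $\mathrm{Tot}^d=\prod_{\mathsf{td}(p,q,r)=d}\mathbf C_\square^{p,q,r}(\mathcal A)$. For $n\ge2$ and $x_1,\dots,x_n\in \prod_{p,q,r}\mathbf C_\square^{p,q,r}(\mathcal A)$ let the $c$-component of $P_n(x_1,\dots,x_n)$ be $$\sum_S(-1)^{S^{\mathsf{td}}+\frac{|S|(|S|+1)}2+|S|\,\mathsf{td}(c)+\sum_{i<j}\mathsf{td}(c_i)\mathsf{td}(c_j)}\,S\big((x_1)_{c_1},\dots,(x_n)_{c_n}\big),$$ the sum over all thin-quadratic stackings $S$ of $n$ boxes with resulting size $c$; $c_1,\dots,c_n$ denote the sizes of the boxes of $S$. A graded module $G$ with multilinear operations $P_n$ of degree $2-n$ $(n\ge2)$ is an *$L_\infty$-admissible algebra* (with zero differential) if for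 all $n\ge2$ $$\sum_{\substack{k+l=n+1\\k,l\ge2}}\ \sum_{\sigma\in\mathbb S_n}\ \sum_{j=1}^k(-1)^{(k-1)l+(j-1)(l-1)}(-1)^\sigma(P_k\circ_jP_l)^\sigma=0$$ on $G$ (with Koszul signs); an *$L_\infty$-admissible subalgebra* is a graded submodule closed under all $P_n$. Finally, let $s^{-1}\mathbf C_{GS}(\mathcal A)\subseteq\prod_{p,q,r}\mathbf C^{p,q,r}_\square(\mathcal A)$ be the desuspended Gerstenhaber–Schack object, with degree $d$ part $\bigoplus_{p+q=d+1}\mathbf C_\square^{p,q,\min\{1,p\}}(\mathcal A)$, and let $\overline{\mathrm{Tot}}\subseteq\mathrm{Tot}$ and $\overline{s^{-1}\mathbf C_{GS}}\subseteq s^{-1}\mathbf C_{GS}(\mathcal A)$ be the graded submodules of the elements whose component in $\mathbf C_\square^{0,0,0}(\mathcal A)$ is zero. **Proposition.** 1. The sums defining $P_n$, $n\ge 2$, have only finitely many nonzero terms, and the $P_n$ are multilinear operations of degree $2-n$ on $\mathrm{Tot}$. 2. $s^{-1}\mathbf C_{GS}(\mathcal A)$ is a graded submodule of $\mathrm{Tot}$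 and is closed under all $P_n$, $n\ge2$. 3. $\overline{\mathrm{Tot}}$ is an $L_\infty$-admissible algebra, and $\overline{s^{-1}\mathbf C_{GS}}$ is an $L_\infty$-admissible subalgebra of it. -/

import Mathlib

open CategoryTheory

/-! ## Quivers on a small category -/

set_option linter.checkUnivs false

universe u v w₁ w₂ w₃

/-- A `k`-quiver on a category `U`: for every object `X` a set of objects `obj X` with
`k`-modules of arrows, and for every `u : X ⟶ Y` a function `u^* : obj Y → obj X`
(no functoriality is required). -/
structure LinQuiver (k : Type w₁) [CommRing k] (U : Type u) [Category.{v} U] where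
  obj : U → Type w₂
  hom : ∀ X : U, obj X → obj X → Type w₃
  [addCommGroup : ∀ X a b, AddCommGroup (hom X a b)]
  [module : ∀ X a b, Module k (hom X a b)]
  restr : ∀ {X Y : U}, (X ⟶ Y) → obj Y → obj X

attribute [instance] LinQuiver.addCommGroup LinQuiver.module

/-! ## Simplices of the nerve, and endpoint preserving strictly increasing maps -/

/-- `NSimplex U p X Y` is the set of `p`-simplices `X = U₀ ⟶ U₁ ⟶ ⋯ ⟶ U_p = Y` of the nerve
of `U` from `X` to `Y`. -/
inductive NSimplex (U : Type u) [Category.{v} U] : ℕ → U → U → Type (max u v)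
  | nil (X : U) : NSimplex U 0 X X
  | cons {p : ℕ} {X Y Z : U} (u : X ⟶ Y) (s : NSimplex U p Y Z) : NSimplex U (p + 1) X Z

/-- `Coarse r p` encodes the strictly increasing maps `f : [r] → [p]` with `f 0 = 0` and
`f r = p`, read from the left.  `keep f` is `0 ↦ 0`, `i + 1 ↦ f i + 1` (the vertex `1` is in the
image); `merge f` is `0 ↦ 0`, `i + 1 ↦ f (i + 1) + 1` (the vertex `1` is not in the image).
See `Coarse.toFun` and `Coarse.toFun_bijective`. -/
inductive Coarse : ℕ → ℕ → Type
  | nil : Coarse 0 0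
  | keep {r p : ℕ} (f : Coarse r p) : Coarse (r + 1) (p + 1)
  | merge {r p : ℕ} (f : Coarse (r + 1) p) : Coarse (r + 1) (p + 1)

namespace Coarse

/-- The map `[r] → [p]` encoded by an element of `Coarse r p`. -/
def toFun : ∀ {r p : ℕ}, Coarse r p → Fin (r + 1) → Fin (p + 1)
  | _, _, nil => fun i => i
  | _, _, keep f => Fin.cons 0 fun i => (f.toFun i).succ
  | _, _, merge f => Fin.cons 0 fun i => (f.toFun i.succ).succ

theorem toFun_zero : ∀ {r p : ℕ} (f : Coarse r p), f.toFun 0 = 0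
  | _, _, nil => rfl
  | _, _, keep _ => rfl
  | _, _, merge _ => rfl

theorem toFun_last : ∀ {r p : ℕ} (f : Coarse r p), f.toFun (Fin.last r) = Fin.last p
  | _, _, nil => rfl
  | _, _, keep f => by
      rw [← Fin.succ_last, toFun, Fin.cons_succ, f.toFun_last, Fin.succ_last]
  | _, _, merge f => by
      rw [← Fin.succ_last, toFun, Fin.cons_succ, Fin.succ_last, f.toFun_last, Fin.succ_last]

theorem toFun_strictMono : ∀ {r p : ℕ} (f : Coarse r p), StrictMono f.toFun
  | _, _, nil => fun _ _ h => h
  | _, _, keep f => by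
      intro i j h
      induction i using Fin.cases with
      | zero =>
        induction j using Fin.cases with
        | zero => exact absurd h (lt_irrefl _)
        | succ j => simp [toFun]
      | succ i =>
        induction j using Fin.cases with
        | zero => exact absurd h (Fin.not_lt_zero _)
        | succ j => simpa [toFun] using f.toFun_strictMono (Fin.succ_lt_succ_iff.mp h)
  | _, _, merge f => by
      intro i j h
      induction i using Fin.cases with
      | zero =>
        induction j using Fin.cases with
        | zero => exact absurd h (lt_irrefl _)
        | succ j => simp [toFun]
      | succ i =>
        induction j using Fin.cases with
        | zero => exact absurd h (Fin.not_lt_zero _)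
        | succ j => simpa [toFun] using f.toFun_strictMono h

theorem toFun_injective : ∀ {r p : ℕ}, Function.Injective (toFun (r := r) (p := p)) := by
  intro r p f
  induction f with
  | nil => intro g _; cases g; rfl
  | keep f ih =>
    intro g h
    cases g with
    | keep g =>
      congr 1
      apply ih
      funext i
      have := congrFun h i.succ
      simpa [toFun] using this
    | merge g =>
      exfalso
      have h1 := congrFun h (Fin.succ 0)
      simp only [toFun, Fin.cons_succ, Fin.succ_inj] at h1
      rw [f.toFun_zero] at h1
      have h2 := g.toFun_strictMono (Fin.succ_pos 0)
      rw [← h1] at h2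
      exact absurd h2 (Fin.not_lt_zero _)
  | merge f ih =>
    intro g h
    cases g with
    | keep g =>
      exfalso
      have h1 := congrFun h (Fin.succ 0)
      simp only [toFun, Fin.cons_succ, Fin.succ_inj] at h1
      rw [g.toFun_zero] at h1
      have h2 := f.toFun_strictMono (Fin.succ_pos 0)
      rw [h1] at h2
      exact absurd h2 (Fin.not_lt_zero _)
    | merge g =>
      congr 1
      apply ih
      funext i
      induction i using Fin.cases with
      | zero => rw [f.toFun_zero, g.toFun_zero]
      | succ i =>
        have := congrFun h i.succ
        simpa [toFun] using this

theorem exists_toFun_eq : ∀ {p r : ℕ} (F : Fin (r + 1) → Fin (p + 1)), StrictMono F → F 0 = 0 →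
    F (Fin.last r) = Fin.last p → ∃ f : Coarse r p, f.toFun = F
  | 0, 0, F, _, _, _ => ⟨nil, by funext i; exact Subsingleton.elim (α := Fin 1) _ _⟩
  | 0, r + 1, F, hF, _, _ => absurd (hF (Fin.succ_pos 0)) (by
      rw [Subsingleton.elim (α := Fin 1) (F 0) (F (Fin.succ 0))]; exact lt_irrefl _)
  | p + 1, 0, F, _, h0, hl => by
      have h : (0 : Fin (p + 1 + 1)) = Fin.last (p + 1) := h0.symm.trans hl
      exact absurd (congrArg Fin.val h) (by simp)
  | p + 1, r + 1, F, hF, h0, hl => by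
      have hpos : ∀ i : Fin (r + 1), F i.succ ≠ 0 := fun i hi => by
        have := hF (Fin.succ_pos i)
        rw [hi] at this
        exact absurd this (Fin.not_lt_zero _)
      -- the map shifted by one on both sides
      let G : Fin (r + 1) → Fin (p + 1) := fun i => (F i.succ).pred (hpos i)
      have hG : ∀ i, (G i).succ = F i.succ := fun i => Fin.succ_pred _ _
      have hGm : StrictMono G := fun i j h => by
        rw [← Fin.succ_lt_succ_iff, hG, hG]
        exact hF (Fin.succ_lt_succ_iff.mpr h)
      have hGl : G (Fin.last r) = Fin.last p := by
        apply Fin.succ_injective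
        rw [hG, Fin.succ_last, Fin.succ_last, hl]
      by_cases h1 : G 0 = 0
      · obtain ⟨f, hf⟩ := exists_toFun_eq G hGm h1 hGl
        refine ⟨keep f, ?_⟩
        funext i
        induction i using Fin.cases with
        | zero => exact h0.symm
        | succ i => rw [toFun, Fin.cons_succ, hf, hG]
      · let H : Fin (r + 1 + 1) → Fin (p + 1) := Fin.cons 0 G
        have hHm : StrictMono H := fun i j h => by
          induction i using Fin.cases with
          | zero =>
            induction j using Fin.cases with
            | zero => exact absurd h (lt_irrefl _)
            | succ j =>
              change 0 < G j
              exact lt_of_lt_of_le (Fin.pos_iff_ne_zero.mpr h1)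
                (hGm.monotone (Fin.zero_le _))
          | succ i =>
            induction j using Fin.cases with
            | zero => exact absurd h (Fin.not_lt_zero _)
            | succ j => exact hGm (Fin.succ_lt_succ_iff.mp h)
        have hHl : H (Fin.last (r + 1)) = Fin.last p := by
          rw [← Fin.succ_last]; exact hGl
        obtain ⟨f, hf⟩ := exists_toFun_eq H hHm rfl hHl
        refine ⟨merge f, ?_⟩
        funext i
        induction i using Fin.cases with
        | zero => exact h0.symm
        | succ i =>
          rw [toFun, Fin.cons_succ, hf]
          exact hG i

/-- `Coarse r p` is exactly the set of strictly increasing endpoint preserving maps. -/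
theorem toFun_bijective (r p : ℕ) : Function.Bijective
    (fun f : Coarse r p => (⟨f.toFun, f.toFun_strictMono, f.toFun_zero, f.toFun_last⟩ :
      {F : Fin (r + 1) → Fin (p + 1) // StrictMono F ∧ F 0 = 0 ∧ F (Fin.last r) = Fin.last p})) :=
  ⟨fun _ _ h => toFun_injective (congrArg Subtype.val h), fun ⟨F, h1, h2, h3⟩ => by
    obtain ⟨f, hf⟩ := exists_toFun_eq F h1 h2 h3
    exact ⟨f, Subtype.ext hf⟩⟩

instance (r p : ℕ) : Finite (Coarse r p) := Finite.of_injective _ toFun_injective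

noncomputable instance (r p : ℕ) : Fintype (Coarse r p) := Fintype.ofFinite _

/-- The identity of `[p]`. -/
def id : ∀ p : ℕ, Coarse p p
  | 0 => nil
  | p + 1 => keep (id p)

/-- Composition of maps: `comp f g` is `f ∘ g`. -/
def comp : ∀ {t r p : ℕ}, Coarse r p → Coarse t r → Coarse t p
  | _, _, _, nil, g => g
  | _, _, _, keep f, keep g => keep (comp f g)
  | _, _, _, keep f, merge g => merge (comp f g)
  | _, _, _, merge f, keep g => merge (comp f (keep g))
  | _, _, _, merge f, merge g => merge (comp f (merge g))

/-- Concatenation `[r' + r] → [p' + p]` of `f : [r] → [p]` followed by `g : [r'] → [p']`. -/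
def append : ∀ {r p r' p' : ℕ}, Coarse r p → Coarse r' p' → Coarse (r' + r) (p' + p)
  | _, _, _, _, nil, g => g
  | _, _, _, _, keep f, g => keep (append f g)
  | r + 1, p + 1, r', p', merge f, g =>
      merge (r := r' + r) (p := p' + p) (append (r := r + 1) (p := p) (r' := r') (p' := p') f g)

theorem toFun_id : ∀ p : ℕ, (id p).toFun = fun i => i
  | 0 => rfl
  | p + 1 => by
      funext i
      induction i using Fin.cases with
      | zero => rfl
      | succ i => simp [id, toFun, toFun_id p]

theorem toFun_comp : ∀ {t r p : ℕ} (f : Coarse r p) (g : Coarse t r),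
    (comp f g).toFun = f.toFun ∘ g.toFun
  | _, _, _, nil, g => by funext i; simp [comp, toFun]
  | _, _, _, keep f, keep g => by
      funext i
      induction i using Fin.cases with
      | zero => rfl
      | succ i => simp [comp, toFun, toFun_comp f g]
  | _, _, _, keep f, merge g => by
      funext i
      induction i using Fin.cases with
      | zero => rfl
      | succ i => simp [comp, toFun, toFun_comp f g]
  | _, _, _, merge f, keep g => by
      funext i
      induction i using Fin.cases with
      | zero => rfl
      | succ i => simp [comp, toFun, toFun_comp f (keep g)]
  | _, _, _, merge f, merge g => by
      funext i
      induction i using Fin.cases with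
      | zero => rfl
      | succ i => simp [comp, toFun, toFun_comp f (merge g)]

end Coarse

namespace NSimplex

variable {U : Type u} [Category.{v} U]

/-- Precomposition of the first arrow of a simplex with `u`. -/
def precomp {r : ℕ} {X Y Z : U} (u : X ⟶ Y) : NSimplex U (r + 1) Y Z → NSimplex U (r + 1) X Z
  | cons w t => cons (u ≫ w) t

/-- The action of `f : [r] → [p]` on a `p`-simplex `s`: the `r`-simplex with vertices
`U_{f 0}, …, U_{f r}`. -/
def act : ∀ {r p : ℕ} {X Y : U}, Coarse r p → NSimplex U p X Y → NSimplex U r X Y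
  | _, _, _, _, .nil, s => s
  | _, _, _, _, .keep f, cons u s => cons u (act f s)
  | _, _, _, _, .merge f, cons u s => precomp u (act f s)

/-- The vertex of a `(p' + p)`-simplex after its first `p` arrows. -/
def mid {p' : ℕ} : ∀ (p : ℕ) {X Z : U}, NSimplex U (p' + p) X Z → U
  | 0, X, _, _ => X
  | p + 1, _, _, cons _ s => mid p s

/-- The first `p` arrows of a `(p' + p)`-simplex. -/
def head {p' : ℕ} : ∀ (p : ℕ) {X Z : U} (s : NSimplex U (p' + p) X Z), NSimplex U p X (s.mid p)
  | 0, X, _, _ => nil X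
  | p + 1, _, _, cons u s => cons u (head p s)

/-- The last `p'` arrows of a `(p' + p)`-simplex. -/
def tail {p' : ℕ} : ∀ (p : ℕ) {X Z : U} (s : NSimplex U (p' + p) X Z), NSimplex U p' (s.mid p) Z
  | 0, _, _, s => s
  | p + 1, _, _, cons _ s => tail p s

/-- Concatenation of simplices. -/
def append {p' : ℕ} : ∀ {p : ℕ} {X Y Z : U}, NSimplex U p X Y → NSimplex U p' Y Z →
    NSimplex U (p' + p) X Z
  | _, _, _, _, nil _, t => t
  | _, _, _, _, cons u s, t => cons u (append s t)

theorem act_append {r' p' : ℕ} {r p : ℕ} (f : Coarse r p) (g : Coarse r' p') :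
    ∀ {X Z : U} (s : NSimplex U (p' + p) X Z),
      act (f.append g) s = append (act f (s.head p)) (act g (s.tail p)) := by
  induction f with
  | nil => intro X Z s; rfl
  | keep f ih =>
    intro X Z s
    cases s with
    | cons u s => exact congrArg (cons u) (ih s)
  | @merge r p f ih =>
    intro X Z s
    cases s with
    | cons u s =>
      change precomp u (act (f.append g) s) =
        append (precomp u (act f (s.head p))) (act g (s.tail p))
      rw [ih s]
      cases act f (s.head p) with
      | cons w t => rfl

theorem act_id : ∀ {p : ℕ} {X Y : U} (s : NSimplex U p X Y), act (Coarse.id p) s = s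
  | _, _, _, nil _ => rfl
  | _, _, _, cons u s => congrArg (cons u) (act_id s)

theorem act_comp : ∀ {t r p : ℕ} {X Y : U} (f : Coarse r p) (g : Coarse t r)
    (s : NSimplex U p X Y), act (Coarse.comp f g) s = act g (act f s)
  | _, _, _, _, _, .nil, g, s => by simp [Coarse.comp, act]
  | _, _, _, _, _, .keep f, .keep g, cons u s => by
      simp [Coarse.comp, act, act_comp f g s]
  | _, _, _, _, _, .keep f, .merge g, cons u s => by
      simp [Coarse.comp, act, act_comp f g s]
  | _, _, _, _, _, .merge f, .keep g, cons u s => by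
      simp only [Coarse.comp, act, act_comp f (.keep g) s]
      cases act f s with
      | cons w t => simp [act, precomp]
  | _, _, _, _, _, .merge f, .merge g, cons u s => by
      simp only [Coarse.comp, act, act_comp f (.merge g) s]
      cases act f s with
      | cons w t =>
        simp only [act, precomp]
        cases act g t with
        | cons w' t' => simp

end NSimplex

namespace LinQuiver

variable {k : Type w₁} [CommRing k] {U : Type u} [Category.{v} U] (A : LinQuiver.{u, v, w₁, w₂, w₃} k U)

/-- For a simplex `s` from `X` to `Y` with arrows `u₁, …, u_p`, the function
`s^* = u₁^* ∘ ⋯ ∘ u_p^*`. -/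
def pull : ∀ {p : ℕ} {X Y : U}, NSimplex U p X Y → A.obj Y → A.obj X
  | _, _, _, .nil _, a => a
  | _, _, _, .cons u s, a => A.restr u (pull s a)

theorem pull_head_tail {p' : ℕ} : ∀ (p : ℕ) {X Z : U} (s : NSimplex U (p' + p) X Z)
    (a : A.obj Z), A.pull (s.head p) (A.pull (s.tail p) a) = A.pull s a
  | 0, _, _, _, _ => rfl
  | p + 1, _, _, .cons u s, a => congrArg (A.restr u) (pull_head_tail p s a)

theorem pull_append {p' : ℕ} : ∀ {p : ℕ} {X Y Z : U} (s : NSimplex U p X Y)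
    (t : NSimplex U p' Y Z) (a : A.obj Z), A.pull s (A.pull t a) = A.pull (s.append t) a
  | _, _, _, _, .nil _, _, _ => rfl
  | _, _, _, _, .cons u s, t, a => congrArg (A.restr u) (pull_append s t a)

/-! ## The modules `C^{p,q,r}(A)` and their box operad structure -/

/-- The `k`-module `C^{p,q,r}(A)`: the product over all `p`-simplices `s` from `X` to `Y`, all
strictly increasing endpoint preserving `f : [r] → [p]` and all objects `a 0, …, a q` of `A(Y)`
of the `k`-module of `k`-linear maps
`⨂ᵢ A(Y)(a (i-1), a i) → A(X)(s^* (a 0), f(s)^* (a q))`.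
It vanishes when there is no such `f`, in particular when `p < r`. -/
abbrev Box (p q r : ℕ) : Type (max u v w₂ w₃) :=
  ∀ (X Y : U) (s : NSimplex U p X Y) (f : Coarse r p) (a : Fin (q + 1) → A.obj Y),
    MultilinearMap k (fun i : Fin q => A.hom Y (a i.castSucc) (a i.succ))
      (A.hom X (A.pull s (a 0)) (A.pull (s.act f) (a (Fin.last q))))

/-- The identity element of `C^{0,1,0}(A)`. -/
def idBox : A.Box 0 1 0 := fun X Y s f =>
  match X, Y, s, f with
  | _, _, .nil _, .nil => fun _ =>
    { toFun := fun m => m 0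
      map_update_add' := fun m i x y => by
        obtain rfl : i = 0 := Subsingleton.elim _ _
        simp only [Function.update_self]
        rfl
      map_update_smul' := fun m i c x => by
        obtain rfl : i = 0 := Subsingleton.elim _ _
        simp only [Function.update_self]
        rfl }

/-- Partial sums `q 0 + ⋯ + q (j-1)`. -/
def partialSum {n : ℕ} (q : Fin n → ℕ) : ∀ j : ℕ, j ≤ n → ℕ
  | 0, _ => 0
  | j + 1, h => partialSum q j (Nat.le_of_succ_le h) + q ⟨j, h⟩

theorem partialSum_mono {n : ℕ} (q : Fin n → ℕ) : ∀ (j : ℕ) (h : j ≤ n) (d : ℕ) (h' : j + d ≤ n),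
    partialSum q j h ≤ partialSum q (j + d) h'
  | _, _, 0, _ => le_rfl
  | j, h, d + 1, h' => (partialSum_mono q j h d (Nat.le_of_succ_le h')).trans (Nat.le_add_right _ _)

theorem partialSum_le {n : ℕ} (q : Fin n → ℕ) (j : ℕ) (h : j ≤ n) :
    partialSum q j h ≤ partialSum q n le_rfl := by
  obtain ⟨d, rfl⟩ := Nat.exists_eq_add_of_le h
  exact partialSum_mono q j h d le_rfl

theorem exists_block {n : ℕ} (q : Fin n → ℕ) (t : ℕ) : ∀ (j : ℕ) (h : j ≤ n),
    t < partialSum q j h → ∃ (i : Fin n) (e : Fin (q i)), t = partialSum q i i.2.le + e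
  | 0, _, ht => absurd ht (Nat.not_lt_zero _)
  | j + 1, h, ht => by
      by_cases hc : t < partialSum q j (Nat.le_of_succ_le h)
      · exact exists_block q t j _ hc
      · refine ⟨⟨j, h⟩, ⟨t - partialSum q j (Nat.le_of_succ_le h), ?_⟩, ?_⟩
        · have : t < partialSum q j (Nat.le_of_succ_le h) + q ⟨j, h⟩ := ht
          omega
        · change t = partialSum q j _ + (t - partialSum q j _)
          omega

theorem block_lt {n : ℕ} (q : Fin n → ℕ) (j : Fin n) (i : ℕ) (hi : i < q j) :
    partialSum q j j.2.le + i < partialSum q n le_rfl :=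
  lt_of_lt_of_le (Nat.add_lt_add_left hi _) (partialSum_le q (j + 1) j.2)

theorem block_disjoint {n : ℕ} (q : Fin n → ℕ) {j j' : Fin n} (hj : j ≠ j') (i : Fin (q j))
    (i' : Fin (q j')) : partialSum q j j.2.le + i ≠ partialSum q j' j'.2.le + i' := by
  have key : ∀ (j j' : Fin n) (i : Fin (q j)), j < j' →
      partialSum q j j.2.le + i < partialSum q j' j'.2.le := fun j j' i h => by
    obtain ⟨d, hd⟩ := Nat.exists_eq_add_of_le (Nat.succ_le_of_lt (Fin.lt_def.mp h))
    have h1 : partialSum q (j + 1) j.2 ≤ partialSum q (j + 1 + d) (hd ▸ j'.2.le) :=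
      partialSum_mono q _ _ _ _
    have h2 : partialSum q j j.2.le + i < partialSum q (j + 1) j.2 :=
      Nat.add_lt_add_left i.2 _
    have h3 : partialSum q (j + 1 + d) (hd ▸ j'.2.le) = partialSum q j' j'.2.le := by
      congr 1
      exact hd.symm
    omega
  rcases lt_or_gt_of_ne hj with h | h
  · have := key j j' i h
    omega
  · have := key j' j i' h
    omega

/-- Transport of arrows along equalities of their endpoints. -/
def homCast {X : U} {a a' b b' : A.obj X} (h₁ : a = a') (h₂ : b = b') :
    A.hom X a b →ₗ[k] A.hom X a' b' :=
  match h₁, h₂ with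
  | rfl, rfl => LinearMap.id

section Row

variable {n : ℕ} {h : Fin (n + 1) → ℕ} {q : Fin n → ℕ}
  (F : ∀ j : Fin n, Coarse (h j.succ) (h j.castSucc)) {Y Z : U}

/-- The simplices `s, F₁(s), F₂(F₁(s)), …` along a row. -/
def rowSimplex (s : NSimplex U (h 0) Y Z) : ∀ (j : ℕ) (hj : j < n + 1), NSimplex U (h ⟨j, hj⟩) Y Z
  | 0, _ => s
  | j + 1, hj => (rowSimplex s j (Nat.lt_of_succ_lt hj)).act (F ⟨j, Nat.lt_of_succ_lt_succ hj⟩)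

/-- The composites `F₁ ∘ ⋯ ∘ F_j`. -/
def rowComp : ∀ (j : ℕ) (hj : j < n + 1), Coarse (h ⟨j, hj⟩) (h 0)
  | 0, _ => Coarse.id _
  | j + 1, hj => (rowComp j (Nat.lt_of_succ_lt hj)).comp (F ⟨j, Nat.lt_of_succ_lt_succ hj⟩)

theorem rowSimplex_eq (s : NSimplex U (h 0) Y Z) : ∀ (j : ℕ) (hj : j < n + 1),
    rowSimplex F s j hj = s.act (rowComp F j hj)
  | 0, _ => (NSimplex.act_id s).symm
  | j + 1, hj => by
      rw [rowSimplex, rowComp, NSimplex.act_comp, rowSimplex_eq s j]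

variable (s : NSimplex U (h 0) Y Z) (a : Fin (partialSum q n le_rfl + 1) → A.obj Z)

/-- The objects between the consecutive boxes of a row. -/
def rowObj (j : Fin (n + 1)) : A.obj Y :=
  A.pull (rowSimplex F s j j.2)
    (a ⟨partialSum q j (Nat.le_of_lt_succ j.2), Nat.lt_succ_of_le (partialSum_le q _ _)⟩)

variable (b : ∀ j : Fin n, A.Box (h j.castSucc) (q j) (h j.succ))

/-- The arrows produced by the boxes of a row: the `j`-th box is evaluated at the `j`-th simplex
and at the `j`-th block of consecutive arrows. -/
def rowArrow (m : ∀ i : Fin (partialSum q n le_rfl), A.hom Z (a i.castSucc) (a i.succ))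
    (j : Fin n) : A.hom Y (A.rowObj F s a j.castSucc) (A.rowObj F s a j.succ) :=
  b j Y Z (rowSimplex F s j (Nat.lt_succ_of_lt j.2)) (F j)
    (fun i => a ⟨partialSum q j j.2.le + i,
      Nat.lt_succ_of_le ((Nat.add_le_add_left (Nat.le_of_lt_succ i.2) _).trans
        (partialSum_le q (j + 1) j.2))⟩)
    (fun i => m ⟨partialSum q j j.2.le + i, block_lt q j i i.2⟩)

theorem rowArrow_update [DecidableEq (Fin (partialSum q n le_rfl))] (t : Fin (partialSum q n le_rfl))
    (m : ∀ i : Fin (partialSum q n le_rfl), A.hom Z (a i.castSucc) (a i.succ)) :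
    ∃ (j : Fin n) (g : A.hom Z (a t.castSucc) (a t.succ) →ₗ[k]
        A.hom Y (A.rowObj F s a j.castSucc) (A.rowObj F s a j.succ)),
      ∀ x, A.rowArrow F s a b (Function.update m t x) =
        Function.update (A.rowArrow F s a b m) j (g x) := by
  obtain ⟨t, ht⟩ := t
  obtain ⟨j, e, rfl⟩ := exists_block q t n le_rfl ht
  let N := b j Y Z (rowSimplex F s j (Nat.lt_succ_of_lt j.2)) (F j)
    (fun i => a ⟨partialSum q j j.2.le + i,
      Nat.lt_succ_of_le ((Nat.add_le_add_left (Nat.le_of_lt_succ i.2) _).trans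
        (partialSum_le q (j + 1) j.2))⟩)
  refine ⟨j, N.toLinearMap (fun i => m ⟨partialSum q j j.2.le + i, block_lt q j i i.2⟩) e, ?_⟩
  intro x
  funext j'
  by_cases hj : j' = j
  · subst hj
    rw [Function.update_self]
    refine congrArg N ?_
    have hinj : Function.Injective (fun i : Fin (q j') =>
        (⟨partialSum q j' j'.2.le + i, block_lt q j' i i.2⟩ : Fin (partialSum q n le_rfl))) := by
      intro i i' hi
      have := congrArg Fin.val hi
      simp only [Nat.add_left_cancel_iff] at this
      exact Fin.ext this
    convert Function.update_comp_eq_of_injective' m hinj e x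
  · rw [Function.update_of_ne hj]
    refine congrArg (b j' Y Z (rowSimplex F s j' (Nat.lt_succ_of_lt j'.2)) (F j') _) ?_
    funext i
    refine Function.update_of_ne ?_ _ _
    intro hc
    exact block_disjoint q hj i e (congrArg Fin.val hc)

end Row

section Composition

variable {n : ℕ} {h : Fin (n + 1) → ℕ} {q : Fin n → ℕ} {p r : ℕ}

/-- The value of `c ∈ C^{p,n,r}(A)` on the arrows produced by a row of boxes, as a multilinear map:
the simplex `s` is cut into its first `p` arrows, on which `c` is evaluated, and the remaining
ones, on which the row is evaluated. -/
def rowMultilinear (c : A.Box p n r)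
    (b : ∀ j : Fin n, A.Box (h j.castSucc) (q j) (h j.succ))
    {X Z : U} (s : NSimplex U (h 0 + p) X Z) (a : Fin (partialSum q n le_rfl + 1) → A.obj Z)
    (f₀ : Coarse r p) (F : ∀ j : Fin n, Coarse (h j.succ) (h j.castSucc)) :
    MultilinearMap k
      (fun i : Fin (partialSum q n le_rfl) => A.hom Z (a i.castSucc) (a i.succ))
      (A.hom X (A.pull (s.head p) (A.rowObj F (s.tail p) a 0))
        (A.pull ((s.head p).act f₀) (A.rowObj F (s.tail p) a (Fin.last n)))) where
  toFun m := c X (s.mid p) (s.head p) f₀ (A.rowObj F (s.tail p) a)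
    (A.rowArrow F (s.tail p) a b m)
  map_update_add' m t x y := by
    obtain ⟨j, g, hg⟩ := A.rowArrow_update F (s.tail p) a b t m
    rw [hg, hg, hg, map_add, MultilinearMap.map_update_add]
  map_update_smul' m t x y := by
    obtain ⟨j, g, hg⟩ := A.rowArrow_update F (s.tail p) a b t m
    rw [hg, hg, map_smul, MultilinearMap.map_update_smul]

theorem pull_rowObj_last {X Z : U} (s : NSimplex U (h 0 + p) X Z)
    (a : Fin (partialSum q n le_rfl + 1) → A.obj Z) (f₀ : Coarse r p)
    (F : ∀ j : Fin n, Coarse (h j.succ) (h j.castSucc)) :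
    A.pull ((s.head p).act f₀) (A.rowObj F (s.tail p) a (Fin.last n)) =
      A.pull (s.act (f₀.append (rowComp F n n.lt_succ_self))) (a (Fin.last _)) := by
  rw [NSimplex.act_append, ← pull_append, ← rowSimplex_eq]
  rfl

open Classical in
/-- The composition of the box operad `C(A)`: the component at `(s, f)` is the sum over all
decompositions of `f` as the concatenation of some `f₀ : [r] → [p]` and some composite
`F₁ ∘ ⋯ ∘ F_n` (it is zero when `f r ≠ p`). -/
noncomputable def compBox (c : A.Box p n r)
    (b : ∀ j : Fin n, A.Box (h j.castSucc) (q j) (h j.succ)) :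
    A.Box (h 0 + p) (partialSum q n le_rfl) (h (Fin.last n) + r) :=
  fun _ _ s f a =>
    ∑ f₀ : Coarse r p, ∑ F : (∀ j : Fin n, Coarse (h j.succ) (h j.castSucc)),
      if e : f₀.append (rowComp F n n.lt_succ_self) = f then
        (A.homCast (A.pull_head_tail p s (a 0))
          ((A.pull_rowObj_last s a f₀ F).trans (by rw [e]))).compMultilinearMap
            (A.rowMultilinear c b s a f₀ F)
      else 0

end Composition

end LinQuiver

/-! ## Stackings of boxes -/

/-- `Stacking p q r` is the set of (admissible) stackings of boxes, with inputs possibly filled by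
the unit `η` of size `(0,1,0)`, whose result has size `(p,q,r)`, numbered in standard order.
In `node p r h c` a bottom box of size `(p,n,r)` has its `n` inputs filled, from left to right, by
the stackings `c 0, …, c (n-1)`; the adjacent depths of neighbouring children agree and are
recorded by `h`.  For `n = 0` the number `h 0` is the start value of the box.  A box all of whose
inputs are filled by the unit is a leaf of the stacking. -/
inductive Stacking : ℕ → ℕ → ℕ → Type
  | unit : Stacking 0 1 0
  | node {n : ℕ} (p r : ℕ) (h : Fin (n + 1) → ℕ) (q : Fin n → ℕ)
      (c : ∀ j : Fin n, Stacking (h j.castSucc) (q j) (h j.succ)) :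
      Stacking (h 0 + p) (LinQuiver.partialSum q n le_rfl) (h (Fin.last n) + r)

/-- The shifted degree of a box of size `c = (p,q,r)`: `q - 1` if it is thin, i.e. `p = r = 0`,
and `p - r + q` otherwise. -/
def thinDeg (c : ℕ × ℕ × ℕ) : ℤ :=
  if c.1 = 0 ∧ c.2.2 = 0 then c.2.1 - 1 else c.1 - c.2.2 + c.2.1

namespace Stacking

/-- The sizes of the boxes of a stacking, in standard order: the bottom box first, then the boxes
of the stackings on top of it, from left to right. -/
def boxes : ∀ {p q r : ℕ}, Stacking p q r → List (ℕ × ℕ × ℕ)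
  | _, _, _, unit => []
  | _, _, _, node (n := n) p r _ _ c => (p, n, r) :: (List.ofFn fun j => (c j).boxes).flatten

/-- The degree of a stacking after thin desuspension. -/
def degree {p q r : ℕ} (S : Stacking p q r) : ℤ :=
  thinDeg (p, q, r) - (S.boxes.map thinDeg).sum

/-- The horizontal composite graph of a stacking has as points its boxes and, for every vertical
boundary line between (or at the ends of) neighbouring children of a box, the unit segments of that
line.  A box of size `(p,q,r)` is joined to its `p` left and its `r` right segments. -/
def Point : ∀ {p q r : ℕ}, Stacking p q r → Type
  | _, _, _, unit => Empty
  | _, _, _, node (n := n) _ _ h _ c => Unit ⊕ (Σ j : Fin (n + 1), Fin (h j)) ⊕ (Σ j, (c j).Point)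

/-- The points attached to the inputs of the graph, i.e. to the left boundary of the stacking, from
bottom to top. -/
def left : ∀ {p q r : ℕ} (S : Stacking p q r), Fin p → S.Point
  | _, _, _, unit => Fin.elim0
  | _, _, _, node p _ _ _ _ => fun i =>
    if hi : i.1 < p then .inl () else .inr (.inl ⟨0, ⟨i.1 - p, by omega⟩⟩)

/-- The points attached to the outputs of the graph, i.e. to the right boundary. -/
def right : ∀ {p q r : ℕ} (S : Stacking p q r), Fin r → S.Point
  | _, _, _, unit => Fin.elim0
  | _, _, _, node (n := n) _ r _ _ _ => fun i =>
    if hi : i.1 < r then .inl () else .inr (.inl ⟨Fin.last n, ⟨i.1 - r, by omega⟩⟩)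

/-- The edges of the horizontal composite graph: those of the children, and those which attach the
left (right) boundary of the `j`-th child to the `j`-th (`(j + 1)`-st) vertical line. -/
def Edge : ∀ {p q r : ℕ} (S : Stacking p q r), S.Point → S.Point → Prop
  | _, _, _, unit => fun x _ => x.elim
  | _, _, _, node (n := n) _ _ h _ c => fun x y =>
    (∃ (j : Fin n) (x' y' : (c j).Point), (c j).Edge x' y' ∧
      x = .inr (.inr ⟨j, x'⟩) ∧ y = .inr (.inr ⟨j, y'⟩)) ∨
    (∃ (j : Fin n) (i : Fin (h j.castSucc)),
      x = .inr (.inl ⟨j.castSucc, i⟩) ∧ y = .inr (.inr ⟨j, (c j).left i⟩)) ∨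
    (∃ (j : Fin n) (i : Fin (h j.succ)),
      x = .inr (.inl ⟨j.succ, i⟩) ∧ y = .inr (.inr ⟨j, (c j).right i⟩))

/-- The number of connected components of the horizontal composite graph. -/
noncomputable def numComponents {p q r : ℕ} (S : Stacking p q r) : ℕ := Nat.card (Quot S.Edge)

/-- A box of size `c = (p,q,r)` is semi-thin if exactly one of `p`, `r` is zero. -/
def IsSemiThin (c : ℕ × ℕ × ℕ) : Prop := (c.1 ≠ 0 ∨ c.2.2 ≠ 0) ∧ (c.1 = 0 ∨ c.2.2 = 0)

/-- Thin-quadratic stackings of `n` boxes. -/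
structure IsThinQuadratic {p q r : ℕ} (S : Stacking p q r) (n : ℕ) : Prop where
  length_boxes : S.boxes.length = n
  degree_eq : S.degree = 2 - n
  numComponents_eq : S.numComponents = 2
  not_isSemiThin : ∀ c ∈ S.boxes, ¬ IsSemiThin c

/-- The exponent of the desuspended sign of a stacking. It is additive under composition, and its
value on the generator `C^{p₀,…,p_n;p,r}_{q₁,…,q_n}` is
`(p₀ + p_n) r + ∑ (q_i - 1) (n - i) + ∑ (q_i - 1) (p - r + p₀ - p_{i-1})`. -/
def desuspExp : ∀ {p q r : ℕ}, Stacking p q r → ℤ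
  | _, _, _, unit => 0
  | _, _, _, node (n := n) p r h q c =>
    ((h 0 : ℤ) + h (Fin.last n)) * r
      + ∑ i : Fin n, ((q i : ℤ) - 1) * (n - (i + 1))
      + ∑ i : Fin n, ((q i : ℤ) - 1) * (p - r + h 0 - h i.castSucc)
      + ∑ i : Fin n, (c i).desuspExp

/-- `∑ₜ td(c t) · #{boxes after t that are not thin}`. -/
def thinShuffleExp : List (ℕ × ℕ × ℕ) → ℤ
  | [] => 0
  | c :: l =>
    thinDeg c * (l.countP fun c' => ¬ (c'.1 = 0 ∧ c'.2.2 = 0)) + thinShuffleExp l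

/-- The exponent of the thin desuspended sign. -/
def thinDesuspExp {p q r : ℕ} (S : Stacking p q r) : ℤ :=
  S.desuspExp + S.boxes.length + thinShuffleExp S.boxes

/-- `∑ₜ td(c t) ∑_{t' > t} td(c t')`. -/
def pairExp : List (ℕ × ℕ × ℕ) → ℤ
  | [] => 0
  | c :: l => thinDeg c * (l.map thinDeg).sum + pairExp l

/-- The exponent of the sign with which a stacking acts on desuspended elements. -/
def actionExp {p q r : ℕ} (S : Stacking p q r) : ℤ :=
  S.degree * (S.degree + 1) / 2 + S.degree * thinDeg (p, q, r) + pairExp S.boxes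

end Stacking

namespace LinQuiver

variable {k : Type w₁} [CommRing k] {U : Type u} [Category.{v} U] (A : LinQuiver.{u, v, w₁, w₂, w₃} k U)

/-- The product of all `C^{p,q,r}(A)`. -/
abbrev Total : Type (max u v w₂ w₃) := ∀ p q r : ℕ, A.Box p q r

/-- The value of a stacking on the elements `x t, x (t + 1), …`: its boxes are filled, in
standard order, by the components of these elements of the appropriate sizes, and composed. -/
noncomputable def eval : ∀ {p q r : ℕ}, Stacking p q r → (ℕ → A.Total) → ℕ → A.Box p q r
  | _, _, _, .unit, _, _ => A.idBox
  | _, _, _, .node (n := n) p r _ _ c, x, t =>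
    A.compBox (x t p n r) fun j =>
      eval (c j) x (t + 1 + ∑ j' : Fin n with j' < j, (c j').boxes.length)

/-- Extension of a finite sequence by zero. -/
def pad {V : Type*} [Zero V] {n : ℕ} (x : Fin n → V) (i : ℕ) : V :=
  if hi : i < n then x ⟨i, hi⟩ else 0

/-- The contribution of a stacking to the `n`-th Gerstenhaber brace. -/
noncomputable def braceTerm {n : ℕ} (x : Fin n → A.Total) {p q r : ℕ} (S : Stacking p q r) :
    A.Box p q r :=
  (S.thinDesuspExp + S.actionExp).negOnePow • A.eval S (pad x) 0

/-- The `n`-th Gerstenhaber brace `P_n`: the signed sum over all thin-quadratic stackings of `n`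
boxes. -/
noncomputable def brace (n : ℕ) (x : Fin n → A.Total) : A.Total := fun p q r =>
  ∑ᶠ S : {S : Stacking p q r // S.IsThinQuadratic n}, A.braceTerm x S.1

/-- The degree `d` part of the totalisation of the thin desuspension of `C(A)`: the product of the
`C^{p,q,r}(A)` over the sizes `(p,q,r)` of shifted degree `d`. -/
def tot (d : ℤ) : Submodule k A.Total where
  carrier := {x | ∀ p q r : ℕ, thinDeg (p, q, r) ≠ d → x p q r = 0}
  zero_mem' := fun _ _ _ _ => rfl
  add_mem' := fun {x y} hx hy p q r hd => by
    rw [Pi.add_apply, Pi.add_apply, Pi.add_apply, hx p q r hd, hy p q r hd, add_zero]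
  smul_mem' := fun c x hx p q r hd => by
    rw [Pi.smul_apply, Pi.smul_apply, Pi.smul_apply, hx p q r hd, smul_zero]

/-- The degree `d` part of the desuspended Gerstenhaber–Schack object: the product of the
`C^{p,q}_GS(A) = C^{p,q,min(1,p)}(A)` over all `p`, `q` with `p + q = d + 1`. -/
def gs (d : ℤ) : Submodule k A.Total where
  carrier := {x | ∀ p q r : ℕ, ¬ (r = min 1 p ∧ (p : ℤ) + q = d + 1) → x p q r = 0}
  zero_mem' := fun _ _ _ _ => rfl
  add_mem' := fun {x y} hx hy p q r hd => by
    rw [Pi.add_apply, Pi.add_apply, Pi.add_apply, hx p q r hd, hy p q r hd, add_zero]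
  smul_mem' := fun c x hx p q r hd => by
    rw [Pi.smul_apply, Pi.smul_apply, Pi.smul_apply, hx p q r hd, smul_zero]

/-- The elements whose component of size `(0,0,0)` vanishes. -/
def uncurved : Submodule k A.Total where
  carrier := {x | x 0 0 0 = 0}
  zero_mem' := rfl
  add_mem' := fun {x y} (hx : x 0 0 0 = 0) (hy : y 0 0 0 = 0) => by
    change x 0 0 0 + y 0 0 0 = 0
    rw [hx, hy, add_zero]
  smul_mem' := fun c x (hx : x 0 0 0 = 0) => by
    change c • x 0 0 0 = 0
    rw [hx, smul_zero]

end LinQuiver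

/-! ## L∞-admissible algebras (with zero differential) and subalgebras -/

section LinfAdmissible

variable {k V : Type*} [CommRing k] [AddCommGroup V] [Module k V]

/-- On the graded module with pieces `G d`, the `P n`, `n ≥ 2`, are (multilinear) operations of
degree `2 - n`. -/
def IsGradedOperations (G : ℤ → Submodule k V) (P : ∀ n : ℕ, (Fin n → V) → V) : Prop :=
  ∀ n : ℕ, 2 ≤ n → ∀ d : Fin n → ℤ,
    ∃ M : MultilinearMap k (fun i => G (d i)) (G (∑ i, d i + 2 - n)),
      ∀ x : ∀ i, G (d i), (M x : V) = P n (fun i => (x i : V))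

/-- The Koszul sign of rearranging homogeneous elements of degrees `d 0, …, d (n-1)` into the
order `σ 0, …, σ (n-1)`. -/
def koszulSign {n : ℕ} (σ : Equiv.Perm (Fin n)) (d : Fin n → ℤ) : ℤˣ :=
  ∏ i : Fin n, ∏ j : Fin n, if i < j ∧ σ j < σ i then (d (σ i) * d (σ j)).negOnePow else 1

/-- `P_k (z 0, …, z (j-1), P_l (z j, …, z (j+l-1)), z (j+l), …)`. -/
def partialComp (P : ∀ n : ℕ, (Fin n → V) → V) (k l j : ℕ) (z : ℕ → V) : V :=
  P k fun i => if i.1 < j then z i else if i.1 = j then P l fun t => z (j + t) else z (i + l - 1)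

/-- The `P n`, `n ≥ 2`, make the graded module with pieces `G d` and zero differential into an
`L∞`-admissible algebra: they are operations of degree `2 - n` on it, and for `n ≥ 2`
`∑_{k + l = n + 1; k, l ≥ 2} ∑_{σ ∈ S_n} ∑_{1 ≤ j ≤ k}
  (-1)^{(k-1)l + (j-1)(l-1)} (-1)^σ (P_k ∘_j P_l)^σ = 0`.
The last exponent is the Koszul sign of moving `P_l` (of degree `2 - l`) past the first `j - 1`
inputs; the index `j` starts at `0` below. -/
structure IsLinfAdmissibleAlgebra (G : ℤ → Submodule k V) (P : ∀ n : ℕ, (Fin n → V) → V) :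
    Prop where
  operations : IsGradedOperations G P
  relation : ∀ n : ℕ, 2 ≤ n → ∀ (d : Fin n → ℤ) (x : Fin n → V), (∀ i, x i ∈ G (d i)) →
    ∑ kl ∈ Finset.HasAntidiagonal.antidiagonal (n + 1) with 2 ≤ kl.1 ∧ 2 ≤ kl.2,
      ∑ σ : Equiv.Perm (Fin n), ∑ j ∈ Finset.range kl.1,
        (((kl.1 - 1 : ℤ) * kl.2 + j * (kl.2 - 1)).negOnePow * Equiv.Perm.sign σ *
          koszulSign σ d *
          ((2 - kl.2 : ℤ) * ∑ i ∈ Finset.range j, LinQuiver.pad (d ∘ σ) i).negOnePow) •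
        partialComp P kl.1 kl.2 j (LinQuiver.pad (x ∘ σ)) = 0

/-- `H` is a graded submodule of `G` closed under the operations `P n`, `n ≥ 2`. -/
def IsClosedUnder (H G : ℤ → Submodule k V) (P : ∀ n : ℕ, (Fin n → V) → V) : Prop :=
  (∀ d, H d ≤ G d) ∧
    ∀ n : ℕ, 2 ≤ n → ∀ (d : Fin n → ℤ) (x : Fin n → V), (∀ i, x i ∈ H (d i)) →
      P n x ∈ H (∑ i, d i + 2 - n)

/-- `H` is an `L∞`-admissible subalgebra of the `L∞`-admissible algebra `G`: a graded submodule
closed under the operations, hence an `L∞`-admissible algebra itself. -/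
structure IsLinfAdmissibleSubalgebra (H G : ℤ → Submodule k V) (P : ∀ n : ℕ, (Fin n → V) → V) :
    Prop where
  ambient : IsLinfAdmissibleAlgebra G P
  closed : IsClosedUnder H G P
  algebra : IsLinfAdmissibleAlgebra H P

end LinfAdmissible

/-! ### Coarsenings and simplices: interchange and associativity. -/

namespace Coarse

/-! A stacking is determined by its planar tree of boxes and the height of its left boundary
(`Stacking.shape_heq`, `Stacking.exists_shape_eq`). Everything is therefore transferred to rows of
labelled planar trees (`Row`), for which filling the inputs of one row by the trees of another is a
plain recursive operation, `Row.graft`. Associativity of the box composition (`put_compBox_compBox`)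
and the left unit law give `ev_graft` and `ev_subst`: filling a box of a tree by the value of a
second tree amounts to evaluating the substituted tree.

The quantity `p - r + q - 1` is additive under composition, so the degree of a stacking only counts
boxes that are not thin (`Stacking.degree_eq`). Connectedness is tested by horizontal cuts: a cut
colours the graph in two colours (`Stacking.exists_separating`), and conversely a break between
neighbouring segments of the left boundary propagates to the right as a cut (`Stacking.separates`).
Hence a thin-quadratic stacking of at least two boxes is either a box with one thin box on top
(`IsPair`), or a thin root carrying a row of full boxes, with inputs and outputs on both sides, that
cannot be cut properly (`IsConn`); this is `Stacking.isThinQuadratic_iff`.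

Components with more outputs than inputs vanish, so in a contributing tree heights do not increase
from left to right; given the left height, the width and the number of boxes only finitely many
trees remain (`finite_rows`). If all boxes satisfy `r = min 1 p`, a cut ending at height one on the
right shows that the whole tree does (`Tree.right_eq`). A tree of size `(0,0,0)` is a pair whose
upper box has size `(0,0,0)`, so vanishing of that component is inherited by the braces.

After expansion, the terms of the `L∞`-relation are indexed by an outer tree with a hole and an
inner tree put into the hole (`Split`). For a fixed resulting tree there are exactly two of them
(`Split.exists_partner`). If the tree consists of a root and two thin boxes, either thin box can be
merged with the box below it. Otherwise the root is thin, exactly one further box is thin, and the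
rest is full and connected. Then the thin box can be merged with the box below it; alternatively, if
it lies at positive height, it is the root of a connected inner tree which ends at the lowest
positive cut above it, and if it lies at height zero, it is the top of an outer pair. The sign
exponent is a part depending only on the resulting tree plus the small quantity `Split.val`
(`Valid.exponent_eq`), and `Split.val` differs by one for the two partners. Boxes of size `(0,0,0)`
must be excluded: they would allow inner or outer trees with a single box, which do not occur in
braces with at least two arguments. -/

theorem le : ∀ {r p : ℕ}, Coarse r p → r ≤ p
  | _, _, nil => le_rfl
  | _, _, keep f => Nat.succ_le_succ f.le
  | _, _, merge f => f.le.trans (Nat.le_succ _)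

/-- The interchange law: a concatenation is coarsened piece by piece. It makes the coarsenings along
a row of composites split into those of the two layers. -/
theorem comp_append : ∀ {t r p t' r' p' : ℕ} (f : Coarse r p) (g : Coarse t r)
    (f' : Coarse r' p') (g' : Coarse t' r'),
    comp (append f f') (append g g') = append (comp f g) (comp f' g')
  | _, _, _, _, _, _, nil, nil, _, _ => rfl
  | _, _, _, _, _, _, keep f, keep g, f', g' => congrArg keep (comp_append f g f' g')
  | _, _, _, _, _, _, keep f, merge g, f', g' => congrArg merge (comp_append f g f' g')
  | _, _, _, _, _, _, merge f, keep g, f', g' => congrArg merge (comp_append f (keep g) f' g')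
  | _, _, _, _, _, _, merge f, merge g, f', g' => congrArg merge (comp_append f (merge g) f' g')

theorem comp_assoc {s t r p : ℕ} (f : Coarse r p) (g : Coarse t r) (h : Coarse s t) :
    comp (comp f g) h = comp f (comp g h) :=
  toFun_injective (by simp only [toFun_comp, Function.comp_assoc])

theorem comp_id {r p : ℕ} (f : Coarse r p) : comp f (id r) = f :=
  toFun_injective (by rw [toFun_comp, toFun_id]; rfl)

theorem id_comp {r p : ℕ} (f : Coarse r p) : comp (id p) f = f :=
  toFun_injective (by rw [toFun_comp, toFun_id]; rfl)

theorem append_id : ∀ (p p' : ℕ), append (id p) (id p') = id (p' + p)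
  | 0, _ => rfl
  | p + 1, p' => congrArg keep (append_id p p')

theorem keep_heq {r p r' p' : ℕ} (hr : r = r') (hp : p = p') {f : Coarse r p} {f' : Coarse r' p'}
    (h : HEq f f') : HEq (keep f) (keep f') := by
  subst hr hp; cases h; rfl

theorem merge_heq {r p r' p' : ℕ} (hr : r = r') (hp : p = p') {f : Coarse (r + 1) p}
    {f' : Coarse (r' + 1) p'} (h : HEq f f') : HEq (merge f) (merge f') := by
  subst hr hp; cases h; rfl

/-- The index types agree only through associativity of addition, hence the heterogeneous equality.
-/
theorem append_assoc_heq : ∀ {r p r' p' r'' p'' : ℕ} (f : Coarse r p) (g : Coarse r' p')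
    (h : Coarse r'' p''), HEq (append (append f g) h) (append f (append g h))
  | _, _, _, _, _, _, nil, _, _ => HEq.rfl
  | _, _, _, _, _, _, keep f, g, h =>
      keep_heq (Nat.add_assoc _ _ _).symm (Nat.add_assoc _ _ _).symm (append_assoc_heq f g h)
  | r + 1, p + 1, r', p', r'', p'', merge f, g, h =>
      merge_heq (r := r'' + (r' + r)) (r' := r'' + r' + r) (p := p'' + (p' + p))
        (p' := p'' + p' + p) (Nat.add_assoc _ _ _).symm (Nat.add_assoc _ _ _).symm
        (append_assoc_heq f g h)

instance : Unique (Coarse 0 0) where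
  default := nil
  uniq f := by cases f; rfl

end Coarse

namespace NSimplex
variable {U : Type u} [Category.{v} U]

theorem append_head_tail {p' : ℕ} : ∀ (p : ℕ) {X Z : U} (s : NSimplex U (p' + p) X Z),
    (s.head p).append (s.tail p) = s
  | 0, _, _, _ => rfl
  | p + 1, _, _, cons u s => congrArg (cons u) (append_head_tail p s)

/-- The splitting of a concatenation. -/
theorem split_append {p' : ℕ} : ∀ {p : ℕ} {X Y Z : U} (s : NSimplex U p X Y)
    (t : NSimplex U p' Y Z),
    (⟨(s.append t).mid p, (s.append t).head p, (s.append t).tail p⟩ :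
      Σ Y, NSimplex U p X Y × NSimplex U p' Y Z) = ⟨Y, s, t⟩
  | _, _, _, _, nil _, _ => rfl
  | _, _, _, _, cons u s, t =>
      congrArg (fun x : Σ Y, NSimplex U _ _ Y × NSimplex U p' Y _ =>
        (⟨x.1, cons u x.2.1, x.2.2⟩ : Σ Y, NSimplex U _ _ Y × NSimplex U p' Y _))
        (split_append s t)

theorem act_append' {r p r' p' : ℕ} (f : Coarse r p) (g : Coarse r' p') {X Y Z : U}
    (s : NSimplex U p X Y) (t : NSimplex U p' Y Z) :
    act (f.append g) (s.append t) = append (act f s) (act g t) := by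
  rw [act_append]
  exact congrArg (fun x : Σ Y, NSimplex U p X Y × NSimplex U p' Y Z =>
    append (act f x.2.1) (act g x.2.2)) (split_append s t)

theorem cons_heq {p p' : ℕ} (hp : p = p') {X Y Z : U} (w : X ⟶ Y) {s : NSimplex U p Y Z}
    {s' : NSimplex U p' Y Z} (h : HEq s s') : HEq (cons w s) (cons w s') := by
  subst hp; cases h; rfl

theorem append_assoc_heq {p' p'' : ℕ} : ∀ {p : ℕ} {X Y Z W : U} (s : NSimplex U p X Y)
    (t : NSimplex U p' Y Z) (t' : NSimplex U p'' Z W),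
    HEq ((s.append t).append t') (s.append (t.append t'))
  | _, _, _, _, _, nil _, _, _ => HEq.rfl
  | _, _, _, _, _, cons u s, t, t' =>
      cons_heq (Nat.add_assoc _ _ _).symm u (append_assoc_heq s t t')

end NSimplex

/-! ### Components and values without transport. -/

namespace LinQuiver

/-- Partial sums of a sequence of natural numbers. -/
def psum (q : ℕ → ℕ) : ℕ → ℕ
  | 0 => 0
  | j + 1 => psum q j + q j

theorem partialSum_eq_psum (q : ℕ → ℕ) {n : ℕ} : ∀ (j : ℕ) (hj : j ≤ n),
    partialSum (fun i : Fin n => q i) j hj = psum q j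
  | 0, _ => rfl
  | j + 1, hj => congrArg (· + q j) (partialSum_eq_psum q j (Nat.le_of_succ_le hj))

theorem psum_add (q : ℕ → ℕ) (i : ℕ) : ∀ j, psum q (i + j) = psum q i + psum (fun t => q (i + t)) j
  | 0 => rfl
  | j + 1 => by
      change psum q (i + j) + q (i + j) = psum q i + (psum (fun t => q (i + t)) j + q (i + j))
      rw [psum_add q i j, Nat.add_assoc]

theorem psum_congr {q q' : ℕ → ℕ} : ∀ {n : ℕ}, (∀ j < n, q j = q' j) → psum q n = psum q' n
  | 0, _ => rfl
  | n + 1, h => by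
      rw [psum, psum, psum_congr fun j hj => h j (Nat.lt_succ_of_lt hj), h n n.lt_succ_self]

variable {k : Type w₁} [CommRing k] {U : Type u} [Category.{v} U] (A : LinQuiver.{u, v, w₁, w₂, w₃} k U)

open Classical in
/-- All arrow modules over `X` embedded in one module. -/
noncomputable def emb {X : U} (a b : A.obj X) :
    A.hom X a b →ₗ[k] (Π₀ ab : A.obj X × A.obj X, A.hom X ab.1 ab.2) :=
  DFinsupp.lsingle (M := fun ab : A.obj X × A.obj X => A.hom X ab.1 ab.2) (a, b)

theorem emb_injective {X : U} (a b : A.obj X) : Function.Injective (A.emb a b) := by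
  classical
  exact DFinsupp.single_injective (β := fun ab : A.obj X × A.obj X => A.hom X ab.1 ab.2) (i := (a, b))

theorem homCast_heq {X : U} {a b a' b' : A.obj X} (ha : a = a') (hb : b = b') (x : A.hom X a b) :
    HEq (A.homCast ha hb x) x := by
  subst ha hb; rfl

/-- In the direct sum over all pairs of objects the endpoints are an index, so transports along
equalities of endpoints disappear and values can be compared by plain equations. -/
theorem emb_homCast {X : U} {a b a' b' : A.obj X} (ha : a = a') (hb : b = b') (x : A.hom X a b) :
    A.emb a' b' (A.homCast ha hb x) = A.emb a b x := by
  subst ha hb; rfl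

theorem box_heq {p q r : ℕ} (θ : A.Box p q r) {X Z : U} {s s' : NSimplex U p X Z}
    {f f' : Coarse r p} {a a' : Fin (q + 1) → A.obj Z}
    {m : ∀ i : Fin q, A.hom Z (a i.castSucc) (a i.succ)}
    {m' : ∀ i : Fin q, A.hom Z (a' i.castSucc) (a' i.succ)}
    (hs : s = s') (hf : f = f') (ha : ∀ i, a i = a' i) (hm : ∀ i, HEq (m i) (m' i)) :
    HEq (θ X Z s f a m) (θ X Z s' f' a' m') := by
  obtain rfl : a = a' := funext ha
  obtain rfl : m = m' := funext fun i => eq_of_heq (hm i)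
  subst hs hf; rfl

theorem emb_box {p q r : ℕ} (θ : A.Box p q r) {X Z : U} {s s' : NSimplex U p X Z}
    {f f' : Coarse r p} {a a' : Fin (q + 1) → A.obj Z}
    {m : ∀ i : Fin q, A.hom Z (a i.castSucc) (a i.succ)}
    {m' : ∀ i : Fin q, A.hom Z (a' i.castSucc) (a' i.succ)}
    (hs : s = s') (hf : f = f') (ha : ∀ i, a i = a' i) (hm : ∀ i, HEq (m i) (m' i)) :
    A.emb _ _ (θ X Z s f a m) = A.emb _ _ (θ X Z s' f' a' m') := by
  obtain rfl : a = a' := funext ha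
  obtain rfl : m = m' := funext fun i => eq_of_heq (hm i)
  subst hs hf; rfl

/-- The inclusion of a component. -/
noncomputable def put (p q r : ℕ) : A.Box p q r →ₗ[k] A.Total :=
  LinearMap.single k (fun p => ∀ q r, A.Box p q r) p ∘ₗ
    LinearMap.single k (fun q => ∀ r, A.Box p q r) q ∘ₗ LinearMap.single k (fun r => A.Box p q r) r

theorem put_self {p q r : ℕ} (θ : A.Box p q r) : A.put p q r θ p q r = θ := by
  simp [put]

theorem put_of_ne {p q r P Q R : ℕ} (θ : A.Box p q r) (h : ¬ (p = P ∧ q = Q ∧ r = R)) :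
    A.put p q r θ P Q R = 0 := by
  by_cases hp : P = p
  · subst hp
    by_cases hq : Q = q
    · subst hq
      have : R ≠ r := fun e => h ⟨rfl, rfl, e.symm⟩
      simp [put, Pi.single_eq_of_ne this]
    · simp [put, Pi.single_eq_of_ne hq]
  · simp [put, Pi.single_eq_of_ne hp]

/-- Sequences indexed by `ℕ` can be shifted by addition, so blocks of arguments need no casts in
`Fin`. Beyond position `q` the last object is repeated and the arrows are zero; these values are
never read. -/
theorem exists_path {Z : U} {q : ℕ} (a : Fin (q + 1) → A.obj Z)
    (m : ∀ i : Fin q, A.hom Z (a i.castSucc) (a i.succ)) :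
    ∃ (α : ℕ → A.obj Z) (μ : ∀ i, A.hom Z (α i) (α (i + 1))), (∀ i : Fin (q + 1), a i = α i) ∧
      ∀ i : Fin q, HEq (m i) (μ i) := by
  let α : ℕ → A.obj Z := fun i => a ⟨min i q, by omega⟩
  have hα : ∀ i : Fin (q + 1), a i = α i := fun i =>
    congrArg a (Fin.ext (by have := i.2; simp only; omega))
  refine ⟨α, fun i => if h : i < q then
    A.homCast (hα ⟨i, by omega⟩) (hα ⟨i + 1, by omega⟩) (m ⟨i, h⟩) else 0, hα, fun i => ?_⟩
  simp only [dif_pos i.2]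
  exact (A.homCast_heq _ _ _).symm

/-- Equality of components may be checked on infinite paths. -/
theorem put_congr {p q r p' q' r' : ℕ} (hp : p = p') (hq : q = q') (hr : r = r')
    {θ : A.Box p q r} {θ' : A.Box p' q' r'}
    (H : ∀ (X Z : U) (s : NSimplex U p X Z) (s' : NSimplex U p' X Z) (f : Coarse r p)
      (f' : Coarse r' p'), HEq s s' → HEq f f' → ∀ (α : ℕ → A.obj Z)
      (μ : ∀ i, A.hom Z (α i) (α (i + 1))),
      A.emb _ _ (θ X Z s f (fun i => α i) (fun i => μ i)) =
        A.emb _ _ (θ' X Z s' f' (fun i => α i) (fun i => μ i))) :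
    A.put p q r θ = A.put p' q' r' θ' := by
  subst hp hq hr
  congr 1
  funext X Z s f a
  refine MultilinearMap.ext fun m => ?_
  obtain ⟨α, μ, ha, hm⟩ := A.exists_path a m
  apply A.emb_injective
  rw [A.emb_box θ rfl rfl ha hm, A.emb_box θ' rfl rfl ha hm]
  exact H X Z s s f f HEq.rfl HEq.rfl α μ

section Comp
variable {n : ℕ} {h : Fin (n + 1) → ℕ} {q : Fin n → ℕ} {p r : ℕ}

open Classical in
theorem emb_compBox (c : A.Box p n r) (b : ∀ j : Fin n, A.Box (h j.castSucc) (q j) (h j.succ))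
    {X Y Z : U} (s₁ : NSimplex U p X Y) (s₂ : NSimplex U (h 0) Y Z)
    (f : Coarse (h (Fin.last n) + r) (h 0 + p)) (a : Fin (partialSum q n le_rfl + 1) → A.obj Z)
    (m : ∀ i : Fin (partialSum q n le_rfl), A.hom Z (a i.castSucc) (a i.succ)) :
    A.emb _ _ (A.compBox c b X Z (s₁.append s₂) f a m) =
      ∑ f₀ : Coarse r p, ∑ F : (∀ j : Fin n, Coarse (h j.succ) (h j.castSucc)),
        if f₀.append (rowComp F n n.lt_succ_self) = f then
          A.emb _ _ (c X Y s₁ f₀ (A.rowObj F s₂ a) (A.rowArrow F s₂ a b m)) else 0 := by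
  -- The middle vertex of a concatenation is `Y` only propositionally, so the vertex and both halves
  -- are replaced together, as one element of a sigma type.
  have key := congrArg (fun x : Σ Y, NSimplex U p X Y × NSimplex U (h 0) Y Z =>
    ∑ f₀ : Coarse r p, ∑ F : (∀ j : Fin n, Coarse (h j.succ) (h j.castSucc)),
        if f₀.append (rowComp F n n.lt_succ_self) = f then
          A.emb _ _ (c X x.1 x.2.1 f₀ (A.rowObj F x.2.2 a) (A.rowArrow F x.2.2 a b m)) else 0)
    (NSimplex.split_append s₁ s₂)
  refine Eq.trans ?_ key
  simp only [compBox, sum_apply, map_sum]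
  refine Finset.sum_congr rfl fun f₀ _ => Finset.sum_congr rfl fun F _ => ?_
  split_ifs with e
  · exact A.emb_homCast _ _ _
  · simp

end Comp

end LinQuiver

/-! ### Associativity of the box composition. -/

namespace LinQuiver

/-- The position of the `i`-th element of the `j`-th block. -/
def blk {n : ℕ} (q : Fin n → ℕ) (j : Fin n) (i : Fin (q j)) : Fin (partialSum q n le_rfl) :=
  ⟨partialSum q j j.2.le + i, block_lt q j i i.2⟩

theorem partialSum_add_le {n : ℕ} (q : Fin n → ℕ) (j : Fin n) {i : ℕ} (hi : i < q j + 1) :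
    partialSum q j j.2.le + i < partialSum q n le_rfl + 1 :=
  Nat.lt_succ_of_le ((Nat.add_le_add_left (Nat.le_of_lt_succ hi) _).trans
    (partialSum_le q (j + 1) j.2))

theorem partialSum_block {N : ℕ} (q' : Fin N → ℕ) (a m : ℕ) (h : a + m ≤ N) : ∀ (i : ℕ) (hi : i ≤ m),
    partialSum q' a ((Nat.le_add_right _ _).trans h) +
      partialSum (fun t : Fin m => q' ⟨a + t, by omega⟩) i hi =
      partialSum q' (a + i) (by omega)
  | 0, _ => rfl
  | i + 1, hi => by
      change _ + (partialSum _ i (by omega) + q' ⟨a + i, by omega⟩) = partialSum q' (a + i) (by omega) +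
        q' ⟨a + i, by omega⟩
      rw [← Nat.add_assoc, partialSum_block q' a m h i (by omega)]

theorem partialSum_partialSum {n : ℕ} (q : Fin n → ℕ) (q' : Fin (partialSum q n le_rfl) → ℕ) :
    ∀ (j : ℕ) (hj : j ≤ n),
      partialSum (fun j => partialSum (fun i => q' (blk q j i)) (q j) le_rfl) j hj =
        partialSum q' (partialSum q j hj) (partialSum_le q j hj)
  | 0, _ => rfl
  | j + 1, hj => by
      change partialSum _ j (Nat.le_of_succ_le hj) + _ = _
      rw [partialSum_partialSum q q' j]
      exact partialSum_block q' _ (q ⟨j, hj⟩) (partialSum_le q (j + 1) hj) _ le_rfl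

/-- The heights in the `j`-th block. -/
def blkH {n : ℕ} {q : Fin n → ℕ} (h' : Fin (partialSum q n le_rfl + 1) → ℕ) (j : Fin n) :
    Fin (q j + 1) → ℕ :=
  fun i => h' ⟨partialSum q j j.2.le + i, partialSum_add_le q j i.2⟩

/-- The heights of a row of composites. -/
def catH {n : ℕ} {q : Fin n → ℕ} (h : Fin (n + 1) → ℕ) (h' : Fin (partialSum q n le_rfl + 1) → ℕ) :
    Fin (n + 1) → ℕ :=
  fun j => h' ⟨partialSum q j (Nat.le_of_lt_succ j.2), Nat.lt_succ_of_le (partialSum_le q _ _)⟩ + h j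

section Rows
variable {n : ℕ} {h : Fin (n + 1) → ℕ} {q : Fin n → ℕ}
  {h' : Fin (partialSum q n le_rfl + 1) → ℕ}
  (F : ∀ j : Fin n, Coarse (h j.succ) (h j.castSucc))
  (F' : ∀ i : Fin (partialSum q n le_rfl), Coarse (h' i.succ) (h' i.castSucc))

/-- The part of a family of coarsenings belonging to the `j`-th block. -/
def blockMap (j : Fin n) (i : Fin (q j)) :
    Coarse (blkH h' j i.succ) (blkH h' j i.castSucc) :=
  F' (blk q j i)

theorem rowComp_blockMap (j : Fin n) : ∀ (i : ℕ) (hi : i < q j + 1),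
    (rowComp F' (partialSum q j j.2.le) (Nat.lt_succ_of_le (partialSum_le q j j.2.le))).comp
      (rowComp (h := blkH h' j) (blockMap F' j) i hi) =
    rowComp F' (partialSum q j j.2.le + i) (partialSum_add_le q j hi)
  | 0, _ => Coarse.comp_id _
  | i + 1, hi => by
      exact (Coarse.comp_assoc _ _ _).symm.trans
        (congrArg (fun z => Coarse.comp z (F' (blk q j ⟨i, Nat.lt_of_succ_lt_succ hi⟩)))
          (rowComp_blockMap j i (Nat.lt_of_succ_lt hi)))

theorem rowSimplex_blockMap {U : Type u} [Category.{v} U] {Y Z : U} (s : NSimplex U (h' 0) Y Z)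
    (j : Fin n) : ∀ (i : ℕ) (hi : i < q j + 1),
    rowSimplex (h := blkH h' j) (blockMap F' j) (rowSimplex F' s (partialSum q j j.2.le)
      (Nat.lt_succ_of_le (partialSum_le q j j.2.le))) i hi =
    rowSimplex F' s (partialSum q j j.2.le + i) (partialSum_add_le q j hi)
  | 0, _ => rfl
  | i + 1, hi => by
      change NSimplex.act _ (rowSimplex (h := blkH h' j) (blockMap F' j) _ i (by omega)) = NSimplex.act _ _
      rw [rowSimplex_blockMap s j i (by omega)]
      rfl

/-- The coarsenings of a row of composites. -/
def rowAppend (j : Fin n) :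
    Coarse (catH h h' j.succ) (catH h h' j.castSucc) :=
  (F j).append (rowComp (h := blkH h' j) (blockMap F' j) (q j) (Nat.lt_succ_self _))

/-- Induction on the position: `Coarse.comp_append` moves one more box of the lower row, together
with the block of the upper row above it, into the concatenation. -/
theorem rowComp_rowAppend : ∀ (j : ℕ) (hj : j < n + 1),
    rowComp (h := catH h h') (rowAppend F F') j hj = (rowComp F j hj).append
      (rowComp F' (partialSum q j (Nat.le_of_lt_succ hj)) (Nat.lt_succ_of_le (partialSum_le q _ _)))
  | 0, _ => (Coarse.append_id _ _).symm
  | j + 1, hj => by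
      have h1 := rowComp_rowAppend j (by omega)
      have h2 := rowComp_blockMap F' ⟨j, by omega⟩ _ (Nat.lt_succ_self _)
      change Coarse.comp (rowComp (h := catH h h') (rowAppend F F') j (by omega)) _ = Coarse.append (Coarse.comp _ _)
        (rowComp F' (partialSum q j (by omega) + q ⟨j, by omega⟩) _)
      rw [h1, ← h2]
      exact Coarse.comp_append _ _ _ _

theorem rowSimplex_rowAppend {U : Type u} [Category.{v} U] {X Y Z : U} (s : NSimplex U (h 0) X Y)
    (s' : NSimplex U (h' 0) Y Z) (j : ℕ) (hj : j < n + 1) :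
    rowSimplex (h := catH h h') (rowAppend F F') (s.append s') j hj = (rowSimplex F s j hj).append
      (rowSimplex F' s' (partialSum q j (Nat.le_of_lt_succ hj))
        (Nat.lt_succ_of_le (partialSum_le q _ _))) := by
  have h0 : rowSimplex (h := catH h h') (rowAppend F F') (s.append s') j hj =
      (s.append s').act (rowComp (h := catH h h') (rowAppend F F') j hj) := rowSimplex_eq _ _ _ _
  rw [h0, rowSimplex_eq, rowSimplex_eq, rowComp_rowAppend]
  exact NSimplex.act_append' _ _ _ _

end Rows

theorem blk_bijective {n : ℕ} (q : Fin n → ℕ) :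
    Function.Bijective fun x : Σ j : Fin n, Fin (q j) => blk q x.1 x.2 := by
  constructor
  · rintro ⟨j, i⟩ ⟨j', i'⟩ e
    have e' := congrArg Fin.val e
    by_cases hj : j = j'
    · subst hj
      have : (i : ℕ) = i' := Nat.add_left_cancel e'
      rw [Fin.ext this]
    · exact absurd e' (block_disjoint q hj i i')
  · intro t
    obtain ⟨j, e, he⟩ := exists_block q t n le_rfl t.2
    exact ⟨⟨j, e⟩, Fin.ext he.symm⟩

/-- This reindexes the sum over the coarsenings of the upper row by those of its blocks. -/
theorem blk_pi_bijective {n : ℕ} (q : Fin n → ℕ) (B : Fin (partialSum q n le_rfl) → Type*) :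
    Function.Bijective fun (G : ∀ t, B t) (j : Fin n) (i : Fin (q j)) => G (blk q j i) := by
  constructor
  · intro G G' e
    funext t
    obtain ⟨⟨j, i⟩, rfl⟩ := (blk_bijective q).2 t
    exact congrFun (congrFun e j) i
  · intro H
    refine ⟨Equiv.piCongrLeft B (Equiv.ofBijective _ (blk_bijective q)) fun x => H x.1 x.2, ?_⟩
    funext j i
    exact Equiv.piCongrLeft_apply_apply B (Equiv.ofBijective _ (blk_bijective q))
      (fun x => H x.1 x.2) ⟨j, i⟩

variable {k : Type w₁} [CommRing k] {U : Type u} [Category.{v} U] (A : LinQuiver.{u, v, w₁, w₂, w₃} k U)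

/-- The terms live in the target module itself rather than in the direct sum behind `emb`, because
such a value will be an argument of a further box and has to be expanded by multilinearity. The
nonzero terms are described for an arbitrary splitting of the simplex. -/
theorem compBox_eq_sum {n p r : ℕ} {h : Fin (n + 1) → ℕ} {q : Fin n → ℕ} (c : A.Box p n r)
    (b : ∀ j : Fin n, A.Box (h j.castSucc) (q j) (h j.succ)) {X Z : U}
    (s : NSimplex U (h 0 + p) X Z) (f : Coarse (h (Fin.last n) + r) (h 0 + p))
    (a : Fin (partialSum q n le_rfl + 1) → A.obj Z)
    (m : ∀ i : Fin (partialSum q n le_rfl), A.hom Z (a i.castSucc) (a i.succ)) :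
    ∃ term : Coarse r p × (∀ j : Fin n, Coarse (h j.succ) (h j.castSucc)) →
        A.hom X (A.pull s (a 0)) (A.pull (s.act f) (a (Fin.last _))),
      A.compBox c b X Z s f a m = ∑ φ, term φ ∧
      (∀ φ, φ.1.append (rowComp φ.2 n n.lt_succ_self) ≠ f → term φ = 0) ∧
      ∀ φ (Y : U) (s₁ : NSimplex U p X Y) (s₂ : NSimplex U (h 0) Y Z), s = s₁.append s₂ →
        φ.1.append (rowComp φ.2 n n.lt_succ_self) = f →
        HEq (term φ) (c X Y s₁ φ.1 (A.rowObj φ.2 s₂ a) (A.rowArrow φ.2 s₂ a b m)) := by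
  classical
  refine ⟨fun φ => if e : φ.1.append (rowComp φ.2 n n.lt_succ_self) = f then
        A.homCast (A.pull_head_tail p s (a 0))
          ((A.pull_rowObj_last s a φ.1 φ.2).trans (by rw [e]))
            (A.rowMultilinear c b s a φ.1 φ.2 m)
      else 0, ?_, fun φ e => dif_neg e, ?_⟩
  · rw [Fintype.sum_prod_type]
    simp only [compBox, sum_apply]
    refine Finset.sum_congr rfl fun f₀ _ => Finset.sum_congr rfl fun F _ => ?_
    split_ifs with e <;> rfl
  · rintro φ Y s₁ s₂ rfl e
    simp only [dif_pos e]
    refine (A.homCast_heq _ _ _).trans ?_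
    have key := NSimplex.split_append s₁ s₂
    exact congr_arg_heq (fun x : Σ Y, NSimplex U p X Y × NSimplex U (h 0) Y Z =>
      c X x.1 x.2.1 φ.1 (A.rowObj φ.2 x.2.2 a) (A.rowArrow φ.2 x.2.2 a b m)) key

theorem sum_four {ι₁ ι₂ ι₃ ι₄ M : Type*} [Fintype ι₁] [Fintype ι₂] [Fintype ι₃] [Fintype ι₄]
    [AddCommMonoid M] (X : ι₁ → ι₂ → ι₃ → ι₄ → M) :
    ∑ a, ∑ b, ∑ c, ∑ d, X a b c d = ∑ c, ∑ d, ∑ b, ∑ a, X a b c d := by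
  calc _ = ∑ a, ∑ c, ∑ d, ∑ b, X a b c d := Finset.sum_congr rfl fun a _ => by
        rw [Finset.sum_comm]
        exact Finset.sum_congr rfl fun c _ => Finset.sum_comm
    _ = _ := by
        rw [Finset.sum_comm]
        refine Finset.sum_congr rfl fun c _ => ?_
        rw [Finset.sum_comm]
        exact Finset.sum_congr rfl fun d _ => Finset.sum_comm

theorem append_heq_iff {r p r' p' r'' p'' : ℕ} (f₀ : Coarse r p) (g : Coarse r' p')
    (g' : Coarse r'' p'') {f : Coarse (r'' + (r' + r)) (p'' + (p' + p))}
    {f' : Coarse (r'' + r' + r) (p'' + p' + p)} (hf : HEq f f') :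
    f₀.append (g.append g') = f' ↔ (f₀.append g).append g' = f := by
  have h := Coarse.append_assoc_heq f₀ g g'
  constructor
  · intro e
    exact eq_of_heq (h.trans ((heq_of_eq e).trans hf.symm))
  · intro e
    exact eq_of_heq (h.symm.trans ((heq_of_eq e).trans hf))

section Assoc
variable {n p r : ℕ} {h : Fin (n + 1) → ℕ} {q : Fin n → ℕ}
  {h' : Fin (partialSum q n le_rfl + 1) → ℕ} {q' : Fin (partialSum q n le_rfl) → ℕ}

-- Both sides are sums with redundant indices: on the left the coarsening of the lower composite is
-- determined by `f₀` and `F`, on the right the coarsenings `G` of the upper composites are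
-- determined by `F` and `F'`. Eliminating them turns both sides into the same sum over `f₀`, `F`
-- and `F'`.
open Classical in
theorem put_compBox_compBox (c : A.Box p n r)
    (b : ∀ j : Fin n, A.Box (h j.castSucc) (q j) (h j.succ))
    (b' : ∀ i : Fin (partialSum q n le_rfl), A.Box (h' i.castSucc) (q' i) (h' i.succ)) :
    A.put _ _ _ (A.compBox (A.compBox c b) b') =
      A.put _ _ _ (A.compBox (h := catH h h')
        (q := fun j => partialSum (fun i => q' (blk q j i)) (q j) le_rfl) c
        fun j => A.compBox (h := blkH h' j) (q := fun i => q' (blk q j i)) (b j)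
          fun i => b' (blk q j i)) := by
  refine A.put_congr (Nat.add_assoc _ _ _).symm (partialSum_partialSum q q' n le_rfl).symm
    (Nat.add_assoc _ _ _).symm ?_
  intro X Z s s' f f' hs hf α μ
  obtain ⟨Y₂, s12, s₃, rfl⟩ : ∃ (Y : U) (t : NSimplex U (h 0 + p) X Y) (t' : NSimplex U (h' 0) Y Z),
    s = t.append t' := ⟨_, _, _, (NSimplex.append_head_tail _ _).symm⟩
  obtain ⟨Y₁, s₁, s₂, rfl⟩ : ∃ (Y : U) (t : NSimplex U p X Y) (t' : NSimplex U (h 0) Y Y₂),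
    s12 = t.append t' := ⟨_, _, _, (NSimplex.append_head_tail _ _).symm⟩
  obtain rfl : s' = s₁.append (s₂.append s₃) :=
    eq_of_heq (hs.symm.trans (NSimplex.append_assoc_heq s₁ s₂ s₃))
  refine (A.emb_compBox (A.compBox c b) b' (s₁.append s₂) s₃ f (fun i => α i) (fun i => μ i)).trans
    (Eq.trans ?_ (A.emb_compBox (h := catH h h')
      (q := fun j => partialSum (fun i => q' (blk q j i)) (q j) le_rfl) c
        (fun j => A.compBox (h := blkH h' j) (q := fun i => q' (blk q j i)) (b j)
          fun i => b' (blk q j i)) s₁ (s₂.append s₃) f' (fun i => α i) (fun i => μ i)).symm)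
  have hB : ∀ G : ∀ j : Fin n, Coarse (catH h h' j.succ) (catH h h' j.castSucc), ∀ j,
      A.rowArrow G (s₂.append s₃) (fun i => α i) (fun j => A.compBox (h := blkH h' j)
        (q := fun i => q' (blk q j i)) (b j) fun i => b' (blk q j i)) (fun i => μ i) j =
      A.compBox (h := blkH h' j) (q := fun i => q' (blk q j i)) (b j) (fun i => b' (blk q j i))
        Y₁ Z (rowSimplex G (s₂.append s₃) j (Nat.lt_succ_of_lt j.2)) (G j)
        (fun i => α (partialSum (fun j => partialSum (fun i => q' (blk q j i)) (q j) le_rfl) j j.2.le + i))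
        (fun i => μ (partialSum (fun j => partialSum (fun i => q' (blk q j i)) (q j) le_rfl) j j.2.le + i)) :=
    fun G j => rfl
  have hex := fun (G : ∀ j : Fin n, Coarse (catH h h' j.succ) (catH h h' j.castSucc)) (j : Fin n) =>
    A.compBox_eq_sum (h := blkH h' j) (q := fun i => q' (blk q j i)) (b j) (fun i => b' (blk q j i))
        (X := Y₁) (Z := Z) (rowSimplex G (s₂.append s₃) j (Nat.lt_succ_of_lt j.2)) (G j)
        (fun i => α (partialSum (fun j => partialSum (fun i => q' (blk q j i)) (q j) le_rfl) j j.2.le + i))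
        (fun i => μ (partialSum (fun j => partialSum (fun i => q' (blk q j i)) (q j) le_rfl) j j.2.le + i))
  choose term hsum hzero hval using hex
  let a := fun i : Fin (partialSum q' (partialSum q n le_rfl) le_rfl + 1) => α i
  let m : ∀ i : Fin (partialSum q' (partialSum q n le_rfl) le_rfl), A.hom Z (a i.castSucc) (a i.succ) :=
    fun i => μ i
  let W : Coarse r p → (∀ j : Fin n, Coarse (h j.succ) (h j.castSucc)) →
      (∀ i : Fin (partialSum q n le_rfl), Coarse (h' i.succ) (h' i.castSucc)) → _ := fun f₀ F F' =>
    A.emb _ _ (c X Y₁ s₁ f₀ (A.rowObj F s₂ (A.rowObj F' s₃ a))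
        (A.rowArrow F s₂ (A.rowObj F' s₃ a) b (A.rowArrow F' s₃ a b' m)))
  trans ∑ f₀, ∑ F, ∑ F', if (f₀.append (rowComp F n n.lt_succ_self)).append
      (rowComp F' _ (Nat.lt_succ_self _)) = f then W f₀ F F' else 0
  · simp only [A.emb_compBox c b]
    have h1 : ∀ (f₀' : Coarse (h (Fin.last n) + r) (h 0 + p))
        (F' : ∀ i : Fin (partialSum q n le_rfl), Coarse (h' i.succ) (h' i.castSucc)),
        (if f₀'.append (rowComp F' _ (Nat.lt_succ_self _)) = f then
          ∑ f₀, ∑ F, if f₀.append (rowComp F n n.lt_succ_self) = f₀' then W f₀ F F' else 0 else 0) =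
        ∑ f₀, ∑ F, if f₀.append (rowComp F n n.lt_succ_self) = f₀' then
          if f₀'.append (rowComp F' _ (Nat.lt_succ_self _)) = f then W f₀ F F' else 0 else 0 := by
      intro f₀' F'
      split_ifs <;> simp
    refine (Finset.sum_congr rfl fun f₀' _ => Finset.sum_congr rfl fun F' _ => h1 f₀' F').trans ?_
    rw [sum_four]
    refine Finset.sum_congr rfl fun f₀ _ => Finset.sum_congr rfl fun F _ =>
      Finset.sum_congr rfl fun F' _ => ?_
    rw [Finset.sum_ite_eq]
    simp
  · refine Finset.sum_congr rfl fun f₀ _ => ?_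
    have h2 : ∀ G : ∀ j : Fin n, Coarse (catH h h' j.succ) (catH h h' j.castSucc),
        A.emb _ _ (c X Y₁ s₁ f₀ (A.rowObj G (s₂.append s₃) fun i => α i)
          (A.rowArrow G (s₂.append s₃) (fun i => α i) (fun j => A.compBox (h := blkH h' j)
            (q := fun i => q' (blk q j i)) (b j) fun i => b' (blk q j i)) (fun i => μ i))) =
        ∑ φ : ∀ j, (Coarse (h j.succ) (h j.castSucc)) ×
          (∀ i : Fin (q j), Coarse (blkH h' j i.succ) (blkH h' j i.castSucc)),
          A.emb _ _ (c X Y₁ s₁ f₀ (A.rowObj (h := catH h h') G (s₂.append s₃) fun i => α i)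
            (fun j => term G j (φ j))) := by
      intro G
      rw [← map_sum]
      refine congrArg _ ?_
      refine Eq.trans (congrArg _ (funext fun j => (hB G j).trans (hsum G j))) ?_
      exact MultilinearMap.map_sum (c X Y₁ s₁ f₀ (A.rowObj G (s₂.append s₃) fun i => α i)) _
    let E := fun (G : ∀ j : Fin n, Coarse (catH h h' j.succ) (catH h h' j.castSucc))
      (φ : ∀ j, (Coarse (h j.succ) (h j.castSucc)) ×
          (∀ i : Fin (q j), Coarse (blkH h' j i.succ) (blkH h' j i.castSucc))) =>
      A.emb _ _ (c X Y₁ s₁ f₀ (A.rowObj (h := catH h h') G (s₂.append s₃) fun i => α i)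
            (fun j => term G j (φ j)))
    trans ∑ φ, ∑ G, if f₀.append (rowComp (h := catH h h') G n n.lt_succ_self) = f' then E G φ else 0
    -- Decomposing each upper composite separately is the same as choosing a coarsening of every box
    -- of the middle and of the top layer.
    · let Φ : (∀ j : Fin n, Coarse (h j.succ) (h j.castSucc)) ×
        (∀ i : Fin (partialSum q n le_rfl), Coarse (h' i.succ) (h' i.castSucc)) →
        (∀ j, (Coarse (h j.succ) (h j.castSucc)) ×
          (∀ i : Fin (q j), Coarse (blkH h' j i.succ) (blkH h' j i.castSucc))) :=
        fun x j => (x.1 j, blockMap x.2 j)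
      have hΦ : Function.Bijective Φ := by
        constructor
        · rintro ⟨F, F'⟩ ⟨G, G'⟩ e
          refine Prod.ext (funext fun j => congrArg Prod.fst (congrFun e j)) ?_
          exact (blk_pi_bijective q _).1 (funext fun j => congrArg Prod.snd (congrFun e j))
        · intro φ
          obtain ⟨F', hF'⟩ := (blk_pi_bijective q fun i => Coarse (h' i.succ) (h' i.castSucc)).2
            fun j => (φ j).2
          exact ⟨(fun j => (φ j).1, F'), funext fun j => Prod.ext rfl (congrFun hF' j)⟩
      rw [← Fintype.sum_prod_type']
      refine Fintype.sum_bijective Φ hΦ _ _ ?_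
      rintro ⟨F, F'⟩
      -- For any other `G` some argument of the bottom box is a vanishing term, so the whole summand
      -- is zero.
      rw [Finset.sum_eq_single (rowAppend F F')]
      · refine ite_congr ?_ (fun _ => ?_) (fun _ => rfl)
        · rw [rowComp_rowAppend]
          exact propext (append_heq_iff f₀ _ _ hf).symm
        · refine (A.emb_box c rfl rfl ?_ ?_).symm
          · intro j
            change A.pull (rowSimplex (h := catH h h') (rowAppend F F') _ j j.2) _ =
              A.pull (rowSimplex F s₂ j j.2) (A.pull (rowSimplex F' s₃ _ _) _)
            rw [rowSimplex_rowAppend, pull_append]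
            exact congrArg _ (congrArg α (partialSum_partialSum q q' j _))
          · intro j
            refine (hval _ j _ Y₂ (rowSimplex F s₂ j (Nat.lt_succ_of_lt j.2))
              (rowSimplex F' s₃ (partialSum q j j.2.le) _) (rowSimplex_rowAppend F F' s₂ s₃ j _)
              rfl).trans ?_
            refine A.box_heq _ rfl rfl ?_ ?_
            · intro i
              change A.pull (rowSimplex (h := blkH h' j) (blockMap F' j) _ i i.2) _ =
                A.pull (rowSimplex F' s₃ _ _) _
              rw [rowSimplex_blockMap]
              refine congrArg _ (congrArg α ?_)
              rw [partialSum_partialSum q q' j]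
              exact partialSum_block q' _ (q j) (partialSum_le q (j + 1) j.2) i _
            · intro i
              refine A.box_heq (b' (blk q j i)) (rowSimplex_blockMap F' s₃ j i _) rfl ?_ ?_
              all_goals
                intro e
                have e1 : partialSum (fun j => partialSum (fun i => q' (blk q j i)) (q j) le_rfl) j
                  j.2.le + (partialSum (fun i => q' (blk q j i)) i i.2.le + e) =
                  partialSum q' (blk q j i) (blk q j i).2.le + e := by
                  rw [partialSum_partialSum q q' j, ← Nat.add_assoc]
                  exact congrArg (· + (e : ℕ)) (partialSum_block q' _ (q j)
                    (partialSum_le q (j + 1) j.2) i _)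
              · exact congrArg α e1
              · exact congr_arg_heq μ e1
      · intro G _ hG
        have : ∃ j, ¬ (F j).append (rowComp (h := blkH h' j) (blockMap F' j) (q j) (Nat.lt_succ_self _)) = G j := by
          by_contra hc
          push Not at hc
          exact hG (funext fun j => (hc j).symm)
        obtain ⟨j, hj⟩ := this
        have h0 : E G (Φ (F, F')) = 0 := by
          refine (congrArg _ (MultilinearMap.map_coord_zero _ j ?_)).trans (map_zero _)
          exact hzero G j _ hj
        rw [h0, ite_self]
      · exact fun hc => absurd (Finset.mem_univ _) hc
    · rw [Finset.sum_comm]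
      refine Finset.sum_congr rfl fun G _ => ?_
      split_ifs with e
      · exact (h2 G).symm
      · simp
end Assoc
end LinQuiver

/-! ### Unit law, linearity, and composition inside the total space. -/

namespace LinQuiver
variable {k : Type w₁} [CommRing k] {U : Type u} [Category.{v} U] (A : LinQuiver.{u, v, w₁, w₂, w₃} k U)

/-- The unit sees only the trivial simplex, which forces the coarsening of the single upper box to
be `f`. The other unit law is not needed: a box carrying only units is never simplified. -/
theorem put_compBox_idBox {h : Fin 2 → ℕ} {q : Fin 1 → ℕ}
    (b : ∀ j : Fin 1, A.Box (h j.castSucc) (q j) (h j.succ)) :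
    A.put _ _ _ (A.compBox (p := 0) (r := 0) A.idBox b) = A.put _ _ _ (b 0) := by
  classical
  refine A.put_congr rfl (Nat.zero_add (q 0)) rfl ?_
  intro X Z s s' f f' hs hf α μ
  obtain rfl := eq_of_heq hs
  obtain rfl := eq_of_heq hf
  refine (A.emb_compBox (p := 0) (r := 0) A.idBox b (.nil X) s f (fun i => α i)
    (fun i => μ i)).trans ?_
  rw [Fintype.sum_unique]
  let F₀ : ∀ j : Fin 1, Coarse (h j.succ) (h j.castSucc) := fun j =>
    Fin.cases (motive := fun j => Coarse (h j.succ) (h j.castSucc)) f (fun i => i.elim0) j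
  have hF : ∀ F : ∀ j : Fin 1, Coarse (h j.succ) (h j.castSucc),
      (default : Coarse 0 0).append (rowComp F 1 (Nat.lt_succ_self 1)) = F 0 := fun F =>
    Coarse.id_comp (F 0)
  rw [Finset.sum_eq_single F₀]
  · have hF₀ : (default : Coarse 0 0).append (rowComp F₀ 1 (Nat.lt_succ_self 1)) = f := hF F₀
    rw [if_pos hF₀]
    exact A.emb_box (b 0) (X := X) (Z := Z) (s := s) (s' := s) (f := f) (f' := f)
      (a := fun i => α (0 + i)) (a' := fun i => α i) (m := fun i => μ (0 + i)) (m' := fun i => μ i)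
      rfl rfl (fun i => congrArg α (Nat.zero_add _))
      (fun i => congr_arg_heq μ (Nat.zero_add (i : ℕ)))
  · intro F _ hne
    refine if_neg fun e => hne ?_
    funext j
    obtain rfl : j = 0 := Subsingleton.elim _ _
    exact (hF F).symm.trans e
  · exact fun hc => absurd (Finset.mem_univ _) hc

section Linear
variable {n p r : ℕ} {h : Fin (n + 1) → ℕ} {q : Fin n → ℕ}

theorem box_ext {p q r : ℕ} {θ θ' : A.Box p q r}
    (H : ∀ X Z s f a m, A.emb _ _ (θ X Z s f a m) = A.emb _ _ (θ' X Z s f a m)) : θ = θ' := by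
  funext X Z s f a
  exact MultilinearMap.ext fun m => A.emb_injective _ _ (H X Z s f a m)

/-- Every simplex is a concatenation, so it suffices to compare where `emb_compBox` applies. -/
theorem box_ext_append {p p' q r : ℕ} {θ θ' : A.Box (p' + p) q r}
    (H : ∀ X Y Z (s : NSimplex U p X Y) (s' : NSimplex U p' Y Z) f a m,
      A.emb _ _ (θ X Z (s.append s') f a m) = A.emb _ _ (θ' X Z (s.append s') f a m)) :
    θ = θ' := by
  refine A.box_ext fun X Z s f a m => ?_
  obtain ⟨Y, t, t', rfl⟩ : ∃ (Y : U) (t : NSimplex U p X Y) (t' : NSimplex U p' Y Z),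
    s = t.append t' := ⟨_, _, _, (NSimplex.append_head_tail _ _).symm⟩
  exact H X Y Z t t' f a m

/-- Composition is linear in the bottom box. -/
noncomputable def compBoxLeft (b : ∀ j : Fin n, A.Box (h j.castSucc) (q j) (h j.succ)) :
    A.Box p n r →ₗ[k] A.Box (h 0 + p) (partialSum q n le_rfl) (h (Fin.last n) + r) where
  toFun c := A.compBox c b
  map_add' c c' := by
    refine A.box_ext_append fun X Y Z s s' f a m => ?_
    simp only [Pi.add_apply, add_apply, map_add]
    rw [A.emb_compBox, A.emb_compBox, A.emb_compBox, ← Finset.sum_add_distrib]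
    refine Finset.sum_congr rfl fun f₀ _ => ?_
    rw [← Finset.sum_add_distrib]
    refine Finset.sum_congr rfl fun F _ => ?_
    split_ifs
    · simp only [Pi.add_apply, add_apply, map_add]
    · simp
  map_smul' t c := by
    refine A.box_ext_append fun X Y Z s s' f a m => ?_
    simp only [Pi.smul_apply, smul_apply, map_smul, RingHom.id_apply]
    rw [A.emb_compBox, A.emb_compBox, Finset.smul_sum]
    refine Finset.sum_congr rfl fun f₀ _ => ?_
    rw [Finset.smul_sum]
    refine Finset.sum_congr rfl fun F _ => ?_
    split_ifs
    · simp only [Pi.smul_apply, smul_apply, map_smul]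
    · simp

theorem rowArrow_update_box {Y Z : U} (F : ∀ j : Fin n, Coarse (h j.succ) (h j.castSucc))
    (s : NSimplex U (h 0) Y Z) (a : Fin (partialSum q n le_rfl + 1) → A.obj Z)
    (b : ∀ j : Fin n, A.Box (h j.castSucc) (q j) (h j.succ))
    (m : ∀ i : Fin (partialSum q n le_rfl), A.hom Z (a i.castSucc) (a i.succ)) (j : Fin n) :
    ∃ Λ : A.Box (h j.castSucc) (q j) (h j.succ) →ₗ[k]
        A.hom Y (A.rowObj F s a j.castSucc) (A.rowObj F s a j.succ), ∀ y,
      A.rowArrow F s a (Function.update b j y) m =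
        Function.update (A.rowArrow F s a b m) j (Λ y) := by
  refine ⟨{ toFun := fun y => y Y Z (rowSimplex F s j (Nat.lt_succ_of_lt j.2)) (F j)
              (fun i => a ⟨partialSum q j j.2.le + i, partialSum_add_le q j i.2⟩)
              (fun i => m (blk q j i))
            map_add' := fun _ _ => rfl
            map_smul' := fun _ _ => rfl }, fun y => ?_⟩
  funext j'
  by_cases hj : j' = j
  · subst hj
    refine Eq.trans ?_ (Function.update_self
      (β := fun j : Fin n => A.hom Y (A.rowObj F s a j.castSucc) (A.rowObj F s a j.succ)) _ _ _).symm
    change Function.update b j' y j' Y Z _ _ _ _ = _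
    rw [Function.update_self]
    rfl
  · refine Eq.trans ?_ (Function.update_of_ne
      (β := fun j : Fin n => A.hom Y (A.rowObj F s a j.castSucc) (A.rowObj F s a j.succ)) hj _ _).symm
    change Function.update b j y j' Y Z _ _ _ _ = _
    rw [Function.update_of_ne hj]
    rfl

/-- Composition is linear in each box of the row. -/
noncomputable def compBoxRight (c : A.Box p n r)
    (b : ∀ j : Fin n, A.Box (h j.castSucc) (q j) (h j.succ)) (j : Fin n) :
    A.Box (h j.castSucc) (q j) (h j.succ) →ₗ[k]
      A.Box (h 0 + p) (partialSum q n le_rfl) (h (Fin.last n) + r) where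
  toFun y := A.compBox c (Function.update b j y)
  map_add' c c' := by
    refine A.box_ext_append fun X Y Z s s' f a m => ?_
    simp only [Pi.add_apply, add_apply, map_add]
    rw [A.emb_compBox, A.emb_compBox, A.emb_compBox, ← Finset.sum_add_distrib]
    refine Finset.sum_congr rfl fun f₀ _ => ?_
    rw [← Finset.sum_add_distrib]
    refine Finset.sum_congr rfl fun F _ => ?_
    split_ifs
    · obtain ⟨Λ, hΛ⟩ := A.rowArrow_update_box F s' a b m j
      rw [hΛ, hΛ, hΛ, map_add, MultilinearMap.map_update_add, map_add]
    · simp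
  map_smul' t c := by
    refine A.box_ext_append fun X Y Z s s' f a m => ?_
    simp only [Pi.smul_apply, smul_apply, map_smul, RingHom.id_apply]
    rw [A.emb_compBox, A.emb_compBox, Finset.smul_sum]
    refine Finset.sum_congr rfl fun f₀ _ => ?_
    rw [Finset.smul_sum]
    refine Finset.sum_congr rfl fun F _ => ?_
    split_ifs
    · obtain ⟨Λ, hΛ⟩ := A.rowArrow_update_box F s' a b m j
      rw [hΛ, hΛ, map_smul, MultilinearMap.map_update_smul, map_smul]
    · simp

/-- Equal but not definitionally equal sizes are exchanged by reading the row off from elements of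
the total space at the new sizes. -/
theorem put_compBox_congr {h₂ : Fin (n + 1) → ℕ} {q₂ : Fin n → ℕ} (hh : h = h₂) (hq : q = q₂)
    (c : A.Box p n r) (b : ∀ j : Fin n, A.Box (h j.castSucc) (q j) (h j.succ)) (T : Fin n → A.Total)
    (hT : ∀ j, A.put _ _ _ (b j) = T j) :
    A.put _ _ _ (A.compBox c b) =
      A.put _ _ _ (A.compBox (h := h₂) (q := q₂) c fun j => T j (h₂ j.castSucc) (q₂ j) (h₂ j.succ)) := by
  subst hh hq
  congr 2
  funext j
  rw [← hT j, put_self]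

end Linear

/-- Composition of a box with a row of elements of the total space, of prescribed sizes. -/
noncomputable def ncomp {p n r : ℕ} (c : A.Box p n r) (b : ℕ → A.Total) (h q : ℕ → ℕ) : A.Total :=
  A.put _ _ _ (A.compBox (h := fun j : Fin (n + 1) => h j) (q := fun j : Fin n => q j) c
    fun j => b j (h j) (q j) (h (j + 1)))

theorem ncomp_of_ne {p n r : ℕ} (c : A.Box p n r) (b : ℕ → A.Total) (h q : ℕ → ℕ) {P Q R : ℕ}
    (H : ¬ (P = h 0 + p ∧ Q = psum q n ∧ R = h n + r)) : A.ncomp c b h q P Q R = 0 := by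
  refine A.put_of_ne _ fun e => H ⟨e.1.symm, e.2.1.symm.trans (partialSum_eq_psum q _ _), e.2.2.symm⟩

theorem ncomp_congr {p n r : ℕ} (c : A.Box p n r) {b b' : ℕ → A.Total} {h q h' q' : ℕ → ℕ}
    (hh : ∀ j ≤ n, h j = h' j) (hq : ∀ j < n, q j = q' j)
    (hb : ∀ j < n, b j (h j) (q j) (h (j + 1)) = b' j (h j) (q j) (h (j + 1))) :
    A.ncomp c b h q = A.ncomp c b' h' q' := by
  have e1 : (fun j : Fin (n + 1) => h j) = fun j : Fin (n + 1) => h' j :=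
    funext fun j => hh j (Nat.le_of_lt_succ j.2)
  have e2 : (fun j : Fin n => q j) = fun j : Fin n => q' j := funext fun j => hq j j.2
  have e3 : A.ncomp c b h q = A.ncomp c b' h q := by
    unfold ncomp
    congr 2
    funext j
    exact hb j j.2
  rw [e3]
  refine A.put_compBox_congr e1 e2 c _ (fun j => A.put _ _ _ (b' j (h j) (q j) (h (j + 1))))
    (fun j => rfl) |>.trans ?_
  unfold ncomp
  congr 2
  funext j
  have h1 : h j = h' j := hh j j.2.le
  have h2 : h (j + 1) = h' (j + 1) := hh (j + 1) j.2
  have h3 : q j = q' j := hq j j.2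
  change A.put _ _ _ (b' j (h j) (q j) (h (j + 1))) (h' j) (q' j) (h' (j + 1)) = _
  rw [← h1, ← h2, ← h3, put_self]

theorem ncomp_idBox (b : ℕ → A.Total) (h q : ℕ → ℕ) :
    A.ncomp A.idBox b h q = A.put _ _ _ (b 0 (h 0) (q 0) (h 1)) :=
  A.put_compBox_idBox (h := fun j : Fin 2 => h j) (q := fun j : Fin 1 => q j)
    fun j => b j (h j) (q j) (h (j + 1))

/-- This is `put_compBox_compBox` with all families extended to `ℕ`: what lies above the `j`-th box
starts at the offset `psum q j`. -/
theorem ncomp_ncomp {p n r : ℕ} (c : A.Box p n r) (b : ℕ → A.Total) (h q : ℕ → ℕ)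
    (b' : ℕ → A.Total) (h' q' : ℕ → ℕ) {Q : ℕ} (hQ : Q = psum q n) :
    A.ncomp (A.ncomp c b h q (h 0 + p) Q (h n + r)) b' h' q' =
      A.ncomp c (fun j => A.ncomp (b j (h j) (q j) (h (j + 1))) (fun i => b' (psum q j + i))
          (fun i => h' (psum q j + i)) (fun i => q' (psum q j + i)))
        (fun j => h' (psum q j) + h j) (fun j => psum (fun i => q' (psum q j + i)) (q j)) := by
  obtain rfl : Q = partialSum (fun j : Fin n => q j) n le_rfl :=
    hQ.trans (partialSum_eq_psum q _ _).symm
  have e : A.ncomp c b h q (h 0 + p) (partialSum (fun j : Fin n => q j) n le_rfl) (h n + r) =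
      A.compBox (h := fun j : Fin (n + 1) => h j) (q := fun j : Fin n => q j) c
        fun j => b j (h j) (q j) (h (j + 1)) := A.put_self _
  rw [e]
  refine (A.put_compBox_compBox (h := fun j : Fin (n + 1) => h j) (q := fun j : Fin n => q j)
    (h' := fun i => h' i) (q' := fun i => q' i) c (fun j => b j (h j) (q j) (h (j + 1)))
    (fun i => b' i (h' i) (q' i) (h' (i + 1)))).trans ?_
  have hps : ∀ (j : ℕ) (hj : j ≤ n), partialSum (fun j : Fin n => q j) j hj = psum q j :=
    fun j hj => partialSum_eq_psum q j hj
  refine A.put_compBox_congr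
    (h := catH (n := n) (q := fun j => q j) (fun j => h j) (fun i => h' i))
    (h₂ := fun j => h' (psum q j) + h j) (q₂ := fun j => psum (fun i => q' (psum q j + i)) (q j))
    ?_ ?_ c _ (fun j => A.ncomp (b j (h j) (q j) (h (j + 1))) (fun i => b' (psum q j + i))
          (fun i => h' (psum q j + i)) (fun i => q' (psum q j + i))) ?_
  · funext j
    change h' (partialSum _ _ _) + h j = _
    rw [hps]
  · funext j
    change partialSum (fun i : Fin (q j) => q' (partialSum _ _ _ + i)) _ _ = _
    rw [hps]
    exact partialSum_eq_psum (fun i => q' (psum q j + i)) _ _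
  · intro j
    change A.put _ _ _ (A.compBox
      (h := fun i : Fin (q j + 1) => h' (partialSum (fun j : Fin n => q j) j j.2.le + i))
      (q := fun i : Fin (q j) => q' (partialSum (fun j : Fin n => q j) j j.2.le + i))
      (b j (h j) (q j) (h (j + 1))) fun i : Fin (q j) => b'
        (partialSum (fun j : Fin n => q j) j j.2.le + i)
        (h' (partialSum (fun j : Fin n => q j) j j.2.le + i))
        (q' (partialSum (fun j : Fin n => q j) j j.2.le + i))
        (h' (partialSum (fun j : Fin n => q j) j j.2.le + i + 1))) = _
    rw [hps]
    rfl

end LinQuiver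

/-! ### Rows of planar trees and their grafting. -/

/-- Rows of planar trees of boxes with labels in `L`: a tree is either a unit or a box of size
`(p, n, r)` carrying a row of `n` trees. -/
inductive Row (L : Type) : Type
  | nil : Row L
  | unit (f : Row L) : Row L
  | node (l : L) (p r : ℕ) (c f : Row L) : Row L

namespace Row
variable {L M : Type}

/-- Concatenation of rows. -/
def append : Row L → Row L → Row L
  | nil, g => g
  | unit f, g => unit (append f g)
  | node l p r c f, g => node l p r c (append f g)

instance : Append (Row L) := ⟨append⟩

@[simp] theorem nil_append (g : Row L) : nil ++ g = g := rfl
@[simp] theorem unit_append (f g : Row L) : unit f ++ g = unit (f ++ g) := rfl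
@[simp] theorem node_append (l : L) (p r : ℕ) (c f g : Row L) :
    node l p r c f ++ g = node l p r c (f ++ g) := rfl

@[simp] theorem append_nil (f : Row L) : f ++ nil = f := by
  induction f <;> simp_all

theorem append_assoc (f g k : Row L) : f ++ g ++ k = f ++ (g ++ k) := by
  induction f <;> simp_all

/-- The number of trees. -/
def len : Row L → ℕ
  | nil => 0
  | unit f => len f + 1
  | node _ _ _ _ f => len f + 1

/-- The number of inputs. -/
def wd : Row L → ℕ
  | nil => 0
  | unit f => wd f + 1
  | node _ _ _ c f => wd c + wd f

/-- The height of the right boundary of a row whose left boundary has height `h`. -/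
def rt : Row L → ℕ → ℕ
  | nil, h => h
  | unit f, h => rt f h
  | node _ p r c f, h => rt f (rt c (h - p) + r)

/-- The row is admissible for the height `h` of its left boundary. -/
def Fit : Row L → ℕ → Prop
  | nil, _ => True
  | unit f, h => h = 0 ∧ Fit f h
  | node _ p r c f, h => p ≤ h ∧ Fit c (h - p) ∧ Fit f (rt c (h - p) + r)

/-- The labelled boxes of a row with their sizes, in standard order. -/
def boxes : Row L → List (L × ℕ × ℕ × ℕ)
  | nil => []
  | unit f => boxes f
  | node l p r c f => (l, p, len c, r) :: (boxes c ++ boxes f)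

/-- The labels in standard order. -/
def labels (f : Row L) : List L := f.boxes.map Prod.fst

/-- The height of the left boundary of the `j`-th tree. -/
def ht : Row L → ℕ → ℕ → ℕ
  | _, h, 0 => h
  | nil, h, _ + 1 => h
  | unit f, h, j + 1 => ht f h j
  | node _ p r c f, h, j + 1 => ht f (rt c (h - p) + r) j

/-- The number of inputs of the `j`-th tree. -/
def w : Row L → ℕ → ℕ
  | nil, _ => 0
  | unit _, 0 => 1
  | unit f, j + 1 => w f j
  | node _ _ _ c _, 0 => wd c
  | node _ _ _ _ f, j + 1 => w f j

@[simp] theorem ht_zero (f : Row L) (h : ℕ) : f.ht h 0 = h := by cases f <;> rfl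

theorem ht_len (f : Row L) : ∀ h, f.ht h f.len = f.rt h := by
  induction f with
  | nil => exact fun _ => rfl
  | unit f ih => exact fun h => ih h
  | node l p r c f _ ih => exact fun h => ih _

@[simp] theorem len_append (f g : Row L) : (f ++ g).len = f.len + g.len := by
  induction f with
  | nil => simp [len]
  | unit f ih => simp only [unit_append, len, ih]; omega
  | node l p r c f _ ih => simp only [node_append, len, ih]; omega

@[simp] theorem wd_append (f g : Row L) : (f ++ g).wd = f.wd + g.wd := by
  induction f with
  | nil => simp [wd]
  | unit f ih => simp only [unit_append, wd, ih]; omega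
  | node l p r c f _ ih => simp only [node_append, wd, ih]; omega

@[simp] theorem rt_append (f g : Row L) : ∀ h, (f ++ g).rt h = g.rt (f.rt h) := by
  induction f with
  | nil => exact fun _ => rfl
  | unit f ih => exact fun h => ih h
  | node l p r c f _ ih => exact fun h => ih _

@[simp] theorem fit_append (f g : Row L) : ∀ h, (f ++ g).Fit h ↔ f.Fit h ∧ g.Fit (f.rt h) := by
  induction f with
  | nil => intro h; simp [Fit, rt]
  | unit f ih => intro h; simp [Fit, rt, ih, and_assoc]
  | node l p r c f _ ih => intro h; simp [Fit, rt, ih, and_assoc]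

@[simp] theorem boxes_append (f g : Row L) : (f ++ g).boxes = f.boxes ++ g.boxes := by
  induction f with
  | nil => rfl
  | unit f ih => exact ih
  | node l p r c f _ ih => simp [boxes, ih]

@[simp] theorem labels_append (f g : Row L) : (f ++ g).labels = f.labels ++ g.labels := by
  simp [labels]

@[simp] theorem labels_nil : (nil : Row L).labels = [] := rfl
@[simp] theorem labels_unit (f : Row L) : (unit f).labels = f.labels := rfl
@[simp] theorem labels_node (l : L) (p r : ℕ) (c f : Row L) :
    (node l p r c f).labels = l :: (c.labels ++ f.labels) := by simp [labels, boxes]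

theorem ht_append_left (f g : Row L) : ∀ h j, j ≤ f.len → (f ++ g).ht h j = f.ht h j := by
  induction f with
  | nil => intro h j hj; obtain rfl := Nat.le_zero.mp hj; simp
  | unit f ih =>
    intro h j hj
    cases j with
    | zero => simp
    | succ j => exact ih h j (Nat.le_of_succ_le_succ hj)
  | node l p r c f _ ih =>
    intro h j hj
    cases j with
    | zero => simp
    | succ j => exact ih _ j (Nat.le_of_succ_le_succ hj)

theorem ht_append_right (f g : Row L) : ∀ h j, (f ++ g).ht h (f.len + j) = g.ht (f.rt h) j := by
  induction f with
  | nil => intro h j; simp [len, rt]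
  | unit f ih => intro h j; simp only [len, Nat.succ_add_eq_add_succ]; exact ih h j
  | node l p r c f _ ih => intro h j; simp only [len, Nat.succ_add_eq_add_succ]; exact ih _ j

theorem w_append_left (f g : Row L) : ∀ j, j < f.len → (f ++ g).w j = f.w j := by
  induction f with
  | nil => intro j hj; exact absurd hj (Nat.not_lt_zero _)
  | unit f ih =>
    intro j hj
    cases j with
    | zero => rfl
    | succ j => exact ih j (Nat.lt_of_succ_lt_succ hj)
  | node l p r c f _ ih =>
    intro j hj
    cases j with
    | zero => rfl
    | succ j => exact ih j (Nat.lt_of_succ_lt_succ hj)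

theorem w_append_right (f g : Row L) : ∀ j, (f ++ g).w (f.len + j) = g.w j := by
  induction f with
  | nil => intro j; simp [len]
  | unit f ih => intro j; simp only [len, Nat.succ_add_eq_add_succ]; exact ih j
  | node l p r c f _ ih => intro j; simp only [len, Nat.succ_add_eq_add_succ]; exact ih j

open LinQuiver (psum psum_add)

theorem psum_one_add (q : ℕ → ℕ) (j : ℕ) :
    psum q (1 + j) = q 0 + psum (fun i => q (i + 1)) j := by
  rw [psum_add]
  simp only [psum, Nat.zero_add, Nat.add_comm 1]

theorem psum_succ' (q : ℕ → ℕ) (j : ℕ) :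
    psum q (j + 1) = q 0 + psum (fun i => q (i + 1)) j := by
  rw [Nat.add_comm, psum_one_add]

theorem psum_w (f : Row L) : psum f.w f.len = f.wd := by
  induction f with
  | nil => rfl
  | unit f ih =>
    rw [len, psum_succ', wd, Nat.add_comm]
    exact congrArg (· + 1) ih
  | node l p r c f _ ih =>
    rw [len, psum_succ', wd]
    exact congrArg (c.wd + ·) ih

/-- The first `m` trees of a row. -/
def take : Row L → ℕ → Row L
  | _, 0 => nil
  | nil, _ + 1 => nil
  | unit f, m + 1 => unit (take f m)
  | node l p r c f, m + 1 => node l p r c (take f m)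

/-- The row without its first `m` trees. -/
def drop : Row L → ℕ → Row L
  | f, 0 => f
  | nil, _ + 1 => nil
  | unit f, m + 1 => drop f m
  | node _ _ _ _ f, m + 1 => drop f m

theorem take_zero (f : Row L) : f.take 0 = nil := by cases f <;> rfl
theorem drop_zero (f : Row L) : f.drop 0 = f := by cases f <;> rfl

theorem take_append (f g : Row L) : (f ++ g).take f.len = f := by
  induction f with
  | nil => exact take_zero g
  | unit f ih => exact congrArg unit ih
  | node l p r c f _ ih => exact congrArg (node l p r c) ih

theorem drop_append (f g : Row L) : (f ++ g).drop f.len = g := by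
  induction f with
  | nil => exact drop_zero g
  | unit f ih => exact ih
  | node l p r c f _ ih => exact ih

theorem exists_append (m : ℕ) : ∀ (f : Row L) (k : ℕ), f.len = m + k →
    ∃ g g', f = g ++ g' ∧ g.len = m ∧ g'.len = k := by
  induction m with
  | zero => intro f k h; exact ⟨nil, f, rfl, rfl, by simpa using h⟩
  | succ m ih =>
    intro f k h
    cases f with
    | nil => simp [len] at h; omega
    | unit f =>
      obtain ⟨g, g', rfl, h1, h2⟩ := ih f k (by simp only [len] at h; omega)
      exact ⟨unit g, g', rfl, by simp [len, h1], h2⟩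
    | node l p r c f =>
      obtain ⟨g, g', rfl, h1, h2⟩ := ih f k (by simp only [len] at h; omega)
      exact ⟨node l p r c g, g', rfl, by simp [len, h1], h2⟩

theorem append_inj {f g f' g' : Row L} (h : f ++ g = f' ++ g') (hl : f.len = f'.len) :
    f = f' ∧ g = g' := by
  have h1 := congrArg (fun z => z.take f.len) h
  have h2 := congrArg (fun z => z.drop f.len) h
  simp only [take_append, drop_append] at h1 h2
  rw [hl, take_append] at h1
  rw [hl, drop_append] at h2
  exact ⟨h1, h2⟩

theorem len_eq_zero {f : Row L} : f.len = 0 ↔ f = nil := by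
  cases f <;> simp [len]

/-- Composition of rows: the inputs of `f` are filled by the trees of `g`. -/
def graft : Row L → Row L → Row L
  | nil, _ => nil
  | unit f, g => g.take 1 ++ graft f (g.drop 1)
  | node l p r c f, g => node l p r (graft c (g.take c.wd)) (graft f (g.drop c.wd))

theorem graft_unit (f : Row L) {T g : Row L} (hT : T.len = 1) :
    graft (unit f) (T ++ g) = T ++ graft f g := by
  rw [graft, ← hT, take_append, drop_append]

theorem graft_node (l : L) (p r : ℕ) {c f g₁ g₂ : Row L} (h : g₁.len = c.wd) :
    graft (node l p r c f) (g₁ ++ g₂) = node l p r (graft c g₁) (graft f g₂) := by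
  rw [graft, ← h, take_append, drop_append]

/-- Induction for the composition of rows. -/
theorem graft_induction {motive : Row L → Row L → Prop} (nil : motive nil nil)
    (unit : ∀ f T g, T.len = 1 → g.len = f.wd → motive f g → motive (unit f) (T ++ g))
    (node : ∀ l p r c f g₁ g₂, g₁.len = c.wd → g₂.len = f.wd → motive c g₁ → motive f g₂ →
      motive (node l p r c f) (g₁ ++ g₂)) :
    ∀ f g, g.len = f.wd → motive f g := by
  intro f
  induction f with
  | nil => intro g h; obtain rfl := len_eq_zero.mp h; exact nil
  | unit f ih =>
    intro g h
    obtain ⟨T, g, rfl, h1, h2⟩ := exists_append 1 g f.wd (by rw [h, wd, Nat.add_comm])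
    exact unit f T g h1 h2 (ih g h2)
  | node l p r c f ihc ih =>
    intro g h
    obtain ⟨g₁, g₂, rfl, h1, h2⟩ := exists_append c.wd g f.wd h
    exact node l p r c f g₁ g₂ h1 h2 (ihc g₁ h1) (ih g₂ h2)

theorem len_graft {f g : Row L} (h : g.len = f.wd) : (graft f g).len = f.len := by
  refine graft_induction (motive := fun f g => (graft f g).len = f.len) rfl ?_ ?_ f g h
  · intro f T g hT _ ih
    rw [graft_unit f hT, len_append, ih, hT, len, Nat.add_comm]
  · intro l p r c f g₁ g₂ h1 _ _ ih
    rw [graft_node l p r h1, len, ih, len]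

theorem wd_graft {f g : Row L} (h : g.len = f.wd) : (graft f g).wd = g.wd := by
  refine graft_induction (motive := fun f g => (graft f g).wd = g.wd) rfl ?_ ?_ f g h
  · intro f T g hT _ ih
    rw [graft_unit f hT, wd_append, ih, wd_append]
  · intro l p r c f g₁ g₂ h1 _ ih1 ih
    rw [graft_node l p r h1, wd, ih, ih1, wd_append]

theorem graft_append {f f' g g' : Row L} (h : g.len = f.wd) :
    graft (f ++ f') (g ++ g') = graft f g ++ graft f' g' := by
  refine graft_induction
    (motive := fun f g => graft (f ++ f') (g ++ g') = graft f g ++ graft f' g') rfl ?_ ?_ f g h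
  · intro f T g hT _ ih
    rw [graft_unit f hT, append_assoc, unit_append, graft_unit _ hT, ih, append_assoc]
  · intro l p r c f g₁ g₂ h1 _ _ ih
    rw [graft_node l p r h1, append_assoc, node_append, graft_node l p r h1, ih, node_append]

/-- The left boundary of a composite consists of that of `f` with that of `g` above it. A box of `f`
takes its inputs from the lower part only, so the two heights evolve independently. -/
theorem rt_graft {f g : Row L} (h : g.len = f.wd) : ∀ {a : ℕ} (b : ℕ), f.Fit a →
    (graft f g).rt (a + b) = f.rt a + g.rt b := by
  refine graft_induction
    (motive := fun f g => ∀ {a : ℕ} (b : ℕ), f.Fit a → (graft f g).rt (a + b) = f.rt a + g.rt b)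
    (fun _ _ => rfl) ?_ ?_ f g h
  · rintro f T g hT _ ih a b ⟨rfl, hf⟩
    rw [graft_unit f hT, rt_append, rt_append, Nat.zero_add, rt, ← ih _ hf, Nat.zero_add]
  · rintro l p r c f g₁ g₂ h1 _ ihc ih a b ⟨hp, hc, hf⟩
    rw [graft_node l p r h1, rt, rt_append, rt, ← ih _ hf, Nat.sub_add_comm hp, ihc _ hc]
    congr 1
    omega

theorem fit_graft {f g : Row L} (h : g.len = f.wd) : ∀ {a : ℕ} (b : ℕ), f.Fit a →
    ((graft f g).Fit (a + b) ↔ g.Fit b) := by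
  refine graft_induction
    (motive := fun f g => ∀ {a : ℕ} (b : ℕ), f.Fit a → ((graft f g).Fit (a + b) ↔ g.Fit b))
    (fun _ _ => Iff.rfl) ?_ ?_ f g h
  · rintro f T g hT _ ih a b ⟨rfl, hf⟩
    rw [graft_unit f hT, fit_append, fit_append, Nat.zero_add, ← ih _ hf, Nat.zero_add]
  · rintro l p r c f g₁ g₂ h1 _ ihc ih a b ⟨hp, hc, hf⟩
    rw [graft_node l p r h1, Fit, fit_append, Nat.sub_add_comm hp, ihc _ hc, rt_graft h1 _ hc]
    have e : c.rt (a - p) + g₁.rt b + r = c.rt (a - p) + r + g₁.rt b := by omega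
    rw [e, ih _ hf]
    exact and_iff_right (hp.trans (Nat.le_add_right _ _))

theorem ht_graft {f g : Row L} (h : g.len = f.wd) : ∀ {a : ℕ} (b j : ℕ), f.Fit a → j ≤ f.len →
    (graft f g).ht (a + b) j = g.ht b (psum f.w j) + f.ht a j := by
  refine graft_induction (motive := fun f g => ∀ {a : ℕ} (b j : ℕ), f.Fit a → j ≤ f.len →
    (graft f g).ht (a + b) j = g.ht b (psum f.w j) + f.ht a j) ?_ ?_ ?_ f g h
  · intro a b j _ hj
    obtain rfl := Nat.le_zero.mp hj
    simp [psum, Nat.add_comm]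
  · rintro f T g hT _ ih a b j ⟨rfl, hf⟩ hj
    cases j with
    | zero => simp [psum]
    | succ j =>
      have e := ht_append_right T (graft f g) b j
      have e' := ht_append_right T g b (psum f.w j)
      have := ih (T.rt b) j hf (Nat.le_of_succ_le_succ hj)
      rw [hT] at e e'
      rw [graft_unit f hT, Nat.zero_add, Nat.add_comm j, e, psum_one_add]
      change _ = (T ++ g).ht b (1 + psum f.w j) + (unit f).ht 0 (1 + j)
      rw [e', Nat.add_comm 1 j]
      rw [Nat.zero_add] at this
      exact this
  · rintro l p r c f g₁ g₂ h1 _ ihc ih a b j ⟨hp, hc, hf⟩ hj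
    cases j with
    | zero => simp [psum, Nat.add_comm]
    | succ j =>
      have e' := ht_append_right g₁ g₂ b (psum f.w j)
      rw [graft_node l p r h1, psum_succ']
      change (graft f g₂).ht ((graft c g₁).rt (a + b - p) + r) j =
        (g₁ ++ g₂).ht b (c.wd + psum f.w j) + f.ht _ j
      rw [← h1, e', Nat.sub_add_comm hp, rt_graft h1 _ hc, ← ih _ j hf (Nat.le_of_succ_le_succ hj)]
      congr 1
      omega

theorem w_graft {f g : Row L} (h : g.len = f.wd) : ∀ j, j < f.len →
    (graft f g).w j = psum (fun i => g.w (psum f.w j + i)) (f.w j) := by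
  refine graft_induction (motive := fun f g => ∀ j, j < f.len →
    (graft f g).w j = psum (fun i => g.w (psum f.w j + i)) (f.w j)) ?_ ?_ ?_ f g h
  · intro j hj
    exact absurd hj (Nat.not_lt_zero _)
  · rintro f T g hT _ ih j hj
    cases j with
    | zero =>
      rw [graft_unit f hT, w_append_left _ _ _ (by omega)]
      change _ = 0 + (T ++ g).w (0 + 0)
      rw [w_append_left _ _ _ (by omega)]
      simp
    | succ j =>
      have e := w_append_right T (graft f g) j
      rw [hT] at e
      rw [graft_unit f hT, Nat.add_comm j, e, ih j (Nat.lt_of_succ_lt_succ hj), psum_one_add,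
        Nat.add_comm 1]
      change psum _ (f.w j) = psum _ (f.w j)
      refine LinQuiver.psum_congr fun i _ => ?_
      have e' := w_append_right T g (psum f.w j + i)
      rw [hT] at e'
      rw [← e', ← Nat.add_assoc]
      rfl
  · rintro l p r c f g₁ g₂ h1 _ ihc ih j hj
    cases j with
    | zero =>
      rw [graft_node l p r h1]
      change (graft c g₁).wd = psum _ c.wd
      rw [wd_graft h1, ← h1, ← psum_w]
      refine LinQuiver.psum_congr fun i hi => ?_
      change _ = (g₁ ++ g₂).w (0 + i)
      rw [Nat.zero_add, w_append_left _ _ _ hi]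
    | succ j =>
      rw [graft_node l p r h1, psum_succ']
      change (graft f g₂).w j = psum _ (f.w j)
      rw [ih j (Nat.lt_of_succ_lt_succ hj)]
      refine LinQuiver.psum_congr fun i _ => ?_
      have e' := w_append_right g₁ g₂ (psum f.w j + i)
      rw [h1] at e'
      rw [← e', ← Nat.add_assoc]
      rfl

end Row

/-! ### Evaluation of rows and its compatibility with grafting. -/

namespace LinQuiver
open Row
variable {k : Type w₁} [CommRing k] {U : Type u} [Category.{v} U] (A : LinQuiver.{u, v, w₁, w₂, w₃} k U)
variable {L M : Type}

/-- The value of the `j`-th tree of a row, whose boxes are filled by the elements `x`. -/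
noncomputable def ev (x : L → A.Total) : Row L → ℕ → A.Total
  | .nil, _ => 0
  | .unit _, 0 => A.put 0 1 0 A.idBox
  | .unit f, j + 1 => ev x f j
  | .node l p r c _, 0 => fun P =>
      if p ≤ P then A.ncomp (x l p c.len r) (fun i => ev x c i) (c.ht (P - p)) c.w P else 0
  | .node _ _ _ _ f, j + 1 => ev x f j

variable (x : L → A.Total)

theorem ev_append_left (f g : Row L) : ∀ j, j < f.len → A.ev x (f ++ g) j = A.ev x f j := by
  induction f with
  | nil => intro j hj; exact absurd hj (Nat.not_lt_zero _)
  | unit f ih =>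
    intro j hj
    cases j with
    | zero => rfl
    | succ j => exact ih j (Nat.lt_of_succ_lt_succ hj)
  | node l p r c f _ ih =>
    intro j hj
    cases j with
    | zero => rfl
    | succ j => exact ih j (Nat.lt_of_succ_lt_succ hj)

theorem ev_append_right (f g : Row L) : ∀ j, A.ev x (f ++ g) (f.len + j) = A.ev x g j := by
  induction f with
  | nil => intro j; simp [len]
  | unit f ih => intro j; simp only [len, Nat.succ_add_eq_add_succ]; exact ih j
  | node l p r c f _ ih => intro j; simp only [len, Nat.succ_add_eq_add_succ]; exact ih j

/-- Once its left height is fixed, the other two sizes of a tree are forced. So its value at this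
height is the inclusion of a single component, which is what the unit case of `ev_graft` needs. -/
theorem ev_of_ne (f : Row L) : ∀ (h j : ℕ) {Q R : ℕ}, ¬ (Q = f.w j ∧ R = f.ht h (j + 1)) →
    A.ev x f j (f.ht h j) Q R = 0 := by
  induction f with
  | nil => intro h j Q R _; rfl
  | unit f ih =>
    intro h j Q R H
    cases j with
    | zero =>
      refine A.put_of_ne _ fun e => H ⟨e.2.1.symm, ?_⟩
      have h0 : 0 = h := by simpa using e.1
      change R = (unit f).ht h 1
      rw [← e.2.2, ← h0]
      simp [Row.ht]
    | succ j => exact ih h j H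
  | node l p r c f _ ih =>
    intro h j Q R H
    cases j with
    | zero =>
      change (if p ≤ (node l p r c f).ht h 0 then _ else (0 : ∀ q r, A.Box _ q r)) Q R = 0
      split_ifs with hp
      · refine A.ncomp_of_ne _ _ _ _ fun e => H ⟨e.2.1.trans (psum_w c), ?_⟩
        rw [e.2.2, ht_len]
        simp [Row.ht]
      · rfl
    | succ j => exact ih _ j H

theorem eq_put_of_forall {y : A.Total} {P Q R : ℕ} (H : ∀ Q' R', ¬ (Q' = Q ∧ R' = R) → y P Q' R' = 0) :
    ∀ Q' R', A.put P Q R (y P Q R) P Q' R' = y P Q' R' := by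
  intro Q' R'
  by_cases h : Q' = Q ∧ R' = R
  · obtain ⟨rfl, rfl⟩ := h
    exact A.put_self _
  · rw [H Q' R' h]
    exact A.put_of_ne _ fun e => h ⟨e.2.1.symm, e.2.2.symm⟩

/-- Operadic associativity for trees: induction on the grafting, with the left unit law at a unit
and `ncomp_ncomp` at a box. The sizes enter through equations so that they can be supplied in any
form. -/
theorem ev_graft {f g : Row L} (hg : g.len = f.wd) : ∀ {a : ℕ} (b j : ℕ) {P p₀ q₀ r₀ o : ℕ},
    f.Fit a → j < f.len → o = psum f.w j → p₀ = f.ht a j → q₀ = f.w j → r₀ = f.ht a (j + 1) →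
    P = g.ht b o + p₀ →
    A.ev x (graft f g) j P = A.ncomp (A.ev x f j p₀ q₀ r₀) (fun i => A.ev x g (o + i))
        (fun i => g.ht b (o + i)) (fun i => g.w (o + i)) P := by
  refine graft_induction (motive := fun f g => ∀ {a : ℕ} (b j : ℕ) {P p₀ q₀ r₀ o : ℕ},
    f.Fit a → j < f.len → o = psum f.w j → p₀ = f.ht a j → q₀ = f.w j → r₀ = f.ht a (j + 1) →
    P = g.ht b o + p₀ →
    A.ev x (graft f g) j P = A.ncomp (A.ev x f j p₀ q₀ r₀) (fun i => A.ev x g (o + i))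
        (fun i => g.ht b (o + i)) (fun i => g.w (o + i)) P) ?_ ?_ ?_ f g hg
  · intro a b j P p₀ q₀ r₀ o _ hj
    exact absurd hj (Nat.not_lt_zero _)
  · rintro f T g hT _ ih a b j P p₀ q₀ r₀ o ⟨rfl, hf⟩ hj ho hp₀ hq₀ hr₀ hP
    cases j with
    | zero =>
      obtain rfl : p₀ = 0 := by simpa using hp₀
      obtain rfl : q₀ = 1 := hq₀
      obtain rfl : r₀ = 0 := by simpa [Row.ht] using hr₀
      obtain rfl : o = 0 := ho
      obtain rfl : P = b := by simpa using hP
      have e0 : A.ev x (unit f) 0 0 1 0 = A.idBox := A.put_self _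
      rw [e0, graft_unit f hT, ev_append_left _ _ _ _ _ (by omega)]
      funext Q R
      refine Eq.trans ?_ (congrFun (congrFun (congrFun (A.ncomp_idBox _ _ _).symm P) Q) R)
      have h1 : (T ++ g).w (0 + 0) = T.w 0 := w_append_left _ _ _ (by omega)
      have h2 : (T ++ g).ht P (0 + 1) = T.ht P 1 := ht_append_left _ _ _ _ (by omega)
      have h3 : A.ev x (T ++ g) (0 + 0) = A.ev x T 0 := ev_append_left _ _ _ _ _ (by omega)
      have h4 : (T ++ g).ht P (0 + 0) = P := ht_zero _ _
      rw [h1, h2, h3, h4]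
      refine (A.eq_put_of_forall (P := P) (fun Q' R' H => ?_) Q R).symm
      have := A.ev_of_ne x T P 0 H
      rwa [ht_zero] at this
    | succ j =>
      have ho' : o = T.len + psum f.w j := by
        rw [ho, psum_succ', hT]; rfl
      subst ho'
      simp only [Nat.add_assoc, ht_append_right, w_append_right, ev_append_right] at hP ⊢
      rw [graft_unit f hT]
      have e := A.ev_append_right x T (graft f g) j
      rw [hT, Nat.add_comm] at e
      rw [e]
      exact ih (T.rt b) j hf (Nat.lt_of_succ_lt_succ hj) rfl hp₀ hq₀ hr₀ hP
  · rintro l p r c f g₁ g₂ h1 _ ihc ih a b j P p₀ q₀ r₀ o ⟨hp, hc, hf⟩ hj ho hp₀ hq₀ hr₀ hP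
    cases j with
    | zero =>
      obtain rfl : a = p₀ := by simpa using hp₀.symm
      obtain rfl : q₀ = c.wd := hq₀
      obtain rfl : r₀ = c.ht (a - p) c.len + r := by simpa [Row.ht, ht_len] using hr₀
      obtain rfl : o = 0 := ho
      obtain rfl : P = b + a := by simpa using hP
      rw [graft_node l p r h1]
      change (if p ≤ b + a then A.ncomp (x l p (graft c g₁).len r) (fun i => A.ev x (graft c g₁) i)
        ((graft c g₁).ht (b + a - p)) (graft c g₁).w (b + a) else 0) = A.ncomp
          ((if p ≤ a then A.ncomp (x l p c.len r) (fun i => A.ev x c i) (c.ht (a - p)) c.w a else 0)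
            c.wd (c.ht (a - p) c.len + r)) _ _ _ _
      rw [if_pos hp, if_pos (hp.trans (Nat.le_add_left _ _)), len_graft h1]
      have key := A.ncomp_ncomp (x l p c.len r) (fun i => A.ev x c i) (c.ht (a - p)) c.w
        (fun i => A.ev x (g₁ ++ g₂) (0 + i)) (fun i => (g₁ ++ g₂).ht b (0 + i))
        (fun i => (g₁ ++ g₂).w (0 + i)) (psum_w c).symm
      rw [ht_zero, Nat.sub_add_cancel hp] at key
      refine Eq.trans ?_ (congrFun key.symm (b + a))
      refine congrFun ?_ (b + a)
      -- The children of the root only use trees of `g₁`; this bound allows `g₂` to be dropped from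
      -- all sequences.
      have hbd : ∀ j, j < c.len → psum c.w j + c.w j ≤ g₁.len := by
        intro j hj
        rw [h1, ← psum_w c]
        obtain ⟨d, hd⟩ := Nat.exists_eq_add_of_lt hj
        rw [hd, show j + d + 1 = (j + 1) + d by omega, psum_add]
        exact Nat.le_add_right _ _
      have hbd' : ∀ j, j ≤ c.len → psum c.w j ≤ g₁.len := by
        intro j hj
        rw [h1, ← psum_w c]
        obtain ⟨d, hd⟩ := Nat.exists_eq_add_of_le hj
        rw [hd, psum_add]
        exact Nat.le_add_right _ _
      simp only [Nat.zero_add]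
      have hht : ∀ j, j ≤ c.len →
          (graft c g₁).ht (b + a - p) j = g₁.ht b (psum c.w j) + c.ht (a - p) j := by
        intro j hj
        rw [Nat.add_comm b a, Nat.sub_add_comm hp, ht_graft h1 _ _ hc hj]
      refine A.ncomp_congr _ ?_ ?_ ?_
      · intro j hj
        rw [hht j hj, ht_append_left _ _ _ _ (hbd' j hj)]
      · intro j hj
        rw [w_graft h1 j hj]
        refine psum_congr fun i hi => ?_
        rw [w_append_left _ _ _ (lt_of_lt_of_le (Nat.add_lt_add_left hi _) (hbd j hj))]
      · intro j hj
        rw [ihc b j hc hj rfl rfl rfl rfl (hht j hj.le)]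
        refine congrFun (congrFun (congrFun ?_ _) _) _
        refine A.ncomp_congr _ ?_ ?_ ?_
        · intro i hi
          rw [ht_append_left _ _ _ _ ((Nat.add_le_add_left hi _).trans (hbd j hj))]
        · intro i hi
          rw [w_append_left _ _ _ (lt_of_lt_of_le (Nat.add_lt_add_left hi _) (hbd j hj))]
        · intro i hi
          rw [ev_append_left _ _ _ _ _ (lt_of_lt_of_le (Nat.add_lt_add_left hi _) (hbd j hj))]
    | succ j =>
      have ho' : o = g₁.len + psum f.w j := by
        rw [ho, psum_succ', h1]; rfl
      subst ho'
      simp only [Nat.add_assoc, ht_append_right, w_append_right, ev_append_right] at hP ⊢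
      rw [graft_node l p r h1]
      exact ih (g₁.rt b) j hf (Nat.lt_of_succ_lt_succ hj) rfl hp₀ hq₀ hr₀ hP

end LinQuiver

/-! ### Vanishing and linearity of the evaluation. -/

namespace LinQuiver
open Row
variable {k : Type w₁} [CommRing k] {U : Type u} [Category.{v} U] (A : LinQuiver.{u, v, w₁, w₂, w₃} k U)
variable {L M : Type}

/-- There is no strictly increasing map `[r] → [p]`, so the product is over an empty set. All
finiteness statements rest on this. -/
theorem box_eq_zero {p q r : ℕ} (h : p < r) (θ : A.Box p q r) : θ = 0 := by
  funext X Z s f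
  exact absurd f.le (Nat.not_le.mpr h)

theorem ev_congr {x y : L → A.Total} (f : Row L) :
    (∀ b ∈ f.boxes, x b.1 b.2.1 b.2.2.1 b.2.2.2 = y b.1 b.2.1 b.2.2.1 b.2.2.2) →
      ∀ j, A.ev x f j = A.ev y f j := by
  induction f with
  | nil => exact fun _ _ => rfl
  | unit f ih =>
    intro h j
    cases j with
    | zero => rfl
    | succ j => exact ih h j
  | node l p r c f ihc ih =>
    intro h j
    simp only [boxes, List.mem_cons, List.mem_append] at h
    cases j with
    | zero =>
      have h1 : (fun i => A.ev x c i) = fun i => A.ev y c i :=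
        funext fun i => ihc (fun b hb => h b (Or.inr (Or.inl hb))) i
      have h2 := h _ (Or.inl rfl)
      simp only at h2
      simp only [ev, h1, h2]
    | succ j => exact ih (fun b hb => h b (Or.inr (Or.inr hb))) j

theorem ncomp_zero_left {p n r : ℕ} (b : ℕ → A.Total) (h q : ℕ → ℕ) :
    A.ncomp (0 : A.Box p n r) b h q = 0 := by
  unfold ncomp
  have := map_zero (A.compBoxLeft (p := p) (r := r) (h := fun j : Fin (n + 1) => h j)
    (q := fun j : Fin n => q j) fun j => b j (h j) (q j) (h (j + 1)))
  exact (congrArg _ this).trans (map_zero _)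

/-- Composition depends linearly on each element of the row. -/
theorem exists_ncomp_linear {p n r : ℕ} (c : A.Box p n r) (b : ℕ → A.Total) (h q : ℕ → ℕ) {i : ℕ}
    (hi : i < n) : ∃ Λ : A.Total →ₗ[k] A.Total, ∀ b' : ℕ → A.Total, (∀ j, j ≠ i → b' j = b j) →
      A.ncomp c b' h q = Λ (b' i) := by
  classical
  let π : A.Total →ₗ[k] A.Box (h i) (q i) (h (i + 1)) :=
    { toFun := fun y => y _ _ _, map_add' := fun _ _ => rfl, map_smul' := fun _ _ => rfl }
  refine ⟨A.put _ _ _ ∘ₗ A.compBoxRight (h := fun j : Fin (n + 1) => h j) (q := fun j : Fin n => q j)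
    c (fun j => b j (h j) (q j) (h (j + 1))) ⟨i, hi⟩ ∘ₗ π, fun b' hb' => ?_⟩
  unfold ncomp
  refine congrArg _ (congrArg (A.compBox (h := fun j : Fin (n + 1) => h j)
    (q := fun j : Fin n => q j) c) ?_)
  funext j
  by_cases hj : j = ⟨i, hi⟩
  · subst hj
    exact (Function.update_self (β := fun j : Fin n => A.Box (h j) (q j) (h (j + 1))) _ _ _).symm
  · refine Eq.trans ?_ (Function.update_of_ne
      (β := fun j : Fin n => A.Box (h j) (q j) (h (j + 1))) hj _ _).symm
    rw [hb' j fun e => hj (Fin.ext e)]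

/-- A zero filling kills its own box, and by linearity in the upper row the zero descends to the
tree of the row that contains the box. -/
theorem exists_ev_eq_zero {x : L → A.Total} (f : Row L) :
    ∀ b ∈ f.boxes, x b.1 b.2.1 b.2.2.1 b.2.2.2 = 0 → ∃ j < f.len, A.ev x f j = 0 := by
  induction f with
  | nil => intro b hb; exact absurd hb List.not_mem_nil
  | unit f ih =>
    intro b hb h0
    obtain ⟨j, hj, e⟩ := ih b hb h0
    exact ⟨j + 1, Nat.succ_lt_succ hj, e⟩
  | node l p r c f ihc ih =>
    intro b hb h0
    simp only [boxes, List.mem_cons, List.mem_append] at hb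
    rcases hb with rfl | hb | hb
    · refine ⟨0, Nat.succ_pos _, ?_⟩
      simp only at h0
      funext P
      simp only [ev, h0, ncomp_zero_left]
      split_ifs <;> rfl
    · obtain ⟨j, hj, e⟩ := ihc b hb h0
      refine ⟨0, Nat.succ_pos _, ?_⟩
      funext P
      simp only [ev]
      obtain ⟨Λ, hΛ⟩ := A.exists_ncomp_linear (x l p c.len r) (fun i => A.ev x c i) (c.ht (P - p))
        c.w hj
      rw [hΛ _ fun _ _ => rfl, e, map_zero]
      split_ifs <;> rfl
    · obtain ⟨j, hj, e⟩ := ih b hb h0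
      exact ⟨j + 1, Nat.succ_lt_succ hj, e⟩

theorem ev_eq_zero {x : L → A.Total} {f : Row L} (hf : f.len = 1) {b : L × ℕ × ℕ × ℕ}
    (hb : b ∈ f.boxes) (h : x b.1 b.2.1 b.2.2.1 b.2.2.2 = 0) : A.ev x f 0 = 0 := by
  obtain ⟨j, hj, e⟩ := A.exists_ev_eq_zero f b hb h
  rw [hf, Nat.lt_one_iff] at hj
  rwa [hj] at e

/-- The value of a row is linear in the element filling a box. -/
theorem exists_ev_update [DecidableEq L] (x : L → A.Total) (l₀ : L) (f : Row L) :
    f.labels.Nodup → l₀ ∈ f.labels → ∃ i < f.len,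
      (∃ Λ : A.Total →ₗ[k] A.Total, ∀ z, A.ev (Function.update x l₀ z) f i = Λ z) ∧
      ∀ j, j ≠ i → ∀ z, A.ev (Function.update x l₀ z) f j = A.ev x f j := by
  -- A row without the label does not feel the update; since labels are distinct, the dependence on
  -- `z` is confined to one tree.
  have hcg : ∀ f : Row L, l₀ ∉ f.labels → ∀ z j, A.ev (Function.update x l₀ z) f j = A.ev x f j := by
    intro f hf z j
    refine A.ev_congr f (fun b hb => ?_) j
    rw [Function.update_of_ne]
    rintro e
    exact hf (e ▸ List.mem_map_of_mem hb)
  induction f with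
  | nil => intro _ h; exact absurd h List.not_mem_nil
  | unit f ih =>
    intro hn h
    obtain ⟨i, hi, ⟨Λ, hΛ⟩, hj⟩ := ih hn h
    refine ⟨i + 1, Nat.succ_lt_succ hi, ⟨Λ, hΛ⟩, fun j hne z => ?_⟩
    cases j with
    | zero => rfl
    | succ j => exact hj j (fun e => hne (congrArg _ e)) z
  | node l p r c f ihc ih =>
    intro hn h
    rw [labels_node, List.nodup_cons, List.mem_append, List.nodup_append] at hn
    obtain ⟨hl, hnc, hnf, hd⟩ := hn
    rw [labels_node, List.mem_cons, List.mem_append] at h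
    by_cases hll : l₀ = l
    · subst hll
      refine ⟨0, Nat.succ_pos _, ?_, fun j hne z => ?_⟩
      · let π : A.Total →ₗ[k] A.Box p c.len r :=
          { toFun := fun y => y _ _ _, map_add' := fun _ _ => rfl, map_smul' := fun _ _ => rfl }
        let Λ : ℕ → (A.Total →ₗ[k] A.Total) := fun P => A.put _ _ _ ∘ₗ A.compBoxLeft (p := p) (r := r)
          (h := fun j : Fin (c.len + 1) => c.ht (P - p) j) (q := fun j : Fin c.len => c.w j)
          (fun j => A.ev x c j (c.ht (P - p) j) (c.w j) (c.ht (P - p) (j + 1))) ∘ₗ π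
        refine ⟨LinearMap.pi fun P => if p ≤ P then LinearMap.proj P ∘ₗ Λ P else 0, fun z => ?_⟩
        funext P
        have e1 : (fun i => A.ev (Function.update x l₀ z) c i) = fun i => A.ev x c i :=
          funext fun i => hcg c (fun hc => hl (Or.inl hc)) z i
        simp only [ev, e1, Function.update_self, LinearMap.pi_apply]
        split_ifs <;> rfl
      · cases j with
        | zero => exact absurd rfl hne
        | succ j => exact hcg f (fun hc => hl (Or.inr hc)) z j
    · rcases h with h | h | h
      · exact absurd h hll
      · obtain ⟨i, hi, ⟨Λ, hΛ⟩, hj⟩ := ihc hnc h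
        have hf : l₀ ∉ f.labels := fun hf => hd _ h _ hf rfl
        refine ⟨0, Nat.succ_pos _, ?_, fun j hne z => ?_⟩
        · choose Λ' hΛ' using fun P => A.exists_ncomp_linear (x l p c.len r)
            (fun i => A.ev x c i) (c.ht (P - p)) c.w hi
          refine ⟨LinearMap.pi fun P => if p ≤ P then LinearMap.proj P ∘ₗ Λ' P ∘ₗ Λ else 0,
            fun z => ?_⟩
          funext P
          have e1 := hΛ' P (fun i => A.ev (Function.update x l₀ z) c i) fun j hne => hj j hne z
          simp only [hΛ] at e1
          simp only [ev, Function.update_of_ne (Ne.symm hll), e1, LinearMap.pi_apply]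
          split_ifs <;> rfl
        · cases j with
          | zero => exact absurd rfl hne
          | succ j => exact hcg f hf z j
      · obtain ⟨i, hi, ⟨Λ, hΛ⟩, hj⟩ := ih hnf h
        have hc : l₀ ∉ c.labels := fun hc => hd _ hc _ h rfl
        refine ⟨i + 1, Nat.succ_lt_succ hi, ⟨Λ, hΛ⟩, fun j hne z => ?_⟩
        cases j with
        | zero =>
          have e1 : (fun i => A.ev (Function.update x l₀ z) c i) = fun i => A.ev x c i :=
            funext fun i => hcg c hc z i
          simp only [ev, e1, Function.update_of_ne (Ne.symm hll)]
        | succ j => exact hj j (fun e => hne (congrArg _ e)) z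

theorem exists_ev_linear [DecidableEq L] (x : L → A.Total) (l₀ : L) {f : Row L} (hf : f.len = 1)
    (hn : f.labels.Nodup) (h : l₀ ∈ f.labels) :
    ∃ Λ : A.Total →ₗ[k] A.Total, ∀ z, A.ev (Function.update x l₀ z) f 0 = Λ z := by
  obtain ⟨i, hi, hΛ, _⟩ := A.exists_ev_update x l₀ f hn h
  rw [hf, Nat.lt_one_iff] at hi
  rwa [hi] at hΛ

end LinQuiver

/-! ### Substitution of a tree into the unlabelled boxes. -/

namespace Row
variable {L : Type}

/-- Substitution of the tree `t` into the boxes without label. -/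
def subst (t : Row L) : Row (Option L) → Row L
  | nil => nil
  | unit f => unit (subst t f)
  | node (some l) p r c f => node l p r (subst t c) (subst t f)
  | node none _ _ c f => graft t (subst t c) ++ subst t f

/-- The boxes without label have the size of the tree `t` at height `a`. -/
def Sized (t : Row L) (a : ℕ) (f : Row (Option L)) : Prop :=
  ∀ b ∈ f.boxes, b.1 = none → b.2 = (a, t.wd, t.rt a)

section
variable {t : Row L} {a : ℕ}

theorem sized_node {l : Option L} {p r : ℕ} {c f : Row (Option L)} :
    Sized t a (node l p r c f) ↔ (l = none → p = a ∧ c.len = t.wd ∧ r = t.rt a) ∧ Sized t a c ∧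
      Sized t a f := by
  simp only [Sized, boxes, List.mem_cons, List.mem_append]
  constructor
  · intro h
    refine ⟨fun e => ?_, fun b hb => h b (Or.inr (Or.inl hb)), fun b hb => h b (Or.inr (Or.inr hb))⟩
    simpa using h _ (Or.inl rfl) e
  · rintro ⟨h1, h2, h3⟩ b (rfl | hb | hb) e
    · obtain ⟨rfl, h, rfl⟩ := h1 e
      rw [← h]
    · exact h2 b hb e
    · exact h3 b hb e

theorem len_subst (ht : t.len = 1) (f : Row (Option L)) (hs : Sized t a f) :
    (subst t f).len = f.len := by
  induction f with
  | nil => rfl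
  | unit f ih => exact congrArg (· + 1) (ih hs)
  | node l p r c f ihc ih =>
    obtain ⟨h1, h2, h3⟩ := sized_node.mp hs
    cases l with
    | some l => exact congrArg (· + 1) (ih h3)
    | none =>
      rw [subst, len_append, ih h3, len_graft ((ihc h2).trans (h1 rfl).2.1), ht, len, Nat.add_comm]

theorem wd_subst (ht : t.len = 1) (f : Row (Option L)) (hs : Sized t a f) :
    (subst t f).wd = f.wd := by
  induction f with
  | nil => rfl
  | unit f ih => exact congrArg (· + 1) (ih hs)
  | node l p r c f ihc ih =>
    obtain ⟨h1, h2, h3⟩ := sized_node.mp hs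
    cases l with
    | some l => exact congrArg₂ (· + ·) (ihc h2) (ih h3)
    | none =>
      rw [subst, wd_append, ih h3, wd_graft ((len_subst ht c h2).trans (h1 rfl).2.1), ihc h2, wd]

/-- By `rt_graft` and `fit_graft`, a box and a tree of the same outer size have the same effect on
the heights of everything around them. -/
theorem rt_subst (ht : t.len = 1) (hta : t.Fit a) (f : Row (Option L)) (hs : Sized t a f) :
    ∀ {h : ℕ}, f.Fit h → (subst t f).rt h = f.rt h ∧ (subst t f).Fit h := by
  induction f with
  | nil => exact fun _ => ⟨rfl, trivial⟩
  | unit f ih => exact fun hf => ⟨(ih hs hf.2).1, hf.1, (ih hs hf.2).2⟩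
  | node l p r c f ihc ih =>
    rintro h ⟨hp, hc, hf⟩
    obtain ⟨h1, h2, h3⟩ := sized_node.mp hs
    obtain ⟨e1, e2⟩ := ihc h2 hc
    obtain ⟨e3, e4⟩ := ih h3 hf
    cases l with
    | some l =>
      refine ⟨?_, hp, e2, ?_⟩
      · rw [subst, rt, rt, e1, e3]
      · rwa [e1]
    | none =>
      obtain ⟨rfl, h5, rfl⟩ := h1 rfl
      have hl := (len_subst ht c h2).trans h5
      have e5 := rt_graft hl (h - p) hta
      rw [Nat.add_sub_cancel' hp, e1, Nat.add_comm] at e5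
      refine ⟨?_, ?_⟩
      · rw [subst, rt_append, e5, e3, rt]
      · rw [subst, fit_append, e5]
        refine ⟨?_, e4⟩
        rw [← Nat.add_sub_cancel' hp]
        exact (fit_graft hl (h - p) hta).mpr e2

theorem ht_subst (ht : t.len = 1) (hta : t.Fit a) (f : Row (Option L)) (hs : Sized t a f) :
    ∀ {h : ℕ} (j : ℕ), f.Fit h → (subst t f).ht h j = f.ht h j := by
  induction f with
  | nil => exact fun _ _ => by rename_i j _; cases j <;> rfl
  | unit f ih =>
    intro h j hf
    cases j with
    | zero => simp
    | succ j => exact ih hs j hf.2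
  | node l p r c f ihc ih =>
    rintro h j ⟨hp, hc, hf⟩
    obtain ⟨h1, h2, h3⟩ := sized_node.mp hs
    cases j with
    | zero => simp
    | succ j =>
      have e1 := (rt_subst ht hta c h2 hc).1
      cases l with
      | some l =>
        change (subst t f).ht ((subst t c).rt (h - p) + r) j = _
        rw [e1]
        exact ih h3 j hf
      | none =>
        obtain ⟨rfl, h5, rfl⟩ := h1 rfl
        have hl := (len_subst ht c h2).trans h5
        have e5 := rt_graft hl (h - p) hta
        rw [Nat.add_sub_cancel' hp, e1, Nat.add_comm] at e5
        have e6 := ht_append_right (graft t (subst t c)) (subst t f) h j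
        rw [len_graft hl, ht, Nat.add_comm] at e6
        rw [subst, e6, e5]
        exact ih h3 j hf

theorem w_subst (ht : t.len = 1) (f : Row (Option L)) (hs : Sized t a f) :
    ∀ j, (subst t f).w j = f.w j := by
  induction f with
  | nil => exact fun _ => rfl
  | unit f ih =>
    intro j
    cases j with
    | zero => rfl
    | succ j => exact ih hs j
  | node l p r c f ihc ih =>
    intro j
    obtain ⟨h1, h2, h3⟩ := sized_node.mp hs
    cases l with
    | some l =>
      cases j with
      | zero => exact wd_subst ht c h2
      | succ j => exact ih h3 j
    | none =>
      have hl := (len_subst ht c h2).trans (h1 rfl).2.1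
      have hl1 : (graft t (subst t c)).len = 1 := (len_graft hl).trans ht
      cases j with
      | zero =>
        rw [subst, w_append_left _ _ _ (by omega)]
        have := psum_w (graft t (subst t c))
        rw [hl1, wd_graft hl, wd_subst ht c h2] at this
        change _ = c.wd
        simpa [LinQuiver.psum] using this
      | succ j =>
        have e6 := w_append_right (graft t (subst t c)) (subst t f) j
        rw [hl1, Nat.add_comm] at e6
        rw [subst, e6]
        exact ih h3 j

end
end Row

namespace LinQuiver
open Row
variable {k : Type w₁} [CommRing k] {U : Type u} [Category.{v} U] (A : LinQuiver.{u, v, w₁, w₂, w₃} k U)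
variable {L : Type}

/-- Induction on `f`. At an unlabelled box the component of `z` that is read agrees with the value
of `t`, and `ev_graft` merges `t` with the row above it. -/
theorem ev_subst {t : Row L} {a : ℕ} (ht : t.len = 1) (hta : t.Fit a) (x : L → A.Total)
    (z : A.Total) (hz : z a t.wd (t.rt a) = A.ev x t 0 a t.wd (t.rt a)) (f : Row (Option L))
    (hs : Sized t a f) : ∀ {h : ℕ} (j : ℕ), f.Fit h →
      A.ev (fun l => l.elim z x) f j (f.ht h j) = A.ev x (subst t f) j (f.ht h j) := by
  induction f with
  | nil => exact fun _ _ => rfl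
  | unit f ih =>
    intro h j hf
    cases j with
    | zero => rfl
    | succ j => exact ih hs j hf.2
  | node l p r c f ihc ih =>
    rintro h j ⟨hp, hc, hf⟩
    obtain ⟨h1, h2, h3⟩ := sized_node.mp hs
    cases j with
    | zero =>
      rw [ht_zero]
      cases l with
      | some l =>
        change (if p ≤ h then A.ncomp (x l p c.len r) (fun i => A.ev (fun l => l.elim z x) c i)
            (c.ht (h - p)) c.w h else 0) = (if p ≤ h then A.ncomp (x l p (subst t c).len r)
            (fun i => A.ev x (subst t c) i) ((subst t c).ht (h - p)) (subst t c).w h else 0)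
        rw [if_pos hp, if_pos hp, len_subst ht c h2]
        refine congrFun (A.ncomp_congr _ ?_ ?_ ?_) h
        · exact fun j _ => (ht_subst ht hta c h2 j hc).symm
        · exact fun j _ => (w_subst ht c h2 j).symm
        · exact fun j _ => by rw [ihc h2 j hc]
      | none =>
        obtain ⟨rfl, h5, rfl⟩ := h1 rfl
        have hl := (len_subst ht c h2).trans h5
        rw [subst, ev_append_left _ _ _ _ _ (by rw [len_graft hl]; omega)]
        rw [A.ev_graft x hl (h - p) 0 (o := 0) hta (by omega) rfl (ht_zero t p).symm
          (q₀ := t.wd) (r₀ := t.rt p) (by rw [← psum_w t, ht]; simp [psum])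
          (by rw [← ht_len, ht]) (by rw [ht_zero]; omega)]
        change (if p ≤ h then A.ncomp (z p c.len (t.rt p)) (fun i => A.ev (fun l => l.elim z x) c i)
            (c.ht (h - p)) c.w h else 0) = _
        rw [if_pos hp, ← hz, ← h5]
        refine congrFun (A.ncomp_congr _ ?_ ?_ ?_) h
        · exact fun j _ => by rw [Nat.zero_add, ht_subst ht hta c h2 j hc]
        · exact fun j _ => by rw [Nat.zero_add, w_subst ht c h2 j]
        · exact fun j _ => by rw [Nat.zero_add, ihc h2 j hc]
    | succ j =>
      cases l with
      | some l => exact ih h3 j hf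
      | none =>
        have hl := (len_subst ht c h2).trans (h1 rfl).2.1
        have e6 := A.ev_append_right x (graft t (subst t c)) (subst t f) j
        rw [len_graft hl, ht, Nat.add_comm] at e6
        rw [subst, e6]
        exact ih h3 j hf

end LinQuiver

/-! ### Rows of given trees; shapes and labels. -/

namespace Row
variable {L M : Type}

/-- The row of the trees `g 0, …, g (n - 1)`. -/
def ofFn : ∀ {n : ℕ}, (Fin n → Row L) → Row L
  | 0, _ => nil
  | _ + 1, g => g 0 ++ ofFn fun j => g j.succ

section
variable {n : ℕ} {g : Fin n → Row L}

theorem len_ofFn (hg : ∀ j, (g j).len = 1) : (ofFn g).len = n := by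
  induction n with
  | zero => rfl
  | succ n ih => rw [ofFn, len_append, hg, ih fun j => hg j.succ, Nat.add_comm]

theorem w_ofFn (hg : ∀ j, (g j).len = 1) (j : Fin n) : (ofFn g).w j = (g j).wd := by
  induction n with
  | zero => exact j.elim0
  | succ n ih =>
    induction j using Fin.cases with
    | zero =>
      rw [ofFn, Fin.val_zero, w_append_left _ _ _ (by rw [hg]; exact Nat.one_pos), ← psum_w, hg]
      simp [LinQuiver.psum]
    | succ j =>
      have e := w_append_right (g 0) (ofFn fun j => g j.succ) j
      rw [hg, Nat.add_comm 1] at e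
      exact e.trans (ih (fun j => hg j.succ) j)

theorem wd_ofFn (hg : ∀ j, (g j).len = 1) {q : ℕ → ℕ} (hq : ∀ j, (g j).wd = q j) :
    (ofFn g).wd = LinQuiver.psum q n := by
  rw [← psum_w, len_ofFn hg]
  refine LinQuiver.psum_congr fun j hj => ?_
  rw [← hq ⟨j, hj⟩, ← w_ofFn hg ⟨j, hj⟩]

theorem rt_ofFn {h : Fin (n + 1) → ℕ} (hr : ∀ j, (g j).rt (h j.castSucc) = h j.succ) :
    (ofFn g).rt (h 0) = h (Fin.last n) := by
  induction n with
  | zero => rfl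
  | succ n ih =>
    rw [ofFn, rt_append, show (g 0).rt (h 0) = h (Fin.succ 0) from hr 0]
    exact ih (h := fun j => h j.succ) fun j => hr j.succ

theorem fit_ofFn {h : Fin (n + 1) → ℕ} (hr : ∀ j, (g j).rt (h j.castSucc) = h j.succ) :
    (ofFn g).Fit (h 0) ↔ ∀ j, (g j).Fit (h j.castSucc) := by
  induction n with
  | zero => exact ⟨fun _ j => j.elim0, fun _ => trivial⟩
  | succ n ih =>
    rw [ofFn, fit_append, show (g 0).rt (h 0) = h (Fin.succ 0) from hr 0, Fin.forall_fin_succ]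
    exact and_congr_right fun _ => ih (h := fun j => h j.succ) fun j => hr j.succ

theorem ht_ofFn (hg : ∀ j, (g j).len = 1) {h : Fin (n + 1) → ℕ}
    (hr : ∀ j, (g j).rt (h j.castSucc) = h j.succ) (j : Fin (n + 1)) :
    (ofFn g).ht (h 0) j = h j := by
  induction n with
  | zero =>
    obtain rfl : j = 0 := Subsingleton.elim (α := Fin 1) _ _
    rfl
  | succ n ih =>
    induction j using Fin.cases with
    | zero => exact ht_zero _ _
    | succ j =>
      have e := ht_append_right (g 0) (ofFn fun j => g j.succ) (h 0) j
      rw [hg, Nat.add_comm 1, show (g 0).rt (h 0) = h (Fin.succ 0) from hr 0] at e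
      refine e.trans ?_
      exact ih (fun j => hg j.succ) (h := fun j => h j.succ) (fun j => hr j.succ) j

theorem boxes_ofFn : (ofFn g).boxes = (List.ofFn fun j => (g j).boxes).flatten := by
  induction n with
  | zero => rfl
  | succ n ih => rw [ofFn, boxes_append, ih, List.ofFn_succ, List.flatten_cons]

theorem ofFn_injective {g' : Fin n → Row L} (hg : ∀ j, (g j).len = 1) (hg' : ∀ j, (g' j).len = 1)
    (e : ofFn g = ofFn g') : g = g' := by
  induction n with
  | zero => exact funext fun j => j.elim0
  | succ n ih =>
    obtain ⟨e1, e2⟩ := append_inj e ((hg 0).trans (hg' 0).symm)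
    have e3 := ih (fun j => hg j.succ) (fun j => hg' j.succ) e2
    funext j
    induction j using Fin.cases with
    | zero => exact e1
    | succ j => exact congrFun e3 j

end

/-- The row with the labels removed. -/
def shape : Row L → Row Unit
  | nil => nil
  | unit f => unit (shape f)
  | node _ p r c f => node () p r (shape c) (shape f)

/-- The row with labels `lab i, lab (i + 1), …`. -/
def relabel (lab : ℕ → L) : Row M → ℕ → Row L
  | nil, _ => nil
  | unit f, i => unit (relabel lab f i)
  | node _ p r c f, i =>
    node (lab i) p r (relabel lab c (i + 1)) (relabel lab f (i + 1 + c.boxes.length))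

@[simp] theorem shape_append (f g : Row L) : (f ++ g).shape = f.shape ++ g.shape := by
  induction f with
  | nil => rfl
  | unit f ih => exact congrArg unit ih
  | node l p r c f _ ih => exact congrArg (node _ p r _) ih

theorem len_shape (f : Row L) : f.shape.len = f.len := by
  induction f with
  | nil => rfl
  | unit f ih => exact congrArg (· + 1) ih
  | node l p r c f _ ih => exact congrArg (· + 1) ih

theorem wd_shape (f : Row L) : f.shape.wd = f.wd := by
  induction f with
  | nil => rfl
  | unit f ih => exact congrArg (· + 1) ih
  | node l p r c f ihc ih => exact congrArg₂ (· + ·) ihc ih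

theorem rt_shape (f : Row L) : ∀ h, f.shape.rt h = f.rt h := by
  induction f with
  | nil => exact fun _ => rfl
  | unit f ih => exact ih
  | node l p r c f ihc ih =>
    intro h
    rw [shape, rt, ihc, ih, rt]

theorem fit_shape (f : Row L) : ∀ h, f.shape.Fit h ↔ f.Fit h := by
  induction f with
  | nil => exact fun _ => Iff.rfl
  | unit f ih => exact fun h => and_congr_right fun _ => ih h
  | node l p r c f ihc ih =>
    intro h
    rw [shape, Fit, ihc, ih, rt_shape, Fit]

theorem boxes_shape (f : Row L) : f.shape.boxes = f.boxes.map fun b => ((), b.2) := by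
  induction f with
  | nil => rfl
  | unit f ih => exact ih
  | node l p r c f ihc ih => simp [shape, boxes, ihc, ih, len_shape]

theorem length_boxes_shape (f : Row L) : f.shape.boxes.length = f.boxes.length := by
  rw [boxes_shape, List.length_map]

theorem length_labels (f : Row L) : f.labels.length = f.boxes.length := List.length_map _

theorem shape_relabel (lab : ℕ → L) (f : Row M) : ∀ i, (relabel lab f i).shape = f.shape := by
  induction f with
  | nil => exact fun _ => rfl
  | unit f ih => exact fun i => congrArg unit (ih i)
  | node l p r c f ihc ih => exact fun i => by rw [relabel, shape, ihc, ih, shape]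

theorem shape_unit (f : Row Unit) : f.shape = f := by
  induction f with
  | nil => rfl
  | unit f ih => exact congrArg unit ih
  | node l p r c f ihc ih => rw [shape, ihc, ih]

theorem relabel_append (lab : ℕ → L) (f g : Row M) : ∀ i,
    relabel lab (f ++ g) i = relabel lab f i ++ relabel lab g (i + f.boxes.length) := by
  induction f with
  | nil => exact fun _ => rfl
  | unit f ih => exact fun i => congrArg unit (ih i)
  | node l p r c f _ ih =>
    intro i
    rw [node_append, relabel, ih, relabel, node_append, boxes, List.length_cons, List.length_append]
    congr 3
    omega

theorem labels_relabel (lab : ℕ → L) (f : Row M) : ∀ i,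
    (relabel lab f i).labels = (List.range' i f.boxes.length).map lab := by
  induction f with
  | nil => exact fun _ => rfl
  | unit f ih => exact ih
  | node l p r c f ihc ih =>
    intro i
    rw [relabel, labels_node, ihc, ih, boxes, List.length_cons, List.length_append,
      List.range'_succ, ← List.range'_append_1, List.map_cons, List.map_append]

/-- The shape tells how many labels belong to each subtree, so the list of labels can be cut up and
distributed recursively. -/
theorem ext_shape : ∀ {f f' : Row L}, f.shape = f'.shape → f.labels = f'.labels → f = f' := by
  intro f
  induction f with
  | nil => intro f' h _; cases f' <;> simp_all [shape]
  | unit f ih =>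
    intro f' h h'
    cases f' with
    | nil => simp [shape] at h
    | unit f' =>
      simp only [shape, unit.injEq] at h
      exact congrArg unit (ih h h')
    | node => simp [shape] at h
  | node l p r c f ihc ih =>
    intro f' h h'
    cases f' with
    | nil => simp [shape] at h
    | unit f' => simp [shape] at h
    | node l' p' r' c' f' =>
      simp only [shape, node.injEq] at h
      obtain ⟨_, rfl, rfl, h1, h2⟩ := h
      simp only [labels_node, List.cons.injEq] at h'
      obtain ⟨rfl, h3⟩ := h'
      have h4 : c.labels.length = c'.labels.length := by
        rw [length_labels, length_labels, ← length_boxes_shape, h1, length_boxes_shape]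
      obtain ⟨h5, h6⟩ := List.append_inj h3 h4
      rw [ihc h1 h5, ih h2 h6]

end Row

/-! ### Stackings as planar trees. -/

namespace Stacking
open Row (ofFn)

/-- The planar tree underlying a stacking. -/
def shape : ∀ {p q r : ℕ}, Stacking p q r → Row Unit
  | _, _, _, unit => .unit .nil
  | _, _, _, node p r _ _ c => .node () p r (ofFn fun j => shape (c j)) .nil

theorem len_shape {p q r : ℕ} (S : Stacking p q r) : S.shape.len = 1 := by cases S <;> rfl

theorem wd_shape {p q r : ℕ} (S : Stacking p q r) : S.shape.wd = q := by
  induction S with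
  | unit => rfl
  | @node n p r h q c ih =>
    let q' : ℕ → ℕ := fun j => if hj : j < n then q ⟨j, hj⟩ else 0
    have e : q = fun j : Fin n => q' j := by funext j; simp [q']
    rw [shape, Row.wd, Row.wd, Row.wd_ofFn (fun j => len_shape _) (q := q') (fun j => by simp [ih, q']),
      ← LinQuiver.partialSum_eq_psum q' n le_rfl, ← e]
    rfl

theorem rt_shape {p q r : ℕ} (S : Stacking p q r) : S.shape.rt p = r := by
  induction S with
  | unit => rfl
  | @node n p r h q c ih =>
    rw [shape, Row.rt, Row.rt, Nat.add_sub_cancel, Row.rt_ofFn ih]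

theorem fit_shape {p q r : ℕ} (S : Stacking p q r) : S.shape.Fit p := by
  induction S with
  | unit => exact ⟨rfl, trivial⟩
  | @node n p r h q c ih =>
    refine ⟨Nat.le_add_left _ _, ?_, trivial⟩
    rw [Nat.add_sub_cancel, Row.fit_ofFn fun j => rt_shape (c j)]
    exact ih

theorem boxes_shape {p q r : ℕ} (S : Stacking p q r) : S.shape.boxes.map Prod.snd = S.boxes := by
  induction S with
  | unit => rfl
  | @node n p r h q c ih =>
    rw [shape, Row.boxes, Row.boxes, List.append_nil, List.map_cons, boxes,
      Row.len_ofFn fun j => len_shape _, Row.boxes_ofFn, List.map_flatten, List.map_ofFn]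
    congr 4
    funext j
    exact ih j

theorem length_boxes_shape {p q r : ℕ} (S : Stacking p q r) :
    S.shape.boxes.length = S.boxes.length := by
  rw [← boxes_shape, List.length_map]

/-- The tree and the left height determine all inner heights and widths from left to right, so the
dependent data of a stacking carry no further information. The right height and the width are not
assumed equal, as they follow. -/
theorem shape_heq {p q r : ℕ} (S : Stacking p q r) : ∀ {p' q' r' : ℕ} (S' : Stacking p' q' r'),
    p = p' → S.shape = S'.shape → HEq S S' := by
  induction S with
  | unit =>
    intro p' q' r' S' hp h
    cases S' with
    | unit => rfl
    | node => simp [shape] at h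
  | @node n p r h q c ih =>
    intro p' q' r' S' hp e
    cases S' with
    | unit => simp [shape] at e
    | @node n' p' r' h' q' c' =>
      simp only [shape, Row.node.injEq, and_true, true_and] at e
      obtain ⟨rfl, rfl, e⟩ := e
      have hn := congrArg Row.len e
      rw [Row.len_ofFn fun j => len_shape _, Row.len_ofFn fun j => len_shape _] at hn
      subst hn
      have e0 : h 0 = h' 0 := Nat.add_right_cancel hp
      have hh : h = h' := by
        funext j
        rw [← Row.ht_ofFn (fun j => len_shape (c j)) (fun j => rt_shape (c j)) j,
          ← Row.ht_ofFn (fun j => len_shape (c' j)) (fun j => rt_shape (c' j)) j, e, e0]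
      subst hh
      have e' := Row.ofFn_injective (fun j => len_shape _) (fun j => len_shape _) e
      have hq : q = q' := by
        funext j
        rw [← wd_shape (c j), ← wd_shape (c' j)]
        exact congrArg Row.wd (congrFun e' j)
      subst hq
      have hc : c = c' := funext fun j => eq_of_heq (ih j _ rfl (congrFun e' j))
      rw [hc]

theorem shape_injective {p q r : ℕ} : Function.Injective (shape (p := p) (q := q) (r := r)) :=
  fun _ _ h => eq_of_heq (shape_heq _ _ rfl h)

end Stacking

namespace Stacking
open Row (ofFn)

/-- The heights `ht` and widths `w` computed along the row supply the dependent sizes of the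
stackings. Rows instead of single trees make the induction go through. -/
theorem exists_shape_row (f : Row Unit) : ∀ h, f.Fit h → ∃ g : Fin f.len → Row Unit, f = ofFn g ∧
    (∀ j, (g j).len = 1) ∧ ∀ (j : Fin f.len) {a b c : ℕ}, a = f.ht h j → b = f.w j →
      c = f.ht h (j + 1) → ∃ S : Stacking a b c, S.shape = g j := by
  induction f with
  | nil => exact fun _ _ => ⟨fun j => j.elim0, rfl, fun j => j.elim0, fun j => j.elim0⟩
  | unit f ih =>
    rintro h ⟨rfl, hf⟩
    obtain ⟨g, e, hg, hS⟩ := ih _ hf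
    refine ⟨Fin.cons (.unit .nil) g, congrArg Row.unit e, Fin.cases rfl hg, ?_⟩
    refine Fin.cases ?_ hS
    rintro a b c ha hb hc
    obtain rfl : a = 0 := ha
    obtain rfl : b = 1 := hb
    obtain rfl : c = 0 := hc.trans (Row.ht_zero f 0)
    exact ⟨unit, rfl⟩
  | node l p r ch f ihc ih =>
    rintro h ⟨hp, hc, hf⟩
    obtain ⟨g, e, hg, hS⟩ := ih _ hf
    obtain ⟨gc, ec, hgc, hSc⟩ := ihc _ hc
    refine ⟨Fin.cons (.node l p r ch .nil) g, congrArg (Row.node l p r ch) e, Fin.cases rfl hg, ?_⟩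
    refine Fin.cases ?_ hS
    rintro a b c ha hb hc'
    choose S hS' using fun j => hSc j rfl rfl rfl
    have e1 : a = ch.ht (h - p) 0 + p := by
      rw [Row.ht_zero, Nat.sub_add_cancel hp]
      exact ha
    have e2 : b = LinQuiver.partialSum (fun j : Fin ch.len => ch.w j) ch.len le_rfl := by
      rw [LinQuiver.partialSum_eq_psum, Row.psum_w]
      exact hb
    have e3 : c = ch.ht (h - p) ch.len + r := by
      rw [Row.ht_len]
      exact hc'.trans (Row.ht_zero f _)
    subst e1 e2 e3
    refine ⟨node p r (fun j : Fin (ch.len + 1) => ch.ht (h - p) j) (fun j => ch.w j) S, ?_⟩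
    change Row.node () p r (ofFn fun j => (S j).shape) .nil = Row.node l p r ch .nil
    rw [show (fun j => (S j).shape) = gc from funext hS', ← ec]

theorem exists_shape_eq {f : Row Unit} {h : ℕ} (hl : f.len = 1) (hf : f.Fit h) :
    ∃ S : Stacking h f.wd (f.rt h), S.shape = f := by
  obtain ⟨g, e, _, hS⟩ := exists_shape_row f h hf
  have h0 : 0 < f.len := by omega
  have h1 := Row.psum_w f
  have h2 := Row.ht_len f h
  rw [hl] at h1 h2
  obtain ⟨S, hS⟩ := hS ⟨0, h0⟩ (a := h) (b := f.wd) (c := f.rt h) (Row.ht_zero _ _).symm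
    (by simpa [LinQuiver.psum] using h1.symm) h2.symm
  refine ⟨S, hS.trans ?_⟩
  have key : ∀ {n : ℕ} (hn : n = 1) (g : Fin n → Row Unit) (j : Fin n), g j = ofFn g := by
    rintro n rfl g j
    rw [ofFn, ofFn, Row.append_nil, Subsingleton.elim j 0]
  rw [key hl g, ← e]

end Stacking

/-! ### Evaluation of stackings through trees. -/

namespace LinQuiver
open Row
variable {k : Type w₁} [CommRing k] {U : Type u} [Category.{v} U] (A : LinQuiver.{u, v, w₁, w₂, w₃} k U)
variable {L : Type}

theorem ev_ofFn {n : ℕ} {g : Fin n → Row L} (hg : ∀ j, (g j).len = 1) (x : L → A.Total)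
    (j : Fin n) : A.ev x (ofFn g) j = A.ev x (g j) 0 := by
  induction n with
  | zero => exact j.elim0
  | succ n ih =>
    induction j using Fin.cases with
    | zero => exact A.ev_append_left x _ _ _ (by rw [hg]; exact Nat.one_pos)
    | succ j =>
      have e := A.ev_append_right x (g 0) (ofFn fun j => g j.succ) j
      rw [hg, Nat.add_comm 1] at e
      exact e.trans (ih (fun j => hg j.succ) j)

theorem relabel_ofFn {M : Type} (lab : ℕ → L) : ∀ {n : ℕ} (g : Fin n → Row M) (i : ℕ),
    relabel lab (ofFn g) i =
      ofFn fun j => relabel lab (g j) (i + ∑ j' : Fin n with j' < j, (g j').boxes.length)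
  | 0, _, _ => rfl
  | n + 1, g, i => by
      rw [ofFn, relabel_append, relabel_ofFn lab _ _, ofFn]
      congr 2
      · have : (Finset.univ.filter fun j' : Fin (n + 1) => j' < 0) = ∅ := by
          ext; simp
        rw [this]
        rfl
      · funext j
        rw [Finset.sum_filter, Finset.sum_filter, Fin.sum_univ_succ, if_pos (Fin.succ_pos j),
          Nat.add_assoc]
        simp

/-- Both sides number boxes with the root first and then child by child, so the boxes of the `j`-th
child start after those of the earlier children. Only the values of `y` at positions occupied by
boxes matter. -/
theorem ev_relabel_shape (x : L → A.Total) (lab : ℕ → L) {p q r : ℕ} (S : Stacking p q r) :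
    ∀ (y : ℕ → A.Total) (i : ℕ), (∀ j, i ≤ j → j < i + S.boxes.length → y j = x (lab j)) →
      A.ev x (relabel lab S.shape i) 0 p q r = A.eval S y i := by
  induction S with
  | unit => exact fun _ _ _ => A.put_self _
  | @node n p r h q c ih =>
    intro y i hy
    have hb : (Stacking.node p r h q c).boxes.length = 1 + ∑ j : Fin n, (c j).boxes.length := by
      rw [Stacking.boxes, List.length_cons, List.length_flatten, List.map_ofFn, List.sum_ofFn,
        Nat.add_comm]
      rfl
    rw [Stacking.shape, relabel, relabel_ofFn]
    simp only [Stacking.length_boxes_shape]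
    set g : Fin n → Row L := fun j => relabel lab (c j).shape
      (i + 1 + ∑ j' : Fin n with j' < j, (c j').boxes.length) with hg
    have hsh : ∀ j, (g j).shape = (c j).shape := fun j => by
      rw [hg]
      exact (shape_relabel _ _ _).trans (shape_unit _)
    have hl : ∀ j, (g j).len = 1 := fun j => by rw [← len_shape, hsh, Stacking.len_shape]
    have hr : ∀ j : Fin n, (g j).rt (h j.castSucc) = h j.succ := fun j => by
      rw [← rt_shape, hsh, Stacking.rt_shape]
    have hw : ∀ j, (g j).wd = q j := fun j => by rw [← wd_shape, hsh, Stacking.wd_shape]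
    change (if p ≤ h 0 + p then A.ncomp (x (lab i) p (ofFn g).len r) (fun i => A.ev x (ofFn g) i)
      ((ofFn g).ht (h 0 + p - p)) (ofFn g).w (h 0 + p) else 0) _ _ = A.compBox (y i p n r) fun j =>
        A.eval (c j) y (i + 1 + ∑ j' : Fin n with j' < j, (c j').boxes.length)
    rw [if_pos (Nat.le_add_left _ _), Nat.add_sub_cancel, len_ofFn hl,
      hy i le_rfl (by rw [hb]; omega)]
    have hh : (fun j : Fin (n + 1) => (ofFn g).ht (h 0) j) = h := funext (ht_ofFn hl hr)
    have hq : (fun j : Fin n => (ofFn g).w j) = q := funext fun j => (w_ofFn hl j).trans (hw j)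
    have hput : ∀ (z : A.Total) {a b c a' b' c' : ℕ}, a = a' → b = b' → c = c' →
        A.put a b c (z a b c) a' b' c' = z a' b' c' := by
      rintro z a b c _ _ _ rfl rfl rfl
      exact A.put_self _
    rw [ncomp, A.put_compBox_congr (h := fun j : Fin (n + 1) => (ofFn g).ht (h 0) j)
      (q := fun j : Fin n => (ofFn g).w j) hh hq _ _ _ fun j => rfl]
    refine (A.put_self _).trans (congrArg _ ?_)
    funext j
    refine (hput _ (congrFun hh j.castSucc) (congrFun hq j) (congrFun hh j.succ)).trans ?_
    rw [A.ev_ofFn hl]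
    refine ih j y _ fun t h1 h2 => hy t (by omega) (lt_of_lt_of_le h2 ?_)
    rw [hb]
    -- The boxes of the `j`-th child stay inside the range where `y` is known.
    have : ∑ j' : Fin n with j' < j, (c j').boxes.length + (c j).boxes.length ≤
        ∑ j', (c j').boxes.length := by
      rw [Nat.add_comm, ← Finset.sum_insert (f := fun j' => (c j').boxes.length) (by simp)]
      exact Finset.sum_le_sum_of_subset (Finset.subset_univ _)
    omega

end LinQuiver

/-! ### Thin and full boxes; horizontal cuts. -/

namespace Row
variable {L M : Type}

/-- A row of units. -/
def units : ℕ → Row L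
  | 0 => nil
  | m + 1 => unit (units m)

/-- No box of the row is semi-thin. -/
def NonSemi : Row L → Prop
  | nil => True
  | unit f => NonSemi f
  | node _ p r c f => (p = 0 ↔ r = 0) ∧ NonSemi c ∧ NonSemi f

/-- All boxes of the row have inputs and outputs. -/
def Strict : Row L → Prop
  | nil => True
  | unit f => Strict f
  | node _ p r c f => (0 < p ∧ 0 < r) ∧ Strict c ∧ Strict f

/-- The number of thin boxes. -/
def thins : Row L → ℕ
  | nil => 0
  | unit f => thins f
  | node _ p r c f => (if p = 0 ∧ r = 0 then 1 else 0) + thins c + thins f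

/-- The row can be cut along a horizontal line which meets the left boundary at the height `x` and
the right boundary at the height `y`. -/
def Cut : Row L → ℕ → ℕ → Prop
  | nil, x, y => x = y
  | unit f, x, y => x = 0 ∧ Cut f 0 y
  | node _ p r c f, x, y => ∃ z, (x = 0 ∧ z = 0 ∨ ∃ x' z', x = p + x' ∧ z = r + z' ∧ Cut c x' z') ∧
      Cut f z y

/-- Trees with two boxes, the upper of which is thin. -/
def IsPair (t : Row L) (P : ℕ) : Prop :=
  ∃ l r i v m k, t = node l P r (units i ++ node v 0 0 (units m) (units k)) nil ∧ (P = 0 ↔ r = 0)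

/-- Trees with thin root on top of which sits a connected row without thin boxes. -/
def IsConn (t : Row L) (P : ℕ) : Prop :=
  ∃ a c, t = node a 0 0 c nil ∧ c.Strict ∧ 0 < P ∧ ∀ x y, c.Cut x y → x = 0 ∨ P ≤ x

@[simp] theorem len_units (m : ℕ) : (units m : Row L).len = m := by
  induction m with
  | zero => rfl
  | succ m ih => exact congrArg (· + 1) ih

@[simp] theorem wd_units (m : ℕ) : (units m : Row L).wd = m := by
  induction m with
  | zero => rfl
  | succ m ih => exact congrArg (· + 1) ih

@[simp] theorem boxes_units (m : ℕ) : (units m : Row L).boxes = [] := by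
  induction m with
  | zero => rfl
  | succ m ih => exact ih

@[simp] theorem labels_units (m : ℕ) : (units m : Row L).labels = [] := by
  simp [labels]

@[simp] theorem rt_units (m h : ℕ) : (units m : Row L).rt h = h := by
  induction m with
  | zero => rfl
  | succ m ih => exact ih

theorem fit_units_zero (m : ℕ) : (units m : Row L).Fit 0 := by
  induction m with
  | zero => trivial
  | succ m ih => exact ⟨rfl, ih⟩

@[simp] theorem nonSemi_units (m : ℕ) : (units m : Row L).NonSemi := by
  induction m with
  | zero => trivial
  | succ m ih => exact ih

theorem eq_units : ∀ {f : Row L}, f.boxes = [] → f = units f.len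
  | nil, _ => rfl
  | unit f, h => congrArg unit (eq_units (f := f) h)
  | node .., h => by simp [boxes] at h

theorem strict_append (f g : Row L) : (f ++ g).Strict ↔ f.Strict ∧ g.Strict := by
  induction f with
  | nil => simp [Strict]
  | unit f ih => exact ih
  | node l p r c f _ ih => simp [Strict, ih, and_assoc]

theorem nonSemi_append (f g : Row L) : (f ++ g).NonSemi ↔ f.NonSemi ∧ g.NonSemi := by
  induction f with
  | nil => simp [NonSemi]
  | unit f ih => exact ih
  | node l p r c f _ ih => simp [NonSemi, ih, and_assoc]

theorem thins_append (f g : Row L) : (f ++ g).thins = f.thins + g.thins := by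
  induction f with
  | nil => simp [thins]
  | unit f ih => exact ih
  | node l p r c f _ ih => simp [thins, ih, Nat.add_assoc]

theorem nonSemi_iff (f : Row L) : f.NonSemi ↔ ∀ b ∈ f.boxes, (b.2.1 = 0 ↔ b.2.2.2 = 0) := by
  induction f with
  | nil => simp [NonSemi, boxes]
  | unit f ih => exact ih
  | node l p r c f ihc ih =>
    simp only [NonSemi, ihc, ih, boxes, List.mem_cons, List.mem_append, forall_eq_or_imp]
    refine and_congr_right fun _ => ⟨?_, fun h => ⟨fun b hb => h b (.inl hb), fun b hb => h b (.inr hb)⟩⟩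
    rintro ⟨h1, h2⟩ b (hb | hb)
    · exact h1 b hb
    · exact h2 b hb

theorem strict_iff_boxes (f : Row L) : f.Strict ↔ ∀ b ∈ f.boxes, 0 < b.2.1 ∧ 0 < b.2.2.2 := by
  induction f with
  | nil => simp [Strict, boxes]
  | unit f ih => exact ih
  | node l p r c f ihc ih =>
    simp only [Strict, ihc, ih, boxes, List.mem_cons, List.mem_append, forall_eq_or_imp]
    refine and_congr_right fun _ => ⟨?_, fun h => ⟨fun b hb => h b (.inl hb), fun b hb => h b (.inr hb)⟩⟩
    rintro ⟨h1, h2⟩ b (hb | hb)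
    · exact h1 b hb
    · exact h2 b hb

theorem thins_eq (f : Row L) :
    f.thins = f.boxes.countP fun b => b.2.1 = 0 ∧ b.2.2.2 = 0 := by
  induction f with
  | nil => rfl
  | unit f ih => exact ih
  | node l p r c f ihc ih =>
    rw [thins, ihc, ih, boxes, List.countP_cons, List.countP_append]
    simp only [decide_eq_true_eq]
    omega

theorem strict_iff (f : Row L) : f.Strict ↔ f.NonSemi ∧ f.thins = 0 := by
  rw [strict_iff_boxes, nonSemi_iff, thins_eq, List.countP_eq_zero]
  constructor
  · intro h
    refine ⟨fun b hb => ?_, fun b hb => ?_⟩ <;> have := h b hb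
    · omega
    · simp; omega
  · rintro ⟨h1, h2⟩ b hb
    have h3 := h1 b hb
    have h4 := h2 b hb
    simp only [decide_eq_true_eq] at h4
    omega

theorem Strict.nonSemi {f : Row L} (h : f.Strict) : f.NonSemi := ((strict_iff f).mp h).1

/-- At height zero all boxes are thin. -/
theorem NonSemi.fit_zero {f : Row L} (h : f.NonSemi) (hf : f.Fit 0) :
    f.rt 0 = 0 ∧ f.thins = f.boxes.length := by
  induction f with
  | nil => exact ⟨rfl, rfl⟩
  | unit f ih => exact ih h hf.2
  | node l p r c f ihc ih =>
    obtain ⟨hp, hc, hf⟩ := hf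
    obtain ⟨h1, h2, h3⟩ := h
    obtain rfl := Nat.le_zero.mp hp
    obtain rfl : r = 0 := h1.mp rfl
    obtain ⟨e1, e2⟩ := ihc h2 hc
    rw [Nat.zero_sub, e1] at hf
    obtain ⟨e3, e4⟩ := ih h3 hf
    refine ⟨?_, ?_⟩
    · rw [rt, Nat.zero_sub, e1, e3]
    · rw [thins, e2, e4, boxes, List.length_cons, List.length_append, if_pos ⟨rfl, rfl⟩]
      omega

/-- A row of positive height has a right boundary of positive height. -/
theorem Strict.rt_pos {f : Row L} (h : f.Strict) : ∀ {a}, 0 < a → 0 < f.rt a := by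
  induction f with
  | nil => exact id
  | unit f ih => exact ih h
  | node l p r c f ihc ih => exact fun _ => ih h.2.2 (by have := h.1.2; omega)

/-- The total degree of the boxes. -/
theorem sum_degree (f : Row L) : ∀ {h : ℕ}, f.Fit h →
    (f.boxes.map fun b => (b.2.1 - b.2.2.2 + b.2.2.1 - 1 : ℤ)).sum = h - f.rt h + f.wd - f.len := by
  induction f with
  | nil => intro h _; simp [boxes, rt, wd, len]
  | unit f ih =>
    rintro h ⟨_, hf⟩
    rw [boxes, ih hf, rt, wd, len]
    push_cast
    ring
  | node l p r c f ihc ih =>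
    rintro h ⟨hp, hc, hf⟩
    rw [boxes, List.map_cons, List.map_append, List.sum_cons, List.sum_append, ihc hc, ih hf, rt, wd,
      len]
    push_cast [hp]
    ring

theorem eq_node_of_length_boxes : ∀ {f : Row L}, f.boxes.length = 1 → ∃ i v p r m k,
    f = units i ++ node v p r (units m) (units k)
  | nil, h => by simp [boxes] at h
  | unit f, h => by
      obtain ⟨i, v, p, r, m, k, e⟩ := eq_node_of_length_boxes (f := f) h
      exact ⟨i + 1, v, p, r, m, k, congrArg unit e⟩
  | node l p r c f, h => by
      simp only [boxes, List.length_cons, List.length_append] at h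
      have h1 : c.boxes = [] := List.eq_nil_of_length_eq_zero (by omega)
      have h2 : f.boxes = [] := List.eq_nil_of_length_eq_zero (by omega)
      exact ⟨0, l, p, r, c.len, f.len, by rw [← eq_units h1, ← eq_units h2]; rfl⟩

section Cut

theorem cut_zero (f : Row L) : f.Cut 0 0 := by
  induction f with
  | nil => rfl
  | unit f ih => exact ⟨rfl, ih⟩
  | node l p r c f _ ih => exact ⟨0, .inl ⟨rfl, rfl⟩, ih⟩

theorem cut_append (f g : Row L) : ∀ x y, (f ++ g).Cut x y ↔ ∃ z, f.Cut x z ∧ g.Cut z y := by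
  induction f with
  | nil => intro x y; simp [Cut]
  | unit f ih => intro x y; simp [Cut, ih, and_assoc]
  | node l p r c f _ ih =>
    intro x y
    simp only [node_append, Cut, ih]
    constructor
    · rintro ⟨z, h, z', h', h''⟩
      exact ⟨z', ⟨z, h, h'⟩, h''⟩
    · rintro ⟨z', ⟨z, h, h'⟩, h''⟩
      exact ⟨z, h, z', h', h''⟩

/-- A thin box touches neither side, so it does not matter on which side of the cut it lies. -/
theorem cut_thin (l : L) (c : Row L) (x y : ℕ) : (node l 0 0 c nil).Cut x y ↔ c.Cut x y := by
  simp only [Cut, Nat.zero_add]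
  constructor
  · rintro ⟨z, ⟨rfl, rfl⟩ | ⟨x, z, rfl, rfl, h⟩, rfl⟩
    · exact cut_zero c
    · exact h
  · exact fun h => ⟨y, .inr ⟨x, y, rfl, rfl, h⟩, rfl⟩

theorem cut_rt (f : Row L) : ∀ {h}, f.Fit h → f.Cut h (f.rt h) := by
  induction f with
  | nil => exact fun _ => rfl
  | unit f ih =>
    rintro h ⟨rfl, hf⟩
    exact ⟨rfl, ih hf⟩
  | node l p r c f ihc ih =>
    rintro h ⟨hp, hc, hf⟩
    exact ⟨_, .inr ⟨h - p, _, by omega, Nat.add_comm _ _, ihc hc⟩, ih hf⟩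

/-- A cut starting at the bottom could only rise above a box without inputs, and such a box has no
outputs either. -/
theorem NonSemi.cut_zero_left {f : Row L} (h : f.NonSemi) : ∀ {y}, f.Cut 0 y → y = 0 := by
  induction f with
  | nil => exact fun e => e.symm
  | unit f ih => exact fun e => ih h e.2
  | node l p r c f ihc ih =>
    rintro y ⟨z, ⟨_, rfl⟩ | ⟨x', z', e, rfl, h'⟩, h''⟩
    · exact ih h.2.2 h''
    · obtain ⟨rfl, rfl⟩ : p = 0 ∧ x' = 0 := by omega
      obtain rfl : r = 0 := h.1.mp rfl
      obtain rfl := ihc h.2.1 h'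
      exact ih h.2.2 h''

theorem NonSemi.cut_zero_right {f : Row L} (h : f.NonSemi) : ∀ {x}, f.Cut x 0 → x = 0 := by
  induction f with
  | nil => exact fun e => e
  | unit f ih => exact fun e => e.1
  | node l p r c f ihc ih =>
    rintro y ⟨z, h', h''⟩
    obtain rfl := ih h.2.2 h''
    obtain ⟨h', _⟩ | ⟨x', z', rfl, e, h'⟩ := h'
    · exact h'
    · obtain ⟨rfl, rfl⟩ : r = 0 ∧ z' = 0 := by omega
      obtain rfl : p = 0 := h.1.mpr rfl
      obtain rfl := ihc h.2.1 h'
      rfl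

theorem cut_ofFn {n : ℕ} {g : Fin n → Row L} : ∀ {x y}, (ofFn g).Cut x y →
    ∃ z : Fin (n + 1) → ℕ, z 0 = x ∧ z (Fin.last n) = y ∧
      ∀ j : Fin n, (g j).Cut (z j.castSucc) (z j.succ) := by
  induction n with
  | zero => exact fun {x y} h => ⟨fun _ => x, rfl, h, fun j => j.elim0⟩
  | succ n ih =>
    intro x y h
    obtain ⟨z, h1, h2⟩ := (cut_append _ _ _ _).mp h
    obtain ⟨Z, rfl, e2, hZ⟩ := ih h2
    exact ⟨Fin.cons x Z, rfl, e2, Fin.cases h1 hZ⟩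

/-- A cut is built tree by tree, while the invariant `V` records its height on each vertical line.
-/
theorem exists_cut_ofFn {n : ℕ} {g : Fin n → Row L} (V : Fin (n + 1) → ℕ → Prop)
    (step : ∀ (j : Fin n) (z : ℕ), V j.castSucc z → ∃ z', V j.succ z' ∧ (g j).Cut z z') {x : ℕ}
    (hx : V 0 x) : ∃ y, V (Fin.last n) y ∧ (ofFn g).Cut x y := by
  induction n generalizing x with
  | zero => exact ⟨x, hx, rfl⟩
  | succ n ih =>
    obtain ⟨z, h1, h2⟩ := step 0 x hx
    obtain ⟨y, h3, h4⟩ := ih (g := fun j => g j.succ) (fun j => V j.succ)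
      (fun j z h => step j.succ z h) h1
    exact ⟨y, h3, (cut_append _ _ _ _).mpr ⟨z, h2, h4⟩⟩

end Cut
end Row

/-! ### Cuts and connected components of the horizontal composite graph. -/

namespace Stacking
open Row (ofFn)

section Line
variable {n p r : ℕ} {h : Fin (n + 1) → ℕ} {q : Fin n → ℕ}
  {c : ∀ j : Fin n, Stacking (h j.castSucc) (q j) (h j.succ)}

/-- The unit segments of the vertical lines of a stacking. -/
abbrev line (p r : ℕ) (c : ∀ j : Fin n, Stacking (h j.castSucc) (q j) (h j.succ)) (j : Fin (n + 1))
    (i : Fin (h j)) : (node p r h q c).Point := .inr (.inl ⟨j, i⟩)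

/-- The points of the children of a stacking. -/
abbrev child (p r : ℕ) (c : ∀ j : Fin n, Stacking (h j.castSucc) (q j) (h j.succ)) (j : Fin n)
    (x : (c j).Point) : (node p r h q c).Point := .inr (.inr ⟨j, x⟩)

/-- The bottom box of a stacking. -/
abbrev root (p r : ℕ) (c : ∀ j : Fin n, Stacking (h j.castSucc) (q j) (h j.succ)) :
    (node p r h q c).Point := .inl ()

theorem left_lt (i : Fin (h 0 + p)) (hi : i.1 < p) : (node p r h q c).left i = root p r c :=
  dif_pos hi

theorem left_ge (i : Fin (h 0 + p)) (hi : ¬ i.1 < p) :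
    (node p r h q c).left i = line p r c 0 ⟨i.1 - p, by omega⟩ := dif_neg hi

theorem right_lt (i : Fin (h (Fin.last n) + r)) (hi : i.1 < r) :
    (node p r h q c).right i = root p r c := dif_pos hi

theorem right_ge (i : Fin (h (Fin.last n) + r)) (hi : ¬ i.1 < r) :
    (node p r h q c).right i = line p r c (Fin.last n) ⟨i.1 - r, by omega⟩ := dif_neg hi

/-- The edges of a stacking, as a case distinction. -/
theorem edge_iff {β : Type*} (χ : (node p r h q c).Point → β) :
    (∀ x y, (node p r h q c).Edge x y → χ x = χ y) ↔
      (∀ j x y, (c j).Edge x y → χ (child p r c j x) = χ (child p r c j y)) ∧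
      (∀ (j : Fin n) i, χ (line p r c j.castSucc i) = χ (child p r c j ((c j).left i))) ∧
      (∀ (j : Fin n) i, χ (line p r c j.succ i) = χ (child p r c j ((c j).right i))) := by
  constructor
  · intro H
    exact ⟨fun j x y e => H _ _ (.inl ⟨j, x, y, e, rfl, rfl⟩),
      fun j i => H _ _ (.inr (.inl ⟨j, i, rfl, rfl⟩)),
      fun j i => H _ _ (.inr (.inr ⟨j, i, rfl, rfl⟩))⟩
  · rintro ⟨h1, h2, h3⟩ x y (⟨j, x, y, e, rfl, rfl⟩ | ⟨j, i, rfl, rfl⟩ | ⟨j, i, rfl, rfl⟩)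
    · exact h1 j x y e
    · exact h2 j i
    · exact h3 j i

end Line

/-- A horizontal cut separates the points below it from those above it. -/
theorem exists_separating {p q r : ℕ} (S : Stacking p q r) : ∀ {x y : ℕ}, S.shape.Cut x y →
    ∃ χ : S.Point → Prop, (∀ a b, S.Edge a b → χ a = χ b) ∧ (∀ i, χ (S.left i) = (i < x)) ∧
      ∀ i, χ (S.right i) = (i < y) := by
  induction S with
  | unit => exact fun _ => ⟨fun _ => True, fun a => a.elim, fun i => i.elim0, fun i => i.elim0⟩
  | @node n p r h q c ih =>
    rintro x y ⟨z, ⟨rfl, rfl⟩ | ⟨x', z', rfl, rfl, h'⟩, rfl⟩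
    · exact ⟨fun _ => False, fun _ _ _ => rfl, fun i => by simp, fun i => by simp⟩
    · obtain ⟨z, rfl, rfl, hz⟩ := Row.cut_ofFn h'
      choose χ h1 h2 h3 using fun j => ih j (hz j)
      -- The colour says whether a point lies below the cut: the root does, on each vertical line
      -- the height `z` decides, and the children are coloured recursively.
      refine ⟨Sum.elim (fun _ => True) (Sum.elim (fun l => l.2.1 < z l.1) fun x => χ x.1 x.2),
        (edge_iff _).mpr ⟨h1, ?_, ?_⟩, ?_, ?_⟩
      · exact fun j i => (h2 j i).symm
      · exact fun j i => (h3 j i).symm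
      · intro i
        by_cases hi : i.1 < p
        · rw [left_lt i hi]
          simp only [Sum.elim_inl, eq_iff_iff, true_iff]
          omega
        · rw [left_ge i hi]
          simp only [Sum.elim_inl, Sum.elim_inr, eq_iff_iff]
          omega
      · intro i
        by_cases hi : i.1 < r
        · rw [right_lt i hi]
          simp only [Sum.elim_inl, eq_iff_iff, true_iff]
          omega
        · rw [right_ge i hi]
          simp only [Sum.elim_inl, Sum.elim_inr, eq_iff_iff]
          omega

theorem strict_ofFn {L : Type} {n : ℕ} {g : Fin n → Row L} :
    (ofFn g).Strict ↔ ∀ j, (g j).Strict := by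
  induction n with
  | zero => exact ⟨fun _ j => j.elim0, fun _ => trivial⟩
  | succ n ih => rw [ofFn, Row.strict_append, ih, Fin.forall_fin_succ]

theorem nonSemi_ofFn {L : Type} {n : ℕ} {g : Fin n → Row L} :
    (ofFn g).NonSemi ↔ ∀ j, (g j).NonSemi := by
  induction n with
  | zero => exact ⟨fun _ j => j.elim0, fun _ => trivial⟩
  | succ n ih => rw [ofFn, Row.nonSemi_append, ih, Fin.forall_fin_succ]

section Line
variable {n p r : ℕ} {h : Fin (n + 1) → ℕ} {q : Fin n → ℕ}
  {c : ∀ j : Fin n, Stacking (h j.castSucc) (q j) (h j.succ)}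

/-- Segments are followed leftwards: each is attached to the right boundary of a child, whose points
are all connected to its left boundary. -/
theorem line_eq_left {β : Type*} {χ : (node p r h q c).Point → β}
    (hχ : ∀ x y, (node p r h q c).Edge x y → χ x = χ y)
    (ih : ∀ j (χ : (c j).Point → β), (∀ x y, (c j).Edge x y → χ x = χ y) →
      ∀ x, ∃ i, χ x = χ ((c j).left i)) (j : Fin (n + 1)) :
    ∀ i, ∃ i', χ (line p r c j i) = χ (line p r c 0 i') := by
  obtain ⟨h1, h2, h3⟩ := (edge_iff χ).mp hχ
  induction j using Fin.induction with
  | zero => exact fun i => ⟨i, rfl⟩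
  | succ j ihj =>
    intro i
    obtain ⟨i', e⟩ := ih j (fun x => χ (child p r c j x)) (h1 j) ((c j).right i)
    obtain ⟨i'', e'⟩ := ihj i'
    exact ⟨i'', by rw [h3, ← e', h2]; exact e⟩

/-- In a stacking without thin boxes every point is connected to the left boundary. -/
theorem eq_left {β : Type*} {p q r : ℕ} (S : Stacking p q r) (hS : S.shape.Strict) :
    ∀ χ : S.Point → β, (∀ x y, S.Edge x y → χ x = χ y) → ∀ x, ∃ i, χ x = χ (S.left i) := by
  induction S with
  | unit => exact fun _ _ x => x.elim
  | @node n p r h q c ih =>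
    intro χ hχ
    obtain ⟨⟨hp, hr⟩, hc, -⟩ := hS
    rw [strict_ofFn] at hc
    have key := line_eq_left hχ fun j => ih j (hc j)
    have key' : ∀ i : Fin (h 0), χ (line p r c 0 i) = χ ((node p r h q c).left ⟨i + p, by omega⟩) := by
      intro i
      rw [left_ge _ (by simp)]
      simp
    rintro (⟨⟩ | ⟨j, i⟩ | ⟨j, x⟩)
    · exact ⟨⟨0, by omega⟩, by rw [left_lt _ hp]⟩
    · obtain ⟨i', e⟩ := key j i
      exact ⟨_, e.trans (key' i')⟩
    · obtain ⟨i', e⟩ := ih j (hc j) (fun x => χ (child p r c j x)) (((edge_iff χ).mp hχ).1 j) x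
      obtain ⟨i'', e'⟩ := key _ i'
      exact ⟨_, e.trans ((((edge_iff χ).mp hχ).2.1 j i').symm.trans (e'.trans (key' i'')))⟩

/-- If neighbouring segments of the left boundary are not connected, then the stacking can be cut
between them. -/
def Separates {p q r : ℕ} (S : Stacking p q r) {β : Type*} (χ : S.Point → β) : Prop :=
  ∀ (b₁ b₂ : β) (x : ℕ), b₁ ≠ b₂ → (∃ (h0 : 0 < x) (hx : x < p), χ (S.left ⟨x - 1, by omega⟩) = b₁ ∧
    χ (S.left ⟨x, hx⟩) = b₂) → ∃ y, (∃ (h0 : 0 < y) (hy : y < r),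
      χ (S.right ⟨y - 1, by omega⟩) = b₁ ∧ χ (S.right ⟨y, hy⟩) = b₂) ∧ S.shape.Cut x y

/-- The change of colour from `b₁` to `b₂` is carried across each child to the next vertical line;
the heights at which it occurs form the cut. -/
theorem exists_line_cut {β : Type*} {χ : (node p r h q c).Point → β}
    (hχ : ∀ x y, (node p r h q c).Edge x y → χ x = χ y)
    (ih : ∀ j, Separates (c j) fun x => χ (child p r c j x)) {b₁ b₂ : β} (hb : b₁ ≠ b₂) {x : ℕ}
    (hx : ∃ (h0 : 0 < x) (hx : x < h 0), χ (line p r c 0 ⟨x - 1, by omega⟩) = b₁ ∧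
      χ (line p r c 0 ⟨x, hx⟩) = b₂) :
    ∃ y, (∃ (h0 : 0 < y) (hy : y < h (Fin.last n)), χ (line p r c (Fin.last n) ⟨y - 1, by omega⟩) = b₁ ∧
      χ (line p r c (Fin.last n) ⟨y, hy⟩) = b₂) ∧ (ofFn fun j => (c j).shape).Cut x y := by
  obtain ⟨-, h2, h3⟩ := (edge_iff χ).mp hχ
  refine Row.exists_cut_ofFn (fun j z => ∃ (h0 : 0 < z) (hz : z < h j),
    χ (line p r c j ⟨z - 1, by omega⟩) = b₁ ∧ χ (line p r c j ⟨z, hz⟩) = b₂) ?_ hx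
  rintro j z ⟨h0, hz, e1, e2⟩
  rw [h2] at e1 e2
  obtain ⟨y, ⟨h0', hy, e1, e2⟩, hcut⟩ := ih j b₁ b₂ z hb ⟨h0, hz, e1, e2⟩
  exact ⟨y, ⟨h0', hy, (h3 j _).trans e1, (h3 j _).trans e2⟩, hcut⟩

/-- The lowest segments on both sides are attached to the bottom box, which is full. -/
theorem left_zero_eq {β : Type*} {p q r : ℕ} (S : Stacking p q r) (hS : S.shape.Strict)
    (χ : S.Point → β) (hp : 0 < p) : ∃ hr : 0 < r, χ (S.left ⟨0, hp⟩) = χ (S.right ⟨0, hr⟩) := by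
  cases S with
  | unit => exact absurd hp (lt_irrefl _)
  | node p r h q c =>
    have h1 := hS.1.1
    have h2 := hS.1.2
    exact ⟨by omega, by rw [left_lt _ h1, right_lt _ h2]⟩

/-- Induction on the stacking, comparing the height of the change of colour with the number of
inputs of the root. -/
theorem separates {β : Type*} {p q r : ℕ} (S : Stacking p q r) (hS : S.shape.Strict) :
    ∀ χ : S.Point → β, (∀ x y, S.Edge x y → χ x = χ y) → S.Separates χ := by
  induction S with
  | unit => rintro _ _ _ _ x _ ⟨_, hx, _⟩; omega
  | @node n p r h q c ih =>
    rintro χ hχ b₁ b₂ x hb ⟨h0, hx, e1, e2⟩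
    obtain ⟨⟨hp, hr⟩, hc, -⟩ := hS
    rw [strict_ofFn] at hc
    obtain ⟨h1, h2, h3⟩ := (edge_iff χ).mp hχ
    rcases lt_trichotomy x p with hxp | rfl | hxp
    -- Both segments are attached to the root, so no change is possible here.
    · rw [left_lt _ (by simp; omega)] at e1 e2
      exact absurd (e1.symm.trans e2) hb
    -- The change occurs directly above the root. The lowest segments of all inner lines then carry
    -- the colour `b₂`, and the cut runs along the top of the root.
    · rw [left_lt _ (by simp; omega)] at e1
      rw [left_ge _ (by simp)] at e2
      simp only [Nat.sub_self] at e2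
      obtain ⟨y, ⟨rfl, hy, e⟩, hcut⟩ := Row.exists_cut_ofFn (g := fun j => (c j).shape)
        (fun j z => z = 0 ∧ ∃ hz : 0 < h j, χ (line x r c j ⟨0, hz⟩) = b₂) (by
          rintro j z ⟨rfl, hz, e⟩
          obtain ⟨hz', e'⟩ := left_zero_eq (c j) (hc j) (fun y => χ (child x r c j y)) hz
          refine ⟨0, ⟨rfl, hz', ?_⟩, Row.cut_zero _⟩
          rw [h3, ← e', ← h2, e]) ⟨rfl, _, e2⟩
      refine ⟨r, ⟨hr, by omega, ?_, ?_⟩, ⟨r, .inr ⟨0, 0, rfl, rfl, hcut⟩, rfl⟩⟩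
      · rw [right_lt _ (by simp; omega), e1]
      · rw [right_ge _ (by simp)]
        simpa using e
    -- The change lies above the root and is passed on to the row of children.
    · obtain ⟨x, rfl⟩ := Nat.exists_eq_add_of_lt hxp
      rw [left_ge _ (by dsimp only; omega)] at e1 e2
      have e3 : p + x + 1 - 1 - p = x + 1 - 1 := by omega
      have e4 : p + x + 1 - p = x + 1 := by omega
      simp only [e3, e4] at e1 e2
      obtain ⟨y, ⟨h0', hy, e1, e2⟩, hcut⟩ := exists_line_cut hχ
        (fun j => ih j (hc j) _ (h1 j)) hb ⟨Nat.succ_pos x, by omega, e1, e2⟩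
      refine ⟨r + y, ⟨by omega, by omega, ?_, ?_⟩, ⟨r + y, .inr ⟨x + 1, y, rfl, rfl, hcut⟩, rfl⟩⟩
      · rw [right_ge _ (by simp; omega)]
        have e5 : r + y - 1 - r = y - 1 := by omega
        simpa only [e5] using e1
      · rw [right_ge _ (by simp)]
        have e5 : r + y - r = y := by omega
        simpa only [e5] using e2

end Line
end Stacking

/-! ### Classification of the thin-quadratic stackings. -/

namespace Stacking
open Row (ofFn)

theorem exists_thins_ofFn {L : Type} {n : ℕ} {g : Fin n → Row L} (h : 0 < (ofFn g).thins) :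
    ∃ j, 0 < (g j).thins := by
  induction n with
  | zero => exact absurd h (lt_irrefl _)
  | succ n ih =>
    rw [ofFn, Row.thins_append] at h
    rcases Nat.eq_zero_or_pos (g 0).thins with h0 | h0
    · obtain ⟨j, hj⟩ := ih (g := fun j => g j.succ) (by omega)
      exact ⟨_, hj⟩
    · exact ⟨0, h0⟩

/-- A stacking with a thin box has an isolated point, not attached to the boundary. -/
theorem exists_isolated {p q r : ℕ} (S : Stacking p q r) (hS : 0 < S.shape.thins) :
    ∃ x, (∀ y, ¬ S.Edge x y ∧ ¬ S.Edge y x) ∧ (∀ i, S.left i ≠ x) ∧ ∀ i, S.right i ≠ x := by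
  induction S with
  | unit => exact absurd hS (lt_irrefl _)
  | @node n p r h q c ih =>
    by_cases hpr : p = 0 ∧ r = 0
    · obtain ⟨rfl, rfl⟩ := hpr
      refine ⟨root 0 0 c, fun y => ⟨?_, ?_⟩, fun i => ?_, fun i => ?_⟩
      · rintro (⟨_, _, _, _, e, _⟩ | ⟨_, _, e, _⟩ | ⟨_, _, e, _⟩) <;> cases e
      · rintro (⟨_, _, _, _, _, e⟩ | ⟨_, _, _, e⟩ | ⟨_, _, _, e⟩) <;> cases e
      · rw [left_ge i (Nat.not_lt_zero _)]
        exact fun e => by cases e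
      · rw [right_ge i (Nat.not_lt_zero _)]
        exact fun e => by cases e
    · rw [shape, Row.thins, if_neg hpr, Row.thins, Nat.zero_add, Nat.add_zero] at hS
      obtain ⟨j, hj⟩ := exists_thins_ofFn hS
      obtain ⟨x, h1, h2, h3⟩ := ih j hj
      refine ⟨child p r c j x, fun y => ⟨?_, ?_⟩, fun i => ?_, fun i => ?_⟩
      · rintro (⟨_, _, _, e', e, _⟩ | ⟨_, _, e, _⟩ | ⟨_, _, e, _⟩) <;> cases e
        exact (h1 _).1 e'
      · rintro (⟨_, _, _, e', _, e⟩ | ⟨_, i, _, e⟩ | ⟨_, i, _, e⟩) <;> cases e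
        · exact (h1 _).2 e'
        · exact h2 i rfl
        · exact h3 i rfl
      · by_cases hi : i.1 < p
        · rw [left_lt i hi]
          exact fun e => by cases e
        · rw [left_ge i hi]
          exact fun e => by cases e
      · by_cases hi : i.1 < r
        · rw [right_lt i hi]
          exact fun e => by cases e
        · rw [right_ge i hi]
          exact fun e => by cases e

instance finite_point {p q r : ℕ} (S : Stacking p q r) : Finite S.Point := by
  induction S with
  | unit => exact inferInstanceAs (Finite Empty)
  | @node n p r h q c ih =>
    exact inferInstanceAs (Finite (Unit ⊕ (Σ j : Fin (n + 1), Fin (h j)) ⊕ (Σ j, (c j).Point)))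

section Line
variable {n p r : ℕ} {h : Fin (n + 1) → ℕ} {q : Fin n → ℕ}
  {c : ∀ j : Fin n, Stacking (h j.castSucc) (q j) (h j.succ)}

theorem card_point_node : Nat.card (node p r h q c).Point =
    1 + (∑ j, h j + ∑ j, Nat.card (c j).Point) := by
  change Nat.card (Unit ⊕ (Σ j : Fin (n + 1), Fin (h j)) ⊕ (Σ j, (c j).Point)) = _
  rw [Nat.card_sum, Nat.card_sum, Nat.card_sigma, Nat.card_sigma]
  simp

theorem length_boxes_node : (node p r h q c).boxes.length = 1 + ∑ j, (c j).boxes.length := by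
  rw [boxes, List.length_cons, List.length_flatten, List.map_ofFn, List.sum_ofFn, Nat.add_comm]
  rfl

theorem line_eq_zero (h0 : h 0 = 0) (hc : ∀ j, (c j).shape.NonSemi) (j : Fin (n + 1)) :
    h j = 0 := by
  induction j using Fin.induction with
  | zero => exact h0
  | succ j ih =>
    have hf := fit_shape (c j)
    have hr := rt_shape (c j)
    have hc' := hc j
    generalize (c j).shape = f at hf hr hc'
    rw [ih] at hf hr
    exact hr ▸ (hc'.fit_zero hf).1

theorem card_point_of_children (h0 : h 0 = 0) (hc : ∀ j, (c j).shape.NonSemi)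
    (ih : ∀ j, (∀ x y, ¬ (c j).Edge x y) ∧ Nat.card (c j).Point = (c j).boxes.length) :
    (∀ x y, ¬ (node p r h q c).Edge x y) ∧
      Nat.card (node p r h q c).Point = (node p r h q c).boxes.length := by
  have hl := line_eq_zero h0 hc
  constructor
  · rintro x y (⟨j, x, y, e, rfl, rfl⟩ | ⟨j, i, rfl, rfl⟩ | ⟨j, i, rfl, rfl⟩)
    · exact (ih j).1 x y e
    · have := i.2
      have := hl j.castSucc
      omega
    · have := i.2
      have := hl j.succ
      omega
  · rw [card_point_node, length_boxes_node]
    simp only [hl, fun j => (ih j).2, Finset.sum_const_zero, Nat.zero_add]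

end Line

theorem card_point_of_eq_zero {p q r : ℕ} (S : Stacking p q r) (hp : p = 0)
    (hS : S.shape.NonSemi) : (∀ x y, ¬ S.Edge x y) ∧ Nat.card S.Point = S.boxes.length := by
  induction S with
  | unit => exact ⟨fun x => x.elim, Nat.card_of_isEmpty (α := Empty)⟩
  | @node n p r h q c ih =>
    have hc := nonSemi_ofFn.mp hS.2.1
    have h0 : h 0 = 0 := by omega
    exact card_point_of_children h0 hc fun j => ih j (line_eq_zero h0 hc _) (hc j)

/-- At height zero all points are isolated. -/
theorem card_point_of_zero {n p r : ℕ} {h : Fin (n + 1) → ℕ} {q : Fin n → ℕ}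
    {c : ∀ j : Fin n, Stacking (h j.castSucc) (q j) (h j.succ)} (h0 : h 0 = 0)
    (hc : ∀ j, (c j).shape.NonSemi) : (∀ x y, ¬ (node p r h q c).Edge x y) ∧
      Nat.card (node p r h q c).Point = (node p r h q c).boxes.length :=
  card_point_of_children h0 hc fun j => card_point_of_eq_zero _ (line_eq_zero h0 hc _) (hc j)

theorem length_boxes_le {p q r : ℕ} (S : Stacking p q r) : S.boxes.length ≤ Nat.card S.Point := by
  induction S with
  | unit => exact Nat.zero_le _
  | @node n p r h q c ih =>
    rw [card_point_node, length_boxes_node]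
    have := Finset.sum_le_sum fun j (_ : j ∈ Finset.univ) => ih j
    omega

/-- The degree `thinDeg` exceeds the additive quantity `p - r + q - 1` by one exactly at the boxes
which are not thin. -/
theorem sum_thinDeg (l : List (ℕ × ℕ × ℕ)) : (l.map thinDeg).sum =
    (l.map fun b => (b.1 - b.2.2 + b.2.1 - 1 : ℤ)).sum +
      (l.length - l.countP fun b => b.1 = 0 ∧ b.2.2 = 0) := by
  induction l with
  | nil => rfl
  | cons b l ih =>
    rw [List.map_cons, List.sum_cons, ih, List.map_cons, List.sum_cons, List.length_cons,
      List.countP_cons, thinDeg]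
    by_cases hb : b.1 = 0 ∧ b.2.2 = 0
    · simp only [hb, and_self, if_true, decide_true]
      push_cast
      ring
    · simp only [hb, if_false, decide_false, Bool.false_eq_true]
      push_cast
      ring

/-- The additive quantity `p - r + q - 1` of the result is the sum of those of the boxes
(`Row.sum_degree`); what is left are the corrections at the boxes, and at the result, that are not
thin. -/
theorem degree_eq {p q r : ℕ} (S : Stacking p q r) : S.degree =
    (if p = 0 ∧ r = 0 then 0 else 1) - (S.boxes.length - S.shape.thins : ℤ) := by
  have h1 := Row.sum_degree _ (fit_shape S)
  have h2 := sum_thinDeg S.boxes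
  rw [← boxes_shape, List.map_map, List.map_map, List.countP_map, List.length_map] at h2
  rw [rt_shape, wd_shape, len_shape] at h1
  rw [degree, ← boxes_shape, List.map_map, h2, List.length_map, Row.thins_eq]
  simp only [Function.comp_def, h1, thinDeg]
  split_ifs with h
  · have h3 : (p : ℤ) = 0 := by exact_mod_cast h.1
    have h4 : (r : ℤ) = 0 := by exact_mod_cast h.2
    push_cast
    linarith
  · push_cast
    ring

theorem numComponents_of_no_edge {p q r : ℕ} {S : Stacking p q r} (h : ∀ x y, ¬ S.Edge x y) :
    S.numComponents = Nat.card S.Point := by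
  refine (Nat.card_congr (Equiv.ofBijective (Quot.mk S.Edge) ⟨fun x y e => ?_, Quot.mk_surjective⟩)).symm
  exact congrArg (Quot.lift id fun a b hab => absurd hab (h a b)) e

/-- Being equal to `x` is constant along edges, hence descends to the quotient. -/
theorem eq_of_isolated {p q r : ℕ} {S : Stacking p q r} {x : S.Point}
    (h : ∀ y, ¬ S.Edge x y ∧ ¬ S.Edge y x) {y : S.Point} (e : Quot.mk S.Edge y = Quot.mk S.Edge x) :
    y = x := by
  have := congrArg (Quot.lift (fun z => z = x) fun a b hab => by
    have h1 : a ≠ x := by rintro rfl; exact (h b).1 hab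
    have h2 : b ≠ x := by rintro rfl; exact (h a).2 hab
    simp [h1, h2]) e
  exact this.mpr rfl

theorem nonSemi_shape_iff {p q r : ℕ} (S : Stacking p q r) :
    S.shape.NonSemi ↔ ∀ c ∈ S.boxes, ¬ IsSemiThin c := by
  rw [Row.nonSemi_iff, ← boxes_shape, List.forall_mem_map]
  refine forall₂_congr fun b _ => ?_
  rw [IsSemiThin]
  omega

section Line
variable {n : ℕ} {h : Fin (n + 1) → ℕ} {q : Fin n → ℕ}
  {c : ∀ j : Fin n, Stacking (h j.castSucc) (q j) (h j.succ)}

theorem root_isolated {p r : ℕ} :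
    ∀ y, ¬ (node p r h q c).Edge (root p r c) y ∧ ¬ (node p r h q c).Edge y (root p r c) := by
  refine fun y => ⟨?_, ?_⟩
  · rintro (⟨_, _, _, _, e, _⟩ | ⟨_, _, e, _⟩ | ⟨_, _, e, _⟩) <;> cases e
  · rintro (⟨_, _, _, _, _, e⟩ | ⟨_, _, _, e⟩ | ⟨_, _, _, e⟩) <;> cases e

/-- The thin root is a component by itself, so the rest must form exactly one. A proper cut would
split the rest by `exists_separating`; conversely everything is joined to the leftmost line, and by
`separates` two of its neighbouring segments in different components would yield a proper cut. -/
theorem numComponents_conn (hc : (ofFn fun j => (c j).shape).Strict) (h0 : 0 < h 0) :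
    (node 0 0 h q c).numComponents = 2 ↔
      ∀ x y, (ofFn fun j => (c j).shape).Cut x y → x = 0 ∨ h 0 ≤ x := by
  rw [numComponents, Nat.card_eq_two_iff]
  have hne : ∀ i, Quot.mk (node 0 0 h q c).Edge (line 0 0 c 0 i) ≠
      Quot.mk (node 0 0 h q c).Edge (root 0 0 c) := fun i e => by
    cases eq_of_isolated root_isolated e
  constructor
  · rintro ⟨a, b, -, hab⟩ x y hcut
    by_contra! hx
    obtain ⟨χ, h1, h2, -⟩ := exists_separating (node 0 0 h q c) (x := x) (y := y)
      ((Row.cut_thin _ _ _ _).mpr hcut)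
    -- The segments below and above the cut and the root represent three different components.
    have hne' : Quot.mk (node 0 0 h q c).Edge (line 0 0 c 0 ⟨0, h0⟩) ≠
        Quot.mk (node 0 0 h q c).Edge (line 0 0 c 0 ⟨x, hx.2⟩) := fun e => by
      have e' := congrArg (Quot.lift χ h1) e
      change χ _ = χ _ at e'
      have e1 := h2 ⟨0, h0⟩
      have e2 := h2 ⟨x, hx.2⟩
      rw [left_ge _ (Nat.not_lt_zero _)] at e1 e2
      have e3 : (0 < x) = (x < x) := e1.symm.trans (e'.trans e2)
      simp only [lt_irrefl, eq_iff_iff, iff_false] at e3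
      omega
    have hall : ∀ z, z = a ∨ z = b := fun z => by
      have : z ∈ ({a, b} : Set _) := hab ▸ Set.mem_univ z
      exact this
    have n1 := hne ⟨0, h0⟩
    have n2 := hne ⟨x, hx.2⟩
    rcases hall (Quot.mk _ (line 0 0 c 0 ⟨0, h0⟩)) with e1 | e1 <;>
    rcases hall (Quot.mk _ (line 0 0 c 0 ⟨x, hx.2⟩)) with e2 | e2 <;>
    rcases hall (Quot.mk _ (root 0 0 c)) with e3 | e3 <;>
    rw [e1, e2] at hne' <;> rw [e1, e3] at n1 <;> rw [e2, e3] at n2 <;> contradiction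
  · intro hcut
    have hχ : ∀ x y, (node 0 0 h q c).Edge x y →
      Quot.mk (node 0 0 h q c).Edge x = Quot.mk (node 0 0 h q c).Edge y := fun _ _ => Quot.sound
    rw [strict_ofFn] at hc
    have h1 := ((edge_iff _).mp hχ).1
    have key : ∀ i (hi : i < h 0), Quot.mk (node 0 0 h q c).Edge (line 0 0 c 0 ⟨i, hi⟩) =
        Quot.mk _ (line 0 0 c 0 ⟨0, h0⟩) := by
      intro i
      induction i with
      | zero => exact fun _ => rfl
      | succ i ih =>
        intro hi
        rw [← ih (by omega)]
        by_contra hn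
        obtain ⟨y, -, hy⟩ := exists_line_cut hχ (fun j => separates (c j) (hc j) _ (h1 j))
          (Ne.symm hn) (x := i + 1) ⟨by omega, hi, rfl, rfl⟩
        have := hcut _ _ hy
        omega
    refine ⟨Quot.mk _ (line 0 0 c 0 ⟨0, h0⟩), Quot.mk _ (root 0 0 c), hne _, ?_⟩
    refine Set.eq_univ_of_forall (Quot.ind ?_)
    have key' := line_eq_left hχ fun j => eq_left (c j) (hc j)
    rintro (⟨⟩ | ⟨j, i⟩ | ⟨j, x⟩)
    · exact .inr rfl
    · obtain ⟨i', e⟩ := key' j i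
      exact .inl (e.trans (key _ i'.2))
    · obtain ⟨i, e⟩ := eq_left (c j) (hc j) (fun x => Quot.mk _ (child 0 0 c j x)) (h1 j) x
      obtain ⟨i', e'⟩ := key' _ i
      exact .inl (e.trans ((((edge_iff _).mp hχ).2.1 j i).symm.trans (e'.trans (key _ i'.2))))

end Line

/-- By `degree_eq`, having degree `2 - n` means that there are two thin boxes if the result is thin
and exactly one otherwise. The cases are distinguished by the root and by the height above it. -/
theorem isThinQuadratic_iff {P Q R : ℕ} (S : Stacking P Q R) {n : ℕ} (hn : 2 ≤ n) :
    S.IsThinQuadratic n ↔ S.boxes.length = n ∧ (S.shape.IsPair P ∨ S.shape.IsConn P) := by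
  have hdeg := degree_eq S
  cases S with
  | unit =>
    constructor
    · intro h
      have := h.length_boxes
      simp [boxes] at this
      omega
    · rintro ⟨h, -⟩
      simp [boxes] at h
      omega
  | @node m p r h q c =>
    have hrt := rt_shape (node p r h q c)
    have hfit := fit_shape (node p r h q c)
    have hlen : (node p r h q c).boxes.length = 1 + (ofFn fun j => (c j).shape).boxes.length := by
      rw [← length_boxes_shape, shape, Row.boxes, List.length_cons, Row.boxes, List.append_nil,
        Nat.add_comm]
    have hthin : (node p r h q c).shape.thins =
      (if p = 0 ∧ r = 0 then 1 else 0) + (ofFn fun j => (c j).shape).thins := rfl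
    have hfit' : (ofFn fun j => (c j).shape).Fit (h 0) := by
      have := hfit.2.1
      rwa [Nat.add_sub_cancel] at this
    have hrt' : (ofFn fun j => (c j).shape).rt (h 0) = h (Fin.last m) := Row.rt_ofFn fun j => rt_shape _
    have hpair : h 0 = 0 → (ofFn fun j => (c j).shape).boxes.length = 1 →
        (ofFn fun j => (c j).shape).thins = 1 → (p = 0 ↔ r = 0) →
          (node p r h q c).shape.IsPair (h 0 + p) := by
      intro h0 hl ht hpr
      obtain ⟨i, v, p', r', k, l, e⟩ := Row.eq_node_of_length_boxes hl
      rw [e, Row.thins_append, Row.thins, Row.thins_eq, Row.thins_eq, Row.thins_eq] at ht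
      simp only [Row.boxes_units, List.countP_nil] at ht
      have ht' : p' = 0 ∧ r' = 0 := by
        by_contra hne
        simp [hne] at ht
      obtain ⟨rfl, rfl⟩ := ht'
      refine ⟨(), r, i, v, k, l, ?_, by simp [h0, hpr]⟩
      rw [← e]
      change Row.node () p r _ _ = Row.node () (h 0 + p) r _ _
      rw [h0, Nat.zero_add]
    constructor
    · rintro ⟨h1, h2, h3, h4⟩
      refine ⟨h1, ?_⟩
      obtain ⟨hpr, hcs, -⟩ := (nonSemi_shape_iff _).mpr h4
      rw [h2, h1, hthin] at hdeg
      by_cases hp : p = 0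
      · obtain rfl := hp
        obtain rfl : r = 0 := hpr.mp rfl
        rcases Nat.eq_zero_or_pos (h 0) with h0 | h0
        -- A thin root with no height above it: the result and all boxes are thin, so there are just
        -- two boxes.
        · have := hcs.fit_zero (by rwa [h0] at hfit')
          rw [h0, this.1] at hrt'
          rw [h0, ← hrt'] at hdeg
          simp at hdeg
          exact .inl (hpair h0 (by omega) (by omega) Iff.rfl)
        -- A thin root with positive height above it: the result is not thin, and the root already
        -- is the only thin box.
        · have hs : (ofFn fun j => (c j).shape).Strict := by
            refine (Row.strict_iff _).mpr ⟨hcs, ?_⟩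
            rw [if_neg (by omega)] at hdeg
            simp at hdeg
            omega
          exact .inr ⟨(), _, rfl, hs, h0, (numComponents_conn hs h0).mp h3⟩
      -- For a full root, the unique thin box lies above it and is an isolated point. The root
      -- itself has no edges in this graph, so two components leave room for these two points only:
      -- no wire and no further box.
      · have hr : r ≠ 0 := fun hr => hp (hpr.mpr hr)
        rw [if_neg (by omega), if_neg (by omega)] at hdeg
        push_cast at hdeg
        have ht : (ofFn fun j => (c j).shape).thins = 1 := by omega
        obtain ⟨j, hj⟩ := exists_thins_ofFn (ht ▸ Nat.one_pos)
        obtain ⟨x, hx, hxl, hxr⟩ := exists_isolated (c j) hj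
        have hx' : ∀ y, ¬ (node p r h q c).Edge (child p r c j x) y ∧
            ¬ (node p r h q c).Edge y (child p r c j x) := by
          refine fun y => ⟨?_, ?_⟩
          · rintro (⟨_, _, _, e', e, _⟩ | ⟨_, _, e, _⟩ | ⟨_, _, e, _⟩) <;> cases e
            exact (hx _).1 e'
          · rintro (⟨_, _, _, e', _, e⟩ | ⟨_, i, _, e⟩ | ⟨_, i, _, e⟩) <;> cases e
            · exact (hx _).2 e'
            · exact hxl i rfl
            · exact hxr i rfl
        obtain ⟨a, b, -, hab⟩ := Nat.card_eq_two_iff.mp h3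
        have hall : ∀ z, z = a ∨ z = b := fun z => by
          have : z ∈ ({a, b} : Set _) := hab ▸ Set.mem_univ z
          exact this
        have hne : Quot.mk (node p r h q c).Edge (root p r c) ≠
            Quot.mk (node p r h q c).Edge (child p r c j x) := fun e => by
          cases eq_of_isolated hx' e
        have hpt : ∀ z, z = root p r c ∨ z = child p r c j x := by
          intro z
          have : Quot.mk (node p r h q c).Edge z = Quot.mk _ (root p r c) ∨
              Quot.mk (node p r h q c).Edge z = Quot.mk _ (child p r c j x) := by
            rcases hall (Quot.mk _ z) with e1 | e1 <;>
            rcases hall (Quot.mk _ (root p r c)) with e2 | e2 <;>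
            rcases hall (Quot.mk _ (child p r c j x)) with e3 | e3 <;>
            rw [e2, e3] at hne <;> simp_all
          exact this.imp (eq_of_isolated root_isolated) (eq_of_isolated hx')
        have hcard : Nat.card (node p r h q c).Point = 2 :=
          Nat.card_eq_two_iff.mpr ⟨root p r c, child p r c j x, (fun e => by cases e),
            Set.eq_univ_of_forall hpt⟩
        have hle := length_boxes_le (node p r h q c)
        have h0 : h 0 = 0 := by
          by_contra h0
          rcases hpt (line p r c 0 ⟨0, by omega⟩) with e | e <;> cases e
        exact .inl (hpair h0 (by omega) ht hpr)
    · rintro ⟨h1, ⟨l, r', i, v, k, k', e, hpr⟩ | ⟨a, f, e, hs, h0, hcut⟩⟩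
      · change Row.node () p r _ _ = _ at e
        simp only [Row.node.injEq] at e
        obtain ⟨-, e1, rfl, e, -⟩ := e
        have h0 : h 0 = 0 := by omega
        have hcs : (ofFn fun j => (c j).shape).NonSemi := by
          rw [e, Row.nonSemi_append]
          exact ⟨Row.nonSemi_units _, Iff.rfl, Row.nonSemi_units _, Row.nonSemi_units _⟩
        have ht : (ofFn fun j => (c j).shape).thins = 1 := by
          rw [e, Row.thins_append, Row.thins, Row.thins_eq, Row.thins_eq, Row.thins_eq]
          simp
        have hl : (ofFn fun j => (c j).shape).boxes.length = 1 := by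
          rw [e, Row.boxes_append, Row.boxes]
          simp
        obtain ⟨h2, h3⟩ := card_point_of_zero (p := p) (r := r) h0 (nonSemi_ofFn.mp hcs)
        rw [hlen, hl] at h1
        rw [h0] at hfit'
        have hz := (hcs.fit_zero hfit').1
        rw [h0, hz] at hrt'
        refine ⟨by omega, ?_, ?_, ?_⟩
        · rw [hdeg, hthin, ht, hlen, hl, ← h1, ← hrt', h0]
          rw [h0, Nat.zero_add] at hpr
          by_cases hp : p = 0
          · simp [hp, hpr.mp hp]
          · simp [hp]
        · rw [numComponents_of_no_edge h2, h3, hlen, hl]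
        · refine (nonSemi_shape_iff _).mp ⟨?_, hcs, trivial⟩
          rw [h0, Nat.zero_add] at hpr
          exact hpr
      · change Row.node () p r _ _ = _ at e
        simp only [Row.node.injEq] at e
        obtain ⟨-, rfl, rfl, rfl, -⟩ := e
        refine ⟨h1, ?_, (numComponents_conn hs h0).mpr hcut, ?_⟩
        · rw [hdeg, hthin, ((Row.strict_iff _).mp hs).2, if_neg (by omega), h1]
          simp
          ring
        · exact (nonSemi_shape_iff _).mp ⟨Iff.rfl, hs.nonSemi, trivial⟩

end Stacking

/-! ### Sign exponents modulo two. -/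

/-- The sign with a given exponent. -/
def parity (e : ZMod 2) : ℤˣ := if e = 0 then 1 else -1

theorem parity_add (a b : ZMod 2) : parity (a + b) = parity a * parity b := by
  revert a b
  decide

theorem parity_add_one (a : ZMod 2) : parity (a + 1) = -parity a := by
  revert a
  decide

theorem negOnePow_eq_parity (m : ℤ) : m.negOnePow = parity (m : ZMod 2) := by
  unfold parity
  split_ifs with h
  · rw [ZMod.intCast_zmod_eq_zero_iff_dvd] at h
    exact Int.negOnePow_even m (even_iff_two_dvd.mpr (by exact_mod_cast h))
  · rw [ZMod.intCast_zmod_eq_zero_iff_dvd] at h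
    exact Int.negOnePow_odd m (Int.not_even_iff_odd.mp fun h' => h (by exact_mod_cast even_iff_two_dvd.mp h'))

theorem ZMod.two_mul_self (a : ZMod 2) : a * a = a := by
  revert a
  decide

namespace Row
variable {L M : Type}

/-- The exponent of the desuspended sign of a row. -/
def sgn : Row L → ℕ → ZMod 2
  | nil, _ => 0
  | unit f, h => sgn f h
  | node _ p r c f, h =>
    (wd c + 1) * (len f + h) + ((h - p : ℕ) + rt c (h - p)) * r + (h + r) * (wd c + len c) +
      sgn c (h - p) + sgn f (rt c (h - p) + r)

/-- The cross term comes from the summands `(q_i - 1)(n - i)`: every tree of `f` gets `g.len` more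
trees to its right, and the `q_i - 1` of `f` add up to `f.wd + f.len` modulo two. -/
theorem sgn_append (f g : Row L) : ∀ h,
    (f ++ g).sgn h = f.sgn h + g.sgn (f.rt h) + (f.wd + f.len) * g.len := by
  induction f with
  | nil => intro h; simp [sgn, rt, wd, len]
  | unit f ih =>
    intro h
    simp only [unit_append, sgn, ih, rt, wd, len, Nat.cast_add, Nat.cast_one]
    linear_combination (-(g.len : ZMod 2)) * CharTwo.two_eq_zero (R := ZMod 2)
  | node l p r c f _ ih =>
    intro h
    simp only [node_append, sgn, ih, rt, wd, len, len_append, Nat.cast_add, Nat.cast_one]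
    ring

theorem sgn_shape (f : Row L) : ∀ h, f.shape.sgn h = f.sgn h := by
  induction f with
  | nil => exact fun _ => rfl
  | unit f ih => exact ih
  | node l p r c f ihc ih =>
    intro h
    simp only [shape, sgn, ihc, ih, wd_shape, len_shape, rt_shape]

theorem sgn_ofFn {n : ℕ} {g : Fin n → Row L} (hg : ∀ j, (g j).len = 1) {h : Fin (n + 1) → ℕ}
    (hr : ∀ j, (g j).rt (h j.castSucc) = h j.succ) : (ofFn g).sgn (h 0) =
      ∑ j : Fin n, (((g j).wd + 1) * (n + (j + 1)) + (g j).sgn (h j.castSucc) : ZMod 2) := by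
  induction n with
  | zero => rfl
  | succ n ih =>
    rw [ofFn, sgn_append, show (g 0).rt (h 0) = h (Fin.succ 0) from hr 0,
      ih (g := fun j => g j.succ) (fun j => hg j.succ) (h := fun j => h j.succ) (fun j => hr j.succ),
      Fin.sum_univ_succ, len_ofFn fun j => hg j.succ, hg]
    have : ∀ j : Fin n, (((g j.succ).wd + 1) * ((n + 1 : ℕ) + ((j.succ : ℕ) + 1)) +
        (g j.succ).sgn (h j.succ.castSucc) : ZMod 2) = (((g j.succ).wd + 1) * (n + (j + 1)) +
        (g j.succ).sgn (h j.castSucc.succ) : ZMod 2) := by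
      intro j
      rw [Fin.succ_castSucc, Fin.val_succ]
      push_cast
      linear_combination ((g j.succ).wd + 1 : ZMod 2) * CharTwo.two_eq_zero (R := ZMod 2)
    rw [Finset.sum_congr rfl fun j _ => this j]
    simp only [Fin.val_zero, Fin.castSucc_zero]
    push_cast
    linear_combination (-((g 0).wd + 1 : ZMod 2)) * CharTwo.two_eq_zero (R := ZMod 2)

end Row

theorem LinQuiver.partialSum_eq_sum {n : ℕ} (q : Fin n → ℕ) : ∀ (j : ℕ) (hj : j ≤ n),
    partialSum q j hj = ∑ i : Fin j, q (i.castLE hj)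
  | 0, _ => rfl
  | j + 1, hj => by
      rw [partialSum, partialSum_eq_sum q j, Fin.sum_univ_castSucc]
      rfl

namespace Stacking
open Row (ofFn)

/-- The row exponent uses absolute heights of left boundaries where the desuspended sign has
differences of heights. The normalisation by `(q + 1) * p` makes up for this, and the induction
becomes an identity in `ZMod 2`. -/
theorem desuspExp_eq {p q r : ℕ} (S : Stacking p q r) :
    (S.desuspExp : ZMod 2) = S.shape.sgn p + (q + 1) * p := by
  have h2 := CharTwo.two_eq_zero (R := ZMod 2)
  induction S with
  | unit => simp [desuspExp, shape, Row.sgn]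
  | @node n p r h q c ih =>
    have hw := wd_shape (node p r h q c)
    rw [shape, Row.wd, Row.wd, Nat.add_zero] at hw
    have hs : (∑ j, ((q j : ZMod 2) + 1)) = LinQuiver.partialSum q n le_rfl + n := by
      rw [Finset.sum_add_distrib]
      simp only [Finset.sum_const, Finset.card_univ, Fintype.card_fin, nsmul_eq_mul, mul_one]
      rw [LinQuiver.partialSum_eq_sum]
      simp
    rw [shape, Row.sgn, Row.sgn, Row.len, Nat.add_sub_cancel, Row.rt_ofFn fun j => rt_shape _, hw,
      Row.sgn_ofFn (fun j => len_shape _) fun j => rt_shape _, Row.len_ofFn fun j => len_shape _,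
      desuspExp]
    push_cast
    simp only [ih, wd_shape]
    have e1 : (∑ j : Fin n, (((q j : ZMod 2) + 1) * (p + r + h 0 + h j.castSucc))) =
        (∑ j, ((q j : ZMod 2) + 1)) * (p + r + h 0) + ∑ j, ((q j : ZMod 2) + 1) * h j.castSucc := by
      rw [Finset.sum_mul, ← Finset.sum_add_distrib]
      exact Finset.sum_congr rfl fun j _ => by ring
    simp only [CharTwo.sub_eq_add, Finset.sum_add_distrib, e1, hs]
    linear_combination (∑ j, ((q j : ZMod 2) + 1) * h j.castSucc -
      (LinQuiver.partialSum q n le_rfl + 1 : ZMod 2) * (h 0 + p)) * h2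

end Stacking

namespace Row
variable {L M : Type}

/-- The parity of the degree `p - r + q - 1` of a box. -/
def deg (b : L × ℕ × ℕ × ℕ) : ZMod 2 := b.2.1 + b.2.2.2 + b.2.2.1 + 1

/-- The sum of `β a b` over the pairs of a member `a` and a later member `b` of a list. -/
def pairs {X : Type*} (β : X → X → ZMod 2) : List X → ZMod 2
  | [] => 0
  | a :: l => (l.map (β a)).sum + pairs β l

/-- The exponent of the sign of a tree in a brace. -/
def braceSgn (t : Row L) (P : ℕ) : ZMod 2 :=
  t.sgn P + (t.wd + 1) * P + pairs (fun a b => (thinDeg a.2 : ZMod 2) * deg b) t.boxes +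
    t.boxes.length * (t.boxes.map fun b => (thinDeg b.2 : ZMod 2)).sum +
    ((2 - t.boxes.length) * (3 - t.boxes.length) / 2 : ℤ)

theorem pairs_map {X Y : Type*} (β : Y → Y → ZMod 2) (f : X → Y) (l : List X) :
    pairs β (l.map f) = pairs (fun a b => β (f a) (f b)) l := by
  induction l with
  | nil => rfl
  | cons a l ih => rw [List.map_cons, pairs, ih, pairs, List.map_map]; rfl

end Row

namespace Stacking

/-- Modulo two, the degree `thinDeg` of a later box plus one if it is not thin is `p + r + q + 1`.
So the shuffle exponent and the exponent of pairs of degrees combine into a single pairing. -/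
theorem pairs_thinDeg (l : List (ℕ × ℕ × ℕ)) : (thinShuffleExp l + pairExp l : ZMod 2) =
    Row.pairs (fun a b => (thinDeg a : ZMod 2) * (b.1 + b.2.2 + b.2.1 + 1)) l := by
  induction l with
  | nil => simp [thinShuffleExp, pairExp, Row.pairs]
  | cons c l ih =>
    rw [Row.pairs, ← ih, thinShuffleExp, pairExp]
    have : ∀ l : List (ℕ × ℕ × ℕ), ((l.map fun b => (thinDeg c : ZMod 2) *
        (b.1 + b.2.2 + b.2.1 + 1)).sum : ZMod 2) = thinDeg c *
          ((l.countP fun c' => ¬ (c'.1 = 0 ∧ c'.2.2 = 0) : ℕ) + ((l.map thinDeg).sum : ℤ)) := by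
      intro l
      induction l with
      | nil => simp
      | cons b l ih =>
        rw [List.map_cons, List.sum_cons, ih, List.map_cons, List.sum_cons, List.countP_cons]
        generalize thinDeg c = d
        generalize (l.map thinDeg).sum = s
        by_cases hb : b.1 = 0 ∧ b.2.2 = 0
        · rw [thinDeg, if_pos hb]
          simp only [hb, and_self, not_true, decide_false, Bool.false_eq_true,
            if_false]
          push_cast
          simp only [CharTwo.sub_eq_add]
          ring
        · rw [thinDeg, if_neg hb]
          simp only [hb, not_false_eq_true, decide_true, if_true]
          push_cast
          simp only [CharTwo.sub_eq_add]
          ring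
    rw [this]
    push_cast
    ring

/-- The size of the result enters only through its degree, which is `|S|` plus the sum of the
degrees of the boxes, and `|S| = 2 - n` for a thin-quadratic stacking. So the exponent becomes a
function of the tree. -/
theorem exponent_eq {p q r n : ℕ} {S : Stacking p q r} (hS : S.IsThinQuadratic n) :
    ((S.thinDesuspExp + S.actionExp : ℤ) : ZMod 2) = S.shape.braceSgn p := by
  have h1 : thinDeg (p, q, r) = S.degree + (S.boxes.map thinDeg).sum := by
    rw [degree]
    ring
  have h2 := CharTwo.two_eq_zero (R := ZMod 2)
  have h3 := pairs_thinDeg S.boxes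
  have h4 := hS.degree_eq
  have h5 : ((S.shape.boxes.map fun b => (thinDeg b.2 : ZMod 2)).sum) =
      ((S.boxes.map thinDeg).sum : ℤ) := by
    rw [← boxes_shape, List.map_map]
    push_cast
    rw [List.map_map]
    rfl
  have h6 : Row.pairs (fun a b => (thinDeg a.2 : ZMod 2) * Row.deg b) S.shape.boxes =
      (thinShuffleExp S.boxes + pairExp S.boxes : ZMod 2) := by
    rw [h3, ← boxes_shape, Row.pairs_map]
    rfl
  have h7 : (2 - n + 1 : ℤ) = 3 - n := by ring
  rw [Row.braceSgn, h5, h6, length_boxes_shape, wd_shape, ← desuspExp_eq, thinDesuspExp, actionExp,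
    h1, h4, hS.length_boxes, h7]
  generalize (S.boxes.map thinDeg).sum = s
  push_cast
  have h8 := ZMod.two_mul_self (n : ZMod 2)
  linear_combination h8 + (2 - (n : ZMod 2) + s - n * s) * h2

end Stacking

/-! ### Passage to shapes, and finiteness of the relevant trees. -/

namespace Row
variable {L M : Type}

theorem strict_shape (f : Row L) : f.shape.Strict ↔ f.Strict := by
  rw [strict_iff_boxes, strict_iff_boxes, boxes_shape, List.forall_mem_map]

theorem cut_shape (f : Row L) : ∀ x y, f.shape.Cut x y ↔ f.Cut x y := by
  induction f with
  | nil => exact fun _ _ => Iff.rfl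
  | unit f ih => exact fun x y => and_congr_right fun _ => ih 0 y
  | node l p r c f ihc ih =>
    intro x y
    simp only [shape, Cut, ihc, ih]

theorem shape_eq_append {f : Row L} {g₁ g₂ : Row Unit} (h : f.shape = g₁ ++ g₂) :
    ∃ f₁ f₂, f = f₁ ++ f₂ ∧ f₁.shape = g₁ ∧ f₂.shape = g₂ := by
  obtain ⟨f₁, f₂, rfl, h1, h2⟩ := exists_append g₁.len f g₂.len (by
    rw [← len_shape, h, len_append])
  rw [shape_append] at h
  obtain ⟨e1, e2⟩ := append_inj h ((len_shape _).trans h1)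
  exact ⟨f₁, f₂, rfl, e1, e2⟩

theorem shape_units (m : ℕ) : (units m : Row L).shape = units m := by
  induction m with
  | zero => rfl
  | succ m ih => exact congrArg unit ih

theorem shape_eq_units {f : Row L} {m : ℕ} (h : f.shape = units m) : f = units m := by
  have h1 : f.boxes = [] := by
    apply List.eq_nil_of_length_eq_zero
    rw [← length_boxes_shape, h, boxes_units, List.length_nil]
  rw [eq_units h1, ← len_shape, h, len_units]

theorem shape_eq_node {f : Row L} {u : Unit} {p r : ℕ} {c g : Row Unit} (h : f.shape = node u p r c g) :
    ∃ l c' g', f = node l p r c' g' ∧ c'.shape = c ∧ g'.shape = g := by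
  cases f with
  | nil => simp [shape] at h
  | unit f => simp [shape] at h
  | node l p' r' c' g' =>
    simp only [shape, node.injEq] at h
    obtain ⟨-, rfl, rfl, h1, h2⟩ := h
    exact ⟨l, c', g', rfl, h1, h2⟩

theorem isPair_shape (f : Row L) (P : ℕ) : f.shape.IsPair P ↔ f.IsPair P := by
  constructor
  · rintro ⟨_, r, i, _, m, k, e, h⟩
    obtain ⟨l, c, g, rfl, e1, e2⟩ := shape_eq_node e
    obtain ⟨f₁, f₂, rfl, e3, e4⟩ := shape_eq_append e1
    obtain ⟨v, c', g', rfl, e5, e6⟩ := shape_eq_node e4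
    refine ⟨l, r, i, v, m, k, ?_, h⟩
    rw [shape_eq_units e3, shape_eq_units e5, shape_eq_units e6, shape_eq_units (m := 0) e2]
    rfl
  · rintro ⟨l, r, i, v, m, k, rfl, h⟩
    refine ⟨(), r, i, (), m, k, ?_, h⟩
    simp only [shape, shape_append, shape_units]

theorem isConn_shape (f : Row L) (P : ℕ) : f.shape.IsConn P ↔ f.IsConn P := by
  constructor
  · rintro ⟨_, c, e, h, hP, hcut⟩
    obtain ⟨a, c', g, rfl, rfl, e2⟩ := shape_eq_node e
    refine ⟨a, c', ?_, (strict_shape _).mp h, hP, fun x y hx => hcut x y ((cut_shape _ _ _).mpr hx)⟩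
    rw [shape_eq_units (m := 0) e2]
    rfl
  · rintro ⟨a, c, rfl, h, hP, hcut⟩
    exact ⟨(), c.shape, rfl, (strict_shape _).mpr h, hP,
      fun x y hx => hcut x y ((cut_shape _ _ _).mp hx)⟩

/-- No box has more outputs than inputs. -/
def Good (f : Row L) : Prop := ∀ b ∈ f.boxes, b.2.2.2 ≤ b.2.1

theorem good_shape (f : Row L) : f.shape.Good ↔ f.Good := by
  rw [Good, Good, boxes_shape, List.forall_mem_map]

theorem good_node {l : L} {p r : ℕ} {c f : Row L} :
    (node l p r c f).Good ↔ r ≤ p ∧ c.Good ∧ f.Good := by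
  simp only [Good, boxes, List.mem_cons, List.mem_append, forall_eq_or_imp]
  refine and_congr_right fun _ => ⟨fun h => ⟨fun b hb => h b (.inl hb), fun b hb => h b (.inr hb)⟩, ?_⟩
  rintro ⟨h1, h2⟩ b (hb | hb)
  · exact h1 b hb
  · exact h2 b hb

/-- Heights never increase from left to right, so the left height bounds the inputs of every box. -/
theorem Good.height {f : Row L} (hf : f.Good) : ∀ {h : ℕ}, f.Fit h →
    f.rt h ≤ h ∧ ∀ b ∈ f.boxes, b.2.1 ≤ h := by
  induction f with
  | nil => exact fun _ => ⟨le_rfl, fun b hb => absurd hb List.not_mem_nil⟩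
  | unit f ih => exact fun h => ih hf h.2
  | node l p r c f ihc ih =>
    rintro h ⟨hp, h1, h2⟩
    obtain ⟨h3, h4, h5⟩ := good_node.mp hf
    obtain ⟨e1, e2⟩ := ihc h4 h1
    obtain ⟨e3, e4⟩ := ih h5 h2
    refine ⟨by rw [rt]; omega, ?_⟩
    simp only [boxes, List.mem_cons, List.mem_append]
    rintro b (rfl | hb | hb)
    · exact hp
    · have := e2 b hb
      omega
    · have := e4 b hb
      omega

/-- Induction on the number of boxes plus the number of inputs, which every unit and every box uses
up by at least one. -/
theorem finite_rows (P N : ℕ) : {f : Row Unit | f.boxes.length + f.wd ≤ N ∧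
    ∀ b ∈ f.boxes, b.2.1 ≤ P ∧ b.2.2.2 ≤ P}.Finite := by
  induction N with
  | zero =>
    refine (Set.finite_singleton nil).subset ?_
    rintro f ⟨h, -⟩
    cases f with
    | nil => rfl
    | unit f => simp [wd] at h
    | node l p r c f => simp [boxes] at h
  | succ N ih =>
    refine ((Set.finite_singleton nil).union ((ih.image unit).union
      (((Set.finite_Iic P).prod ((Set.finite_Iic P).prod (ih.prod ih))).image
        fun z => node () z.1 z.2.1 z.2.2.1 z.2.2.2))).subset ?_
    rintro f ⟨h, h'⟩
    cases f with
    | nil => exact .inl rfl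
    | unit f =>
      refine .inr (.inl ⟨f, ⟨?_, h'⟩, rfl⟩)
      simp only [boxes, wd] at h
      omega
    | node l p r c f =>
      simp only [boxes, List.mem_cons, List.mem_append, List.length_cons, List.length_append,
        wd] at h h'
      refine .inr (.inr ⟨(p, r, c, f), ⟨(h' _ (.inl rfl)).1, (h' _ (.inl rfl)).2, ⟨?_, ?_⟩, ⟨?_, ?_⟩⟩,
        rfl⟩)
      · show c.boxes.length + c.wd ≤ N
        omega
      · exact fun b hb => h' b (.inr (.inl hb))
      · show f.boxes.length + f.wd ≤ N
        omega
      · exact fun b hb => h' b (.inr (.inr hb))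

theorem finite_trees (P Q N : ℕ) : {f : Row Unit | f.boxes.length = N ∧ f.wd = Q ∧ f.Fit P ∧
    f.Good}.Finite := by
  refine (finite_rows P (N + Q)).subset ?_
  rintro f ⟨h1, h2, h3, h4⟩
  refine ⟨by omega, fun b hb => ?_⟩
  have := (h4.height h3).2 b hb
  exact ⟨this, (h4 b hb).trans this⟩

/-- The trees of a brace. -/
def Tree (P Q R : ℕ) (t : Row L) : Prop :=
  t.len = 1 ∧ t.Fit P ∧ t.wd = Q ∧ t.rt P = R ∧ (t.IsPair P ∨ t.IsConn P)

theorem tree_shape {P Q R : ℕ} (t : Row L) : t.shape.Tree P Q R ↔ t.Tree P Q R := by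
  rw [Tree, Tree, len_shape, fit_shape, wd_shape, rt_shape, isPair_shape, isConn_shape]

theorem finite_tree (ls : List L) (P Q R : ℕ) :
    {t : Row L | t.labels = ls ∧ t.Tree P Q R ∧ t.Good}.Finite := by
  refine Set.Finite.of_finite_image (f := shape) ((finite_trees P Q ls.length).subset ?_) ?_
  · rintro _ ⟨t, ⟨rfl, h, h'⟩, rfl⟩
    refine ⟨?_, ?_, ?_, (good_shape _).mpr h'⟩
    · rw [length_boxes_shape, length_labels]
    · rw [wd_shape, h.2.2.1]
    · exact (fit_shape _ _).mpr h.2.1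
  · rintro t ⟨h, -⟩ t' ⟨h', -⟩ e
    exact ext_shape e (h.trans h'.symm)

/-- The finite set of the trees of a brace with prescribed labels. -/
noncomputable def trees (ls : List L) (P Q R : ℕ) : Finset (Row L) := (finite_tree ls P Q R).toFinset

theorem mem_trees {ls : List L} {P Q R : ℕ} {t : Row L} :
    t ∈ trees ls P Q R ↔ t.labels = ls ∧ t.Tree P Q R ∧ t.Good := by
  rw [trees, Set.Finite.mem_toFinset, Set.mem_ofPred_eq]

theorem braceSgn_shape (t : Row L) (P : ℕ) : t.shape.braceSgn P = t.braceSgn P := by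
  rw [braceSgn, braceSgn, sgn_shape, wd_shape, length_boxes_shape, boxes_shape, pairs_map,
    List.map_map]
  rfl

end Row

/-! ### Braces as finite sums over labelled trees. -/

namespace LinQuiver
open Row
variable {k : Type w₁} [CommRing k] {U : Type u} [Category.{v} U] (A : LinQuiver.{u, v, w₁, w₂, w₃} k U)
variable {L : Type}

theorem good_of_ev_ne_zero {x : L → A.Total} {t : Row L} (ht : t.len = 1) (h : A.ev x t 0 ≠ 0) :
    t.Good := by
  intro b hb
  by_contra! hlt
  exact h (A.ev_eq_zero ht hb (A.box_eq_zero hlt _))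

/-- An extension of a finite sequence of labels. -/
def extend {n : ℕ} (hn : 2 ≤ n) (g : Fin n → L) (i : ℕ) : L :=
  -- The default label is never read; the bound on `n` serves to supply it.
  if hi : i < n then g ⟨i, hi⟩ else g ⟨0, by omega⟩

section
variable {n : ℕ} (hn : 2 ≤ n) (g : Fin n → L)

theorem map_extend : (List.range' 0 n).map (extend hn g) = List.ofFn g := by
  apply List.ext_getElem
  · simp
  · intro i h1 h2
    have : i < n := by simpa using h1
    simp [extend, this]

theorem eval_eq_ev (x : L → A.Total) {p q r : ℕ} (S : Stacking p q r) (hS : S.boxes.length = n) :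
    A.eval S (pad fun i => x (g i)) 0 = A.ev x (relabel (extend hn g) S.shape 0) 0 p q r := by
  refine (A.ev_relabel_shape x _ S _ _ fun j _ hj => ?_).symm
  have : j < n := by omega
  simp [pad, extend, this]

theorem tree_relabel {p q r : ℕ} (S : Stacking p q r) (lab : ℕ → L) :
    (relabel lab S.shape 0).Tree p q r ↔ S.shape.IsPair p ∨ S.shape.IsConn p := by
  rw [← tree_shape, shape_relabel, shape_unit, Row.Tree]
  simp [Stacking.len_shape, Stacking.fit_shape, Stacking.wd_shape, Stacking.rt_shape]

theorem braceTerm_eq (x : L → A.Total) {p q r : ℕ} (S : Stacking p q r) (hS : S.IsThinQuadratic n) :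
    A.braceTerm (fun i => x (g i)) S = parity ((relabel (extend hn g) S.shape 0).braceSgn p) •
      A.ev x (relabel (extend hn g) S.shape 0) 0 p q r := by
  rw [braceTerm, A.eval_eq_ev hn g x S hS.length_boxes, negOnePow_eq_parity, Stacking.exponent_eq hS,
    ← braceSgn_shape (relabel _ _ _), shape_relabel, shape_unit]

/-- A nonzero term has no box with more outputs than inputs, and its stacking is recovered from the
shape; so the support injects into a finite set of trees. -/
theorem braceTerm_support_finite (hn : 2 ≤ n) (x : Fin n → A.Total) (p q r : ℕ) :
    (Function.support fun S : {S : Stacking p q r // S.IsThinQuadratic n} =>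
      A.braceTerm x S.1).Finite := by
  refine Set.Finite.of_finite_image (f := fun S => S.1.shape) ((finite_trees p q n).subset ?_)
    (fun S _ S' _ h => Subtype.ext (Stacking.shape_injective h))
  rintro _ ⟨S, hS, rfl⟩
  refine ⟨?_, S.1.wd_shape, S.1.fit_shape, ?_⟩
  · rw [Stacking.length_boxes_shape, S.2.length_boxes]
  · rw [Function.mem_support, show A.braceTerm x S.1 = _ from A.braceTerm_eq hn id x S.1 S.2] at hS
    have := A.good_of_ev_ne_zero (x := x) (t := relabel (extend hn id) S.1.shape 0)
      (by rw [← len_shape, shape_relabel, shape_unit, Stacking.len_shape])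
      (fun h => hS (by rw [h]; exact smul_zero _))
    rwa [← good_shape, shape_relabel, shape_unit] at this

/-- Stackings are replaced by trees through the classification, and trees with a vanishing box are
dropped, which leaves a genuine finite sum. Arguments are indexed by labels, so that permuted
arguments, or a brace as an argument under the label `none`, are covered. -/
theorem brace_eq (hn : 2 ≤ n) (g : Fin n → L) (x : L → A.Total) (P Q R : ℕ) : A.brace n (fun i => x (g i)) P Q R =
    ∑ t ∈ trees (List.ofFn g) P Q R, parity (t.braceSgn P) • A.ev x t 0 P Q R := by
  let e : {S : Stacking P Q R // S.IsThinQuadratic n} → Row L :=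
    fun S => relabel (extend hn g) S.1.shape 0
  have he : Function.Injective e := fun S S' h => by
    have := congrArg shape h
    simp only [e, shape_relabel, shape_unit] at this
    exact Subtype.ext (Stacking.shape_injective this)
  have hlab : ∀ S, (e S).labels = List.ofFn g := fun S => by
    rw [labels_relabel, Stacking.length_boxes_shape, S.2.length_boxes, map_extend]
  calc A.brace n (fun i => x (g i)) P Q R
      = ∑ᶠ S, (fun t => parity (t.braceSgn P) • A.ev x t 0 P Q R) (e S) :=
        finsum_congr fun S => A.braceTerm_eq hn g x S.1 S.2
    _ = ∑ᶠ t ∈ Set.range e, parity (t.braceSgn P) • A.ev x t 0 P Q R := (finsum_mem_range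
        (f := fun t => parity (t.braceSgn P) • A.ev x t 0 P Q R) he).symm
    _ = _ := by
      refine finsum_mem_eq_sum_of_inter_support_eq _ ?_
      ext t
      simp only [Set.mem_inter_iff, Set.mem_range, Finset.mem_coe, mem_trees, Function.mem_support]
      refine and_congr_left fun h0 => ⟨?_, ?_⟩
      · rintro ⟨S, rfl⟩
        have ht : (e S).Tree P Q R := (tree_relabel S.1 _).mpr
          ((Stacking.isThinQuadratic_iff S.1 hn).mp S.2).2
        exact ⟨hlab S, ht, A.good_of_ev_ne_zero ht.1 fun h => h0 (by rw [h]; exact smul_zero _)⟩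
      · rintro ⟨h1, h2, h3⟩
        obtain ⟨h4, h5, h6, h7, h8⟩ := (tree_shape t).mpr h2
        have hS := Stacking.exists_shape_eq h4 h5
        rw [h6, h7] at hS
        obtain ⟨S, hS⟩ := hS
        have hq : S.IsThinQuadratic n := by
          refine (Stacking.isThinQuadratic_iff S hn).mpr ⟨?_, by rwa [hS]⟩
          rw [← Stacking.length_boxes_shape, hS, length_boxes_shape, ← length_labels, h1,
            List.length_ofFn]
        refine ⟨⟨S, hq⟩, ext_shape ?_ ((hlab _).trans h1.symm)⟩
        simp only [e, shape_relabel, shape_unit, hS]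

end

end LinQuiver

/-! ### Size of the result of a brace. -/

namespace Row
variable {L M : Type}

theorem Tree.exists_stacking {P Q R n : ℕ} {t : Row L} (h : t.Tree P Q R) (hn : 2 ≤ n)
    (ht : t.boxes.length = n) : ∃ S : Stacking P Q R, S.IsThinQuadratic n ∧ S.shape = t.shape := by
  obtain ⟨h4, h5, h6, h7, h8⟩ := (tree_shape t).mpr h
  have hS := Stacking.exists_shape_eq h4 h5
  rw [h6, h7] at hS
  obtain ⟨S, hS⟩ := hS
  refine ⟨S, (Stacking.isThinQuadratic_iff S hn).mpr ⟨?_, by rwa [hS]⟩, hS⟩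
  rw [← Stacking.length_boxes_shape, hS, length_boxes_shape, ht]

theorem Tree.thinDeg_eq {P Q R n : ℕ} {t : Row L} (h : t.Tree P Q R) (hn : 2 ≤ n)
    (ht : t.boxes.length = n) :
    thinDeg (P, Q, R) = (t.boxes.map fun b => thinDeg b.2).sum + 2 - n := by
  obtain ⟨S, hS, e⟩ := h.exists_stacking hn ht
  have h1 := hS.degree_eq
  rw [Stacking.degree, ← Stacking.boxes_shape, e, boxes_shape, List.map_map, List.map_map] at h1
  simp only [Function.comp_def] at h1
  linarith

/-- Whether a cut passes below or above a full box is decided by its height on the left: zero, or at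
least `p > 0`. -/
theorem Strict.cut_unique {f : Row L} (hf : f.Strict) : ∀ {x y y'}, f.Cut x y → f.Cut x y' → y = y' := by
  induction f with
  | nil => exact fun h h' => h.symm.trans h'
  | unit f ih => exact fun h h' => ih hf h.2 h'.2
  | node l p r c f ihc ih =>
    rintro x y y' ⟨z, h1, h2⟩ ⟨z', h1', h2'⟩
    have : z = z' := by
      obtain ⟨⟨hp, -⟩, hc, -⟩ := hf
      rcases h1 with ⟨rfl, rfl⟩ | ⟨x1, z1, rfl, rfl, h1⟩ <;>
        rcases h1' with ⟨e, rfl⟩ | ⟨x1', z1', e, rfl, h1'⟩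
      · rfl
      · omega
      · omega
      · obtain rfl : x1 = x1' := by omega
        rw [ihc hc h1 h1']
    subst this
    exact ih hf.2.2 h2 h2'

/-- The cut is traced from right to left. A box with a single output is never hit in its interior:
the cut passes below it at height zero and above it otherwise. -/
theorem exists_cut {f : Row L} (hf : ∀ b ∈ f.boxes, b.2.2.2 = 1) : ∀ {h y}, f.Fit h → y ≤ f.rt h →
    ∃ x ≤ h, f.Cut x y := by
  induction f with
  | nil => exact fun _ h => ⟨_, h, rfl⟩
  | unit f ih =>
    rintro h y ⟨rfl, h1⟩ h2
    obtain ⟨x, hx, hcut⟩ := ih hf h1 h2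
    obtain rfl : x = 0 := by omega
    exact ⟨0, le_rfl, rfl, hcut⟩
  | node l p r c f ihc ih =>
    rintro h y ⟨hp, h1, h2⟩ h3
    simp only [boxes, List.mem_cons, List.mem_append] at hf
    obtain rfl : r = 1 := hf _ (.inl rfl)
    obtain ⟨z, hz, hcut⟩ := ih (fun b hb => hf b (.inr (.inr hb))) h2 h3
    rcases Nat.eq_zero_or_pos z with rfl | hz'
    · exact ⟨0, Nat.zero_le _, 0, .inl ⟨rfl, rfl⟩, hcut⟩
    · obtain ⟨x, hx, hcut'⟩ := ihc (fun b hb => hf b (.inr (.inl hb))) (y := z - 1) h1 (by omega)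
      exact ⟨p + x, by omega, z, .inr ⟨x, z - 1, rfl, by omega, hcut'⟩, hcut⟩

/-- In a pair the sizes on both sides are those of the root. In the connected case the cut ending at
height one on the right does not start at zero, hence starts at `P`; but the cut starting at `P` is
the whole boundary and ends at `R`. -/
theorem Tree.right_eq {P Q R : ℕ} {t : Row L} (h : t.Tree P Q R)
    (hb : ∀ b ∈ t.boxes, b.2.2.2 = min 1 b.2.1) : R = min 1 P := by
  obtain ⟨-, h2, -, rfl, ⟨l, r, i, v, m, k, rfl, h3⟩ | ⟨a, c, rfl, h3, h4, h5⟩⟩ := h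
  · have := hb (l, P, _, r) List.mem_cons_self
    simp only at this
    simp [rt, this]
  · have hfit : c.Fit P := h2.2.1
    have hrt : (node a 0 0 c nil).rt P = c.rt P := rfl
    have hc : ∀ b ∈ c.boxes, b.2.2.2 = 1 := fun b hb' => by
      have h6 := hb b (List.mem_cons_of_mem _ (List.mem_append_left _ hb'))
      have h7 := (strict_iff_boxes _).mp h3 b hb'
      omega
    have hpos := h3.rt_pos h4
    obtain ⟨x, hx, hcut⟩ := exists_cut hc hfit (y := 1) hpos
    have hx0 : x ≠ 0 := by
      rintro rfl
      exact absurd (h3.nonSemi.cut_zero_left hcut) one_ne_zero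
    obtain rfl : x = P := by
      have := h5 x 1 hcut
      omega
    rw [hrt, h3.cut_unique (cut_rt c hfit) hcut]
    omega

end Row

/-! ### Multilinearity, degrees and closedness of the braces. -/

namespace LinQuiver
open Row
variable {k : Type w₁} [CommRing k] {U : Type u} [Category.{v} U] (A : LinQuiver.{u, v, w₁, w₂, w₃} k U)
variable {L : Type}

/-- The Gerstenhaber braces are multilinear. -/
noncomputable def braceMultilinear {n : ℕ} (hn : 2 ≤ n) :
    MultilinearMap k (fun _ : Fin n => A.Total) A.Total where
  toFun := A.brace n
  map_update_add' x i y z := by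
    obtain rfl : ‹DecidableEq (Fin n)› = instDecidableEqFin n := Subsingleton.elim _ _
    funext P Q R
    have hb : ∀ y, A.brace n y P Q R = ∑ t ∈ trees (List.ofFn id) P Q R,
        parity (t.braceSgn P) • A.ev y t 0 P Q R := fun y => A.brace_eq hn id y P Q R
    rw [Pi.add_apply, Pi.add_apply, Pi.add_apply, hb, hb, hb, ← Finset.sum_add_distrib]
    refine Finset.sum_congr rfl fun t ht => ?_
    obtain ⟨hl, ht, -⟩ := mem_trees.mp ht
    obtain ⟨Λ, hΛ⟩ := A.exists_ev_linear x i ht.1 (by rw [hl]; exact List.nodup_ofFn.mpr fun _ _ h => h)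
      (by rw [hl]; exact List.mem_ofFn.mpr ⟨i, rfl⟩)
    rw [hΛ, hΛ, hΛ, map_add, Pi.add_apply, Pi.add_apply, Pi.add_apply, smul_add]
  map_update_smul' x i a y := by
    obtain rfl : ‹DecidableEq (Fin n)› = instDecidableEqFin n := Subsingleton.elim _ _
    funext P Q R
    have hb : ∀ y, A.brace n y P Q R = ∑ t ∈ trees (List.ofFn id) P Q R,
        parity (t.braceSgn P) • A.ev y t 0 P Q R := fun y => A.brace_eq hn id y P Q R
    rw [Pi.smul_apply, Pi.smul_apply, Pi.smul_apply, hb, hb, Finset.smul_sum]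
    refine Finset.sum_congr rfl fun t ht => ?_
    obtain ⟨hl, ht, -⟩ := mem_trees.mp ht
    obtain ⟨Λ, hΛ⟩ := A.exists_ev_linear x i ht.1 (by rw [hl]; exact List.nodup_ofFn.mpr fun _ _ h => h)
      (by rw [hl]; exact List.mem_ofFn.mpr ⟨i, rfl⟩)
    rw [hΛ, hΛ, map_smul, Pi.smul_apply, Pi.smul_apply, Pi.smul_apply, smul_comm]

theorem isGradedOperations_of_closed (G : ℤ → Submodule k A.Total)
    (hG : ∀ n : ℕ, 2 ≤ n → ∀ (d : Fin n → ℤ) (x : Fin n → A.Total), (∀ i, x i ∈ G (d i)) →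
      A.brace n x ∈ G (∑ i, d i + 2 - n)) : IsGradedOperations G A.brace := by
  intro n hn d
  exact ⟨((A.braceMultilinear hn).compLinearMap fun i => (G (d i)).subtype).codRestrict _
    fun x => hG n hn d _ fun i => (x i).2, fun x => rfl⟩

/-- A nonzero contribution to a brace comes from a tree whose boxes have nonzero values. -/
theorem exists_tree_of_brace_ne_zero {n : ℕ} (hn : 2 ≤ n) {x : Fin n → A.Total} {P Q R : ℕ}
    (h : A.brace n x P Q R ≠ 0) : ∃ t : Row (Fin n), t.labels = List.ofFn id ∧ t.Tree P Q R ∧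
      ∀ b ∈ t.boxes, x b.1 b.2.1 b.2.2.1 b.2.2.2 ≠ 0 := by
  have e := A.brace_eq hn id x P Q R
  obtain ⟨t, ht, h0⟩ := Finset.exists_ne_zero_of_sum_ne_zero (e ▸ h)
  obtain ⟨h1, h2, -⟩ := mem_trees.mp ht
  refine ⟨t, h1, h2, fun b hb hx => h0 ?_⟩
  rw [A.ev_eq_zero h2.1 hb hx]
  exact smul_zero _

theorem sum_thinDeg_eq {n : ℕ} {t : Row (Fin n)} (ht : t.labels = List.ofFn id) {d : Fin n → ℤ}
    (hd : ∀ b ∈ t.boxes, thinDeg b.2 = d b.1) :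
    (t.boxes.map fun b => thinDeg b.2).sum = ∑ i, d i := by
  rw [List.map_congr_left hd]
  have : (t.boxes.map fun b => d b.1) = t.labels.map d := by rw [labels, List.map_map]; rfl
  rw [this, ht, List.map_ofFn, List.sum_ofFn]
  rfl

theorem length_boxes_eq {n : ℕ} {t : Row (Fin n)} (ht : t.labels = List.ofFn id) :
    t.boxes.length = n := by
  rw [← length_labels, ht, List.length_ofFn]

theorem brace_mem_tot {n : ℕ} (hn : 2 ≤ n) (d : Fin n → ℤ) (x : Fin n → A.Total)
    (hx : ∀ i, x i ∈ A.tot (d i)) : A.brace n x ∈ A.tot (∑ i, d i + 2 - n) := by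
  intro P Q R hne
  by_contra h
  obtain ⟨t, h1, h2, h3⟩ := A.exists_tree_of_brace_ne_zero hn h
  refine hne ?_
  rw [h2.thinDeg_eq hn (length_boxes_eq h1), sum_thinDeg_eq h1 fun b hb => ?_]
  by_contra hb'
  exact h3 b hb (hx b.1 _ _ _ hb')

/-- For `p = 0` both degrees are `q - 1`; for `p > 0` one has `r = 1` and both are `p + q - 1`. -/
theorem gs_le_tot (d : ℤ) : A.gs d ≤ A.tot d := by
  intro x hx p q r hne
  refine hx p q r ?_
  rintro ⟨rfl, h⟩
  refine hne ?_
  rw [thinDeg]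
  split_ifs with h0
  · have : (p : ℤ) = 0 := by exact_mod_cast h0.1
    dsimp only
    linarith
  · have : min 1 p = 1 := by dsimp only at h0; omega
    rw [this]
    push_cast
    linarith

theorem brace_mem_gs {n : ℕ} (hn : 2 ≤ n) (d : Fin n → ℤ) (x : Fin n → A.Total)
    (hx : ∀ i, x i ∈ A.gs (d i)) : A.brace n x ∈ A.gs (∑ i, d i + 2 - n) := by
  intro P Q R hne
  by_contra h
  obtain ⟨t, h1, h2, h3⟩ := A.exists_tree_of_brace_ne_zero hn h
  have hb : ∀ b ∈ t.boxes, b.2.2.2 = min 1 b.2.1 := fun b hb => by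
    by_contra hb'
    exact h3 b hb (hx b.1 _ _ _ fun h => hb' h.1)
  have hR := h2.right_eq hb
  refine hne ⟨hR, ?_⟩
  have hmem := A.brace_mem_tot hn d x (fun i => A.gs_le_tot _ (hx i)) P Q R
  have e : thinDeg (P, Q, R) = ∑ i, d i + 2 - n := by
    by_contra h'
    exact h (hmem h')
  rw [← e, thinDeg, hR]
  split_ifs with h0
  · dsimp only at h0 ⊢
    rw [h0.1]
    push_cast
    ring
  · have : min 1 P = 1 := by dsimp only at h0; omega
    dsimp only
    rw [this]
    push_cast
    ring

/-- At left height zero the connected type is impossible, and a pair without inputs has a thin box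
of size `(0,0,0)` on top. -/
theorem brace_mem_uncurved {n : ℕ} (hn : 2 ≤ n) (x : Fin n → A.Total)
    (hx : ∀ i, x i ∈ A.uncurved) : A.brace n x ∈ A.uncurved := by
  by_contra h
  obtain ⟨t, -, h2, h3⟩ := A.exists_tree_of_brace_ne_zero hn (P := 0) (Q := 0) (R := 0) h
  obtain ⟨-, -, hw, -, ⟨l, r, i, v, m, j, rfl, -⟩ | ⟨a, c, -, -, h4, -⟩⟩ := h2
  · simp only [wd, wd_append, wd_units] at hw
    obtain rfl : m = 0 := by omega
    refine h3 (v, 0, 0, 0) ?_ (hx v)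
    simp [boxes, units, len]
  · exact absurd h4 (lt_irrefl _)

end LinQuiver

/-! ### Relabelling, and rows with a hole. -/

namespace Row
variable {L M : Type}

/-- Change of labels. -/
def map (φ : L → M) : Row L → Row M
  | nil => nil
  | unit f => unit (map φ f)
  | node l p r c f => node (φ l) p r (map φ c) (map φ f)

section map
variable (φ : L → M)

theorem map_id (f : Row L) : f.map id = f := by
  induction f <;> simp_all [map]

@[simp] theorem shape_map (f : Row L) : (f.map φ).shape = f.shape := by
  induction f <;> simp_all [map, shape]

@[simp] theorem len_map (f : Row L) : (f.map φ).len = f.len := by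
  rw [← len_shape, shape_map, len_shape]

@[simp] theorem wd_map (f : Row L) : (f.map φ).wd = f.wd := by
  rw [← wd_shape, shape_map, wd_shape]

@[simp] theorem rt_map (f : Row L) (h : ℕ) : (f.map φ).rt h = f.rt h := by
  rw [← rt_shape, shape_map, rt_shape]

@[simp] theorem fit_map (f : Row L) (h : ℕ) : (f.map φ).Fit h ↔ f.Fit h := by
  rw [← fit_shape, shape_map, fit_shape]

@[simp] theorem cut_map (f : Row L) (x y : ℕ) : (f.map φ).Cut x y ↔ f.Cut x y := by
  rw [← cut_shape, shape_map, cut_shape]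

@[simp] theorem sgn_map (f : Row L) (h : ℕ) : (f.map φ).sgn h = f.sgn h := by
  rw [← sgn_shape, shape_map, sgn_shape]

/-- Relabelling of a box. -/
def mapBox (b : L × ℕ × ℕ × ℕ) : M × ℕ × ℕ × ℕ := (φ b.1, b.2)

theorem boxes_map (f : Row L) : (f.map φ).boxes = f.boxes.map (mapBox φ) := by
  induction f with
  | nil => rfl
  | unit f ih => exact ih
  | node l p r c f ihc ih => simp [map, boxes, ihc, ih, mapBox]

theorem labels_map (f : Row L) : (f.map φ).labels = f.labels.map φ := by
  simp [labels, boxes_map, mapBox, Function.comp_def]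

end map

theorem subst_map (t f : Row L) : subst t (f.map some) = f := by
  induction f <;> simp_all [map, subst]

/-- Rows with a hole for one tree. -/
inductive Ctx (L : Type) : Type
  | hole (f : Row L) : Ctx L
  | unit (C : Ctx L) : Ctx L
  | left (l : L) (p r : ℕ) (C : Ctx L) (f : Row L) : Ctx L
  | right (l : L) (p r : ℕ) (c : Row L) (C : Ctx L) : Ctx L

namespace Ctx

/-- The row obtained by putting a tree into the hole. -/
def fill (φ : L → M) : Ctx L → Row M → Row M
  | hole f, T => T ++ f.map φ
  | unit C, T => .unit (fill φ C T)
  | left l p r C f, T => node (φ l) p r (fill φ C T) (f.map φ)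
  | right l p r c C, T => node (φ l) p r (c.map φ) (fill φ C T)

/-- The number of trees, including the hole. -/
def len : Ctx L → ℕ
  | hole f => f.len + 1
  | unit C => len C + 1
  | left _ _ _ _ f => f.len + 1
  | right _ _ _ _ C => len C + 1

/-- The number of inputs to the left of the hole. -/
def lw : Ctx L → ℕ
  | hole _ => 0
  | unit C => lw C + 1
  | left _ _ _ C _ => lw C
  | right _ _ _ c C => c.wd + lw C

/-- The number of inputs to the right of the hole. -/
def rw : Ctx L → ℕ
  | hole f => f.wd
  | unit C => rw C
  | left _ _ _ C f => rw C + f.wd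
  | right _ _ _ _ C => rw C

/-- The boxes before the hole. -/
def pre : Ctx L → List (L × ℕ × ℕ × ℕ)
  | hole _ => []
  | unit C => pre C
  | left l p r C _ => (l, p, C.len, r) :: pre C
  | right l p r c C => (l, p, c.len, r) :: (c.boxes ++ pre C)

/-- The boxes after the hole. -/
def post : Ctx L → List (L × ℕ × ℕ × ℕ)
  | hole f => f.boxes
  | unit C => post C
  | left _ _ _ C f => post C ++ f.boxes
  | right _ _ _ _ C => post C

/-- The height of the left boundary of the hole. -/
def height : Ctx L → ℕ → ℕ
  | hole _, h => h
  | unit C, h => height C h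
  | left _ p _ C _, h => height C (h - p)
  | right _ p r c C, h => height C (c.rt (h - p) + r)

section
variable (φ : L → M)

theorem len_fill (C : Ctx L) {T : Row M} (hT : T.len = 1) : (C.fill φ T).len = C.len := by
  induction C with
  | hole f => simp [fill, len, hT, Nat.add_comm]
  | unit C ih => simp [fill, len, Row.len, ih]
  | left l p r C f ih => simp [fill, len, Row.len]
  | right l p r c C ih => simp [fill, len, Row.len, ih]

theorem wd_fill (C : Ctx L) (T : Row M) : (C.fill φ T).wd = C.lw + T.wd + C.rw := by
  induction C with
  | hole f => simp [fill, lw, rw]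
  | unit C ih => simp only [fill, lw, rw, Row.wd, ih]; omega
  | left l p r C f ih => simp only [fill, lw, rw, Row.wd, ih, wd_map]; omega
  | right l p r c C ih => simp only [fill, lw, rw, Row.wd, ih, wd_map]; omega

theorem boxes_fill (C : Ctx L) {T : Row M} (hT : T.len = 1) :
    (C.fill φ T).boxes = C.pre.map (mapBox φ) ++ T.boxes ++ C.post.map (mapBox φ) := by
  induction C with
  | hole f => simp [fill, pre, post, boxes_map]
  | unit C ih => exact ih
  | left l p r C f ih =>
    simp [fill, pre, post, boxes, boxes_map, ih, len_fill φ C hT, mapBox]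
  | right l p r c C ih => simp [fill, pre, post, boxes, boxes_map, ih, mapBox]

theorem labels_fill (C : Ctx L) {T : Row M} (hT : T.len = 1) :
    (C.fill φ T).labels =
      (C.pre.map Prod.fst).map φ ++ T.labels ++ (C.post.map Prod.fst).map φ := by
  simp [labels, boxes_fill φ C hT, mapBox, Function.comp_def]

end

section
variable {M' : Type} (φ : L → M) (ψ : L → M') {T : Row M} {T' : Row M'}

theorem rt_fill (C : Ctx L) : ∀ {h : ℕ}, T.rt (C.height h) = T'.rt (C.height h) →
    (C.fill φ T).rt h = (C.fill ψ T').rt h := by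
  induction C with
  | hole f => intro h e; simp_all [fill, height]
  | unit C ih => exact fun e => ih e
  | left l p r C f ih =>
    intro h e
    simp only [fill, rt, rt_map]
    rw [ih e]
  | right l p r c C ih =>
    intro h e
    simp only [fill, rt, rt_map]
    exact ih e

theorem fit_fill (C : Ctx L) : ∀ {h : ℕ}, T.rt (C.height h) = T'.rt (C.height h) →
    (T.Fit (C.height h) ↔ T'.Fit (C.height h)) → ((C.fill φ T).Fit h ↔ (C.fill ψ T').Fit h) := by
  induction C with
  | hole f => intro h e e'; simp_all [fill, height]
  | unit C ih => exact fun e e' => and_congr_right fun _ => ih e e'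
  | left l p r C f ih =>
    intro h e e'
    simp only [fill, Fit, fit_map, C.rt_fill φ ψ e, ih e e']
  | right l p r c C ih =>
    intro h e e'
    simp only [fill, Fit, fit_map, rt_map, ih e e']

theorem fit_of_fill (C : Ctx L) : ∀ {h : ℕ}, (C.fill φ T).Fit h → T.Fit (C.height h) := by
  induction C with
  | hole f => exact fun h => ((fit_append _ _ _).mp h).1
  | unit C ih => exact fun h => ih h.2
  | left l p r C f ih => exact fun h => ih h.2.1
  | right l p r c C ih =>
    intro h hf
    have := hf.2.2
    rw [rt_map] at this
    exact ih this

theorem cut_fill (C : Ctx L) (hT : ∀ x y, T.Cut x y ↔ T'.Cut x y) : ∀ x y,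
    (C.fill φ T).Cut x y ↔ (C.fill ψ T').Cut x y := by
  induction C with
  | hole f => intro x y; simp only [fill, cut_append, cut_map, hT]
  | unit C ih => intro x y; simp only [fill, Cut, ih]
  | left l p r C f ih => intro x y; simp only [fill, Cut, ih, cut_map]
  | right l p r c C ih => intro x y; simp only [fill, Cut, ih, cut_map]

end

theorem subst_fill (C : Ctx L) (t c : Row L) (a r : ℕ) :
    subst t (C.fill some (node none a r (c.map some) nil)) = C.fill id (graft t c) := by
  induction C with
  | hole f => simp [fill, subst, subst_map, map_id]
  | unit C ih => simp [fill, subst, ih]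
  | left l p r C f ih => simp [fill, subst, subst_map, map_id, ih]
  | right l p r c C ih => simp [fill, subst, subst_map, map_id, ih]

/-- Filling the hole by a unit first and then grafting a tree onto this single input gives the same
row; all other inputs receive units. -/
theorem graft_fill (C : Ctx L) {T : Row L} (hT : T.len = 1) :
    graft (C.fill id (.unit nil)) (units C.lw ++ (T ++ units C.rw)) = C.fill id T := by
  have hu : ∀ f : Row L, graft f (units f.wd) = f := by
    intro f
    induction f with
    | nil => rfl
    | unit f ih => exact (graft_unit f (T := .unit nil) (g := units f.wd) rfl).trans (congrArg _ ih)
    | node l p r c f ihc ih =>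
      have e : (units (c.wd + f.wd) : Row L) = units c.wd ++ units f.wd := by
        induction c.wd with
        | zero => simp [units]
        | succ m ih => rw [Nat.succ_add]; exact congrArg Row.unit ih
      rw [Row.wd, e, graft_node _ _ _ (len_units _), ihc, ih]
  have hadd : ∀ m n : ℕ, (units (m + n) : Row L) = units m ++ units n := by
    intro m n
    induction m with
    | zero => simp [units]
    | succ m ih => rw [Nat.succ_add]; exact congrArg Row.unit ih
  induction C with
  | hole f =>
    change graft (.unit (f.map id)) (T ++ units f.wd) = T ++ f.map id
    rw [graft_unit _ hT, map_id, hu]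
  | unit C ih =>
    exact (graft_unit _ (T := .unit nil) rfl).trans (congrArg Row.unit ih)
  | left l p r C f ih =>
    simp only [fill, lw, rw, hadd, map_id]
    rw [← append_assoc, ← append_assoc, append_assoc (units _), graft_node _ _ _ (by
      rw [wd_fill]; simp [hT, Row.wd, Nat.add_assoc]), ih, hu]
  | right l p r c C ih =>
    simp only [fill, lw, rw, hadd, map_id, append_assoc]
    rw [graft_node _ _ _ (len_units _), hu, ih]

end Ctx

/-- A row with exactly one box without label is a filling. -/
theorem exists_fill : ∀ (f : Row (Option L)) (w₁ w₂ : List L),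
    f.labels = w₁.map some ++ none :: w₂.map some →
    ∃ (C : Ctx L) (a r : ℕ) (c : Row L), f = C.fill some (node none a r (c.map some) nil) ∧
      w₁ = C.pre.map Prod.fst ∧ w₂ = c.labels ++ C.post.map Prod.fst := by
  classical
  -- Rows without the label `none` come from honest labels.
  have hsome : ∀ (f : Row (Option L)), none ∉ f.labels → ∃ g : Row L, f = g.map some := by
    intro f
    induction f with
    | nil => exact fun _ => ⟨nil, rfl⟩
    | unit f ih => exact fun h => let ⟨g, e⟩ := ih h; ⟨unit g, congrArg unit e⟩
    | node l p r c f ihc ih =>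
      intro h
      simp only [labels_node, List.mem_cons, List.mem_append, not_or] at h
      obtain ⟨g, rfl⟩ := ihc h.2.1
      obtain ⟨g', rfl⟩ := ih h.2.2
      cases l with
      | none => exact absurd rfl h.1
      | some l => exact ⟨node l p r g g', rfl⟩
  -- The path to the unique unlabelled box is found by counting `none` in the subtrees.
  have key : ∀ (f : Row (Option L)), f.labels.count none = 1 → ∃ (C : Ctx L) (a r : ℕ) (c : Row L),
      f = C.fill some (node none a r (c.map some) nil) := by
    intro f
    induction f with
    | nil => intro h; simp at h
    | unit f ih => exact fun h => let ⟨C, a, r, c, e⟩ := ih h; ⟨C.unit, a, r, c, congrArg unit e⟩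
    | node l p r c f ihc ih =>
      intro h
      rw [labels_node, List.count_cons, List.count_append] at h
      cases l with
      | none =>
        simp only [BEq.rfl, if_true] at h
        obtain ⟨c, rfl⟩ := hsome c (List.count_eq_zero.mp (by omega))
        obtain ⟨f, rfl⟩ := hsome f (List.count_eq_zero.mp (by omega))
        exact ⟨.hole f, p, r, c, rfl⟩
      | some l =>
        simp only [beq_iff_eq, reduceCtorEq, if_false] at h
        rcases Nat.eq_zero_or_pos (c.labels.count none) with h0 | h0
        · obtain ⟨c, rfl⟩ := hsome c (List.count_eq_zero.mp h0)
          obtain ⟨C, a, r', c', rfl⟩ := ih (by omega)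
          exact ⟨.right l p r c C, a, r', c', rfl⟩
        · obtain ⟨f, rfl⟩ := hsome f (List.count_eq_zero.mp (by omega))
          obtain ⟨C, a, r', c', rfl⟩ := ihc (by omega)
          exact ⟨.left l p r C f, a, r', c', rfl⟩
  have hcut : ∀ w₁ w₂ w₁' w₂' : List L, w₁.map some ++ none :: w₂.map some =
      w₁'.map some ++ none :: w₂'.map some → w₁ = w₁' ∧ w₂ = w₂' := by
    intro w₁
    induction w₁ with
    | nil =>
      intro w₂ w₁' w₂' h
      cases w₁' with
      | nil =>
        simp only [List.map_nil, List.nil_append, List.cons.injEq, true_and] at h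
        exact ⟨rfl, List.map_injective_iff.mpr (Option.some_injective L) h⟩
      | cons b w₁' => simp at h
    | cons a w₁ ih =>
      intro w₂ w₁' w₂' h
      cases w₁' with
      | nil => simp at h
      | cons b w₁' =>
        simp only [List.map_cons, List.cons_append, List.cons.injEq, Option.some.injEq] at h
        obtain ⟨rfl, rfl⟩ := ih _ _ _ h.2
        exact ⟨by rw [h.1], rfl⟩
  intro f w₁ w₂ h
  obtain ⟨C, a, r, c, rfl⟩ := key f (by
    rw [h, List.count_append, List.count_cons_self, List.count_eq_zero.mpr (by simp),
      List.count_eq_zero.mpr (by simp)])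
  refine ⟨C, a, r, c, rfl, ?_⟩
  rw [C.labels_fill some (T := node none a r (c.map some) nil) rfl, labels_node, labels_map,
    labels_nil, List.append_nil, List.append_assoc, List.cons_append, ← List.map_append] at h
  exact (hcut _ _ _ _ h).imp Eq.symm Eq.symm

end Row

/-! ### Boxes and cuts of a composite; decomposition along a cut. -/

namespace Row
variable {L M : Type}

/-- Only a permutation: in standard order, boxes of `g` are interleaved with those of `f`. The
resulting reordering is accounted for in `sgn_graft`. -/
theorem boxes_graft {f g : Row L} (h : g.len = f.wd) :
    (graft f g).boxes.Perm (f.boxes ++ g.boxes) := by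
  refine graft_induction (motive := fun f g => (graft f g).boxes.Perm (f.boxes ++ g.boxes))
    (List.Perm.refl _) ?_ ?_ f g h
  · intro f T g hT _ ih
    rw [graft_unit f hT, boxes_append, boxes_append, boxes]
    refine (List.Perm.append_left _ ih).trans ?_
    rw [← List.append_assoc, ← List.append_assoc]
    exact List.Perm.append_right _ List.perm_append_comm
  · intro l p r c f g₁ g₂ h1 _ ihc ih
    rw [graft_node l p r h1, boxes, boxes, boxes_append, len_graft h1, List.cons_append]
    refine List.Perm.cons _ ((ihc.append ih).trans ?_)
    simp only [List.append_assoc]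
    refine List.Perm.append_left _ ?_
    simp only [← List.append_assoc]
    exact List.Perm.append_right _ List.perm_append_comm

theorem labels_graft {f g : Row L} (h : g.len = f.wd) :
    (graft f g).labels.Perm (f.labels ++ g.labels) := by
  have := (boxes_graft h).map Prod.fst
  rwa [List.map_append] at this

theorem nonSemi_graft {f g : Row L} (h : g.len = f.wd) (hf : f.NonSemi) (hg : g.NonSemi) :
    (graft f g).NonSemi := by
  rw [nonSemi_iff] at *
  intro b hb
  rcases List.mem_append.mp ((boxes_graft h).mem_iff.mp hb) with hb | hb
  · exact hf b hb
  · exact hg b hb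

theorem strict_graft {f g : Row L} (h : g.len = f.wd) :
    (graft f g).Strict ↔ f.Strict ∧ g.Strict := by
  simp only [strict_iff_boxes, (boxes_graft h).mem_iff, List.mem_append]
  exact ⟨fun H => ⟨fun b hb => H b (.inl hb), fun b hb => H b (.inr hb)⟩,
    fun H b hb => hb.elim (H.1 b) (H.2 b)⟩

section Cut

theorem cut_graft_left {f g : Row L} (h : g.len = f.wd) : ∀ {x y}, f.Cut x y →
    (graft f g).Cut x y := by
  refine graft_induction (motive := fun f g => ∀ {x y}, f.Cut x y → (graft f g).Cut x y)
    (fun h => h) ?_ ?_ f g h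
  · rintro f T g hT _ ih x y ⟨rfl, h⟩
    rw [graft_unit f hT, cut_append]
    exact ⟨0, cut_zero T, ih h⟩
  · rintro l p r c f g₁ g₂ h1 _ ihc ih x y ⟨z, h, h'⟩
    rw [graft_node l p r h1]
    refine ⟨z, h.imp id ?_, ih h'⟩
    rintro ⟨x', z', e1, e2, h⟩
    exact ⟨x', z', e1, e2, ihc h⟩

theorem cut_graft_right {f g : Row L} (h : g.len = f.wd) : ∀ {a x y}, f.Fit a → g.Cut x y →
    (graft f g).Cut (a + x) (f.rt a + y) := by
  refine graft_induction (motive := fun f g => ∀ {a x y}, f.Fit a → g.Cut x y →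
    (graft f g).Cut (a + x) (f.rt a + y)) ?_ ?_ ?_ f g h
  · rintro a x y _ rfl
    rfl
  · rintro f T g hT _ ih a x y ⟨rfl, hf⟩ h
    obtain ⟨z, h1, h2⟩ := (cut_append _ _ _ _).mp h
    rw [graft_unit f hT, cut_append, Nat.zero_add]
    have := ih hf h2
    rw [Nat.zero_add] at this
    exact ⟨z, h1, this⟩
  · rintro l p r c f g₁ g₂ h1 _ ihc ih a x y ⟨hp, hc, hf⟩ h
    obtain ⟨z, h2, h3⟩ := (cut_append _ _ _ _).mp h
    rw [graft_node l p r h1]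
    exact ⟨_, .inr ⟨a - p + x, c.rt (a - p) + z, by omega, by omega, ihc hc h2⟩, ih hf h3⟩

/-- A cut cannot change from one layer to the other. If it looks as if it did, it follows the
interface between the layers there, and this interface is itself a cut of the lower layer. -/
theorem cut_graft {f g : Row L} (h : g.len = f.wd) : ∀ {a x y}, f.Fit a → f.NonSemi → g.NonSemi →
    (graft f g).Cut x y → (x ≤ a ∧ y ≤ f.rt a ∧ f.Cut x y) ∨
      ∃ x' y', x = a + x' ∧ y = f.rt a + y' ∧ g.Cut x' y' := by
  refine graft_induction (motive := fun f g => ∀ {a x y}, f.Fit a → f.NonSemi → g.NonSemi →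
    (graft f g).Cut x y → (x ≤ a ∧ y ≤ f.rt a ∧ f.Cut x y) ∨
      ∃ x' y', x = a + x' ∧ y = f.rt a + y' ∧ g.Cut x' y') ?_ ?_ ?_ f g h
  · rintro a x y _ _ _ rfl
    rcases le_total x a with h | h
    · exact .inl ⟨h, h, rfl⟩
    · exact .inr ⟨x - a, x - a, by omega, by simp only [rt]; omega, rfl⟩
  · rintro f T g hT _ ih a x y ⟨rfl, hf⟩ hsf hs h
    rw [graft_unit f hT, cut_append] at h
    obtain ⟨z, h1, h2⟩ := h
    rw [nonSemi_append] at hs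
    rcases ih hf hsf hs.2 h2 with ⟨h3, h4, h5⟩ | ⟨x', y', rfl, rfl, h5⟩
    · obtain rfl : z = 0 := by omega
      obtain rfl := hs.1.cut_zero_right h1
      exact .inl ⟨le_rfl, h4, rfl, h5⟩
    · refine .inr ⟨x, y', (Nat.zero_add x).symm, rfl, (cut_append _ _ _ _).mpr ⟨x', ?_, h5⟩⟩
      rwa [Nat.zero_add] at h1
  · rintro l p r c f g₁ g₂ h1 h2 ihc ih a x y ⟨hp, hc, hf⟩ ⟨hs, hsc, hsf⟩ hsg h
    rw [nonSemi_append] at hsg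
    rw [graft_node l p r h1] at h
    obtain ⟨z, ⟨rfl, rfl⟩ | ⟨x₁, z₁, rfl, rfl, h3⟩, h4⟩ := h
    · obtain rfl := (nonSemi_graft h2 hsf hsg.2).cut_zero_left h4
      exact .inl ⟨Nat.zero_le _, Nat.zero_le _, cut_zero _⟩
    · rcases ihc hc hsc hsg.1 h3 with ⟨e1, e2, e3⟩ | ⟨x', z', rfl, rfl, e3⟩ <;>
        rcases ih hf hsf hsg.2 h4 with ⟨e4, e5, e6⟩ | ⟨x'', y', e4, rfl, e6⟩
      · exact .inl ⟨by omega, e5, _, .inr ⟨_, _, rfl, rfl, e3⟩, e6⟩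
      · obtain rfl : x'' = 0 := by omega
        obtain rfl := hsg.2.cut_zero_left e6
        refine .inl ⟨by omega, le_rfl, _, .inr ⟨_, _, rfl, rfl, e3⟩, ?_⟩
        rw [e4]
        exact cut_rt f hf
      · obtain rfl : z' = 0 := by omega
        obtain rfl := hsg.1.cut_zero_right e3
        refine .inl ⟨by omega, e5, _, .inr ⟨_, _, rfl, rfl, ?_⟩, e6⟩
        exact cut_rt c hc
      · obtain rfl : z' = x'' := by omega
        exact .inr ⟨x', y', by omega, rfl, (cut_append _ _ _ _).mpr ⟨z', e3, e6⟩⟩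

/-- A cut decomposes a row into two rows. -/
theorem exists_graft_of_cut {e : Row L} : ∀ {x y}, e.Cut x y → ∃ K c, e = graft K c ∧
    c.len = K.wd ∧ K.Fit x ∧ K.rt x = y := by
  induction e with
  | nil => rintro x _ rfl; exact ⟨nil, nil, rfl, rfl, trivial, rfl⟩
  | unit f ih =>
    rintro x y ⟨rfl, h⟩
    obtain ⟨K, c, rfl, h1, h2, h3⟩ := ih h
    refine ⟨unit K, unit nil ++ c, (graft_unit K (T := unit nil) rfl).symm, ?_, ⟨rfl, h2⟩, h3⟩
    simp [wd, len, h1]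
  | node l p r g f ihg ih =>
    rintro x y ⟨z, ⟨rfl, rfl⟩ | ⟨x', z', rfl, rfl, h⟩, h'⟩
    · obtain ⟨K, c, rfl, h1, h2, h3⟩ := ih h'
      refine ⟨unit K, node l p r g nil ++ c, (graft_unit K (T := node l p r g nil) rfl).symm, ?_, ⟨rfl, h2⟩, h3⟩
      simp [wd, len, h1]
    · obtain ⟨K, c, rfl, h1, h2, h3⟩ := ih h'
      obtain ⟨K', c', rfl, h1', h2', h3'⟩ := ihg h
      refine ⟨node l p r K' K, c' ++ c, (graft_node l p r h1').symm, ?_, ?_, ?_⟩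
      · rw [len_append, h1, h1', wd]
      · refine ⟨Nat.le_add_right _ _, ?_, ?_⟩ <;> rw [Nat.add_sub_cancel_left]
        · exact h2'
        · rwa [h3', Nat.add_comm]
      · rw [rt, Nat.add_sub_cancel_left, h3', Nat.add_comm, h3]

/-- At a common left height, the remaining height tells where `K` ends: a unit of `K` requires
height zero, while a full box requires positive height. -/
theorem graft_inj {K c : Row L} (h : c.len = K.wd) : ∀ {a : ℕ} {K' c' : Row L}, K.Strict →
    K'.Strict → K.Fit a → K'.Fit a → c'.len = K'.wd → graft K c = graft K' c' →
    K = K' ∧ c = c' := by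
  refine graft_induction (motive := fun K c => ∀ {a : ℕ} {K' c' : Row L}, K.Strict →
    K'.Strict → K.Fit a → K'.Fit a → c'.len = K'.wd → graft K c = graft K' c' →
    K = K' ∧ c = c') ?_ ?_ ?_ K c h
  · intro a K' c' _ _ _ _ h' e
    have := congrArg len e
    rw [len_graft h', graft, len] at this
    obtain rfl := len_eq_zero.mp this.symm
    exact ⟨rfl, (len_eq_zero.mp h').symm⟩
  · rintro f T g hT hg ih a K' c' hs hs' ⟨rfl, hf⟩ hf' h' e
    cases K' with
    | nil =>
      have := congrArg len e
      rw [len_graft (by rw [len_append, hT, hg, wd, Nat.add_comm]), graft, len, len] at this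
      omega
    | unit f' =>
      obtain ⟨T', g', rfl, h1, h2⟩ := exists_append 1 c' f'.wd (by rw [h', wd, Nat.add_comm])
      rw [graft_unit f hT, graft_unit f' h1] at e
      obtain ⟨rfl, e'⟩ := append_inj e (hT.trans h1.symm)
      obtain ⟨rfl, rfl⟩ := ih (K' := f') hs hs' hf hf'.2 h2 e'
      exact ⟨rfl, rfl⟩
    | node l p r c f' =>
      have h1 := hf'.1
      have h2 := hs'.1.1
      omega
  · rintro l p r c f g₁ g₂ h1 h2 ihc ih a K' c' hs hs' hf hf' h' e
    cases K' with
    | nil =>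
      have := congrArg len e
      rw [len_graft (by rw [len_append, h1, h2, wd]), graft, len, len] at this
      omega
    | unit f' =>
      have h1 := hf.1
      have h2 := hs.1.1
      have h3 := hf'.1
      omega
    | node l' p' r' k f' =>
      obtain ⟨g₁', g₂', rfl, h3, h4⟩ := exists_append k.wd c' f'.wd h'
      rw [graft_node _ _ _ h1, graft_node _ _ _ h3, node.injEq] at e
      obtain ⟨rfl, rfl, rfl, e1, e2⟩ := e
      obtain ⟨rfl, rfl⟩ := ihc hs.2.1 hs'.2.1 hf.2.1 hf'.2.1 h3 e1
      obtain ⟨rfl, rfl⟩ := ih hs.2.2 hs'.2.2 hf.2.2 hf'.2.2 h4 e2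
      exact ⟨rfl, rfl⟩

end Cut

theorem graft_units (g : Row L) : graft (units g.len) g = g := by
  obtain ⟨m, hm⟩ : ∃ m, g.len = m := ⟨_, rfl⟩
  rw [hm]
  induction m generalizing g with
  | zero => exact (len_eq_zero.mp hm).symm
  | succ m ih =>
    obtain ⟨T, g, rfl, h1, h2⟩ := exists_append 1 g m (by omega)
    exact (graft_unit _ h1).trans (congrArg (T ++ ·) (ih g h2))

theorem graft_pair (l v : L) (a r : ℕ) (g₁ g₂ g₃ : Row L) :
    graft (node l a r (units g₁.len ++ node v 0 0 (units g₂.len) (units g₃.len)) nil)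
      (g₁ ++ (g₂ ++ g₃)) = node l a r (g₁ ++ node v 0 0 g₂ g₃) nil := by
  have h : g₁.len = (units g₁.len : Row L).wd := (wd_units _).symm
  have h' : (g₁ ++ (g₂ ++ g₃)).len =
      (units g₁.len ++ node v 0 0 (units g₂.len) (units g₃.len) : Row L).wd := by simp [wd]
  have := graft_node l a r (f := nil) (g₂ := nil) h'
  rw [append_nil] at this
  rw [this, graft_append h, graft_units, graft_node _ _ _ (by simp), graft_units, graft_units]
  rfl

/-- As a thin box is invisible to cuts, it may be replaced by the row it carries. -/
theorem cut_pair (l v : L) (a r : ℕ) (g₁ g₂ g₃ f : Row L) (x y : ℕ) :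
    (node l a r (g₁ ++ node v 0 0 g₂ g₃) f).Cut x y ↔ (node l a r (g₁ ++ (g₂ ++ g₃)) f).Cut x y := by
  have h : ∀ x y, (g₁ ++ node v 0 0 g₂ g₃).Cut x y ↔ (g₁ ++ (g₂ ++ g₃)).Cut x y := by
    intro x y
    have e : node v 0 0 g₂ g₃ = node v 0 0 g₂ nil ++ g₃ := rfl
    rw [e]
    simp only [cut_append, cut_thin]
  simp only [Cut, h]

namespace Ctx

/-- Addition of a row to the left of a row with a hole. -/
def shift (C : Ctx L) : Row L → Ctx L
  | .nil => C
  | .unit f => unit (shift C f)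
  | .node l p r c f => right l p r c (shift C f)

/-- The context of a tree on top of a box whose context is given. -/
def nest (l : L) (p r : ℕ) (g₁ g₂ : Row L) : Ctx L → Ctx L
  | hole f => left l p r (shift (hole g₂) g₁) f
  | unit C => unit (nest l p r g₁ g₂ C)
  | left l' p' r' C f => left l' p' r' (nest l p r g₁ g₂ C) f
  | right l' p' r' c C => right l' p' r' c (nest l p r g₁ g₂ C)

/-- The number of boxes below the hole. -/
def depth : Ctx L → ℕ
  | hole _ => 0
  | unit C => depth C
  | left _ _ _ C _ => depth C + 1
  | right _ _ _ _ C => depth C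

theorem fill_shift (C : Ctx L) (g T : Row L) : (C.shift g).fill id T = g ++ C.fill id T := by
  induction g with
  | nil => rfl
  | unit g ih => exact congrArg Row.unit ih
  | node l p r c g _ ih => simp [shift, fill, map_id, ih]

theorem fill_nest (l : L) (p r : ℕ) (g₁ g₂ : Row L) (C : Ctx L) (T : Row L) :
    (C.nest l p r g₁ g₂).fill id T = C.fill id (node l p r (g₁ ++ (T ++ g₂)) .nil) := by
  induction C with
  | hole f => simp [nest, fill, fill_shift, map_id]
  | unit C ih => exact congrArg Row.unit ih
  | left l' p' r' C f ih => simp [nest, fill, map_id, ih]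
  | right l' p' r' c C ih => simp [nest, fill, map_id, ih]

theorem depth_shift (g : Row L) (C : Ctx L) : (C.shift g).depth = C.depth := by
  induction g with
  | nil => rfl
  | unit g ih => exact ih
  | node l p r c g _ ih => exact ih

theorem depth_nest (l : L) (p r : ℕ) (g₁ g₂ : Row L) (C : Ctx L) :
    (C.nest l p r g₁ g₂).depth = C.depth + 1 := by
  induction C with
  | hole f => simp [nest, depth, depth_shift]
  | unit C ih => exact ih
  | left l' p' r' C f ih => exact congrArg (· + 1) ih
  | right l' p' r' c C ih => exact ih

theorem shift_injective {f f' : Row L} : ∀ {g g' : Row L},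
    (hole f).shift g = (hole f').shift g' → g = g' ∧ f = f'
  | .nil, .nil, h => ⟨rfl, by simpa [shift] using h⟩
  | .unit g, .unit g', h => by
      simp only [shift, unit.injEq] at h
      obtain ⟨rfl, rfl⟩ := shift_injective h
      exact ⟨rfl, rfl⟩
  | .node l p r c g, .node l' p' r' c' g', h => by
      simp only [shift, right.injEq] at h
      obtain ⟨rfl, rfl, rfl, rfl, h⟩ := h
      obtain ⟨rfl, rfl⟩ := shift_injective h
      exact ⟨rfl, rfl⟩
  | .nil, .unit _, h => by simp [shift] at h
  | .nil, .node .., h => by simp [shift] at h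
  | .unit _, .nil, h => by simp [shift] at h
  | .unit _, .node .., h => by simp [shift] at h
  | .node .., .nil, h => by simp [shift] at h
  | .node .., .unit _, h => by simp [shift] at h

/-- The box directly below the hole is the last one on the way to the hole; the number of boxes
below the hole excludes any other matching of the two contexts. -/
theorem nest_injective {l l' : L} {p r p' r' : ℕ} {g₁ g₂ g₁' g₂' : Row L} : ∀ {C C' : Ctx L},
    C.nest l p r g₁ g₂ = C'.nest l' p' r' g₁' g₂' →
    C = C' ∧ l = l' ∧ p = p' ∧ r = r' ∧ g₁ = g₁' ∧ g₂ = g₂' := by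
  intro C
  induction C with
  | hole f =>
    intro C' h
    cases C' with
    | hole f' =>
      simp only [nest, left.injEq] at h
      obtain ⟨rfl, rfl, rfl, h, rfl⟩ := h
      obtain ⟨rfl, rfl⟩ := shift_injective h
      exact ⟨rfl, rfl, rfl, rfl, rfl, rfl⟩
    | left l₁ p₁ r₁ C' f' =>
      simp only [nest, left.injEq] at h
      have := congrArg depth h.2.2.2.1
      rw [depth_nest, depth_shift] at this
      simp [depth] at this
    | unit C' => simp [nest] at h
    | right => simp [nest] at h
  | unit C ih =>
    intro C' h
    cases C' with
    | unit C' =>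
      simp only [nest, unit.injEq] at h
      obtain ⟨rfl, h'⟩ := ih h
      exact ⟨rfl, h'⟩
    | hole => simp [nest] at h
    | left => simp [nest] at h
    | right => simp [nest] at h
  | left l₁ p₁ r₁ C f ih =>
    intro C' h
    cases C' with
    | hole f' =>
      simp only [nest, left.injEq] at h
      have := congrArg depth h.2.2.2.1
      rw [depth_nest, depth_shift] at this
      simp [depth] at this
    | left l₂ p₂ r₂ C' f' =>
      simp only [nest, left.injEq] at h
      obtain ⟨rfl, rfl, rfl, h, rfl⟩ := h
      obtain ⟨rfl, h'⟩ := ih h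
      exact ⟨rfl, h'⟩
    | unit C' => simp [nest] at h
    | right => simp [nest] at h
  | right l₁ p₁ r₁ c C ih =>
    intro C' h
    cases C' with
    | right l₂ p₂ r₂ c' C' =>
      simp only [nest, right.injEq] at h
      obtain ⟨rfl, rfl, rfl, rfl, h⟩ := h
      obtain ⟨rfl, h'⟩ := ih h
      exact ⟨rfl, h'⟩
    | hole => simp [nest] at h
    | left => simp [nest] at h
    | unit => simp [nest] at h

/-- The context of a box is determined by its label. -/
theorem fill_injective {v : L} {p r p' r' : ℕ} {g g' : Row L} : ∀ {C C' : Ctx L},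
    (C.fill id (node v p r g .nil)).labels.Nodup →
    C.fill id (node v p r g .nil) = C'.fill id (node v p' r' g' .nil) →
    C = C' ∧ p = p' ∧ r = r' ∧ g = g' := by
  have hmem : ∀ {C : Ctx L} {p r g}, v ∈ (C.fill id (node v p r g .nil)).labels := by
    intro C p r g
    rw [C.labels_fill id (T := node v p r g .nil) rfl, labels_node]
    simp
  intro C
  induction C with
  | hole f =>
    intro C' hn h
    cases C' with
    | hole f' =>
      simp only [fill, map_id, node_append, nil_append, node.injEq, true_and] at h
      obtain ⟨rfl, rfl, rfl, rfl⟩ := h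
      exact ⟨rfl, rfl, rfl, rfl⟩
    | unit C' => simp [fill] at h
    | left l₁ p₁ r₁ C' f' =>
      simp only [fill, map_id, node_append, nil_append, node.injEq, labels_node, List.nodup_cons,
        List.mem_append] at h hn
      obtain ⟨-, -, -, rfl, rfl⟩ := h
      exact absurd (.inl hmem) hn.1
    | right l₁ p₁ r₁ c C' =>
      simp only [fill, map_id, node_append, nil_append, node.injEq, labels_node, List.nodup_cons,
        List.mem_append] at h hn
      obtain ⟨-, -, -, rfl, rfl⟩ := h
      exact absurd (.inr hmem) hn.1
  | unit C ih =>
    intro C' hn h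
    cases C' with
    | unit C' =>
      simp only [fill, Row.unit.injEq] at h
      obtain ⟨rfl, h'⟩ := ih hn h
      exact ⟨rfl, h'⟩
    | hole => simp [fill] at h
    | left => simp [fill] at h
    | right => simp [fill] at h
  | left l₁ p₁ r₁ C f ih =>
    intro C' hn h
    simp only [fill, labels_node, List.nodup_cons, List.mem_append, List.nodup_append] at hn
    cases C' with
    | hole f' =>
      simp only [fill, map_id, node_append, nil_append, node.injEq] at h
      obtain ⟨rfl, -⟩ := h
      exact absurd (.inl hmem) hn.1
    | unit C' => simp [fill] at h
    | left l₂ p₂ r₂ C' f' =>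
      simp only [fill, map_id, node.injEq, id] at h
      obtain ⟨rfl, rfl, rfl, h, rfl⟩ := h
      obtain ⟨rfl, h'⟩ := ih hn.2.1 h
      exact ⟨rfl, h'⟩
    | right l₂ p₂ r₂ c C' =>
      simp only [fill, map_id, node.injEq, id] at h
      have h1 := hn.2.2.2 v hmem v
      rw [map_id, h.2.2.2.2] at h1
      exact absurd rfl (h1 hmem)
  | right l₁ p₁ r₁ c C ih =>
    intro C' hn h
    simp only [fill, labels_node, List.nodup_cons, List.mem_append, List.nodup_append] at hn
    cases C' with
    | hole f' =>
      simp only [fill, map_id, node_append, nil_append, node.injEq] at h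
      obtain ⟨rfl, -⟩ := h
      exact absurd (.inr hmem) hn.1
    | unit C' => simp [fill] at h
    | right l₂ p₂ r₂ c' C' =>
      simp only [fill, map_id, node.injEq, id] at h
      obtain ⟨rfl, rfl, rfl, rfl, h⟩ := h
      obtain ⟨rfl, h'⟩ := ih hn.2.2.1 h
      exact ⟨rfl, h'⟩
    | left l₂ p₂ r₂ C' f' =>
      simp only [fill, map_id, node.injEq, id] at h
      have h1 := hn.2.2.2 v
      rw [map_id, h.2.2.2.1] at h1
      exact absurd rfl (h1 hmem v hmem)

end Ctx

/-- A box which is not the root lies on top of another box. -/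
theorem exists_pair {v : L} {m : ℕ} : ∀ {F : Row L}, (v, 0, m, 0) ∈ F.boxes →
    (∃ F₁ g F₂, F = F₁ ++ node v 0 0 g F₂) ∨
    ∃ (C : Ctx L) (l : L) (a r : ℕ) (g₁ g₂ g₃ : Row L),
      F = C.fill id (node l a r (g₁ ++ node v 0 0 g₂ g₃) nil) := by
  intro F
  induction F with
  | nil => exact fun h => absurd h List.not_mem_nil
  | unit f ih =>
    intro h
    rcases ih h with ⟨F₁, g, F₂, rfl⟩ | ⟨C, l, a, r, g₁, g₂, g₃, rfl⟩
    · exact .inl ⟨unit F₁, g, F₂, rfl⟩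
    · exact .inr ⟨.unit C, l, a, r, g₁, g₂, g₃, rfl⟩
  | node l p r c f ihc ih =>
    intro h
    simp only [boxes, List.mem_cons, List.mem_append] at h
    rcases h with h | h | h
    · simp only [Prod.mk.injEq] at h
      obtain ⟨rfl, rfl, -, rfl⟩ := h
      exact .inl ⟨nil, c, f, rfl⟩
    · rcases ihc h with ⟨F₁, g, F₂, rfl⟩ | ⟨C, l', a, r', g₁, g₂, g₃, rfl⟩
      · exact .inr ⟨.hole f, l, p, r, F₁, g, F₂, by simp [Ctx.fill, map_id]⟩
      · exact .inr ⟨.left l p r C f, l', a, r', g₁, g₂, g₃, by simp [Ctx.fill, map_id]⟩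
    · rcases ih h with ⟨F₁, g, F₂, rfl⟩ | ⟨C, l', a, r', g₁, g₂, g₃, rfl⟩
      · exact .inl ⟨node l p r c F₁, g, F₂, rfl⟩
      · exact .inr ⟨.right l p r c C, l', a, r', g₁, g₂, g₃, by simp [Ctx.fill, map_id]⟩

/-- The position of a box. -/
theorem exists_ctx {b : L × ℕ × ℕ × ℕ} : ∀ {F : Row L}, b ∈ F.boxes →
    ∃ (C : Ctx L) (g : Row L), g.len = b.2.2.1 ∧ F = C.fill id (node b.1 b.2.1 b.2.2.2 g nil) := by
  intro F
  induction F with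
  | nil => exact fun h => absurd h List.not_mem_nil
  | unit f ih =>
    intro h
    obtain ⟨C, g, h1, rfl⟩ := ih h
    exact ⟨.unit C, g, h1, rfl⟩
  | node l p r c f ihc ih =>
    intro h
    simp only [boxes, List.mem_cons, List.mem_append] at h
    rcases h with rfl | h | h
    · exact ⟨.hole f, c, rfl, by simp [Ctx.fill, map_id]⟩
    · obtain ⟨C, g, h1, rfl⟩ := ihc h
      exact ⟨.left l p r C f, g, h1, by simp [Ctx.fill, map_id]⟩
    · obtain ⟨C, g, h1, rfl⟩ := ih h
      exact ⟨.right l p r c C, g, h1, by simp [Ctx.fill, map_id]⟩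

end Row

/-! ### Trees as results of a substitution. -/

namespace Row
variable {L M : Type}

/-- The box has neither inputs nor outputs on its sides. -/
def Thin (b : L × ℕ × ℕ × ℕ) : Prop := b.2.1 = 0 ∧ b.2.2.2 = 0

/-- The box has inputs and outputs on its sides. -/
def Full (b : L × ℕ × ℕ × ℕ) : Prop := 0 < b.2.1 ∧ 0 < b.2.2.2

theorem Full.not_thin {b : L × ℕ × ℕ × ℕ} (h : Full b) : ¬ Thin b := fun h' => by
  have := h.1
  have := h'.1
  omega

theorem eq_node_of_len {t : Row L} (ht : t.len = 1) :
    t = unit nil ∨ ∃ l p r c, t = node l p r c nil := by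
  cases t with
  | nil => simp [len] at ht
  | unit f =>
    simp only [len, Nat.add_eq_right] at ht
    rw [len_eq_zero.mp ht]
    exact .inl rfl
  | node l p r c f =>
    simp only [len, Nat.add_eq_right] at ht
    rw [len_eq_zero.mp ht]
    exact .inr ⟨l, p, r, c, rfl⟩

/-- This form only uses the list of boxes and the cuts, which are easy to compare between the outer
tree of a substitution and its result. -/
theorem isConn_iff {t : Row L} (ht : t.len = 1) (P : ℕ) : t.IsConn P ↔ ∃ b bs, t.boxes = b :: bs ∧
    Thin b ∧ (∀ b' ∈ bs, Full b') ∧ 0 < P ∧ ∀ x y, t.Cut x y → x = 0 ∨ P ≤ x := by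
  constructor
  · rintro ⟨a, c, rfl, h, hP, hcut⟩
    refine ⟨_, _, rfl, ⟨rfl, rfl⟩, ?_, hP, fun x y hxy => hcut x y ((cut_thin _ _ _ _).mp hxy)⟩
    rw [boxes, List.append_nil]
    exact (strict_iff_boxes c).mp h
  · rintro ⟨b, bs, e, h, h', hP, hcut⟩
    rcases eq_node_of_len ht with rfl | ⟨l, p, r, c, rfl⟩
    · simp [boxes] at e
    · simp only [boxes, List.append_nil, List.cons.injEq] at e
      obtain ⟨rfl, rfl⟩ := e
      obtain ⟨rfl, rfl⟩ : p = 0 ∧ r = 0 := h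
      exact ⟨l, c, rfl, (strict_iff_boxes c).mpr h', hP,
        fun x y hxy => hcut x y ((cut_thin _ _ _ _).mpr hxy)⟩

theorem isPair_iff {t : Row L} (ht : t.len = 1) (P : ℕ) : t.IsPair P ↔ ∃ b b', t.boxes = [b, b'] ∧
    b.2.1 = P ∧ Thin b' ∧ (P = 0 ↔ b.2.2.2 = 0) := by
  constructor
  · rintro ⟨l, r, i, v, m, k, rfl, h⟩
    refine ⟨(l, P, i + (k + 1), r), (v, 0, m, 0), ?_, rfl, ⟨rfl, rfl⟩, h⟩
    simp [boxes, len]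
  · rintro ⟨b, b', e, hP, h, h'⟩
    rcases eq_node_of_len ht with rfl | ⟨l, p, r, c, rfl⟩
    · simp [boxes] at e
    · simp only [boxes, List.append_nil, List.cons.injEq] at e
      obtain ⟨rfl, e⟩ := e
      obtain ⟨i, v, p', r', m, k, rfl⟩ := eq_node_of_length_boxes (by rw [e]; rfl)
      simp only [boxes_append, boxes_units, boxes, List.append_nil, List.nil_append,
        List.cons.injEq, and_true] at e
      subst e
      obtain ⟨rfl, rfl⟩ : p' = 0 ∧ r' = 0 := h
      obtain rfl : p = P := hP
      exact ⟨l, r, i, v, m, k, rfl, h'⟩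

theorem mapBox_id : mapBox (id : L → L) = id := rfl

/-- A tree as the result of substituting a tree in a tree. -/
structure Split (L : Type) where
  ctx : Ctx L
  sub : Row L
  a : ℕ
  row : Row L

namespace Split

/-- The tree in which another one is substituted. -/
def outer (D : Split L) : Row (Option L) :=
  D.ctx.fill some (node none D.a (D.sub.rt D.a) (D.row.map some) nil)

/-- The result of the substitution. -/
def total (D : Split L) : Row L := D.ctx.fill id (graft D.sub D.row)

/-- Both trees contribute to braces. -/
structure Valid (D : Split L) (P : ℕ) : Prop where
  len_row : D.row.len = D.sub.wd
  len_sub : D.sub.len = 1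
  fit_sub : D.sub.Fit D.a
  sub : D.sub.IsPair D.a ∨ D.sub.IsConn D.a
  len_outer : D.outer.len = 1
  fit_outer : D.outer.Fit P
  outer : D.outer.IsPair P ∨ D.outer.IsConn P

/-- The tree to be substituted consists of a box with a thin box on top of it. -/
def pair (C : Ctx L) (l v : L) (a r : ℕ) (g₁ g₂ g₃ : Row L) : Split L where
  ctx := C
  sub := node l a r (units g₁.len ++ node v 0 0 (units g₂.len) (units g₃.len)) nil
  a := a
  row := g₁ ++ (g₂ ++ g₃)

/-- The hole and the tree put into it have the same outer size, so the heights outside agree. -/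
theorem outer_fit {D : Split L} {P : ℕ} (h : D.row.len = D.sub.wd) (h' : D.sub.Fit D.a)
    (ha : D.a ≤ D.ctx.height P) :
    (D.outer.Fit P ↔ D.total.Fit P) ∧ D.outer.rt P = D.total.rt P := by
  obtain ⟨b, hb⟩ := Nat.exists_eq_add_of_le ha
  have e : (node none D.a (D.sub.rt D.a) (D.row.map some) nil).rt (D.ctx.height P) =
      (graft D.sub D.row).rt (D.ctx.height P) := by
    rw [hb, rt_graft h b h', rt, rt, rt_map, Nat.add_sub_cancel_left, Nat.add_comm]
  have e' : (node none D.a (D.sub.rt D.a) (D.row.map some) nil).Fit (D.ctx.height P) ↔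
      (graft D.sub D.row).Fit (D.ctx.height P) := by
    rw [hb, fit_graft h b h', Fit, fit_map, Nat.add_sub_cancel_left]
    simp [Fit]
  exact ⟨D.ctx.fit_fill some id e e', D.ctx.rt_fill some id e⟩

theorem len_total {D : Split L} (h : D.row.len = D.sub.wd) (h' : D.sub.len = 1) :
    D.total.len = D.outer.len := by
  rw [total, outer, D.ctx.len_fill id ((len_graft h).trans h'), D.ctx.len_fill some rfl]

theorem wd_total {D : Split L} (h : D.row.len = D.sub.wd) : D.total.wd = D.outer.wd := by
  rw [total, outer, Ctx.wd_fill, Ctx.wd_fill, wd_graft h, wd, wd, wd_map, Nat.add_zero]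

theorem boxes_outer (D : Split L) : D.outer.boxes = D.ctx.pre.map (mapBox some) ++
    (none, D.a, D.row.len, D.sub.rt D.a) :: (D.row.boxes.map (mapBox some) ++
      D.ctx.post.map (mapBox some)) := by
  rw [outer, D.ctx.boxes_fill some rfl, boxes, boxes_map, len_map]
  simp [boxes]

theorem boxes_total {D : Split L} (h : D.row.len = D.sub.wd) (h' : D.sub.len = 1) :
    D.total.boxes = D.ctx.pre ++ (graft D.sub D.row).boxes ++ D.ctx.post := by
  rw [total, D.ctx.boxes_fill id ((len_graft h).trans h'), mapBox_id, List.map_id, List.map_id]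

namespace Valid
variable {D : Split L} {P : ℕ} (hD : D.Valid P)
include hD

theorem height : D.a ≤ D.ctx.height P := (D.ctx.fit_of_fill some hD.fit_outer).1

theorem fit_total : D.total.Fit P := (outer_fit hD.len_row hD.fit_sub hD.height).1.mp hD.fit_outer

theorem rt_total : D.total.rt P = D.outer.rt P :=
  (outer_fit hD.len_row hD.fit_sub hD.height).2.symm

theorem len_total_eq : D.total.len = 1 := (len_total hD.len_row hD.len_sub).trans hD.len_outer

theorem len_ctx : D.ctx.len = 1 := (D.ctx.len_fill some rfl).symm.trans hD.len_outer

end Valid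

section pair
variable (C : Ctx L) (l v : L) (a r : ℕ) (g₁ g₂ g₃ : Row L)

theorem total_pair :
    (pair C l v a r g₁ g₂ g₃).total = C.fill id (node l a r (g₁ ++ node v 0 0 g₂ g₃) nil) :=
  congrArg (C.fill id) (graft_pair l v a r g₁ g₂ g₃)

theorem rt_pair : (pair C l v a r g₁ g₂ g₃).sub.rt a = r := by simp [pair, rt]

theorem outer_pair : (pair C l v a r g₁ g₂ g₃).outer =
    C.fill some (node none a r ((g₁ ++ (g₂ ++ g₃)).map some) nil) := by
  rw [outer]
  have := rt_pair C l v a r g₁ g₂ g₃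
  exact congrArg (fun r => C.fill some (node none a r ((g₁ ++ (g₂ ++ g₃)).map some) nil)) this

theorem len_row_pair : (pair C l v a r g₁ g₂ g₃).row.len = (pair C l v a r g₁ g₂ g₃).sub.wd := by
  simp [pair, wd]

theorem fit_sub_pair : (pair C l v a r g₁ g₂ g₃).sub.Fit a := by
  simp [pair, Fit, fit_units_zero]

theorem cut_total_pair (x y : ℕ) :
    (pair C l v a r g₁ g₂ g₃).total.Cut x y ↔ (pair C l v a r g₁ g₂ g₃).outer.Cut x y := by
  rw [total_pair, outer_pair]
  refine C.cut_fill id some (fun x y => ?_) x y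
  rw [cut_pair]
  simp only [Cut, cut_map]

theorem boxes_pair : (pair C l v a r g₁ g₂ g₃).total.boxes = C.pre ++
    (l, a, g₁.len + (g₃.len + 1), r) :: (g₁.boxes ++ (v, 0, g₂.len, 0) :: (g₂.boxes ++ g₃.boxes) ++
      C.post) := by
  rw [total_pair, C.boxes_fill id rfl, mapBox_id]
  simp [boxes, len]

end pair

theorem exists_pair_eq {D : Split L} (h : D.row.len = D.sub.wd) (h' : D.sub.IsPair D.a) :
    ∃ C l v a r g₁ g₂ g₃, D = pair C l v a r g₁ g₂ g₃ ∧ (a = 0 ↔ r = 0) := by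
  obtain ⟨C, t, a, c⟩ := D
  dsimp only at h h'
  obtain ⟨l, r, i, v, m, k, rfl, h1⟩ := h'
  obtain ⟨g₁, g, rfl, rfl, h2⟩ := exists_append i c (m + k) (by rw [h]; simp [wd])
  obtain ⟨g₂, g₃, rfl, rfl, rfl⟩ := exists_append m g k h2
  exact ⟨C, l, v, a, r, g₁, g₂, g₃, rfl, h1⟩

/-- The thin box is located in the result by its label (`Ctx.fill_injective`), and the box it was
merged with is the one directly below (`Ctx.nest_injective`). -/
theorem pair_injective {C C' : Ctx L} {l l' v : L} {a r a' r' : ℕ} {g₁ g₂ g₃ g₁' g₂' g₃' : Row L}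
    (hn : (pair C l v a r g₁ g₂ g₃).total.labels.Nodup)
    (h : (pair C l v a r g₁ g₂ g₃).total = (pair C' l' v a' r' g₁' g₂' g₃').total) :
    pair C l v a r g₁ g₂ g₃ = pair C' l' v a' r' g₁' g₂' g₃' := by
  have key : ∀ (C : Ctx L) (l : L) (a r : ℕ) (g₁ g₂ g₃ : Row L), (pair C l v a r g₁ g₂ g₃).total =
      (C.nest l a r g₁ g₃).fill id (node v 0 0 g₂ nil) := by
    intro C l a r g₁ g₂ g₃
    rw [total_pair, Ctx.fill_nest]
    rfl
  rw [key] at hn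
  rw [key, key] at h
  obtain ⟨h1, -, -, rfl⟩ := Ctx.fill_injective hn h
  obtain ⟨rfl, rfl, rfl, rfl, rfl, rfl⟩ := Ctx.nest_injective h1
  rfl

end Split

theorem Ctx.eq_hole {C : Ctx L} (h : C.len = 1) (h' : C.pre = []) : C = .hole nil := by
  cases C with
  | hole f =>
    simp only [len, Nat.add_eq_right] at h
    rw [len_eq_zero.mp h]
  | unit C =>
    have : C.len ≠ 0 := by cases C <;> simp [len]
    simp only [len, Nat.add_eq_right] at h
    exact absurd h this
  | left l p r C f => simp [pre] at h'
  | right l p r c C => simp [pre] at h'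

/-! ### Signs -/

section signs

/-- Moving `v` to the front replaces `β a v` by `β v a` for each `a` before it, which costs one each
time. -/
theorem pairs_move {X : Type*} {β : X → X → ZMod 2} {v : X} (l₁ l₂ : List X)
    (h : ∀ a ∈ l₁, β a v + β v a = 1) :
    pairs β (l₁ ++ v :: l₂) = l₁.length + pairs β (v :: (l₁ ++ l₂)) := by
  induction l₁ with
  | nil => simp
  | cons a l₁ ih =>
    have h1 := h a List.mem_cons_self
    rw [List.cons_append, pairs, ih fun b hb => h b (List.mem_cons_of_mem _ hb)]
    simp only [pairs, List.cons_append, List.map_cons, List.map_append, List.sum_cons,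
      List.sum_append, List.length_cons, Nat.cast_add, Nat.cast_one]
    linear_combination h1 - β v a * CharTwo.two_eq_zero (R := ZMod 2)

theorem pairs_eq_zero {X : Type*} {β : X → X → ZMod 2} {l : List X}
    (h : ∀ a ∈ l, ∀ b ∈ l, β a b = 0) : pairs β l = 0 := by
  induction l with
  | nil => rfl
  | cons a l ih =>
    rw [pairs, ih fun b hb c hc => h b (List.mem_cons_of_mem _ hb) c (List.mem_cons_of_mem _ hc),
      add_zero]
    refine List.sum_eq_zero fun x hx => ?_
    obtain ⟨b, hb, rfl⟩ := List.mem_map.mp hx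
    exact h a List.mem_cons_self b (List.mem_cons_of_mem _ hb)

variable {u : L → ZMod 2}

variable (u) in
/-- The weights indicate the boxes which are not thin. -/
structure Weights (T : Row L) : Prop where
  nodup : T.labels.Nodup
  thin : ∀ b ∈ T.boxes, Thin b → u b.1 = 0
  full : ∀ b ∈ T.boxes, Full b → u b.1 = 1
  ne : ∀ b ∈ T.boxes, b.2 ≠ (0, 0, 0)

theorem Weights.eq {T : Row L} (hT : Weights u T) {b b' : L × ℕ × ℕ × ℕ} (hb : b ∈ T.boxes)
    (hb' : b' ∈ T.boxes) (h : b.1 = b'.1) : b = b' :=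
  List.inj_on_of_nodup_map hT.nodup hb hb' h

theorem Weights.root_ne {T : Row L} (hT : Weights u T) {b₀ : L × ℕ × ℕ × ℕ} {bs} (h : T.boxes = b₀ :: bs)
    {b} (hb : b ∈ bs) : b₀.1 ≠ b.1 := by
  have := hT.nodup
  rw [labels, h, List.map_cons, List.nodup_cons] at this
  exact fun e => this.1 (e ▸ List.mem_map_of_mem hb)

/-- The weight of an inversion: inversions between two boxes which are not thin do not count. -/
def inv [LinearOrder L] (u : L → ZMod 2) (a b : L) : ZMod 2 := if b < a then 1 + u a * u b else 0

variable [LinearOrder L]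

/-- Exactly one of the two orders is an inversion, and an inversion involving a thin box has weight
one. -/
theorem inv_add {a v : L} (h : a ≠ v) (hv : u v = 0) : inv u a v + inv u v a = 1 := by
  unfold inv
  rcases lt_or_gt_of_ne h with h | h
  · rw [if_neg h.not_gt, if_pos h, hv]; ring
  · rw [if_pos h, if_neg h.not_gt, hv]; ring

theorem inv_eq_zero {a b : L} (ha : u a = 1) (hb : u b = 1) : inv u a b = 0 := by
  unfold inv
  split_ifs
  · rw [ha, hb]; decide
  · rfl

/-- Inversions among full boxes have weight zero, so their order is irrelevant. -/
theorem pairs_perm_of_full {w w' : List L} {a v : L} (h : w.Perm w') (hw : ∀ b ∈ w, u b = 1) :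
    pairs (inv u) (v :: a :: w) = pairs (inv u) (v :: a :: w') := by
  have hw' : ∀ b ∈ w', u b = 1 := fun b hb => hw b (h.mem_iff.mpr hb)
  simp only [pairs, List.map_cons, List.sum_cons]
  rw [pairs_eq_zero fun b hb c hc => inv_eq_zero (hw b hb) (hw c hc),
    pairs_eq_zero fun b hb c hc => inv_eq_zero (hw' b hb) (hw' c hc),
    (h.map _).sum_eq, (h.map (inv u a)).sum_eq]

variable (u) in
/-- The part of the exponent of the sign of a substitution which depends on the substitution. -/
def Split.val (D : Split L) : ZMod 2 :=
  (D.ctx.pre.length : ZMod 2) + D.sub.labels.length * ((D.row.labels ++ D.ctx.post.map Prod.fst).map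
    fun b => 1 + u b).sum + pairs (inv u) (D.ctx.pre.map Prod.fst ++ (D.sub.labels ++
      (D.row.labels ++ D.ctx.post.map Prod.fst)))

variable (u) in
/-- The root and exactly one other box are thin. -/
def OneThin (T : Row L) (P : ℕ) (b : L × ℕ × ℕ × ℕ) (X : ZMod 2) : Prop :=
  ∃ b₀ bs rest, T.boxes = b₀ :: bs ∧ bs.Perm (b :: rest) ∧ Thin b₀ ∧ Thin b ∧
    (∀ b' ∈ rest, Full b') ∧ 0 < P ∧ (∀ x y, T.Cut x y → x = 0 ∨ P ≤ x) ∧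
    X = pairs (inv u) (b.1 :: b₀.1 :: rest.map Prod.fst)

variable (u) in
/-- There are exactly two boxes besides the root, both of which are thin. -/
def TwoThin (T : Row L) (P : ℕ) (b b' : L × ℕ × ℕ × ℕ) (X : ZMod 2) : Prop :=
  ∃ b₀ bs, T.boxes = b₀ :: bs ∧ bs.Perm [b, b'] ∧ b₀.2.1 = P ∧ (P = 0 ↔ b₀.2.2.2 = 0) ∧ Thin b ∧
    Thin b' ∧ X = pairs (inv u) [b₀.1, b.1, b'.1]

/-- The distinguished box is the only thin one besides the root, and the order of the remaining full
boxes does not affect the exponent. -/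
theorem OneThin.unique {T : Row L} (hT : Weights u T) {P : ℕ} {b b' X X'}
    (h : OneThin u T P b X) (h' : OneThin u T P b' X') : b = b' ∧ X = X' := by
  obtain ⟨b₀, bs, rest, h1, h2, h3, h4, h5, -, -, rfl⟩ := h
  obtain ⟨b₀', bs', rest', h1', h2', h3', h4', h5', -, -, rfl⟩ := h'
  obtain ⟨rfl, rfl⟩ := List.cons.inj (h1.symm.trans h1')
  have h6 := h2.symm.trans h2'
  obtain rfl : b = b' := by
    rcases List.mem_cons.mp (h6.mem_iff.mp List.mem_cons_self) with h | h
    · exact h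
    · exact absurd h4 (h5' _ h).not_thin
  have h7 := (List.perm_cons b).mp h6
  refine ⟨rfl, pairs_perm_of_full (h7.map _) fun l hl => ?_⟩
  obtain ⟨b', hb', rfl⟩ := List.mem_map.mp hl
  refine hT.full b' ?_ (h5 b' hb')
  rw [h1]
  exact List.mem_cons_of_mem _ (h2.mem_iff.mpr (List.mem_cons_of_mem _ hb'))

theorem OneThin.not_twoThin {T : Row L} {P : ℕ} {b b₁ b₂ X X'}
    (h : OneThin u T P b X) : ¬ TwoThin u T P b₁ b₂ X' := by
  rintro ⟨b₀', bs', h1', h2', -, -, h4', h5', rfl⟩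
  obtain ⟨b₀, bs, rest, h1, h2, h3, h4, h5, -, -, rfl⟩ := h
  obtain ⟨rfl, rfl⟩ := List.cons.inj (h1.symm.trans h1')
  have h6 := h2.symm.trans h2'
  have h7 := h6.length_eq
  obtain ⟨b', rfl⟩ : ∃ b', rest = [b'] := List.length_eq_one_iff.mp (by simpa using h7)
  have h8 : b' ∈ [b₁, b₂] := h6.mem_iff.mp (by simp)
  have h9 : Thin b' := by
    simp only [List.mem_cons, List.not_mem_nil, or_false] at h8
    rcases h8 with rfl | rfl
    · exact h4'
    · exact h5'
  exact (h5 b' List.mem_cons_self).not_thin h9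

/-- Exchanging the two thin labels reverses exactly one pair, of total weight one. -/
theorem TwoThin.swap {T : Row L} (hT : Weights u T) {P : ℕ} {b b' X} (h : TwoThin u T P b b' X) :
    TwoThin u T P b' b (X + 1) := by
  obtain ⟨b₀, bs, h1, h2, h3, h3', h4, h5, rfl⟩ := h
  refine ⟨b₀, bs, h1, h2.trans (List.Perm.swap _ _ _), h3, h3', h5, h4, ?_⟩
  have hb : b ∈ T.boxes := by
    rw [h1]; exact List.mem_cons_of_mem _ (h2.mem_iff.mpr (by simp))
  have hne : b.1 ≠ b'.1 := by
    have := hT.nodup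
    rw [labels, h1, List.map_cons, List.nodup_cons, (h2.map _).nodup_iff] at this
    simpa using this.2
  have := inv_add hne.symm (hT.thin b hb h4)
  simp only [pairs, List.map_cons, List.map_nil, List.sum_cons, List.sum_nil]
  linear_combination -this + inv u b.1 b'.1 * CharTwo.two_eq_zero (R := ZMod 2)

theorem TwoThin.unique {T : Row L} (hT : Weights u T) {P : ℕ} {b b' b₁ b₂ X X'}
    (h : TwoThin u T P b b' X) (h' : TwoThin u T P b₁ b₂ X') :
    (b₁ = b ∧ X' = X) ∨ (b₁ = b' ∧ X' = X + 1) := by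
  have hs := h.swap hT
  obtain ⟨b₀, bs, h1, h2, -, -, -, -, rfl⟩ := h
  obtain ⟨b₀', bs', h1', h2', -, -, -, -, e⟩ := hs
  obtain ⟨b₀'', bs'', h1'', h2'', -, -, -, -, rfl⟩ := h'
  obtain ⟨rfl, rfl⟩ := List.cons.inj (h1.symm.trans h1')
  obtain ⟨rfl, rfl⟩ := List.cons.inj (h1.symm.trans h1'')
  have h3 := h2.symm.trans h2''
  have h4 : b₁ ∈ [b, b'] := h3.mem_iff.mpr (by simp)
  simp only [List.mem_cons, List.not_mem_nil, or_false] at h4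
  rcases h4 with rfl | rfl
  · have := List.perm_singleton.mp ((List.perm_cons _).mp h3)
    simp only [List.cons.injEq, and_true] at this
    rw [this]
    exact .inl ⟨rfl, rfl⟩
  · have := List.perm_singleton.mp ((List.perm_cons _).mp ((List.Perm.swap _ _ _).trans h3))
    simp only [List.cons.injEq, and_true] at this
    rw [← this, e]
    exact .inr ⟨rfl, rfl⟩

end signs

end Row

/-! ### Classification of the substitutions by their result. -/

namespace Row
variable {L M : Type}

theorem graft_root (l : L) (p r : ℕ) {c g : Row L} (h : g.len = c.wd) :
    graft (node l p r c nil) g = node l p r (graft c g) nil := by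
  have := graft_node l p r (f := nil) (g₂ := nil) h
  rwa [append_nil] at this

theorem nonSemi_of_isPair_or_isConn {t : Row L} (ht : t.len = 1) {P : ℕ}
    (h : t.IsPair P ∨ t.IsConn P) : t.NonSemi := by
  rw [nonSemi_iff]
  rcases h with h | h
  · obtain ⟨b, b', e, hP, h1, h2⟩ := (isPair_iff ht P).mp h
    rw [e]
    intro c hc
    simp only [List.mem_cons, List.not_mem_nil, or_false] at hc
    rcases hc with rfl | rfl
    · rw [hP]; exact h2
    · rw [h1.1, h1.2]
  · obtain ⟨b, bs, e, h1, h2, -, -⟩ := (isConn_iff ht P).mp h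
    rw [e]
    intro c hc
    rcases List.mem_cons.mp hc with rfl | hc
    · rw [h1.1, h1.2]
    · have := h2 c hc
      exact ⟨fun h => absurd this.1 (by omega), fun h => absurd this.2 (by omega)⟩

/-- A tree of the connected type with a single box would be a thin root without children, of size
`(0,0,0)`; a unit on the root is impossible at positive height. -/
theorem two_le_length_boxes {t : Row L} (ht : t.len = 1) {P : ℕ} (hf : t.Fit P)
    (h : t.IsPair P ∨ t.IsConn P) (hne : ∀ b ∈ t.boxes, b.2 ≠ (0, 0, 0)) : 2 ≤ t.boxes.length := by
  rcases h with h | ⟨a, c, rfl, -, hP, -⟩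
  · obtain ⟨b, b', e, -⟩ := (isPair_iff ht P).mp h
    simp [e]
  · cases c with
    | nil => exact absurd rfl (hne (a, 0, 0, 0) List.mem_cons_self)
    | unit c =>
      have := hf.2.1.1
      omega
    | node l p r c f => simp [boxes]

namespace Split

theorem Valid.two_le {D : Split L} {P : ℕ} (hD : D.Valid P)
    (hne : ∀ b ∈ D.total.boxes, b.2 ≠ (0, 0, 0)) :
    2 ≤ D.sub.boxes.length ∧ 2 ≤ D.outer.boxes.length := by
  have hp := fun b => (boxes_graft hD.len_row).mem_iff (a := b)
  have hb := boxes_total hD.len_row hD.len_sub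
  have hsub : ∀ b ∈ D.sub.boxes, b.2 ≠ (0, 0, 0) := fun b h => hne b (by rw [hb]; simp [hp, h])
  refine ⟨two_le_length_boxes hD.len_sub hD.fit_sub hD.sub hsub,
    two_le_length_boxes hD.len_outer hD.fit_outer hD.outer fun b h => ?_⟩
  rw [boxes_outer] at h
  simp only [List.mem_append, List.mem_cons, List.mem_map] at h
  rcases h with ⟨b, h, rfl⟩ | rfl | ⟨b, h, rfl⟩ | ⟨b, h, rfl⟩
  · exact hne b (by rw [hb]; simp [h])
  · intro h
    simp only [Prod.mk.injEq] at h
    obtain ⟨h1, h2, -⟩ := h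
    rcases hD.sub with ⟨l, r, i, v, m, k, e, -⟩ | ⟨-, -, -, -, h3, -⟩
    · rw [hD.len_row, e] at h2
      simp only [wd, wd_append, wd_units] at h2
      obtain rfl : m = 0 := by omega
      exact hsub (v, 0, 0, 0) (by rw [e]; simp [boxes, len]) rfl
    · omega
  · exact hne b (by rw [hb]; simp [hp, h])
  · exact hne b (by rw [hb]; simp [h])

theorem Valid.nonSemi_total {D : Split L} {P : ℕ} (hD : D.Valid P) : D.total.NonSemi := by
  have ho := (nonSemi_iff _).mp (nonSemi_of_isPair_or_isConn hD.len_outer hD.outer)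
  have hs := (nonSemi_iff _).mp (nonSemi_of_isPair_or_isConn hD.len_sub hD.sub)
  have hp := fun b => (boxes_graft hD.len_row).mem_iff (a := b)
  rw [nonSemi_iff, boxes_total hD.len_row hD.len_sub]
  rw [boxes_outer] at ho
  intro b h
  simp only [List.mem_append, hp] at h
  rcases h with (h | h | h) | h
  · exact ho (mapBox some b) (by simp only [List.mem_append]; exact .inl (List.mem_map_of_mem h))
  · exact hs b h
  · exact ho (mapBox some b) (by
      simp only [List.mem_append, List.mem_cons]
      exact .inr (.inr (.inl (List.mem_map_of_mem h))))
  · exact ho (mapBox some b) (by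
      simp only [List.mem_append, List.mem_cons]
      exact .inr (.inr (.inr (List.mem_map_of_mem h))))

/-- The labels in the order of the outer tree, the substituted tree being inserted. -/
def word (D : Split L) : List L :=
  D.ctx.pre.map Prod.fst ++ (D.sub.labels ++ (D.row.labels ++ D.ctx.post.map Prod.fst))

theorem labels_total {D : Split L} (h : D.row.len = D.sub.wd) (h' : D.sub.len = 1) :
    D.total.labels.Perm D.word := by
  rw [labels, boxes_total h h', List.map_append, List.map_append, word, List.append_assoc]
  refine List.Perm.append_left _ ?_
  rw [← List.append_assoc]
  exact List.Perm.append_right _ (labels_graft h)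

/-- The inner tree has no cuts besides its bottom and its top, so cuts treat it like a single box;
what lies above it is handled by `cut_graft` and `cut_graft_right`. -/
theorem cut_total_conn {D : Split L} (h : D.row.len = D.sub.wd) (h' : D.sub.Fit D.a)
    (hc : D.sub.IsConn D.a) (hr : D.row.NonSemi) (x y : ℕ) :
    D.total.Cut x y ↔ D.outer.Cut x y := by
  obtain ⟨C, t, a, c⟩ := D
  obtain ⟨v, K, rfl, hK, ha, hcut⟩ := hc
  dsimp only at *
  have hw : c.len = K.wd := h
  have hf : K.Fit a := h'.2.1
  refine C.cut_fill id some (fun x y => ?_) x y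
  dsimp only
  rw [graft_root _ _ _ hw, cut_thin]
  have hrt : (node v 0 0 K nil).rt a = K.rt a := rfl
  simp only [Cut, cut_map, hrt]
  constructor
  · intro hxy
    rcases cut_graft hw hf hK.nonSemi hr hxy with ⟨h1, h2, h3⟩ | ⟨x', y', rfl, rfl, h3⟩
    · rcases hcut x y h3 with rfl | h4
      · exact ⟨y, .inl ⟨rfl, hK.nonSemi.cut_zero_left h3⟩, rfl⟩
      · obtain rfl : x = a := le_antisymm h1 h4
        obtain rfl := hK.cut_unique h3 (cut_rt K hf)
        exact ⟨_, .inr ⟨0, 0, rfl, rfl, cut_zero c⟩, rfl⟩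
    · exact ⟨_, .inr ⟨x', y', rfl, rfl, h3⟩, rfl⟩
  · rintro ⟨z, ⟨rfl, rfl⟩ | ⟨x', z', rfl, rfl, h3⟩, rfl⟩
    · exact cut_zero _
    · exact cut_graft_right hw hf h3

section
variable {D : Split L} {P : ℕ} (hD : D.Valid P)
include hD

theorem Valid.nonSemi_outer : D.outer.NonSemi := nonSemi_of_isPair_or_isConn hD.len_outer hD.outer

theorem Valid.nonSemi_row : D.row.NonSemi := by
  rw [nonSemi_iff]
  intro b hb
  refine (nonSemi_iff _).mp hD.nonSemi_outer (mapBox some b) ?_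
  rw [boxes_outer]
  simp only [List.mem_append, List.mem_cons]
  exact .inr (.inr (.inl (List.mem_map_of_mem hb)))

theorem Valid.cut_total (x y : ℕ) : D.total.Cut x y ↔ D.outer.Cut x y := by
  rcases hD.sub with h | h
  · obtain ⟨C, l, v, a, r, g₁, g₂, g₃, rfl, -⟩ := exists_pair_eq hD.len_row h
    exact cut_total_pair C l v a r g₁ g₂ g₃ x y
  · exact cut_total_conn hD.len_row hD.fit_sub h hD.nonSemi_row x y

end

section
variable [LinearOrder L] {u : L → ZMod 2}

theorem val_eq (D : Split L) : D.val u = (D.ctx.pre.length : ZMod 2) + D.sub.labels.length *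
    ((D.row.labels ++ D.ctx.post.map Prod.fst).map fun b => 1 + u b).sum + pairs (inv u) D.word := rfl

/-- If the outer tree is a pair as well, the result has three boxes, and the second thin box is the
upper one of the outer pair or the box with which `v` was merged. If the outer tree is connected,
`v` is the only thin box besides the root. Moving `v` into the normal position gives the exponent.
-/
theorem pair_class {C : Ctx L} {l v : L} {a r : ℕ} {g₁ g₂ g₃ : Row L} {P : ℕ}
    (hD : (pair C l v a r g₁ g₂ g₃).Valid P) (hu : Weights u (pair C l v a r g₁ g₂ g₃).total) :
    OneThin u (pair C l v a r g₁ g₂ g₃).total P (v, 0, g₂.len, 0)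
      ((pair C l v a r g₁ g₂ g₃).val u + 1) ∨
    ∃ b, TwoThin u (pair C l v a r g₁ g₂ g₃).total P (v, 0, g₂.len, 0) b
      ((pair C l v a r g₁ g₂ g₃).val u) := by
  have hb := boxes_pair C l v a r g₁ g₂ g₃
  have ho := boxes_outer (pair C l v a r g₁ g₂ g₃)
  have hn := (labels_total hD.len_row hD.len_sub).nodup_iff.mp hu.nodup
  have hv : u v = 0 := hu.thin (v, 0, g₂.len, 0) (by rw [hb]; simp) ⟨rfl, rfl⟩
  have hval := val_eq (u := u) (pair C l v a r g₁ g₂ g₃)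
  have hl := hD.len_ctx
  have hcut := hD.cut_total
  have hw : (pair C l v a r g₁ g₂ g₃).word = C.pre.map Prod.fst ++ (l :: v ::
      ((g₁ ++ (g₂ ++ g₃)).labels ++ C.post.map Prod.fst)) := by
    simp [word, pair]
  have hlab : (pair C l v a r g₁ g₂ g₃).sub.labels.length = 2 := by simp [pair]
  have h2 := CharTwo.two_eq_zero (R := ZMod 2)
  -- The inner tree has two boxes, so the middle summand of the value disappears.
  rw [hlab, hw, show ((2 : ℕ) : ZMod 2) = 0 from rfl, zero_mul, add_zero] at hval
  rw [hw] at hn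
  have hrt := rt_pair C l v a r g₁ g₂ g₃
  rw [show (pair C l v a r g₁ g₂ g₃).a = a from rfl, hrt] at ho
  have hrow : (pair C l v a r g₁ g₂ g₃).row = g₁ ++ (g₂ ++ g₃) := rfl
  have hctx : (pair C l v a r g₁ g₂ g₃).ctx = C := rfl
  rw [hrow, hctx] at ho
  rw [hctx] at hval
  rw [hctx] at hl
  clear hctx hrow hlab hw hrt
  have hp := hD.outer
  rw [isPair_iff hD.len_outer, isConn_iff hD.len_outer] at hp
  clear hD
  generalize (pair C l v a r g₁ g₂ g₃).val u = X at *
  generalize (pair C l v a r g₁ g₂ g₃).total = T at *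
  generalize (pair C l v a r g₁ g₂ g₃).outer = O at *
  have hc : (g₁.boxes ++ (v, 0, g₂.len, 0) :: (g₂.boxes ++ g₃.boxes)).Perm
      ((v, 0, g₂.len, 0) :: (g₁ ++ (g₂ ++ g₃)).boxes) := by
    rw [boxes_append, boxes_append]
    exact List.perm_middle
  rcases hp with ⟨β, β', e, hP, hβ, hβ'⟩ | ⟨β, βs, e, hβ, hβs, hP, hc'⟩
  · refine .inr ?_
    rw [ho] at e
    cases hpre : C.pre with
    | nil =>
      obtain rfl := C.eq_hole hl hpre
      simp only [Ctx.pre, Ctx.post, boxes, List.map_nil, List.nil_append, List.append_nil,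
        List.cons.injEq] at e hb hval
      obtain ⟨rfl, e⟩ := e
      obtain ⟨b', e', rfl⟩ := List.map_eq_singleton_iff.mp e
      refine ⟨b', _, _, hb, e' ▸ hc, hP, hβ', ⟨rfl, rfl⟩, hβ, ?_⟩
      rw [hval, labels, e']
      simp
    -- Here the hole is the upper box of the outer pair; so `l` is thin too, and its order with `v`
    -- has to be exchanged.
    | cons b₀ pre' =>
      rw [hpre] at e hb hval hn
      simp only [List.map_cons, List.cons_append, List.cons.injEq] at e hb
      obtain ⟨rfl, e⟩ := e
      obtain rfl : pre' = [] := by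
        cases pre' with
        | nil => rfl
        | cons b pre' => simp at e
      simp only [List.map_nil, List.nil_append, List.cons.injEq, List.append_eq_nil_iff,
        List.map_eq_nil_iff] at e hb
      obtain ⟨rfl, e, e'⟩ := e
      rw [e] at hc
      rw [e', List.append_nil, List.perm_singleton.mp hc] at hb
      refine ⟨_, _, _, hb, List.Perm.swap _ _ _, hP, hβ', ⟨rfl, rfl⟩, hβ, ?_⟩
      rw [labels, e, e'] at hn hval
      have hlv : l ≠ v := by
        simp only [List.map_cons, List.map_nil, List.cons_append, List.nil_append, List.append_nil,
          List.nodup_cons, List.mem_cons, List.not_mem_nil] at hn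
        exact fun h => hn.2.1 (.inl h)
      have := inv_add hlv hv
      rw [hval]
      simp only [pairs, List.map_cons, List.map_nil, List.sum_cons, List.sum_nil, List.cons_append,
        List.nil_append, List.append_nil, List.length_cons, List.length_nil]
      push_cast
      linear_combination this + (1 - inv u v l) * h2
  · refine .inl ?_
    rw [ho] at e
    cases hpre : C.pre with
    | nil =>
      obtain rfl := C.eq_hole hl hpre
      simp only [Ctx.pre, Ctx.post, boxes, List.map_nil, List.nil_append, List.append_nil,
        List.cons.injEq] at e hb hval hn
      obtain ⟨rfl, rfl⟩ := e
      refine ⟨_, _, _, hb, hc, hβ, ⟨rfl, rfl⟩, fun b' hb' => hβs _ (List.mem_map_of_mem hb'), hP,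
        fun x y h => hc' x y ((hcut x y).mp h), ?_⟩
      have hm := pairs_move (β := inv u) (v := v) [l] ((g₁ ++ (g₂ ++ g₃)).labels) (by
        intro b hb'
        obtain rfl := List.mem_singleton.mp hb'
        refine inv_add ?_ hv
        rw [List.nodup_cons, List.mem_cons] at hn
        exact fun h => hn.1 (.inl h))
      simp only [List.cons_append, List.nil_append, List.length_singleton] at hm
      rw [hval, hm]
      simp only [labels, List.length_nil]
      push_cast
      linear_combination h2
    | cons b₀ pre' =>
      rw [hpre] at e hb hval hn
      simp only [List.map_cons, List.cons_append, List.cons.injEq] at e hb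
      obtain ⟨rfl, rfl⟩ := e
      refine ⟨_, _, pre' ++ (l, a, g₁.len + (g₃.len + 1), r) :: ((g₁ ++ (g₂ ++ g₃)).boxes ++ C.post),
        hb, ?_, hβ, ⟨rfl, rfl⟩, ?_, hP, fun x y h => hc' x y ((hcut x y).mp h), ?_⟩
      · refine (List.Perm.append_left _ (((hc.append_right _).cons _).trans
          (List.Perm.swap _ _ _))).trans ?_
        exact List.perm_middle
      · intro b hb'
        simp only [List.mem_append, List.mem_cons] at hb' hβs
        rcases hb' with h | rfl | h | h
        · exact hβs (mapBox some b) (.inl (List.mem_map_of_mem h))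
        · exact hβs _ (.inr (.inl rfl))
        · exact hβs (mapBox some b) (.inr (.inr (.inl (List.mem_map_of_mem h))))
        · exact hβs (mapBox some b) (.inr (.inr (.inr (List.mem_map_of_mem h))))
      · have hm := pairs_move (β := inv u) (v := v) ((b₀ :: pre').map Prod.fst ++ [l])
          ((g₁ ++ (g₂ ++ g₃)).labels ++ C.post.map Prod.fst) (by
          intro b hb'
          refine inv_add ?_ hv
          rintro rfl
          rw [List.nodup_append] at hn
          simp only [List.mem_append, List.mem_singleton] at hb'
          rcases hb' with h | rfl
          · exact hn.2.2 b h b (by simp) rfl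
          · exact (List.nodup_cons.mp hn.2.1).1 List.mem_cons_self)
        rw [List.append_assoc, List.singleton_append] at hm
        rw [hval, hm]
        simp only [List.map_cons, List.map_append, List.cons_append, List.length_cons,
          List.length_append, List.length_map, List.append_assoc, List.nil_append, labels,
          List.length_nil]
        push_cast
        linear_combination (pre'.length + 2 : ZMod 2) * h2

end

end Split
end Row

namespace Row
variable {L M : Type}

namespace Split
section
variable [LinearOrder L] {u : L → ZMod 2}

/-- The hole has positive height, so it is never thin. In an outer pair it is the root, and the thin
box on top is the distinguished one; in a connected outer tree it is a full box, and the
distinguished one is the root `v` of the inner tree. -/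
theorem conn_class {D : Split L} {P : ℕ} (hD : D.Valid P) (hu : Weights u D.total)
    (hc : D.sub.IsConn D.a) : ∃ b, OneThin u D.total P b (D.val u) := by
  have hb := boxes_total hD.len_row hD.len_sub
  have ho := boxes_outer D
  have hn := (labels_total hD.len_row hD.len_sub).nodup_iff.mp hu.nodup
  have hval := val_eq (u := u) D
  have hl := hD.len_ctx
  have hcut := hD.cut_total
  have h2 := CharTwo.two_eq_zero (R := ZMod 2)
  have hp := hD.outer
  rw [isPair_iff hD.len_outer, isConn_iff hD.len_outer] at hp
  obtain ⟨v, K, hK, hKs, ha, -⟩ := hc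
  have hw : D.row.len = K.wd := by
    have := hD.len_row
    rw [hK] at this
    exact this
  have hg : (graft D.sub D.row).boxes = (v, 0, K.len, 0) :: (graft K D.row).boxes := by
    rw [hK, graft_root _ _ _ hw, boxes, boxes, List.append_nil, len_graft hw]
  have hgp := boxes_graft hw
  have hsub : D.sub.labels = v :: K.labels := by simp [hK]
  rw [hg] at hb
  rw [strict_iff_boxes] at hKs
  rw [word, hsub] at hn
  rw [word, hsub] at hval
  have hrow : ∀ l ∈ D.row.labels, ∃ b ∈ D.row.boxes, b.1 = l := fun l h => List.mem_map.mp h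
  rcases hp with ⟨β, β', e, hP, hβ, hβ'⟩ | ⟨β, βs, e, hβ, hβs, hP, hc'⟩
  · rw [ho] at e
    cases hpre : D.ctx.pre with
    | nil =>
      have hC := D.ctx.eq_hole hl hpre
      rw [hpre, hC] at e hb hval hn
      simp only [Ctx.post, boxes, List.map_nil, List.nil_append, List.append_nil,
        List.cons.injEq] at e hb hval hn
      obtain ⟨rfl, e⟩ := e
      obtain ⟨b', e', rfl⟩ := List.map_eq_singleton_iff.mp e
      rw [e'] at hgp
      have hb' : b' ∈ D.total.boxes := by
        rw [hb]
        exact List.mem_cons_of_mem _ (hgp.mem_iff.mpr (by simp))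
      have hub : u b'.1 = 0 := hu.thin b' hb' hβ
      -- The hole is the root of the outer pair, so the inner tree occupies the full left height.
      obtain rfl : D.a = P := hP
      refine ⟨b', _, _, K.boxes, hb, ?_, ⟨rfl, rfl⟩, hβ, hKs, ha, ?_, ?_⟩
      · exact hgp.trans (List.perm_append_singleton _ _)
      · intro x y h
        rw [hcut, outer, hC] at h
        obtain ⟨z, ⟨h, -⟩ | ⟨x', z', rfl, -, -⟩, -⟩ := h
        · exact .inl h
        · exact .inr (Nat.le_add_right _ _)
      · have hm := pairs_move (β := inv u) (v := b'.1) (v :: K.labels) [] (by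
          intro b hb''
          refine inv_add ?_ hub
          rintro rfl
          rw [labels, labels, e', List.map_singleton, List.nodup_append] at hn
          exact hn.2.2 b'.1 hb'' b'.1 (by simp) rfl)
        have hlab : D.row.labels = [b'.1] := by rw [labels, e']; rfl
        rw [hlab, hm, List.append_nil] at hval
        rw [hval]
        simp only [List.map_cons, List.map_nil, List.sum_cons, List.sum_nil, hub, labels,
          List.length_nil, List.length_cons]
        push_cast
        linear_combination ((K.boxes.map Prod.fst).length + 1 : ZMod 2) * h2
    | cons b₀ pre' =>
      exfalso
      rw [hpre] at e
      simp only [List.map_cons, List.cons_append, List.cons.injEq] at e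
      obtain ⟨rfl, e⟩ := e
      obtain rfl : pre' = [] := by
        cases pre' with
        | nil => rfl
        | cons b pre' => simp at e
      simp only [List.map_nil, List.nil_append, List.cons.injEq] at e
      obtain ⟨rfl, -⟩ := e
      have : D.a = 0 := hβ.1
      omega
  · rw [ho] at e
    cases hpre : D.ctx.pre with
    | nil =>
      exfalso
      rw [hpre] at e
      simp only [List.map_nil, List.nil_append, List.cons.injEq] at e
      obtain ⟨rfl, -⟩ := e
      have : D.a = 0 := hβ.1
      omega
    | cons b₀ pre' =>
      rw [hpre] at e hb hval hn
      simp only [List.map_cons, List.cons_append, List.cons.injEq] at e hb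
      obtain ⟨rfl, rfl⟩ := e
      simp only [List.mem_append, List.mem_cons] at hβs
      have h1 : ∀ b ∈ pre', Full b := fun b h => hβs (mapBox some b) (.inl (List.mem_map_of_mem h))
      have h3 : ∀ b ∈ D.row.boxes, Full b := fun b h =>
        hβs (mapBox some b) (.inr (.inr (.inl (List.mem_map_of_mem h))))
      have h4 : ∀ b ∈ D.ctx.post, Full b := fun b h =>
        hβs (mapBox some b) (.inr (.inr (.inr (List.mem_map_of_mem h))))
      have hv : u v = 0 := hu.thin (v, 0, K.len, 0) (by rw [hb]; simp) ⟨rfl, rfl⟩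
      refine ⟨(v, 0, K.len, 0), _, _, pre' ++ (K.boxes ++ (D.row.boxes ++ D.ctx.post)),
        hb, ?_, hβ, ⟨rfl, rfl⟩, ?_, hP, fun x y h => hc' x y ((hcut x y).mp h), ?_⟩
      · rw [List.append_assoc, List.cons_append]
        refine List.perm_middle.trans (List.Perm.cons _ (List.Perm.append_left _ ?_))
        rw [← List.append_assoc]
        exact hgp.append_right _
      · intro b hb'
        simp only [List.mem_append] at hb'
        rcases hb' with h | h | h | h
        · exact h1 b h
        · exact hKs b h
        · exact h3 b h
        · exact h4 b h
      · have hm := pairs_move (β := inv u) (v := v) ((b₀ :: pre').map Prod.fst)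
          (K.labels ++ (D.row.labels ++ D.ctx.post.map Prod.fst)) (by
          intro b hb'
          refine inv_add ?_ hv
          rintro rfl
          rw [List.nodup_append] at hn
          exact hn.2.2 b hb' b (by simp) rfl)
        -- All boxes after the inner tree are full, so the middle summand of the value vanishes.
        have hz : ((D.row.labels ++ D.ctx.post.map Prod.fst).map fun b => 1 + u b).sum = 0 := by
          refine List.sum_eq_zero fun x hx => ?_
          obtain ⟨l, hl', rfl⟩ := List.mem_map.mp hx
          have : u l = 1 := by
            rcases List.mem_append.mp hl' with h | h
            · obtain ⟨b, hb', rfl⟩ := hrow l h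
              refine hu.full b ?_ (h3 b hb')
              rw [hb]
              simp [hgp.mem_iff, hb']
            · obtain ⟨b, hb', rfl⟩ := List.mem_map.mp h
              refine hu.full b ?_ (h4 b hb')
              rw [hb]
              simp [hb']
          rw [this]
          rfl
        rw [hz, mul_zero, add_zero, List.cons_append (a := v), hm] at hval
        rw [hval]
        simp only [List.map_cons, List.map_append, List.cons_append, List.length_cons,
          List.length_map, labels]
        push_cast
        linear_combination (pre'.length + 1 : ZMod 2) * h2

/-- A thin box which is not the root can be merged with the box below it. -/
theorem exists_pair_split {T : Row L} {P : ℕ} {b : L × ℕ × ℕ × ℕ} (hT : Weights u T)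
    (hl : T.len = 1) (hf : T.Fit P)
    (h : (∃ X, OneThin u T P b X) ∨ ∃ b' X, TwoThin u T P b b' X) :
    ∃ C l a r g₁ g₂ g₃, (pair C l b.1 a r g₁ g₂ g₃).total = T ∧
      (pair C l b.1 a r g₁ g₂ g₃).Valid P := by
  have key : ∃ b₀ bs, T.boxes = b₀ :: bs ∧ b ∈ bs ∧ Thin b ∧ (b₀.2.1 = 0 ↔ b₀.2.2.2 = 0) ∧
      ∀ b' ∈ bs, (b'.2.1 = 0 ↔ b'.2.2.2 = 0) := by
    have hthin : ∀ b : L × ℕ × ℕ × ℕ, Thin b → (b.2.1 = 0 ↔ b.2.2.2 = 0) := fun b hb => by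
      rw [hb.1, hb.2]
    rcases h with ⟨X, b₀, bs, rest, h1, h2, h3, h4, h5, -⟩ | ⟨b', X, b₀, bs, h1, h2, h3, h4, h5, h6, -⟩
    · refine ⟨b₀, bs, h1, h2.mem_iff.mpr List.mem_cons_self, h4, hthin _ h3, fun b' hb' => ?_⟩
      rcases List.mem_cons.mp (h2.mem_iff.mp hb') with rfl | h
      · exact hthin _ h4
      · have := h5 b' h
        exact ⟨fun h => absurd this.1 (by omega), fun h => absurd this.2 (by omega)⟩
    · refine ⟨b₀, bs, h1, h2.mem_iff.mpr List.mem_cons_self, h5, by rw [h3]; exact h4, ?_⟩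
      intro b'' hb''
      have := h2.mem_iff.mp hb''
      simp only [List.mem_cons, List.not_mem_nil, or_false] at this
      rcases this with rfl | rfl
      · exact hthin _ h5
      · exact hthin _ h6
  obtain ⟨b₀, bs, hb, hbs, ⟨hthin1, hthin2⟩, hs0, hs⟩ := key
  have hmem : (b.1, 0, b.2.2.1, 0) ∈ T.boxes := by
    rw [hb]
    refine List.mem_cons_of_mem _ ?_
    have : b = (b.1, 0, b.2.2.1, 0) := Prod.ext rfl (Prod.ext hthin1 (Prod.ext rfl hthin2))
    rwa [← this]
  rcases exists_pair hmem with ⟨F₁, g, F₂, rfl⟩ | ⟨C, l, a, r, g₁, g₂, g₃, e⟩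
  -- By distinctness of labels the chosen thin box is not the root.
  · exfalso
    simp only [len_append, len] at hl
    obtain rfl := len_eq_zero.mp (show F₁.len = 0 by omega)
    obtain rfl := len_eq_zero.mp (show F₂.len = 0 by omega)
    have := hT.root_ne hb hbs
    simp only [nil_append, boxes, List.append_nil, List.cons.injEq] at hb
    rw [← hb.1] at this
    exact this rfl
  · refine ⟨C, l, a, r, g₁, g₂, g₃, by rw [total_pair, e], ?_⟩
    have htot : (pair C l b.1 a r g₁ g₂ g₃).total = T := by rw [total_pair, e]
    have hlen := len_row_pair C l b.1 a r g₁ g₂ g₃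
    have hfs := fit_sub_pair C l b.1 a r g₁ g₂ g₃
    have hlo : (pair C l b.1 a r g₁ g₂ g₃).outer.len = 1 := by
      rw [← len_total hlen rfl, htot, hl]
    have hcut := cut_total_pair C l b.1 a r g₁ g₂ g₃
    have ho := boxes_outer (pair C l b.1 a r g₁ g₂ g₃)
    have hbp := boxes_pair C l b.1 a r g₁ g₂ g₃
    rw [htot] at hbp hcut
    have hctx : C.len = 1 := (C.len_fill some rfl).symm.trans hlo
    have hrt := rt_pair C l b.1 a r g₁ g₂ g₃
    rw [show (pair C l b.1 a r g₁ g₂ g₃).a = a from rfl, hrt] at ho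
    have hrow : (pair C l b.1 a r g₁ g₂ g₃).row = g₁ ++ (g₂ ++ g₃) := rfl
    have hctx' : (pair C l b.1 a r g₁ g₂ g₃).ctx = C := rfl
    rw [hrow, hctx'] at ho
    have hc : (g₁.boxes ++ (b.1, 0, g₂.len, 0) :: (g₂.boxes ++ g₃.boxes)).Perm
        ((b.1, 0, g₂.len, 0) :: (g₁ ++ (g₂ ++ g₃)).boxes) := by
      rw [boxes_append, boxes_append]
      exact List.perm_middle
    have hbe : b = (b.1, 0, g₂.len, 0) := by
      refine hT.eq (by rw [hb]; exact List.mem_cons_of_mem _ hbs) ?_ rfl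
      rw [hbp]
      simp
    -- The inner pair must not be semi-thin; its lower box is a box of the result.
    have har : a = 0 ↔ r = 0 := by
      have : (l, a, g₁.len + (g₃.len + 1), r) ∈ T.boxes := by rw [hbp]; simp
      rw [hb] at this
      rcases List.mem_cons.mp this with h | h
      · rw [← h] at hs0
        exact hs0
      · exact hs _ h
    refine ⟨hlen, rfl, hfs, .inl ⟨l, r, _, b.1, _, _, rfl, har⟩, hlo, ?_, ?_⟩
    · refine (outer_fit hlen hfs ?_).1.mpr (htot ▸ hf)
      rw [e] at hf
      exact (C.fit_of_fill id hf).1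
    · rw [isPair_iff hlo, isConn_iff hlo, ho]
      rw [hbp] at hb
      rcases h with ⟨X, b₀', bs', rest, h1, h2, h3, h4, h5, h6, h7, -⟩ |
        ⟨b', X, b₀', bs', h1, h2, h3, h4, h5, h6, -⟩
      · obtain ⟨rfl, rfl⟩ := List.cons.inj ((hbp.symm.trans h1).symm.trans hb)
        refine .inr ?_
        cases hpre : C.pre with
        | nil =>
          rw [hpre] at hb
          have hpost : C.post = [] := by rw [C.eq_hole hctx hpre]; rfl
          rw [hpost] at hb ⊢
          simp only [List.nil_append, List.append_nil, List.cons.injEq] at hb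
          obtain ⟨rfl, rfl⟩ := hb
          rw [hbe] at h2
          have h8 := (List.perm_cons _).mp (hc.symm.trans h2)
          refine ⟨_, _, rfl, h3, fun β hβ => ?_, h6, fun x y hxy => h7 x y ((hcut x y).mpr hxy)⟩
          simp only [List.map_nil, List.append_nil, List.mem_map] at hβ
          obtain ⟨b', hb', rfl⟩ := hβ
          exact h5 b' (h8.mem_iff.mp hb')
        | cons b₁ pre' =>
          rw [hpre] at hb
          simp only [List.cons_append, List.cons.injEq] at hb
          obtain ⟨rfl, rfl⟩ := hb
          have h8 : (b :: (pre' ++ (l, a, g₁.len + (g₃.len + 1), r) ::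
              ((g₁ ++ (g₂ ++ g₃)).boxes ++ C.post))).Perm (b :: rest) := by
            refine List.Perm.trans ?_ h2
            rw [hbe]
            refine List.perm_middle.symm.trans (List.Perm.append_left _ ?_)
            refine (List.Perm.swap _ _ _).trans (List.Perm.cons _ ?_)
            exact (hc.append_right C.post).symm
          have h9 := (List.perm_cons _).mp h8
          refine ⟨_, _, rfl, h3, fun β hβ => ?_, h6, fun x y hxy => h7 x y ((hcut x y).mpr hxy)⟩
          replace hβ := (List.mem_append (s := pre'.map (mapBox some))).mp hβ
          simp only [List.mem_append, List.mem_cons, List.mem_map] at hβ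
          rcases hβ with ⟨b', hb', rfl⟩ | rfl | ⟨b', hb', rfl⟩ | ⟨b', hb', rfl⟩
          · exact h5 b' (h9.mem_iff.mp (by simp only [List.mem_append, List.mem_cons, hb', true_or]))
          · exact h5 (l, a, g₁.len + (g₃.len + 1), r) (h9.mem_iff.mp (by simp))
          · exact h5 b' (h9.mem_iff.mp (by simp only [List.mem_append, List.mem_cons, hb', true_or, or_true]))
          · exact h5 b' (h9.mem_iff.mp (by simp only [List.mem_append, List.mem_cons, hb', or_true]))
      · obtain ⟨rfl, rfl⟩ := List.cons.inj ((hbp.symm.trans h1).symm.trans hb)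
        refine .inl ?_
        cases hpre : C.pre with
        | nil =>
          rw [hpre] at hb
          have hpost : C.post = [] := by rw [C.eq_hole hctx hpre]; rfl
          rw [hpost] at hb ⊢
          simp only [List.nil_append, List.append_nil, List.cons.injEq] at hb
          obtain ⟨rfl, rfl⟩ := hb
          rw [hbe] at h2
          have h8 := List.perm_singleton.mp ((List.perm_cons _).mp (hc.symm.trans h2))
          rw [h8]
          exact ⟨_, _, rfl, h3, h6, h4⟩
        | cons b₁ pre' =>
          rw [hpre] at hb
          simp only [List.cons_append, List.cons.injEq] at hb
          obtain ⟨rfl, rfl⟩ := hb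
          have h8 : (b :: (pre' ++ (l, a, g₁.len + (g₃.len + 1), r) ::
              ((g₁ ++ (g₂ ++ g₃)).boxes ++ C.post))).Perm (b :: [b']) := by
            refine List.Perm.trans ?_ h2
            rw [hbe]
            refine List.perm_middle.symm.trans (List.Perm.append_left _ ?_)
            refine (List.Perm.swap _ _ _).trans (List.Perm.cons _ ?_)
            exact (hc.append_right C.post).symm
          have h9 := List.perm_singleton.mp ((List.perm_cons _).mp h8)
          obtain ⟨rfl, h10⟩ : pre' = [] ∧ _ := by
            cases pre' with
            | nil => exact ⟨rfl, h9⟩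
            | cons _ _ => simp at h9
          simp only [List.nil_append, List.cons.injEq, List.append_eq_nil_iff] at h10
          obtain ⟨rfl, e1, e2⟩ := h10
          rw [e1, e2]
          exact ⟨_, _, rfl, h3, h6, h4⟩

end

end Split
end Row

/-! ### The substitutions with a given result come in pairs. -/

namespace Row
variable {L M : Type}

/-- Each input of a row is a unit in it; this unit is turned into the hole. -/
theorem exists_ctx_unit : ∀ (f : Row L) (i k : ℕ), f.wd = i + (1 + k) →
    ∃ C : Ctx L, f = C.fill id (unit nil) ∧ C.lw = i ∧ C.rw = k := by
  intro f
  induction f with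
  | nil => intro i k h; simp only [wd] at h; omega
  | unit f ih =>
    intro i k h
    cases i with
    | zero =>
      refine ⟨.hole f, by simp [Ctx.fill, map_id], rfl, ?_⟩
      simp only [wd] at h
      simp only [Ctx.rw]
      omega
    | succ i =>
      obtain ⟨C, rfl, rfl, rfl⟩ := ih i k (by simp only [wd] at h; omega)
      exact ⟨.unit C, rfl, rfl, rfl⟩
  | node l p r c f ihc ih =>
    intro i k h
    simp only [wd] at h
    rcases lt_or_ge i c.wd with hi | hi
    · obtain ⟨C, rfl, rfl, h'⟩ := ihc i (c.wd - i - 1) (by omega)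
      refine ⟨.left l p r C f, by simp [Ctx.fill, map_id], rfl, ?_⟩
      simp only [Ctx.rw]
      omega
    · obtain ⟨C, rfl, h1, rfl⟩ := ih (i - c.wd) k (by omega)
      refine ⟨.right l p r c C, by simp [Ctx.fill, map_id], ?_, rfl⟩
      simp only [Ctx.lw]
      omega

theorem eq_of_cut_units {m x y : ℕ} (h : (units (m + 1) : Row L).Cut x y) : x = 0 ∧ y = 0 := by
  have key : ∀ {m y : ℕ}, (units m : Row L).Cut 0 y → y = 0 := by
    intro m
    induction m with
    | zero => exact fun h => Eq.symm h
    | succ m ih => exact fun h => ih h.2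
  exact ⟨h.1, key h.2⟩

namespace Split

/-- Two trees the upper one of which is a thin box without boxes on top of it. -/
def thinTop (C : Ctx L) (v : L) (m P : ℕ) : Split L where
  ctx := .hole nil
  sub := C.fill id (unit nil)
  a := P
  row := units C.lw ++ (node v 0 0 (units m) nil ++ units C.rw)

theorem total_thinTop (C : Ctx L) (v : L) (m P : ℕ) :
    (thinTop C v m P).total = C.fill id (node v 0 0 (units m) nil) := by
  rw [total]
  simp only [thinTop, Ctx.fill, map, append_nil]
  exact C.graft_fill rfl

/-- A normal form for uniqueness: either the thin box is the root of the inner tree and carries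
boxes within it, or the outer tree is a pair with the thin box on top. -/
theorem conn_form {u : L → ZMod 2} {D : Split L} {P : ℕ} (hD : D.Valid P) (hu : Weights u D.total)
    (hc : D.sub.IsConn D.a) : ∃ b₀ bs b, D.total.boxes = b₀ :: bs ∧ b ∈ bs ∧ Thin b ∧
      ((∃ K, D.sub = node b.1 0 0 K nil ∧ K.Strict ∧ D.row.Strict ∧ K.boxes ≠ [] ∧ 0 < D.a ∧
        ∀ x y, K.Cut x y → x = 0 ∨ D.a ≤ x) ∨ ∃ C m, D = thinTop C b.1 m P) := by
  have hb := boxes_total hD.len_row hD.len_sub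
  have ho := boxes_outer D
  have hl := hD.len_ctx
  have hp := hD.outer
  rw [isPair_iff hD.len_outer, isConn_iff hD.len_outer] at hp
  obtain ⟨v, K, hK, hKs, ha, hcut⟩ := hc
  have hw : D.row.len = K.wd := by
    have := hD.len_row
    rw [hK] at this
    exact this
  have hg : (graft D.sub D.row).boxes = (v, 0, K.len, 0) :: (graft K D.row).boxes := by
    rw [hK, graft_root _ _ _ hw, boxes, boxes, List.append_nil, len_graft hw]
  have hgp := boxes_graft hw
  rw [hg] at hb
  rcases hp with ⟨β, β', e, hP, hβ, hβ'⟩ | ⟨β, βs, e, hβ, hβs, hP, hc'⟩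
  · rw [ho] at e
    cases hpre : D.ctx.pre with
    | nil =>
      have hC := D.ctx.eq_hole hl hpre
      rw [hpre, hC] at e hb
      simp only [Ctx.post, boxes, List.map_nil, List.nil_append, List.append_nil,
        List.cons.injEq] at e hb
      obtain ⟨rfl, e⟩ := e
      obtain ⟨b', e', rfl⟩ := List.map_eq_singleton_iff.mp e
      rw [e'] at hgp
      obtain ⟨i, v', p, r, m, k, hrow⟩ := eq_node_of_length_boxes (f := D.row) (by rw [e']; rfl)
      have hb' : b' = (v', p, m, r) := by
        rw [hrow] at e'
        simpa [boxes] using e'.symm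
      have hp0 : b'.2.1 = 0 := hβ.1
      have hr0 : b'.2.2.2 = 0 := hβ.2
      rw [hb'] at hp0 hr0
      dsimp only at hp0 hr0
      rw [hp0, hr0] at hrow
      have hwd := hD.len_row
      rw [hrow, len_append, len_units, len, len_units] at hwd
      obtain ⟨C, h1, rfl, rfl⟩ := exists_ctx_unit D.sub i k (by omega)
      refine ⟨_, _, b', hb, hgp.mem_iff.mpr (by simp), hβ, .inr ⟨C, m, ?_⟩⟩
      obtain ⟨C₀, t, a, c⟩ := D
      dsimp only at *
      obtain rfl : a = P := hP
      subst hC h1 hrow hb'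
      rfl
    | cons b₀ pre' =>
      exfalso
      rw [hpre] at e
      simp only [List.map_cons, List.cons_append, List.cons.injEq] at e
      obtain ⟨rfl, e⟩ := e
      obtain rfl : pre' = [] := by
        cases pre' with
        | nil => rfl
        | cons b pre' => simp at e
      simp only [List.map_nil, List.nil_append, List.cons.injEq] at e
      obtain ⟨rfl, -⟩ := e
      have : D.a = 0 := hβ.1
      omega
  · rw [ho] at e
    cases hpre : D.ctx.pre with
    | nil =>
      exfalso
      rw [hpre] at e
      simp only [List.map_nil, List.nil_append, List.cons.injEq] at e
      obtain ⟨rfl, -⟩ := e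
      have : D.a = 0 := hβ.1
      omega
    | cons b₀ pre' =>
      rw [hpre] at e hb
      simp only [List.map_cons, List.cons_append, List.cons.injEq] at e hb
      obtain ⟨rfl, rfl⟩ := e
      simp only [List.mem_append, List.mem_cons] at hβs
      have h3 : D.row.Strict := (strict_iff_boxes _).mpr fun b h =>
        hβs (mapBox some b) (.inr (.inr (.inl (List.mem_map_of_mem h))))
      refine ⟨_, _, (v, 0, K.len, 0), hb, by simp, ⟨rfl, rfl⟩,
        .inl ⟨K, hK, hKs, h3, fun hK0 => ?_, ha, hcut⟩⟩
      have hf := hD.fit_sub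
      rw [hK] at hf
      have hf' : K.Fit D.a := hf.2.1
      cases K with
      | nil =>
        refine hu.ne (v, 0, 0, 0) ?_ rfl
        rw [hb]
        simp [len]
      | unit K =>
        have := hf'.1
        omega
      | node l p r c f => simp [boxes] at hK0

section
variable [LinearOrder L] {u : L → ZMod 2}

/-- At positive height, the lowest positive cut of the row above the thin box bounds a connected
inner tree rooted at this box. At height zero nothing but units sits on the thin box, and it is
split off as the top of an outer pair. -/
theorem exists_conn_split {T : Row L} {P : ℕ} {b : L × ℕ × ℕ × ℕ} {X : ZMod 2} (hT : Weights u T)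
    (hl : T.len = 1) (hf : T.Fit P) (h : OneThin u T P b X) :
    ∃ D : Split L, D.total = T ∧ D.Valid P ∧ D.sub.IsConn D.a := by
  obtain ⟨b₀, bs, rest, h1, h2, h3, ⟨h4, h4'⟩, h5, h6, h7, -⟩ := h
  have hbs : b ∈ bs := h2.mem_iff.mpr List.mem_cons_self
  have hbT : b ∈ T.boxes := by rw [h1]; exact List.mem_cons_of_mem _ hbs
  obtain ⟨C, g, hg, e⟩ := exists_ctx hbT
  rw [h4, h4'] at e
  have hbT' := C.boxes_fill id (T := node b.1 0 0 g nil) rfl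
  rw [← e, mapBox_id, List.map_id, List.map_id, boxes, boxes, List.append_nil] at hbT'
  have hne := hT.root_ne h1 hbs
  have hbe : b = (b.1, 0, g.len, 0) := Prod.ext rfl (Prod.ext h4 (Prod.ext hg.symm h4'))
  obtain ⟨pre', hpre⟩ : ∃ pre', C.pre = b₀ :: pre' := by
    cases hpre : C.pre with
    | nil =>
      rw [hpre, h1] at hbT'
      simp only [List.nil_append, List.cons_append, List.cons.injEq] at hbT'
      rw [hbT'.1] at hne
      exact absurd rfl hne
    | cons b₁ pre' =>
      rw [hpre, h1] at hbT'
      simp only [List.cons_append, List.cons.injEq] at hbT'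
      exact ⟨pre', by rw [hbT'.1]⟩
  have hCl : C.len = 1 := by
    rw [e, C.len_fill id rfl] at hl
    exact hl
  have hperm : (pre' ++ (g.boxes ++ C.post)).Perm rest := by
    rw [hpre, h1] at hbT'
    simp only [List.cons_append, List.append_assoc, List.cons.injEq, true_and] at hbT'
    rw [hbT', hbe] at h2
    exact (List.perm_cons _).mp (List.perm_middle.symm.trans h2)
  have hfull : ∀ b' ∈ pre' ++ (g.boxes ++ C.post), Full b' := fun b' hb' => h5 b' (hperm.mem_iff.mp hb')
  simp only [List.mem_append] at hfull
  have hgs : g.Strict := (strict_iff_boxes g).mpr fun b' hb' => hfull b' (.inr (.inl hb'))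
  have hgf : g.Fit (C.height P) := by
    rw [e] at hf
    exact (C.fit_of_fill id hf).2.1
  rcases Nat.eq_zero_or_pos (C.height P) with h0 | h0
  · rw [h0] at hgf
    obtain ⟨hg0, hg1⟩ := hgs.nonSemi.fit_zero hgf
    rw [((strict_iff g).mp hgs).2] at hg1
    have hgu := eq_units (List.eq_nil_of_length_eq_zero hg1.symm)
    -- Without inputs the box would have size `(0,0,0)`. One input is needed below: units force a
    -- cut to height zero, an empty row does not.
    obtain ⟨m, hm⟩ : ∃ m, g.len = m + 1 := by
      refine Nat.exists_eq_succ_of_ne_zero fun h => hT.ne b hbT ?_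
      rw [hbe, h]
    rw [hm] at hgu
    rw [hgu] at e
    have hcut : ∀ x y, (C.fill id (unit nil)).Cut x y ↔ T.Cut x y := by
      rw [e]
      refine C.cut_fill id id fun x y => ?_
      rw [cut_thin]
      exact ⟨fun ⟨h, h'⟩ => ⟨h, by rw [← h']; exact cut_zero _⟩, fun h => ⟨h.1, (eq_of_cut_units h).2.symm⟩⟩
    have hbox : (C.fill id (unit nil)).boxes = b₀ :: (pre' ++ C.post) := by
      rw [C.boxes_fill id rfl, mapBox_id, List.map_id, List.map_id, hpre]
      simp [boxes]
    have hlen : (C.fill id (unit nil)).len = 1 := (C.len_fill id rfl).trans hCl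
    have hconn : (C.fill id (unit nil)).IsConn P := by
      refine (isConn_iff hlen P).mpr ⟨_, _, hbox, h3, fun b' hb' => ?_, h6,
        fun x y hxy => h7 x y ((hcut x y).mp hxy)⟩
      rcases List.mem_append.mp hb' with h | h
      · exact hfull b' (.inl h)
      · exact hfull b' (.inr (.inr h))
    have hfit : (C.fill id (unit nil)).Fit P := by
      rw [e] at hf
      refine (C.fit_fill id id ?_ ?_).mp hf
      · rw [h0]
        simp [rt]
      · rw [h0]
        simp [Fit, fit_units_zero]
    have hwd : (thinTop C b.1 (m + 1) P).row.len = (thinTop C b.1 (m + 1) P).sub.wd := by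
      simp [thinTop, len, Ctx.wd_fill, wd, Nat.add_assoc, Nat.add_comm 1]
    refine ⟨thinTop C b.1 (m + 1) P, ?_, ⟨hwd, hlen, hfit, .inr hconn, rfl, ?_, ?_⟩, hconn⟩
    · rw [total_thinTop, e]
    · refine (outer_fit hwd hfit le_rfl).1.mpr ?_
      rw [total_thinTop, ← e]
      exact hf
    · refine .inl ((isPair_iff rfl P).mpr ⟨(none, P, (thinTop C b.1 (m + 1) P).row.len,
        (C.fill id (unit nil)).rt P), (some b.1, 0, m + 1, 0), ?_, rfl, ⟨rfl, rfl⟩, ?_⟩)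
      · rw [boxes_outer]
        simp only [thinTop, Ctx.pre, Ctx.post, List.map_nil, boxes_append, boxes_units, boxes,
          len_units, List.nil_append, List.append_nil, mapBox, List.map_cons]
      · obtain ⟨a', c', e', hs', -⟩ := hconn
        have : 0 < (C.fill id (unit nil)).rt P := by
          rw [e']
          exact hs'.rt_pos h6
        exact ⟨fun h => absurd h6 (by omega), fun h => absurd this (Nat.not_lt.mpr (le_of_eq h))⟩
  · classical
    -- The top of the row is a positive cut, so a lowest one exists.
    have hex : ∃ x, 0 < x ∧ ∃ y, g.Cut x y := ⟨_, h0, _, cut_rt g hgf⟩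
    obtain ⟨hx0, y, hxy⟩ := Nat.find_spec hex
    have hmin : ∀ x' y', g.Cut x' y' → x' = 0 ∨ Nat.find hex ≤ x' := fun x' y' h' => by
      rcases Nat.eq_zero_or_pos x' with h | h
      · exact .inl h
      · exact .inr (Nat.find_min' hex ⟨h, y', h'⟩)
    have hle : Nat.find hex ≤ C.height P := Nat.find_min' hex ⟨h0, _, cut_rt g hgf⟩
    generalize Nat.find hex = x at *
    obtain ⟨K, c, rfl, hw, hKf, hKr⟩ := exists_graft_of_cut hxy
    obtain ⟨hKs, hcs⟩ := (strict_graft hw).mp hgs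
    have hconn : (node b.1 0 0 K nil).IsConn x :=
      ⟨b.1, K, rfl, hKs, hx0, fun x' y' h' => hmin x' y' (cut_graft_left hw h')⟩
    let D : Split L := ⟨C, node b.1 0 0 K nil, x, c⟩
    have hDt : D.total = T := by rw [e, total, graft_root _ _ _ hw]
    have hDf : D.sub.Fit D.a := ⟨Nat.zero_le _, hKf, trivial⟩
    have hDl : D.outer.len = 1 := by
      rw [← len_total (D := D) hw rfl, hDt, hl]
    refine ⟨D, hDt, ⟨hw, rfl, hDf, .inr hconn, hDl, ?_, ?_⟩, hconn⟩
    · rw [(outer_fit (D := D) hw hDf hle).1, hDt]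
      exact hf
    · have hob := boxes_outer D
      rw [show D.ctx.pre = b₀ :: pre' from hpre, List.map_cons, List.cons_append] at hob
      refine .inr ((isConn_iff hDl P).mpr ⟨_, _, hob, h3, ?_, h6, fun x y hxy => ?_⟩)
      · intro β hβ
        simp only [List.mem_append, List.mem_cons, List.mem_map] at hβ
        rcases hβ with ⟨b', hb', rfl⟩ | rfl | ⟨b', hb', rfl⟩ | ⟨b', hb', rfl⟩
        · exact hfull b' (.inl hb')
        · refine ⟨hx0, ?_⟩
          change 0 < K.rt x
          exact hKs.rt_pos hx0
        · exact (strict_iff_boxes c).mp hcs b' hb'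
        · exact hfull b' (.inr (.inr hb'))
      · refine h7 x y ?_
        rw [← hDt]
        exact (cut_total_conn (D := D) hw hDf hconn hcs.nonSemi x y).mpr hxy

/-- The result determines the unique thin box besides the root, hence its position. The two normal
forms are distinguished by whether it carries boxes, and within the first form the height `a` is the
lowest positive cut above the thin box. -/
theorem conn_injective {D D' : Split L} {P : ℕ} (hD : D.Valid P) (hD' : D'.Valid P)
    (hu : Weights u D.total) (hc : D.sub.IsConn D.a) (hc' : D'.sub.IsConn D'.a)
    (h : D.total = D'.total) : D = D' := by
  obtain ⟨β, hX⟩ := conn_class hD hu hc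
  obtain ⟨b₀, bs, b, h1, h2, h3, h4⟩ := conn_form hD hu hc
  obtain ⟨b₀', bs', b', h1', h2', h3', h4'⟩ := conn_form hD' (h ▸ hu) hc'
  rw [← h] at h1'
  obtain ⟨rfl, rfl⟩ := List.cons.inj (h1.symm.trans h1')
  obtain ⟨b₁, bs₁, rest, h5, h6, -, -, h7, -⟩ := hX
  obtain ⟨rfl, rfl⟩ := List.cons.inj (h1.symm.trans h5)
  have huniq : ∀ b ∈ bs, Thin b → b = β := fun b hb hb' => by
    rcases List.mem_cons.mp (h6.mem_iff.mp hb) with h | h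
    · exact h
    · exact absurd hb' (h7 b h).not_thin
  obtain rfl := huniq b h2 h3
  obtain rfl := huniq b' h2' h3'
  have key : ∀ {D : Split L} {K : Row L}, D.Valid P → D.sub = node b'.1 0 0 K nil →
      D.total = D.ctx.fill id (node b'.1 0 0 (graft K D.row) nil) := by
    intro D K hD hK
    have hw := hD.len_row
    rw [hK] at hw
    replace hw : D.row.len = K.wd := hw
    rw [total, hK, graft_root _ _ _ hw]
  have hmix : ∀ {D D' : Split L} {K C m}, D.Valid P → D.sub = node b'.1 0 0 K nil → K.boxes ≠ [] →
      Weights u D.total → D' = thinTop C b'.1 m P → D.total ≠ D'.total := by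
    rintro D _ K C m hD hK hK0 hu rfl e
    rw [key hD hK] at e hu
    rw [total_thinTop] at e
    obtain ⟨-, -, -, e⟩ := Ctx.fill_injective hu.nodup e
    have hw := hD.len_row
    rw [hK] at hw
    replace hw : D.row.len = K.wd := hw
    have := boxes_graft (show D.row.len = K.wd from hw)
    rw [e, boxes_units] at this
    exact hK0 (List.append_eq_nil_iff.mp this.symm.eq_nil).1
  rcases h4 with ⟨K, hK, hKs, hrs, hK0, ha, hcut⟩ | ⟨C, m, e1⟩ <;>
    rcases h4' with ⟨K', hK', hKs', hrs', hK0', ha', hcut'⟩ | ⟨C', m', e2⟩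
  · have hn := hu.nodup
    have e := h
    rw [key hD hK] at e hn
    rw [key hD' hK'] at e
    obtain ⟨e1, -, -, e2⟩ := Ctx.fill_injective hn e
    have hw := hD.len_row
    rw [hK] at hw
    replace hw : D.row.len = K.wd := hw
    have hw' := hD'.len_row
    rw [hK'] at hw'
    replace hw' : D'.row.len = K'.wd := hw'
    have hf := hD.fit_sub
    rw [hK] at hf
    have hf' := hD'.fit_sub
    rw [hK'] at hf'
    replace hf : K.Fit D.a := hf.2.1
    replace hf' : K'.Fit D'.a := hf'.2.1
    -- The top of `K'` is a positive cut of the common row; below height `a` it would be a proper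
    -- cut of `K`.
    have hle : ∀ {K K' c c' : Row L} {a a' : ℕ}, c.len = K.wd → c'.len = K'.wd → K.Fit a →
        K'.Fit a' → K.NonSemi → c.NonSemi → 0 < a' → (∀ x y, K.Cut x y → x = 0 ∨ a ≤ x) →
        graft K c = graft K' c' → a ≤ a' := by
      intro K K' c c' a a' hw hw' hf hf' hs hs' ha hcut e
      have h1 := cut_graft_left hw' (cut_rt K' hf')
      rw [← e] at h1
      rcases cut_graft hw hf hs hs' h1 with ⟨-, -, h2⟩ | ⟨x', y', h2, -⟩
      · rcases hcut _ _ h2 with h | h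
        · omega
        · exact h
      · omega
    have haa : D.a = D'.a := le_antisymm
      (hle hw hw' hf hf' hKs.nonSemi hrs.nonSemi ha' hcut e2)
      (hle hw' hw hf' hf hKs'.nonSemi hrs'.nonSemi ha hcut' e2.symm)
    rw [← haa] at hf'
    obtain ⟨rfl, e3⟩ := graft_inj hw hKs hKs' hf hf' hw' e2
    obtain ⟨C, t, a, c⟩ := D
    obtain ⟨C', t', a', c'⟩ := D'
    dsimp only at *
    subst e1 hK hK' haa e3
    rfl
  · exact absurd h (hmix hD hK hK0 hu e2)
  · exact absurd h.symm (hmix hD' hK' hK0' (h ▸ hu) e1)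
  · subst e1 e2
    have hn := hu.nodup
    rw [total_thinTop] at hn
    rw [total_thinTop, total_thinTop] at h
    obtain ⟨rfl, -, -, e⟩ := Ctx.fill_injective hn h
    have := congrArg len e
    rw [len_units, len_units] at this
    rw [this]

/-- The substitutions with the same result come in pairs. -/
theorem exists_partner {D : Split L} {P : ℕ} (hD : D.Valid P) (hu : Weights u D.total) :
    ∃ D' : Split L, D'.Valid P ∧ D'.total = D.total ∧ D' ≠ D ∧ D'.val u = D.val u + 1 ∧
      ∀ E : Split L, E.Valid P → E.total = D.total → E = D ∨ E = D' := by
  have hlen := hD.len_total_eq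
  have hfit := hD.fit_total
  have h11 : (1 : ZMod 2) + 1 = 0 := rfl
  have hne : ∀ {X Y : ZMod 2} , X = Y + 1 → X ≠ Y := by decide
  rcases hD.sub with hp | hc
  · obtain ⟨C, l, v, a, r, g₁, g₂, g₃, rfl, -⟩ := exists_pair_eq hD.len_row hp
    rcases pair_class hD hu with h | ⟨b, h⟩
    -- One thin box besides the root: the partner of merging it downwards is the substitution with a
    -- connected inner tree.
    · obtain ⟨D', e, hD', hc'⟩ := exists_conn_split hu hlen hfit h
      obtain ⟨b, h'⟩ := conn_class hD' (e ▸ hu) hc'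
      rw [e] at h'
      have hX := (h.unique hu h').2.symm
      refine ⟨D', hD', e, fun e' => hne hX (by rw [e']), hX, fun E hE hEt => ?_⟩
      rcases hE.sub with hp' | hc''
      · obtain ⟨C', l', v', a', r', g₁', g₂', g₃', rfl, -⟩ := exists_pair_eq hE.len_row hp'
        rcases pair_class hE (hEt ▸ hu) with h'' | ⟨b', h''⟩
        · rw [hEt] at h''
          obtain rfl : v' = v := congrArg Prod.fst (h''.unique hu h).1
          exact .inl (pair_injective (hEt ▸ hu.nodup) hEt)
        · rw [hEt] at h''
          exact absurd h'' h.not_twoThin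
      · exact .inr (conn_injective hE hD' (hEt ▸ hu) hc'' hc' (hEt.trans e.symm))
    -- Two thin boxes: the partner merges the other one, with opposite exponent by `TwoThin.swap`.
    · obtain ⟨C', l', a', r', g₁', g₂', g₃', e, hD'⟩ :=
        exists_pair_split hu hlen hfit (.inr ⟨_, _, h.swap hu⟩)
      have hval : (pair C' l' b.1 a' r' g₁' g₂' g₃').val u = (pair C l v a r g₁ g₂ g₃).val u + 1 := by
        rcases pair_class hD' (e ▸ hu) with h' | ⟨b', h'⟩
        · rw [e] at h'
          exact absurd h h'.not_twoThin
        · rw [e] at h'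
          rcases h.unique hu h' with ⟨h1, h2⟩ | ⟨-, h2⟩
          · exfalso
            obtain ⟨b₀, bs, h3, h4, -⟩ := h
            have h5 := hu.nodup
            rw [labels, h3, List.map_cons, List.nodup_cons, (h4.map _).nodup_iff] at h5
            have h6 : b.1 = v := congrArg Prod.fst h1
            simp [h6] at h5
          · exact h2
      refine ⟨_, hD', e, fun e' => hne hval (by rw [e']), hval, fun E hE hEt => ?_⟩
      rcases hE.sub with hp' | hc''
      · obtain ⟨C'', l'', v'', a'', r'', g₁'', g₂'', g₃'', rfl, -⟩ := exists_pair_eq hE.len_row hp'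
        rcases pair_class hE (hEt ▸ hu) with h'' | ⟨b', h''⟩
        · rw [hEt] at h''
          exact absurd h h''.not_twoThin
        · rw [hEt] at h''
          rcases h.unique hu h'' with ⟨h1, -⟩ | ⟨h1, -⟩
          · obtain rfl : v'' = v := congrArg Prod.fst h1
            exact .inl (pair_injective (hEt ▸ hu.nodup) hEt)
          · obtain rfl : v'' = b.1 := congrArg Prod.fst h1
            exact .inr (pair_injective (hEt ▸ hu.nodup) (hEt.trans e.symm))
      · obtain ⟨b', h'⟩ := conn_class hE (hEt ▸ hu) hc''
        rw [hEt] at h'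
        exact absurd h h'.not_twoThin
  -- Conversely, a connected inner tree is paired with merging the thin box besides the root with
  -- the box below it.
  · obtain ⟨b, h⟩ := conn_class hD hu hc
    obtain ⟨C', l', a', r', g₁', g₂', g₃', e, hD'⟩ :=
      exists_pair_split hu hlen hfit (.inl ⟨_, h⟩)
    have hval : (pair C' l' b.1 a' r' g₁' g₂' g₃').val u = D.val u + 1 := by
      rcases pair_class hD' (e ▸ hu) with h' | ⟨b', h'⟩
      · rw [e] at h'
        rw [(h.unique hu h').2, add_assoc, h11, add_zero]
      · rw [e] at h'
        exact absurd h' h.not_twoThin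
    refine ⟨_, hD', e, fun e' => hne hval (by rw [e']), hval, fun E hE hEt => ?_⟩
    rcases hE.sub with hp' | hc''
    · obtain ⟨C'', l'', v'', a'', r'', g₁'', g₂'', g₃'', rfl, -⟩ := exists_pair_eq hE.len_row hp'
      rcases pair_class hE (hEt ▸ hu) with h'' | ⟨b', h''⟩
      · rw [hEt] at h''
        obtain rfl : v'' = b.1 := congrArg Prod.fst (h''.unique hu h).1
        exact .inr (pair_injective (hEt ▸ hu.nodup) (hEt.trans e.symm))
      · rw [hEt] at h''
        exact absurd h'' h.not_twoThin
    · exact .inl (conn_injective hE hD (hEt ▸ hu) hc'' hc hEt)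

end

end Split
end Row

/-! ### Signs of substitutions. -/

namespace Row

section pairs
variable {X : Type*}

/-- The sum of `β a b` over the members `a` of a list and the members `b` of another list. -/
def cross (β : X → X → ZMod 2) (l₁ l₂ : List X) : ZMod 2 :=
  (l₁.map fun a => (l₂.map (β a)).sum).sum

variable {β : X → X → ZMod 2}

theorem cross_append_left (l₁ l₁' l₂ : List X) :
    cross β (l₁ ++ l₁') l₂ = cross β l₁ l₂ + cross β l₁' l₂ := by
  simp [cross]

theorem cross_append_right (l₁ l₂ l₂' : List X) :
    cross β l₁ (l₂ ++ l₂') = cross β l₁ l₂ + cross β l₁ l₂' := by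
  simp [cross, List.sum_map_add]

theorem cross_perm {l₁ l₁' l₂ l₂' : List X} (h : l₁.Perm l₁') (h' : l₂.Perm l₂') :
    cross β l₁ l₂ = cross β l₁' l₂' := by
  rw [cross, cross, (h.map _).sum_eq]
  congr 1
  exact List.map_congr_left fun a _ => (h'.map _).sum_eq

theorem pairs_append (l₁ l₂ : List X) :
    pairs β (l₁ ++ l₂) = pairs β l₁ + pairs β l₂ + cross β l₁ l₂ := by
  induction l₁ with
  | nil => simp [pairs, cross]
  | cons a l₁ ih =>
    simp only [List.cons_append, pairs, ih, List.map_append, List.sum_append, cross,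
      List.map_cons, List.sum_cons]
    ring

theorem pairs_cons (a : X) (l : List X) : pairs β (a :: l) = pairs β l + cross β [a] l := by
  simp [pairs, cross, add_comm]

/-- Interchanging two blocks costs the product of their total degrees. -/
theorem cross_add_cross {τ : X → ZMod 2} {l₁ l₂ : List X}
    (h : ∀ a ∈ l₁, ∀ b ∈ l₂, β a b + β b a = τ a * τ b) :
    cross β l₁ l₂ + cross β l₂ l₁ = (l₁.map τ).sum * (l₂.map τ).sum := by
  induction l₁ with
  | nil => simp [cross]
  | cons a l₁ ih =>
    have h1 := ih fun b hb => h b (List.mem_cons_of_mem _ hb)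
    have h2 : (l₂.map (β a)).sum + (l₂.map fun b => β b a).sum = τ a * (l₂.map τ).sum := by
      rw [← List.sum_map_add, ← List.sum_map_mul_left]
      exact congrArg List.sum (List.map_congr_left fun b hb => h a List.mem_cons_self b hb)
    have h3 : cross β l₂ (a :: l₁) = (l₂.map fun b => β b a).sum + cross β l₂ l₁ := by
      simp [cross, List.sum_map_add]
    rw [h3]
    simp only [cross, List.map_cons, List.sum_cons] at h1 ⊢
    linear_combination h1 + h2

end pairs

variable {L M M' : Type}

theorem sum_deg (f : Row L) {h : ℕ} (hf : f.Fit h) :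
    (f.boxes.map deg).sum = h + f.rt h + f.wd + f.len := by
  have := congrArg (Int.cast (R := ZMod 2)) (sum_degree f hf)
  push_cast [List.map_map] at this
  simp only [CharTwo.sub_eq_add] at this
  rw [← this]
  refine congrArg List.sum (List.map_congr_left fun b _ => ?_)
  simp [deg, CharTwo.sub_eq_add]

/-- The exponents of the signs of the composite of two rows and of the rows. -/
theorem sgn_graft {β : L × ℕ × ℕ × ℕ → L × ℕ × ℕ × ℕ → ZMod 2} {f g : Row L} (h : g.len = f.wd) :
    ∀ {a b : ℕ}, f.Fit a → g.Fit b →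
      (∀ x ∈ f.boxes, ∀ y ∈ g.boxes, β x y + β y x = deg x * deg y) →
      (graft f g).sgn (a + b) + pairs β (graft f g).boxes = f.sgn a + g.sgn b +
        (g.boxes.map deg).sum * f.rt a + b * (f.len + f.wd) + pairs β (f.boxes ++ g.boxes) := by
  refine graft_induction (motive := fun f g => ∀ {a b : ℕ}, f.Fit a → g.Fit b →
      (∀ x ∈ f.boxes, ∀ y ∈ g.boxes, β x y + β y x = deg x * deg y) →
      (graft f g).sgn (a + b) + pairs β (graft f g).boxes = f.sgn a + g.sgn b +
        (g.boxes.map deg).sum * f.rt a + b * (f.len + f.wd) + pairs β (f.boxes ++ g.boxes))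
    (by intro a b _ _ _; simp [graft, sgn, boxes, pairs, len, wd]) ?_ ?_ f g h
  · rintro f T g hT hg ih a b ⟨rfl, hf⟩ hTg hβ
    obtain ⟨hTf, hgf⟩ := (fit_append _ _ _).mp hTg
    simp only [boxes, boxes_append, List.mem_append] at hβ
    have e1 := ih hf hgf fun x hx y hy => hβ x hx y (.inr hy)
    have e2 := cross_add_cross (β := β) (τ := deg) (l₁ := f.boxes) (l₂ := T.boxes)
      fun x hx y hy => hβ x hx y (.inl hy)
    have e3 := sum_deg f hf
    have e4 := sum_deg T hTf
    have e5 : (g.len : ZMod 2) = f.wd := congrArg Nat.cast hg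
    have e6 : (T.len : ZMod 2) = 1 := by rw [hT]; rfl
    have e7 := len_graft hg
    rw [Nat.zero_add] at e1
    rw [graft_unit f hT, sgn_append, Nat.zero_add, e7]
    simp only [boxes_append, boxes, pairs_append, cross_append_right,
      cross_perm (List.Perm.refl _) (boxes_graft hg), sgn, sgn_append, List.map_append,
      List.sum_append, rt, len, wd, Nat.cast_add, Nat.cast_one, e6, e5] at e1 ⊢
    rw [e3, e4, e6] at e2
    rw [e4, e6]
    generalize ((g.boxes.map deg).sum) = X at *
    grind
  · rintro l p r c f g₁ g₂ h1 h2 ihc ih a b ⟨hp, hc, hf⟩ hg hβ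
    obtain ⟨hg1, hg2⟩ := (fit_append _ _ _).mp hg
    simp only [boxes, boxes_append, List.mem_append, List.mem_cons] at hβ
    have e1 := ihc hc hg1 fun x hx y hy => hβ x (.inr (.inl hx)) y (.inl hy)
    have e2 := ih hf hg2 fun x hx y hy => hβ x (.inr (.inr hx)) y (.inr hy)
    have e3 := cross_add_cross (β := β) (τ := deg) (l₁ := f.boxes) (l₂ := g₁.boxes)
      fun x hx y hy => hβ x (.inr (.inr hx)) y (.inl hy)
    rw [sum_deg f hf] at e3
    have e4 := sum_deg g₁ hg1
    have e5 := sum_deg g₂ hg2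
    have e6 : (g₁.len : ZMod 2) = c.wd := congrArg Nat.cast h1
    have e7 : (g₂.len : ZMod 2) = f.wd := congrArg Nat.cast h2
    have e8 : a + b - p = a - p + b := Nat.sub_add_comm hp
    have e9 : c.rt (a - p) + g₁.rt b + r = c.rt (a - p) + r + g₁.rt b := by omega
    have e10 : (a : ZMod 2) = (a - p : ℕ) + p := by rw [← Nat.cast_add, Nat.sub_add_cancel hp]
    have e11 := fun l => cross_perm (β := β) (boxes_graft h1) (List.Perm.refl l)
    rw [graft_node l p r h1, sgn, e8, rt_graft h1 b hc, e9, wd_graft h1, len_graft h1, len_graft h2,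
      boxes, len_graft h1]
    simp only [boxes, boxes_append, List.cons_append, pairs_cons, pairs_append, cross_append_left,
      cross_append_right, cross_perm (List.Perm.refl _) (boxes_graft h1),
      cross_perm (List.Perm.refl _) (boxes_graft h2), e11,
      sgn, sgn_append, List.map_append, List.sum_append, rt, len, wd, Nat.cast_add, Nat.cast_one,
      e4, e5, e6, e7] at e1 e2 e3 ⊢
    clear ihc ih hβ
    grind

section pairs
variable {X : Type*} {β β' : X → X → ZMod 2}

theorem pairs_congr {l : List X} (h : ∀ a ∈ l, ∀ b ∈ l, β a b = β' a b) : pairs β l = pairs β' l := by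
  induction l with
  | nil => rfl
  | cons a l ih =>
    rw [pairs, pairs, ih fun b hb c hc => h b (List.mem_cons_of_mem _ hb) c (List.mem_cons_of_mem _ hc)]
    congr 2
    exact List.map_congr_left fun b hb => h a List.mem_cons_self b (List.mem_cons_of_mem _ hb)

theorem pairs_perm {l l' : List X} (h : l.Perm l') (hβ : ∀ a b, β a b = β b a) :
    pairs β l = pairs β l' := by
  induction h with
  | nil => rfl
  | cons a h ih => rw [pairs, pairs, ih, (h.map _).sum_eq]
  | swap a b l =>
    simp only [pairs, List.map_cons, List.sum_cons, hβ a b]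
    ring
  | trans _ _ ih ih' => exact ih.trans ih'

theorem cross_mul (f g : X → ZMod 2) (l₁ l₂ : List X) :
    cross (fun a b => f a * g b) l₁ l₂ = (l₁.map f).sum * (l₂.map g).sum := by
  simp [cross, List.sum_map_mul_left, List.sum_map_mul_right]

theorem pairs_add (l : List X) : pairs (fun a b => β a b + β' a b) l = pairs β l + pairs β' l := by
  induction l with
  | nil => simp [pairs]
  | cons a l ih =>
    rw [pairs, ih, pairs, pairs, List.sum_map_add]
    ring

end pairs

/-- The effect on the exponent of a sign of a change of the tree in the hole of a context. -/
theorem Ctx.sgn_fill (φ : L → M) (ψ : L → M') {T : Row M} {T' : Row M'} (hT : T.len = 1)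
    (hT' : T'.len = 1) (hw : T.wd = T'.wd) (C : Ctx L) : ∀ {h : ℕ},
    T.rt (C.height h) = T'.rt (C.height h) → (C.fill φ T).sgn h + (C.fill ψ T').sgn h =
      T.sgn (C.height h) + T'.sgn (C.height h) := by
  have hc : ∀ C : Ctx L, (C.fill φ T).wd = (C.fill ψ T').wd := fun C => by
    rw [C.wd_fill, C.wd_fill, hw]
  have hm : ∀ (c : Row L) h, (c.map φ).sgn h = (c.map ψ).sgn h := fun c h => by
    rw [sgn_map, sgn_map]
  induction C with
  | hole f =>
    intro h e
    simp only [fill, sgn_append, hm f, height, len_map, hT, hT', hw] at e ⊢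
    rw [e]
    grind
  | unit C ih => exact ih
  | left l p r C f ih =>
    intro h e
    have := ih (h := h - p) e
    simp only [fill, sgn, hc C, len_map, C.rt_fill φ ψ e, hm f, C.len_fill _ hT, C.len_fill _ hT',
      height] at this ⊢
    grind
  | right l p r c C ih =>
    intro h e
    have := ih e
    simp only [fill, sgn, len_map, wd_map, rt_map, hm c, C.len_fill _ hT, C.len_fill _ hT',
      height] at this ⊢
    grind

/-- For a tree with `n` boxes, `(2-n)(3-n)/2` is the term `|S|(|S|+1)/2`. Together with `k * l` the
two constants depend only on `k + l`, hence only on the number of boxes of the result. -/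
theorem const_eq (k l : ℤ) : (((2 - k) * (3 - k) / 2 : ℤ) + ((2 - l) * (3 - l) / 2 : ℤ) +
    k * l : ZMod 2) = (((k + l) * (k + l) - 5 * (k + l) + 12) / 2 : ℤ) := by
  obtain ⟨m, hm⟩ := Int.even_mul_succ_self (2 - k)
  obtain ⟨m', hm'⟩ := Int.even_mul_succ_self (2 - l)
  have h1 : (2 - k) * (3 - k) / 2 = m := by
    rw [show (2 - k) * (3 - k) = 2 * m by linarith, Int.mul_ediv_cancel_left _ two_ne_zero]
  have h2 : (2 - l) * (3 - l) / 2 = m' := by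
    rw [show (2 - l) * (3 - l) = 2 * m' by linarith, Int.mul_ediv_cancel_left _ two_ne_zero]
  have h3 : ((k + l) * (k + l) - 5 * (k + l) + 12) / 2 = m + m' + k * l := by
    rw [show (k + l) * (k + l) - 5 * (k + l) + 12 = 2 * (m + m' + k * l) by linarith,
      Int.mul_ediv_cancel_left _ two_ne_zero]
  rw [h1, h2, h3]
  push_cast
  rfl

namespace Split
variable [LinearOrder L] {D : Split L} {P : ℕ}

/-- The exponent of the sign of a substitution in the relation of an `L∞`-algebra, for boxes of
the degrees `d`. -/
def exponent (d : L → ZMod 2) (D : Split L) (P : ℕ) : ZMod 2 :=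
  (D.outer.boxes.length + 1) * D.sub.boxes.length + D.ctx.pre.length * (D.sub.boxes.length + 1) +
    pairs (inv d) D.word + D.sub.boxes.length * ((D.ctx.pre.map Prod.fst).map d).sum +
    D.outer.braceSgn P + D.sub.braceSgn D.a

/-- The part of the exponent which depends only on the result of the substitution. -/
def base (u d : L → ZMod 2) (T : Row L) (P : ℕ) : ZMod 2 :=
  T.sgn P + pairs (fun a b => if b < a then (d a + u a) * (d b + u b) else 0) T.labels +
    pairs (fun a b => if b < a then (d a + u a) * d b else d a * (d b + u b)) T.labels +
    (T.wd + 1) * P + (T.boxes.length + 1) * (T.labels.map d).sum +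
    ((((T.boxes.length : ℤ) + 1) * (T.boxes.length + 1) - 5 * (T.boxes.length + 1) + 12) / 2 : ℤ)

/-- `Ctx.sgn_fill` compares the result with the outer tree around the hole, and `sgn_graft` compares
the contents of the hole; the terms in the height above the inner tree cancel. -/
theorem Valid.sgn_eq (hD : D.Valid P) {τ : L → ZMod 2} (hn : D.total.labels.Nodup)
    (hτ : ∀ b ∈ D.total.boxes, deg b = τ b.1) :
    D.total.sgn P + pairs (fun a b => if b < a then τ a * τ b else 0) D.total.labels =
      D.outer.sgn P + D.sub.sgn D.a + (D.sub.wd + 1) * D.a +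
        pairs (fun a b => if b < a then τ a * τ b else 0) D.word := by
  have hb := boxes_total hD.len_row hD.len_sub
  have hp := boxes_graft hD.len_row
  have hw := (labels_total hD.len_row hD.len_sub).nodup_iff.mp hn
  obtain ⟨b, e⟩ := Nat.exists_eq_add_of_le hD.height
  have hr : (graft D.sub D.row).rt (D.ctx.height P) =
      (node none D.a (D.sub.rt D.a) (D.row.map some) nil).rt (D.ctx.height P) := by
    rw [e, rt_graft hD.len_row b hD.fit_sub, rt, rt, rt_map, Nat.add_sub_cancel_left, Nat.add_comm]
  have hf : D.row.Fit b := by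
    have := D.ctx.fit_of_fill some hD.fit_outer
    rw [e, Fit, fit_map, Nat.add_sub_cancel_left] at this
    exact this.2.1
  have hl := (len_graft hD.len_row).trans hD.len_sub
  have h1 := D.ctx.sgn_fill id some hl rfl (by rw [wd_graft hD.len_row, wd, wd_map]; rfl) hr
  have h2 := sgn_graft (β := fun a b => if b.1 < a.1 then τ a.1 * τ b.1 else 0) hD.len_row
    hD.fit_sub hf (fun x hx y hy => by
      have hxy : x.1 ≠ y.1 := by
        have h3 := (List.nodup_append.mp (List.nodup_append.mp hw).2.1).2.2
        exact h3 _ (List.mem_map_of_mem hx) _ (List.mem_append_left _ (List.mem_map_of_mem hy))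
      rw [hτ x (by rw [hb]; simp [hp.mem_iff, hx]), hτ y (by rw [hb]; simp [hp.mem_iff, hy])]
      rcases lt_or_gt_of_ne hxy with h | h
      · simp only [h, h.not_gt, if_true, if_false]; ring
      · simp only [h, h.not_gt, if_true, if_false]; ring)
  have h3 := sum_deg D.row hf
  have h4 : (D.row.len : ZMod 2) = D.sub.wd := congrArg Nat.cast hD.len_row
  have h5 : (D.sub.len : ZMod 2) = 1 := congrArg Nat.cast hD.len_sub
  have e' : (D.ctx.height P : ZMod 2) = D.a + b := by rw [e]; push_cast; rfl
  have e'' : D.ctx.height P - D.a = b := by omega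
  rw [show D.ctx.fill id (graft D.sub D.row) = D.total from rfl,
    show D.ctx.fill some (node none D.a (D.sub.rt D.a) (D.row.map some) nil) = D.outer from rfl,
    sgn, e'', sgn_map, rt_map, wd_map, len_map, len, e', e] at h1
  have h6 : D.word = (D.ctx.pre ++ (D.sub.boxes ++ (D.row.boxes ++ D.ctx.post))).map Prod.fst := by
    simp [word, labels]
  rw [h6, labels, hb, pairs_map, pairs_map]
  have h7 := fun l => cross_perm (β := fun a b : L × ℕ × ℕ × ℕ => if b.1 < a.1 then τ a.1 * τ b.1 else 0)
    hp (List.Perm.refl l)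
  simp only [pairs_append, cross_append_left, cross_append_right, h7,
    cross_perm (List.Perm.refl _) hp, h3, h4, h5, sgn, Nat.cast_zero] at h1 h2 ⊢
  generalize cross (fun a b : L × ℕ × ℕ × ℕ => if b.1 < a.1 then τ a.1 * τ b.1 else 0) = X at *
  clear h6 h7 hp hb hw hn hτ
  grind

/-- All contributions are rewritten over the list of boxes in the order of the word. Every pairing
that remains besides `inv u` is symmetric or occurs in `sgn_eq`, and therefore depends only on the
result. -/
theorem Valid.exponent_eq (hD : D.Valid P) {d u : L → ZMod 2} (hn : D.total.labels.Nodup)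
    (hl : 2 ≤ D.sub.boxes.length) (hd : ∀ b ∈ D.total.boxes, (thinDeg b.2 : ZMod 2) = d b.1)
    (hu : ∀ b ∈ D.total.boxes, deg b = d b.1 + u b.1) :
    D.exponent d P = base u d D.total P + D.val u := by
  have hs := hD.sgn_eq (τ := fun a => d a + u a) hn hu
  have hb := boxes_total hD.len_row hD.len_sub
  have hp := labels_total hD.len_row hD.len_sub
  have hp' : D.total.boxes.Perm (D.ctx.pre ++ (D.sub.boxes ++ (D.row.boxes ++ D.ctx.post))) := by
    rw [hb, List.append_assoc]
    refine List.Perm.append_left _ ?_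
    rw [← List.append_assoc]
    exact List.Perm.append_right _ (boxes_graft hD.len_row)
  -- This kernel is symmetric, so the word may be replaced by the standard order of the result.
  have hperm := pairs_perm (β := fun a b => if b < a then (d a + u a) * d b else d a * (d b + u b))
    hp (fun a b => by
      rcases lt_trichotomy a b with h | rfl | h
      · simp only [h, h.not_gt, if_true, if_false]; ring
      · rfl
      · simp only [h, h.not_gt, if_true, if_false]; ring)
  have hlen : (D.total.boxes.length : ZMod 2) = D.ctx.pre.length + (D.sub.boxes.length +
      (D.row.boxes.length + D.ctx.post.length)) := by
    rw [hp'.length_eq]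
    push_cast [List.length_append]
    rfl
  have hout : D.outer.boxes.length = D.ctx.pre.length + (D.row.boxes.length + D.ctx.post.length + 1) := by
    rw [boxes_outer]
    simp
  have hconst := const_eq D.outer.boxes.length D.sub.boxes.length
  have hkl : (D.outer.boxes.length : ℤ) + D.sub.boxes.length = D.total.boxes.length + 1 := by
    rw [hp'.length_eq, hout]
    push_cast [List.length_append]
    ring
  rw [hkl] at hconst
  -- The hole has the degree of the brace that fills it: the sum of the degrees of its boxes,
  -- shifted by `2 - l`.
  have hnone : (thinDeg (D.a, D.row.len, D.sub.rt D.a) : ZMod 2) =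
      (D.sub.boxes.map fun b => (thinDeg b.2 : ZMod 2)).sum + D.sub.boxes.length := by
    rw [hD.len_row, Tree.thinDeg_eq ⟨hD.len_sub, hD.fit_sub, rfl, rfl, hD.sub⟩ hl rfl]
    push_cast [List.map_map]
    rw [CharTwo.sub_eq_add, show (2 : ZMod 2) = 0 from rfl, add_zero]
    rfl
  have hnone' : deg ((none, D.a, D.row.len, D.sub.rt D.a) : Option L × ℕ × ℕ × ℕ) =
      (D.sub.boxes.map deg).sum := by
    rw [sum_deg _ hD.fit_sub, hD.len_sub, deg, hD.len_row]
    push_cast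
    rfl
  -- This holds for each pair of labels separately. It exchanges inversions weighted by the degrees
  -- `d` for inversions weighted by `u`.
  have hpairs : pairs (inv d) D.word + pairs (fun a b => (thinDeg a.2 : ZMod 2) * deg b)
      (D.ctx.pre ++ (D.sub.boxes ++ (D.row.boxes ++ D.ctx.post))) +
        pairs (fun a b => if b < a then (d a + u a) * (d b + u b) else 0) D.word =
      pairs (inv u) D.word +
        pairs (fun a b => if b < a then (d a + u a) * d b else d a * (d b + u b)) D.word := by
    have e : D.word =
        (D.ctx.pre ++ (D.sub.boxes ++ (D.row.boxes ++ D.ctx.post))).map Prod.fst := by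
      simp [word, labels]
    rw [e]
    simp only [pairs_map, ← pairs_add]
    refine pairs_congr fun a ha b hb => ?_
    rw [hd a (hp'.mem_iff.mpr ha), hu b (hp'.mem_iff.mpr hb)]
    simp only [inv]
    split_ifs <;> grind
  have hval : D.val u = (D.ctx.pre.length : ZMod 2) + D.sub.boxes.length *
      ((D.row.boxes.length + D.ctx.post.length) + ((D.row.boxes ++ D.ctx.post).map fun b =>
        (thinDeg b.2 : ZMod 2)).sum + ((D.row.boxes ++ D.ctx.post).map deg).sum) +
        pairs (inv u) D.word := by
    have e : (D.row.labels ++ D.ctx.post.map Prod.fst) = (D.row.boxes ++ D.ctx.post).map Prod.fst := by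
      simp [labels]
    have e' : ∀ l : List (L × ℕ × ℕ × ℕ), (∀ b ∈ l, b ∈ D.total.boxes) →
        ((l.map Prod.fst).map fun b => 1 + u b).sum =
          l.length + (l.map fun b => (thinDeg b.2 : ZMod 2)).sum + (l.map deg).sum := by
      intro l hl
      induction l with
      | nil => simp
      | cons b l ih =>
        have hb := hl b List.mem_cons_self
        simp only [List.map_cons, List.sum_cons, ih fun b hb => hl b (List.mem_cons_of_mem _ hb),
          hd b hb, hu b hb, List.length_cons, Nat.cast_add, Nat.cast_one]
        grind
    rw [val_eq, e, e' _ fun b hb => hp'.mem_iff.mpr (by simp at hb ⊢; tauto), labels,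
      List.length_map, List.length_append, Nat.cast_add]
  have hsum : ∀ l : List (L × ℕ × ℕ × ℕ), (∀ b ∈ l, b ∈ D.total.boxes) →
      ((l.map Prod.fst).map d).sum = (l.map fun b => (thinDeg b.2 : ZMod 2)).sum := by
    intro l hl
    rw [List.map_map]
    exact congrArg List.sum (List.map_congr_left fun b hb => (hd b (hl b hb)).symm)
  have hpre := hsum D.ctx.pre fun b hb => hp'.mem_iff.mpr (by simp [hb])
  have htot : (D.total.labels.map d).sum =
      ((D.ctx.pre ++ (D.sub.boxes ++ (D.row.boxes ++ D.ctx.post))).map fun b =>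
        (thinDeg b.2 : ZMod 2)).sum := by
    rw [labels, hsum _ fun b hb => hb, (hp'.map _).sum_eq]
  have hlen' : (D.outer.boxes.length : ZMod 2) = D.ctx.pre.length +
      (D.row.boxes.length + D.ctx.post.length + 1) := by
    rw [hout]
    push_cast
    rfl
  have hout1 : (D.outer.boxes.map fun b => (thinDeg b.2 : ZMod 2)).sum =
      (D.total.labels.map d).sum + D.sub.boxes.length := by
    rw [htot, boxes_outer]
    simp only [List.map_append, List.map_cons, List.sum_append, List.sum_cons, List.map_map,
      hnone, Function.comp_def, mapBox]
    ring
  have hdeg : ∀ b : L × ℕ × ℕ × ℕ, deg (mapBox some b) = deg b := fun _ => rfl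
  -- Opening the hole in the outer pairing yields the pairing of all boxes; the shift by `l` in the
  -- degree of the hole produces the correction with the later boxes.
  have hout2 : pairs (fun a b => (thinDeg a.2 : ZMod 2) * deg b) D.outer.boxes +
      pairs (fun a b => (thinDeg a.2 : ZMod 2) * deg b) D.sub.boxes =
      pairs (fun a b => (thinDeg a.2 : ZMod 2) * deg b)
        (D.ctx.pre ++ (D.sub.boxes ++ (D.row.boxes ++ D.ctx.post))) +
        D.sub.boxes.length * ((D.row.boxes ++ D.ctx.post).map deg).sum := by
    rw [boxes_outer, ← List.map_append]
    simp only [pairs_append, pairs_cons, cross_append_right, pairs_map, cross_mul,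
      List.map_append, List.sum_append, List.map_map, List.map_cons, List.sum_cons, List.map_nil,
      List.sum_nil, hnone, hnone', Function.comp_def, hdeg]
    simp only [mapBox]
    grind
  clear hb hp hp' hn hd hu hdeg hsum hnone hnone' hkl
  rw [exponent, base, hval, hpre, braceSgn, braceSgn, wd_total hD.len_row, ← hconst, hperm, hout1]
  simp only [List.map_append, List.sum_append] at htot hout2 ⊢
  rw [htot]
  push_cast
  grind

end Split
end Row

/-! ### A brace as a filling of the hole. -/

namespace Row
variable {L : Type}

open Classical in
/-- The size of the box with the label `none`. -/
noncomputable def holeSize (t : Row (Option L)) : ℕ × ℕ × ℕ :=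
  if h : ∃ b ∈ t.boxes, b.1 = none then h.choose.2 else (0, 0, 0)

theorem holeSize_eq {t : Row (Option L)} (ht : t.labels.Nodup) {b : Option L × ℕ × ℕ × ℕ}
    (hb : b ∈ t.boxes) (h : b.1 = none) : t.holeSize = b.2 := by
  have hex : ∃ b ∈ t.boxes, b.1 = none := ⟨b, hb, h⟩
  rw [holeSize, dif_pos hex]
  have := hex.choose_spec
  exact congrArg Prod.snd (List.inj_on_of_nodup_map ht this.1 hb (this.2.trans h.symm))

end Row

namespace LinQuiver
open Row
variable {k : Type w₁} [CommRing k] {U : Type u} [Category.{v} U] (A : LinQuiver.{u, v, w₁, w₂, w₃} k U)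
variable {L : Type}

/-- The evaluation of a tree, one of whose boxes is filled by a brace. -/
theorem ev_brace {l : ℕ} (hl : 2 ≤ l) (g : Fin l → L) (x : L → A.Total) {t : Row (Option L)}
    (ht : t.len = 1) (hn : t.labels.Nodup) (h : none ∈ t.labels) {P : ℕ} (hf : t.Fit P) :
    A.ev (fun o => o.elim (A.brace l fun i => x (g i)) x) t 0 P =
      ∑ t' ∈ trees (List.ofFn g) t.holeSize.1 t.holeSize.2.1 t.holeSize.2.2,
        parity (t'.braceSgn t.holeSize.1) • A.ev x (subst t' t) 0 P := by
  classical
  set z := A.brace l fun i => x (g i)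
  set s := trees (List.ofFn g) t.holeSize.1 t.holeSize.2.1 t.holeSize.2.2
  obtain ⟨Λ, hΛ⟩ := A.exists_ev_linear (fun o : Option L => o.elim 0 x) none ht hn h
  have hup : ∀ z, Function.update (fun o : Option L => o.elim 0 x) none z = fun o => o.elim z x := by
    intro z
    funext o
    cases o <;> simp
  simp only [hup] at hΛ
  -- Only the component of the size of the hole is read, and there the brace is a finite sum over
  -- trees; linearity then takes the sum out.
  have h1 : A.ev (fun o => o.elim z x) t 0 = A.ev (fun o => o.elim
      (∑ t' ∈ s, parity (t'.braceSgn t.holeSize.1) • A.ev x t' 0) x) t 0 := by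
    refine A.ev_congr t (fun b hb => ?_) 0
    obtain ⟨o, p, q, r⟩ := b
    cases o with
    | some l => rfl
    | none =>
      have e := holeSize_eq hn hb rfl
      simp only [Option.elim, s, e]
      rw [show z p q r = _ from A.brace_eq hl g x p q r]
      simp only [Finset.sum_apply, Pi.smul_apply]
  rw [h1, hΛ, map_sum, Finset.sum_apply]
  refine Finset.sum_congr rfl fun t' ht' => ?_
  obtain ⟨-, ht', -⟩ := mem_trees.mp ht'
  rw [Units.smul_def, map_zsmul, ← hΛ, ← Units.smul_def, Pi.smul_apply]
  congr 1
  have := A.ev_subst ht'.1 ht'.2.1 x (A.ev x t' 0) rfl t (fun b hb h => by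
    rw [ht'.2.2.1, ht'.2.2.2.1, ← holeSize_eq hn hb h]) 0 hf
  rwa [ht_zero] at this

end LinQuiver

/-- A sum vanishes if its terms cancel in pairs. -/
theorem Finset.sum_eq_zero_of_partner {ι κ M : Type*} [AddCommMonoid M] {s : Finset ι} {f : ι → M}
    (T : ι → κ) (h : ∀ i ∈ s, f i ≠ 0 → ∃ i' ∈ s, i' ≠ i ∧ T i' = T i ∧ f i + f i' = 0 ∧
      ∀ j ∈ s, T j = T i → j = i ∨ j = i') : ∑ i ∈ s, f i = 0 := by
  classical
  rw [← Finset.sum_filter_ne_zero]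
  have h' : ∀ i ∈ s.filter fun i => f i ≠ 0, ∃ i' ∈ s, i' ≠ i ∧ T i' = T i ∧ f i + f i' = 0 ∧
      ∀ j ∈ s, T j = T i → j = i ∨ j = i' := fun i hi =>
    h i (Finset.mem_filter.mp hi).1 (Finset.mem_filter.mp hi).2
  choose! g hg1 hg2 hg3 hg4 hg5 using h'
  have hmem : ∀ i ∈ s.filter fun i => f i ≠ 0, g i ∈ s.filter fun i => f i ≠ 0 := by
    intro i hi
    -- If the partner of a term is zero, so is the term; hence partners stay within the support.
    refine Finset.mem_filter.mpr ⟨hg1 i hi, fun h0 => (Finset.mem_filter.mp hi).2 ?_⟩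
    have := hg4 i hi
    rwa [h0, add_zero] at this
  refine Finset.sum_involution (fun i _ => g i) hg4 (fun i hi _ => hg2 i hi) hmem fun i hi => ?_
  rcases hg5 i hi (g (g i)) (hg1 _ (hmem i hi)) ((hg3 _ (hmem i hi)).trans (hg3 i hi)) with h | h
  · exact h
  · exact absurd h (hg2 _ (hmem i hi))

/-! ### Koszul signs and the indices of the relation. -/

namespace Row

theorem pairs_ofFn {X : Type*} (β : X → X → ZMod 2) {n : ℕ} (g : Fin n → X) :
    pairs β (List.ofFn g) = ∑ i, ∑ j, if i < j then β (g i) (g j) else 0 := by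
  induction n with
  | zero => rfl
  | succ n ih =>
    rw [List.ofFn_succ, pairs, ih, Fin.sum_univ_succ, Fin.sum_univ_succ, List.map_ofFn, List.sum_ofFn]
    simp [Fin.sum_univ_succ, Fin.succ_pos]

theorem parity_sum {ι : Type*} (s : Finset ι) (e : ι → ZMod 2) :
    parity (∑ i ∈ s, e i) = ∏ i ∈ s, parity (e i) := by
  classical
  induction s using Finset.induction_on with
  | empty => rfl
  | insert a s ha ih => rw [Finset.sum_insert ha, Finset.prod_insert ha, parity_add, ih]

/-- Both signs are products over the inversions; together an inversion contributes the exponent one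
plus the product of the degrees. -/
theorem sign_mul_koszulSign {n : ℕ} (σ : Equiv.Perm (Fin n)) (d : Fin n → ℤ) :
    Equiv.Perm.sign σ * koszulSign σ d = parity (pairs (inv fun i => (d i : ZMod 2)) (List.ofFn σ)) := by
  rw [pairs_ofFn, parity_sum, koszulSign, Equiv.Perm.sign_eq_prod_prod_Ioi, ← Finset.prod_mul_distrib]
  refine Finset.prod_congr rfl fun i _ => ?_
  rw [parity_sum, ← Finset.filter_lt_eq_Ioi, Finset.prod_filter, ← Finset.prod_mul_distrib]
  refine Finset.prod_congr rfl fun j _ => ?_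
  by_cases h : i < j
  · simp only [h, if_true, true_and, inv, negOnePow_eq_parity]
    rcases lt_or_gt_of_ne (σ.injective.ne h.ne) with h' | h'
    · rw [if_pos h', if_neg h'.not_gt, if_neg h'.not_gt]
      rfl
    · rw [if_neg h'.not_gt, if_pos h', if_pos h', add_comm, parity_add_one]
      push_cast
      exact neg_one_mul _
  · simp [h, parity]

/-- The labels of the outer tree of a substitution. -/
def outerWord {n : ℕ} (s : ℕ → Fin n) (k l j : ℕ) : List (Option (Fin n)) :=
  ((List.range' 0 j).map s).map some ++ none :: ((List.range' (j + l) (k - 1 - j)).map s).map some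

theorem ofFn_outer {n : ℕ} (s : ℕ → Fin n) {k l j : ℕ} (hl : 1 ≤ l) (hj : j < k) :
    (List.ofFn fun i : Fin k => if i.1 < j then some (s i) else if i.1 = j then none else
      some (s (i + l - 1))) = outerWord s k l j := by
  apply List.ext_getElem
  · simp [outerWord]
    omega
  · intro i h1 h2
    simp only [outerWord, List.getElem_ofFn, List.getElem_append, List.length_map, List.length_range',
      List.getElem_map, List.getElem_range', List.getElem_cons]
    split_ifs with h3 h4 h5
    · simp
    · rfl
    · omega
    · omega
    · congr 2
      omega

theorem ofFn_inner {n : ℕ} (s : ℕ → Fin n) (l j : ℕ) :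
    (List.ofFn fun i : Fin l => s (j + i)) = (List.range' j l).map s := by
  apply List.ext_getElem <;> simp

/-- The permuted arguments are those before the inner brace, its `l` arguments, and the remaining
ones. This matches the decomposition of the word of a splitting. -/
theorem range_split {n : ℕ} (s : ℕ → Fin n) {k l j : ℕ} (hkl : k + l = n + 1) (hj : j < k) :
    (List.range' 0 n).map s = (List.range' 0 j).map s ++ ((List.range' j l).map s ++
      (List.range' (j + l) (k - 1 - j)).map s) := by
  have h := List.range'_append_1 (s := 0) (m := j) (n := l + (k - 1 - j))
  rw [Nat.zero_add, ← List.range'_append_1, show j + (l + (k - 1 - j)) = n by omega] at h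
  rw [← h, List.map_append, List.map_append]

theorem nodup_outer {w₁ w w₂ : List L} (h : (w₁ ++ (w ++ w₂)).Nodup) :
    (w₁.map some ++ none :: w₂.map some).Nodup := by
  have h' : (w₁ ++ w₂).Nodup :=
    h.sublist ((List.sublist_append_right w w₂).append_left w₁)
  rw [List.nodup_middle, List.nodup_cons, ← List.map_append]
  exact ⟨by simp, h'.map (Option.some_injective L)⟩

theorem exists_perm {n : ℕ} {w : List (Fin n)} (hw : w.Nodup) (hl : w.length = n) :
    ∃ σ : Equiv.Perm (Fin n), List.ofFn σ = w := by
  have hi : Function.Injective fun i : Fin n => w.get (i.cast hl.symm) :=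
    hw.injective_get.comp (Fin.cast_injective _)
  refine ⟨Equiv.ofBijective _ (Finite.injective_iff_bijective.mp hi), ?_⟩
  apply List.ext_getElem
  · simp [hl]
  · simp

/-- A substitution and its indices in the relation of an `L∞`-algebra. -/
structure Split.Index {n : ℕ} (D : Split (Fin n)) (P k l : ℕ) (σ : Equiv.Perm (Fin n)) (j : ℕ)
    (t : Row (Option (Fin n))) (t' : Row (Fin n)) : Prop where
  valid : D.Valid P
  outer : D.outer = t
  sub : D.sub = t'
  word : D.word = List.ofFn σ
  length_pre : D.ctx.pre.length = j
  length_outer : D.outer.boxes.length = k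
  length_sub : D.sub.boxes.length = l

namespace Split
variable {n : ℕ} (hn : 2 ≤ n) {P Q R k l j : ℕ} {σ : Equiv.Perm (Fin n)}

/-- The outer tree has exactly one box labelled `none`, so it is a filled context; the size of its
hole is that of the inner tree, and the labels spell the permutation. -/
theorem exists_index (hkl : k + l = n + 1) (hj : j < k) {t : Row (Option (Fin n))} {t' : Row (Fin n)}
    (ht : t ∈ trees (outerWord (LinQuiver.extend hn σ) k l j) P Q R)
    (ht' : t' ∈ trees ((List.range' j l).map (LinQuiver.extend hn σ)) t.holeSize.1 t.holeSize.2.1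
      t.holeSize.2.2) : ∃ D : Split (Fin n), D.Index P k l σ j t t' ∧ t.holeSize.1 = D.a ∧
        D.total = subst t' t ∧ D.total.wd = Q ∧ D.total.rt P = R := by
  obtain ⟨h1, h2, h3⟩ := mem_trees.mp ht
  have hw := range_split (LinQuiver.extend hn σ) hkl hj
  rw [LinQuiver.map_extend] at hw
  have hnd : t.labels.Nodup := by
    rw [h1]
    exact nodup_outer (hw ▸ List.nodup_ofFn.mpr σ.injective)
  obtain ⟨C, a, r, c, rfl, h4, h5⟩ := exists_fill t _ _ h1
  have hs : holeSize (C.fill some (node none a r (c.map some) nil)) = (a, c.len, r) :=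
    holeSize_eq hnd (b := (none, a, c.len, r)) (by
      rw [C.boxes_fill some rfl]
      simp [boxes]) rfl
  rw [hs] at ht' ⊢
  obtain ⟨h6, h7, -⟩ := mem_trees.mp ht'
  have ho : (⟨C, t', a, c⟩ : Split (Fin n)).outer = C.fill some (node none a r (c.map some) nil) := by
    rw [outer]
    simp only [show t'.rt a = r from h7.2.2.2.1]
  have hv : (⟨C, t', a, c⟩ : Split (Fin n)).Valid P :=
    ⟨h7.2.2.1.symm, h7.1, h7.2.1, h7.2.2.2.2, ho ▸ h2.1, ho ▸ h2.2.1, ho ▸ h2.2.2.2.2⟩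
  refine ⟨⟨C, t', a, c⟩, ⟨hv, ho, rfl, ?_, ?_, ?_, ?_⟩, rfl, (Ctx.subst_fill C t' c a r).symm, ?_, ?_⟩
  · rw [hw, h4, h6.symm, h5]
    rfl
  · simpa using (congrArg List.length h4).symm
  · rw [ho, ← length_labels, h1, outerWord]
    simp
    omega
  · rw [← length_labels, h6]
    simp
  · rw [wd_total hv.len_row, ho, h2.2.2.1]
  · rw [hv.rt_total, ho, h2.2.2.2.1]

/-- The word of a splitting, having distinct letters, is a permutation; the lengths of its pieces
give `k`, `l` and `j`. Absence of boxes with more outputs than inputs passes to the inner tree, and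
then to the hole. -/
theorem Valid.exists_index {D : Split (Fin n)} (hD : D.Valid P) (hg : D.total.Good)
    (hnd : D.word.Nodup) (hlen : D.word.length = n) (hQ : D.total.wd = Q) (hR : D.total.rt P = R) :
    ∃ σ k l j, k + l = n + 1 ∧ j < k ∧ D.Index P k l σ j D.outer D.sub ∧ D.outer.holeSize.1 = D.a ∧
      D.outer ∈ trees (outerWord (LinQuiver.extend hn σ) k l j) P Q R ∧
      D.sub ∈ trees ((List.range' j l).map (LinQuiver.extend hn σ)) D.outer.holeSize.1
        D.outer.holeSize.2.1 D.outer.holeSize.2.2 := by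
  obtain ⟨σ, hσ⟩ := exists_perm hnd hlen
  have hk : D.outer.boxes.length = D.ctx.pre.length + (D.row.boxes.length + D.ctx.post.length + 1) := by
    rw [boxes_outer]
    simp
  have hl := hlen
  simp only [word, labels, List.length_append, List.length_map] at hl
  have hkl : D.outer.boxes.length + D.sub.boxes.length = n + 1 := by omega
  have hj : D.ctx.pre.length < D.outer.boxes.length := by omega
  have hw := range_split (LinQuiver.extend hn σ) hkl hj
  rw [LinQuiver.map_extend, hσ, word] at hw
  obtain ⟨e1, e2⟩ := List.append_inj hw (by simp)
  obtain ⟨e2, e3⟩ := List.append_inj e2 (by simp [labels])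
  have hlab : D.outer.labels = outerWord (LinQuiver.extend hn σ) D.outer.boxes.length
      D.sub.boxes.length D.ctx.pre.length := by
    rw [outerWord, ← e1, ← e3, labels, boxes_outer]
    simp [labels]
    rfl
  have hs : D.outer.holeSize = (D.a, D.row.len, D.sub.rt D.a) :=
    holeSize_eq (b := (none, D.a, D.row.len, D.sub.rt D.a)) (by
      rw [hlab, outerWord, ← e1, ← e3]
      exact nodup_outer hnd) (by rw [boxes_outer]; simp) rfl
  have hp := fun b => (boxes_graft hD.len_row).mem_iff (a := b)
  have hb := boxes_total hD.len_row hD.len_sub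
  have hgs : D.sub.Good := fun b h => hg b (by rw [hb]; simp [hp, h])
  refine ⟨σ, _, _, _, hkl, hj, ⟨hD, rfl, rfl, hσ.symm, rfl, rfl, rfl⟩, by rw [hs], mem_trees.mpr ⟨hlab,
    ⟨hD.len_outer, hD.fit_outer, (wd_total hD.len_row).symm.trans hQ, hD.rt_total.symm.trans hR,
      hD.outer⟩, fun b h => ?_⟩, mem_trees.mpr ⟨e2, ?_, hgs⟩⟩
  · rw [boxes_outer] at h
    simp only [List.mem_append, List.mem_cons, List.mem_map] at h
    rcases h with ⟨b, h, rfl⟩ | rfl | ⟨b, h, rfl⟩ | ⟨b, h, rfl⟩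
    · exact hg b (by rw [hb]; simp [h])
    · exact (hgs.height hD.fit_sub).1
    · exact hg b (by rw [hb]; simp [hp, h])
    · exact hg b (by rw [hb]; simp [h])
  · rw [hs]
    exact ⟨hD.len_sub, hD.fit_sub, hD.len_row.symm, rfl, hD.sub⟩

end Split

end Row

namespace Row
variable {n : ℕ}

/-- The exponent of the sign of a substitution is that of the corresponding term of the relation. -/
theorem Split.Index.sign_eq {D : Split (Fin n)} (hn : 2 ≤ n) {P k l j : ℕ} {σ : Equiv.Perm (Fin n)}
    {t : Row (Option (Fin n))} {t' : Row (Fin n)} (hD : D.Index P k l σ j t t') (hkl : k + l = n + 1)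
    (hj : j < k) (d : Fin n → ℤ) :
    ((k - 1 : ℤ) * l + j * (l - 1)).negOnePow * Equiv.Perm.sign σ * koszulSign σ d *
      ((2 - l : ℤ) * ∑ i ∈ Finset.range j, LinQuiver.pad (d ∘ σ) i).negOnePow *
      (parity (t.braceSgn P) * parity (t'.braceSgn D.a)) =
    parity (D.exponent (fun i => (d i : ZMod 2)) P) := by
  have h1 : ((∑ i ∈ Finset.range j, LinQuiver.pad (d ∘ σ) i : ℤ) : ZMod 2) =
      ((D.ctx.pre.map Prod.fst).map fun i => (d i : ZMod 2)).sum := by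
    have hw := range_split (LinQuiver.extend hn σ) hkl hj
    rw [LinQuiver.map_extend, ← hD.word, Split.word] at hw
    have hpre := (List.append_inj hw (by simp [hD.length_pre])).1
    rw [hpre, List.map_map, ← List.range_eq_range',
      Int.cast_sum, ← List.sum_toFinset _ List.nodup_range, List.toFinset_range]
    refine Finset.sum_congr rfl fun i hi => ?_
    have : i < n := by have := Finset.mem_range.mp hi; omega
    simp [LinQuiver.pad, LinQuiver.extend, this]
  rw [mul_assoc (Int.negOnePow _), sign_mul_koszulSign, negOnePow_eq_parity, negOnePow_eq_parity,
    ← hD.word, ← parity_add, ← parity_add, ← parity_add, ← parity_add, exponent, hD.length_pre,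
    hD.length_outer, hD.length_sub, hD.outer, hD.sub]
  push_cast at h1 ⊢
  rw [h1]
  congr 1
  grind

open Classical in
/-- The weight of a label is `0` or `1` according as its box is thin or not. -/
noncomputable def weight {L : Type} (T : Row L) (l : L) : ZMod 2 :=
  if ∃ b ∈ T.boxes, b.1 = l ∧ Full b then 1 else 0

theorem weights_weight {L : Type} {T : Row L} (hn : T.labels.Nodup) (h : ∀ b ∈ T.boxes, b.2 ≠ (0, 0, 0)) :
    Weights T.weight T where
  nodup := hn
  thin _ hb hb' := if_neg fun ⟨_, h1, h2, h3⟩ =>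
    h3.not_thin (List.inj_on_of_nodup_map hn h1 hb h2 ▸ hb')
  full _ hb hb' := if_pos ⟨_, hb, rfl, hb'⟩
  ne := h

theorem Thin.deg_eq {L : Type} {b : L × ℕ × ℕ × ℕ} (h : Thin b) : deg b = thinDeg b.2 := by
  rw [deg, thinDeg, if_pos (show b.2.1 = 0 ∧ b.2.2.2 = 0 from h), h.1, h.2]
  push_cast
  grind

theorem Full.deg_eq {L : Type} {b : L × ℕ × ℕ × ℕ} (h : Full b) : deg b = thinDeg b.2 + 1 := by
  rw [deg, thinDeg, if_neg (show ¬ (b.2.1 = 0 ∧ b.2.2.2 = 0) from h.not_thin)]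
  push_cast
  grind

end Row

/-! ### The `L∞`-relation and the conclusion. -/

namespace LinQuiver
open Row
variable {k : Type w₁} [CommRing k] {U : Type u} [Category.{v} U] (A : LinQuiver.{u, v, w₁, w₂, w₃} k U)
variable {n : ℕ}

/-- The inner brace is treated as the filling of a box labelled `none`: `brace_eq` expands the outer
brace and `ev_brace` the inner one. -/
theorem partialComp_eq (hn : 2 ≤ n) (x : Fin n → A.Total) {a l j : ℕ} (ha : 2 ≤ a) (hl : 2 ≤ l)
    (hal : a + l = n + 1) (hj : j < a) (σ : Equiv.Perm (Fin n)) (P Q R : ℕ) :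
    partialComp A.brace a l j (pad (x ∘ σ)) P Q R =
      ∑ t ∈ trees (outerWord (extend hn σ) a l j) P Q R,
        ∑ t' ∈ trees ((List.range' j l).map (extend hn σ)) t.holeSize.1 t.holeSize.2.1
          t.holeSize.2.2, (parity (t.braceSgn P) * parity (t'.braceSgn t.holeSize.1)) •
            A.ev x (subst t' t) 0 P Q R := by
  have hpad : ∀ i, i < n → pad (x ∘ σ) i = x (extend hn σ i) := fun i hi => by
    simp [pad, extend, hi]
  have e1 : (fun i : Fin l => pad (x ∘ σ) (j + i)) = fun i : Fin l => x (extend hn σ (j + i)) := by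
    funext i
    exact hpad _ (by omega)
  have e2 : (fun i : Fin a => if i.1 < j then pad (x ∘ σ) i else if i.1 = j then
      A.brace l fun t => pad (x ∘ σ) (j + t) else pad (x ∘ σ) (i + l - 1)) = fun i : Fin a =>
        (fun o : Option (Fin n) => o.elim (A.brace l fun i => x (extend hn σ (j + i))) x)
          (if i.1 < j then some (extend hn σ i) else if i.1 = j then none else
            some (extend hn σ (i + l - 1))) := by
    funext i
    rw [e1]
    split_ifs with h1 h2
    · exact hpad _ (by omega)
    · rfl
    · exact hpad _ (by omega)
  have hw := range_split (extend hn σ) hal hj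
  rw [map_extend] at hw
  rw [partialComp, e2, A.brace_eq ha _ (fun o : Option (Fin n) =>
    o.elim (A.brace l fun i => x (extend hn σ (j + i))) x), ofFn_outer _ (by omega) hj]
  refine Finset.sum_congr rfl fun t ht => ?_
  obtain ⟨h1, h2, -⟩ := mem_trees.mp ht
  rw [A.ev_brace hl _ x h2.1 (h1 ▸ nodup_outer (hw ▸ List.nodup_ofFn.mpr σ.injective))
    (h1 ▸ by simp [outerWord]) h2.2.1, ofFn_inner]
  simp only [Finset.sum_apply, Pi.smul_apply, Finset.smul_sum, mul_smul]

/-- A nonzero value means that every component entering it is nonzero. So each box has the degree of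
its argument and none has size `(0,0,0)`, which is what the combinatorial pairing and the sign
formula require. -/
theorem exists_partner_term {d : Fin n → ℤ} {x : Fin n → A.Total} (hx : ∀ i, x i ∈ A.tot (d i))
    (hx' : ∀ i, x i ∈ A.uncurved) {D : Split (Fin n)} {P : ℕ} (hD : D.Valid P)
    (hnd : D.word.Nodup) (hev : A.ev x D.total 0 ≠ 0) :
    (∀ b ∈ D.total.boxes, b.2 ≠ (0, 0, 0)) ∧ ∃ D' : Split (Fin n), D'.Valid P ∧ D'.total = D.total ∧ D' ≠ D ∧
      D'.exponent (fun i => (d i : ZMod 2)) P = D.exponent (fun i => (d i : ZMod 2)) P + 1 ∧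
      ∀ E : Split (Fin n), E.Valid P → E.total = D.total → E = D ∨ E = D' := by
  have hnd' := (Split.labels_total hD.len_row hD.len_sub).nodup_iff.mpr hnd
  have hb : ∀ b ∈ D.total.boxes, x b.1 b.2.1 b.2.2.1 b.2.2.2 ≠ 0 := fun b hb h =>
    hev (A.ev_eq_zero hD.len_total_eq hb h)
  have hd : ∀ b ∈ D.total.boxes, thinDeg b.2 = d b.1 := fun b h => by
    by_contra h'
    exact hb b h (hx b.1 _ _ _ h')
  have hne : ∀ b ∈ D.total.boxes, b.2 ≠ (0, 0, 0) := fun b h h' =>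
    hb b h (by rw [h']; exact hx' b.1)
  have hw := weights_weight hnd' hne
  have hns : ∀ b ∈ D.total.boxes, Thin b ∨ Full b := by
    intro b h
    have := (nonSemi_iff _).mp hD.nonSemi_total b h
    rw [Thin, Full]
    omega
  have hu : ∀ b ∈ D.total.boxes, deg b = (d b.1 : ZMod 2) + D.total.weight b.1 := fun b h => by
    rw [← hd b h]
    rcases hns b h with h' | h'
    · rw [hw.thin b h h', h'.deg_eq, add_zero]
    · rw [hw.full b h h', h'.deg_eq]
  obtain ⟨D', h1, h2, h3, h4, h5⟩ := Split.exists_partner hD hw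
  have hd' : ∀ b ∈ D.total.boxes, (thinDeg b.2 : ZMod 2) = (d b.1 : ZMod 2) := fun b h => by
    rw [hd b h]
  refine ⟨hne, D', h1, h2, h3, ?_, h5⟩
  rw [hD.exponent_eq hnd' (hD.two_le hne).1 hd' hu, h1.exponent_eq (h2 ▸ hnd')
    (h1.two_le (h2 ▸ hne)).1 (h2 ▸ hd') (h2 ▸ hu), h2, h4, add_assoc]

/-- Fully expanded, the relation is a signed sum over splittings, and splittings with the same
result carry the same value; so the nonzero terms cancel in pairs. -/
theorem brace_relation (hn : 2 ≤ n) (d : Fin n → ℤ) (x : Fin n → A.Total) (hx : ∀ i, x i ∈ A.tot (d i))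
    (hx' : ∀ i, x i ∈ A.uncurved) :
    ∑ kl ∈ Finset.HasAntidiagonal.antidiagonal (n + 1) with 2 ≤ kl.1 ∧ 2 ≤ kl.2,
      ∑ σ : Equiv.Perm (Fin n), ∑ j ∈ Finset.range kl.1,
        (((kl.1 - 1 : ℤ) * kl.2 + j * (kl.2 - 1)).negOnePow * Equiv.Perm.sign σ *
          koszulSign σ d * ((2 - kl.2 : ℤ) * ∑ i ∈ Finset.range j, pad (d ∘ σ) i).negOnePow) •
        partialComp A.brace kl.1 kl.2 j (pad (x ∘ σ)) = 0 := by
  funext P Q R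
  simp only [Finset.sum_apply, Pi.smul_apply]
  have key : ∀ kl ∈ (Finset.HasAntidiagonal.antidiagonal (n + 1)).filter
      (fun kl : ℕ × ℕ => 2 ≤ kl.1 ∧ 2 ≤ kl.2), ∀ σ : Equiv.Perm (Fin n), ∀ j ∈ Finset.range kl.1,
      partialComp A.brace kl.1 kl.2 j (pad (x ∘ σ)) P Q R =
        ∑ t ∈ trees (outerWord (extend hn σ) kl.1 kl.2 j) P Q R,
          ∑ t' ∈ trees ((List.range' j kl.2).map (extend hn σ)) t.holeSize.1 t.holeSize.2.1
            t.holeSize.2.2, (parity (t.braceSgn P) * parity (t'.braceSgn t.holeSize.1)) •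
              A.ev x (subst t' t) 0 P Q R := fun kl hkl σ j hj => by
    obtain ⟨h1, h2, h3⟩ := Finset.mem_filter.mp hkl
    exact A.partialComp_eq hn x h2 h3 (Finset.HasAntidiagonal.mem_antidiagonal.mp h1) (Finset.mem_range.mp hj) σ P Q R
  rw [Finset.sum_congr rfl fun kl hkl => Finset.sum_congr rfl fun σ _ => Finset.sum_congr rfl fun j hj =>
    congrArg _ (key kl hkl σ j hj)]
  simp only [Finset.smul_sum, smul_smul, Finset.sum_sigma']
  refine Finset.sum_eq_zero_of_partner (fun i => subst i.2.2.2.2 i.2.2.2.1) ?_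
  rintro ⟨kl, σ, j, t, t'⟩ hi hne
  simp only [Finset.mem_sigma, Finset.mem_filter, Finset.HasAntidiagonal.mem_antidiagonal,
    Finset.mem_univ, Finset.mem_range, true_and] at hi hne ⊢
  obtain ⟨⟨hkl, -⟩, hj, ht, ht'⟩ := hi
  obtain ⟨D, hD, ha, hT, hQ, hR⟩ := Split.exists_index hn hkl hj ht ht'
  have hev : A.ev x D.total 0 ≠ 0 := fun h => hne (by rw [← hT, h]; exact smul_zero _)
  have hw : D.word.Nodup := hD.word ▸ List.nodup_ofFn.mpr σ.injective
  obtain ⟨hb, D', hD', hT', hne', he, huniq⟩ := A.exists_partner_term hx hx' hD.valid hw hev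
  have hwp := (Split.labels_total hD'.len_row hD'.len_sub).symm.trans
    (hT' ▸ Split.labels_total hD.valid.len_row hD.valid.len_sub)
  obtain ⟨σ', k', l', j', hkl', hj', hI, ha', h1, h2⟩ := hD'.exists_index hn
    (hT' ▸ A.good_of_ev_ne_zero hD.valid.len_total_eq hev) (hwp.nodup_iff.mpr hw)
    (by rw [hwp.length_eq, hD.word, List.length_ofFn]) (hT' ▸ hQ) (hT' ▸ hR)
  -- A splitting determines all its summation indices, the permutation being read off from its word.
  have hinj : ∀ {kl kl' : ℕ × ℕ} {σ σ' : Equiv.Perm (Fin n)} {j j' : ℕ} {t t₁ : Row (Option (Fin n))}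
      {t' t₁' : Row (Fin n)} {D : Split (Fin n)}, D.Index P kl.1 kl.2 σ j t t' →
      D.Index P kl'.1 kl'.2 σ' j' t₁ t₁' →
      (⟨kl, σ, j, t, t'⟩ : (_ : ℕ × ℕ) × (_ : Equiv.Perm (Fin n)) × (_ : ℕ) ×
        (_ : Row (Option (Fin n))) × Row (Fin n)) = ⟨kl', σ', j', t₁, t₁'⟩ := by
    rintro ⟨k, l⟩ ⟨k', l'⟩ σ σ' j j' t t₁ t' t₁' D h h'
    obtain rfl : k = k' := h.length_outer.symm.trans h'.length_outer
    obtain rfl : l = l' := h.length_sub.symm.trans h'.length_sub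
    obtain rfl : j = j' := h.length_pre.symm.trans h'.length_pre
    obtain rfl : t = t₁ := h.outer.symm.trans h'.outer
    obtain rfl : t' = t₁' := h.sub.symm.trans h'.sub
    obtain rfl : σ = σ' := DFunLike.coe_injective (List.ofFn_injective (h.word.symm.trans h'.word))
    rfl
  have htwo := hD'.two_le (hT' ▸ hb)
  rw [hI.length_sub, hI.length_outer] at htwo
  have hs := hD.sign_eq hn hkl hj d
  have hs' := hI.sign_eq hn hkl' hj' d
  have hT'' : subst D'.sub D'.outer = D'.total := Ctx.subst_fill _ _ _ _ _
  refine ⟨⟨(k', l'), σ', j', D'.outer, D'.sub⟩, ?_, fun e => ?_, hT''.trans (hT'.trans hT), ?_, ?_⟩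
  · exact ⟨⟨hkl', htwo.2, htwo.1⟩, hj', h1, h2⟩
  -- Equal indices would have equal signs, whereas the signs of partners are opposite.
  · simp only [Sigma.mk.injEq, heq_eq_eq] at e
    obtain ⟨rfl, rfl, rfl, e1, e2⟩ := e
    rw [← ha', e1, e2, ha, hs, he, parity_add_one] at hs'
    exact absurd hs' (units_ne_neg_self _)
  · simp only
    rw [ha, ha', hs, hs', hT'', hT', ← hT, he, parity_add_one]
    simp only [Units.smul_def, Units.val_neg, neg_smul]
    exact add_neg_cancel _
  · rintro ⟨kl₁, σ₁, j₁, t₁, t₁'⟩ hi₁ hT₁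
    obtain ⟨⟨hkl₁, -⟩, hj₁, ht₁, ht₁'⟩ := hi₁
    obtain ⟨D₁, hI₁, -, hE, -⟩ := Split.exists_index hn hkl₁ hj₁ ht₁ ht₁'
    rcases huniq D₁ hI₁.valid (hE.trans (hT₁.trans hT.symm)) with rfl | rfl
    · exact .inl (hinj hI₁ hD)
    · exact .inr (hinj (kl' := (k', l')) hI₁ hI)

end LinQuiver

/-- The relation holds for all homogeneous uncurved elements, so closedness is all that a graded
submodule has to provide; this serves the ambient algebra and the subalgebra alike. -/
theorem LinQuiver.isLinfAdmissibleAlgebra {k : Type w₁} [CommRing k] {U : Type u} [Category.{v} U]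
    (A : LinQuiver.{u, v, w₁, w₂, w₃} k U) (G : ℤ → Submodule k A.Total)
    (hG : ∀ d, G d ≤ A.tot d ⊓ A.uncurved)
    (hcl : ∀ n : ℕ, 2 ≤ n → ∀ (d : Fin n → ℤ) (x : Fin n → A.Total), (∀ i, x i ∈ G (d i)) →
      A.brace n x ∈ G (∑ i, d i + 2 - n)) : IsLinfAdmissibleAlgebra G A.brace where
  operations := A.isGradedOperations_of_closed G hcl
  relation _ hn d x hx := A.brace_relation hn d x (fun i => (hG _ (hx i)).1) fun i => (hG _ (hx i)).2

theorem mainTheorem6 {k : Type*} [CommRing k] {U : Type*} [Category U] (A : LinQuiver k U) :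
    (∀ n : ℕ, 2 ≤ n → ∀ (x : Fin n → A.Total) (p q r : ℕ),
      (Function.support fun S : {S : Stacking p q r // S.IsThinQuadratic n} =>
        A.braceTerm x S.1).Finite) ∧
    IsGradedOperations A.tot A.brace ∧
    IsClosedUnder A.gs A.tot A.brace ∧
    IsLinfAdmissibleSubalgebra (fun d => A.gs d ⊓ A.uncurved) (fun d => A.tot d ⊓ A.uncurved)
      A.brace := by
  have hle : ∀ d, A.gs d ⊓ A.uncurved ≤ A.tot d ⊓ A.uncurved := fun d =>
    inf_le_inf_right _ (A.gs_le_tot d)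
  have hgs : ∀ n : ℕ, 2 ≤ n → ∀ (d : Fin n → ℤ) (x : Fin n → A.Total),
      (∀ i, x i ∈ A.gs (d i) ⊓ A.uncurved) →
        A.brace n x ∈ A.gs (∑ i, d i + 2 - n) ⊓ A.uncurved := fun _ hn d x hx =>
    ⟨A.brace_mem_gs hn d x fun i => (hx i).1, A.brace_mem_uncurved hn x fun i => (hx i).2⟩
  exact ⟨fun _ hn x p q r => A.braceTerm_support_finite hn x p q r,
    A.isGradedOperations_of_closed _ fun _ hn d x hx => A.brace_mem_tot hn d x hx,
    ⟨A.gs_le_tot, fun _ hn d x hx => A.brace_mem_gs hn d x hx⟩,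
    A.isLinfAdmissibleAlgebra _ (fun _ => le_rfl) fun _ hn d x hx =>
      ⟨A.brace_mem_tot hn d x fun i => (hx i).1, A.brace_mem_uncurved hn x fun i => (hx i).2⟩,
    ⟨hle, hgs⟩, A.isLinfAdmissibleAlgebra _ hle hgs⟩
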